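/- Let $n\ge 2$, let $\mathbf S^n=\{x\in\mathbb C^n:|x|=1\}$ (a real manifold of dimension $d=2n-1$) with normalized surface measure, $\langle\phi,\psi\rangle=\int_{\mathbf S^n}\phi\,\overline\psi$, $\|\phi\|^2=\langle\phi,\phi\rangle$, and $x\cdot z=\sum_s x_s\overline{z_s}$ for $x,z\in\mathbb C^n$. For $\hbar>0$ and $p\in\{0,-1\}$ put $$K_p(x,z)=\sum_{\ell\ge 0}\frac{c_{\ell,p}}{\ell!}\Big(\frac{x\cdot z}{\hbar}\Big)^{\ell},\qquad c_{\ell,p}=\sqrt{\frac{(n)_\ell}{(n+p)_\ell}},\qquad x\in\mathbf S^n,\ z\in\mathbb C^n,$$ where $(a)_\ell=a(a+1)\cdots(a+\ell-1)$. *Symbols.* Fix $\hbar_0>0$ and $m\in\mathbb R$, and let $\langle\xi\rangle=\sqrt{1+|\xi|^2}$. The class $S(\langle\xi\rangle^m)$ consists of the functions $a(b,\xi;\hbar)$ on $\mathbb R^d\times\mathbb R^d\times(0,\hbar_0]$, smooth in $(b,\xi)$, each of whose $(b,\xi)$-derivatives is $O(\langle\xi\rangle^m)$ uniformly in $(b,\xi,\hbar)$.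 Such an $a$ is classical if there are $\hbar$-independent $a^{(j)}\in S(\langle\xi\rangle^m)$, $a^{(0)}\not\equiv0$, such that for every $N$ every $(b,\xi)$-derivative of $a-\sum_{j\le N}\hbar^ja^{(j)}$ is $O(\hbar^N\langle\xi\rangle^m)$ uniformly for small $\hbar$. For $t\in[0,1]$ and $f\in C_0^\infty(\mathbb R^d)$, $$\mathrm{Op}^t_\hbar(a)f(b)=\frac1{(2\pi\hbar)^d}\int\!\!\int e^{i(b-c)\cdot\xi/\hbar}\Big(\frac{1+\hbar\,\xi\cdot D_c}{1+|\xi|^2}\Big)^k\big[a((1-t)b+tc,\xi;\hbar)f(c)\big]\,d\xi\,dc,\qquad D_c=\tfrac1i\partial_c,$$ for any integer $k\ge0$ with $k>m+d$ (the value does not depend on $k$). *Operators.* Let $\mathcal F$ be a smooth atlas of $\mathbf S^n$. A family of linear operators $A_\hbar:C^\infty(\mathbf S^n)\to C^\infty(\mathbf S^n)$, $\hbar\in(0,\hbar_0]$, is a semiclassical pseudo-differential operator of order zero if there are $m\in\mathbb R$, $t\in[0,1]$ and, for each chart $\kappa:U_\kappa\to V_\kappa$ in $\mathcal F$, a classical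 symbol $a_\kappa\in S(\langle\xi\rangle^m)$ such that: (A) $\Phi A_\hbar(\Psi u)=\Phi\,\kappa^*\mathrm{Op}^t_\hbar(a_\kappa)(\kappa^{-1})^*(\Psi u)$ for all $\Phi,\Psi\in C_0^\infty(U_\kappa)$ and $u\in C^\infty(\mathbf S^n)$, where $(\kappa^{-1})^*(\Psi u)$ is extended by zero; (B) for all $\Phi_1,\Phi_2\in C^\infty(\mathbf S^n)$ with disjoint supports and every $N$, $\|\Phi_1A_\hbar(\Phi_2u)\|\le C_N\hbar^N\|u\|$ for all $u\in C^\infty(\mathbf S^n)$ and all small $\hbar$; (C) the expression $\wp(A_\hbar)(x,\eta):=a_\kappa^{(0)}\big(\kappa(x),(\kappa^{-1})^*\eta\big)$, for $x\in U_\kappa$ and $\eta\in T_x^*\mathbf S^n$, with $(\kappa^{-1})^*\eta=\eta\circ(d\kappa_x)^{-1}$, does not depend on the chart $\kappa\in\mathcal F$ around $x$. The function $\wp(A_\hbar)$ on $T^*\mathbf S^n$ is the principal symbol. For $x\in\mathbf S^n$ and $w\in\mathbb C^n$ let $(x,w)$ also denote the point of $T^*\mathbf S^n$ over $x$ given by the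 covector $v\mapsto\mathrm{Re}(v\cdot w)$, $v\in T_x\mathbf S^n\subset\mathbb C^n$. **Theorem.** Let $n\ge2$, $p\in\{0,-1\}$, and let $A_\hbar$ be a semiclassical pseudo-differential operator of order zero on $\mathbf S^n$. Then for every $z\in\mathbb C^n\setminus\{0\}$, as $\hbar\searrow0$, $$\frac{\langle A_\hbar K_p(\cdot,z),K_p(\cdot,z)\rangle}{\langle K_p(\cdot,z),K_p(\cdot,z)\rangle}=\wp(A_\hbar)\Big(\frac z{|z|},\,i z\Big)+O(\hbar),$$ that is, the symbol is evaluated at $z/|z|$ on the covector $v\mapsto\mathrm{Im}(v\cdot z)$. -/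

import Mathlib

open scoped Manifold ContDiff ComplexConjugate Topology InnerProductSpace

noncomputable section

namespace SphereEgorov

/-! ### The complex unit sphere -/

/-- The space `ℂⁿ` with its Euclidean norm; it is also a real inner product space, with inner
product `Re (∑ₛ wₛ * conj vₛ)`. -/
abbrev Cn (n : ℕ) : Type := EuclideanSpace ℂ (Fin n)

/-- The unit sphere of `ℂⁿ`, a real manifold of dimension `2 n - 1`. -/
abbrev CSphere (n : ℕ) : Type := Metric.sphere (0 : Cn n) 1

/-- The model space `ℝ^(2n-1)` of the charts of the sphere. -/
abbrev Model (n : ℕ) : Type := EuclideanSpace ℝ (Fin (2 * n - 1))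

instance finrankFact (n : ℕ) [NeZero n] :
    Fact (Module.finrank ℝ (Cn n) = (2 * n - 1) + 1) := by
  have hn : n ≠ 0 := NeZero.ne n
  have h1 : Module.finrank ℝ (Cn n) = 2 * n := by
    rw [finrank_real_of_complex, finrank_euclideanSpace_fin]
  exact ⟨by omega⟩

/-- The product `x · z = ∑ₛ xₛ * conj zₛ`. -/
def dot {n : ℕ} (x z : Cn n) : ℂ := ∑ s, x s * conj (z s)

/-- The normalized surface measure on the sphere. -/
def surfaceMeasure (n : ℕ) : MeasureTheory.Measure (CSphere n) :=
  ((MeasureTheory.volume : MeasureTheory.Measure (Cn n)).toSphere Set.univ)⁻¹ •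
    (MeasureTheory.volume : MeasureTheory.Measure (Cn n)).toSphere

/-- The inner product `⟨φ, ψ⟩ = ∫ φ * conj ψ` over the sphere. -/
def sphereInner {n : ℕ} (φ ψ : CSphere n → ℂ) : ℂ :=
  ∫ x, φ x * conj (ψ x) ∂(surfaceMeasure n)

/-- The `L²` norm over the sphere. -/
def sphereNorm {n : ℕ} (φ : CSphere n → ℂ) : ℝ :=
  √(∫ x, ‖φ x‖ ^ 2 ∂(surfaceMeasure n))

/-- The algebra `C^∞(Sⁿ)` of smooth complex-valued functions on the sphere. -/
def Smooth (n : ℕ) [NeZero n] : Subalgebra ℂ (CSphere n → ℂ) where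
  carrier := {f | ContMDiff (𝓡 (2 * n - 1)) 𝓘(ℝ, ℂ) ∞ f}
  mul_mem' {f g} hf hg := by
    have h : ContDiff ℝ ∞ (fun y : ℂ × ℂ => y.1 * y.2) := contDiff_fst.mul contDiff_snd
    exact h.contMDiff.comp (hf.prodMk_space hg)
  add_mem' {f g} hf hg := by
    have h : ContDiff ℝ ∞ (fun y : ℂ × ℂ => y.1 + y.2) := contDiff_fst.add contDiff_snd
    exact h.contMDiff.comp (hf.prodMk_space hg)
  algebraMap_mem' c := contMDiff_const

/-! ### The complete family `K_p` -/

/-- The coefficient `c_{ℓ,p} = √((n)_ℓ / (n+p)_ℓ)`. -/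
def familyCoeff (n : ℕ) (p : ℝ) (l : ℕ) : ℝ :=
  √((ascPochhammer ℝ l).eval (n : ℝ) / (ascPochhammer ℝ l).eval ((n : ℝ) + p))

/-- The entire function `w ↦ ∑ c_{ℓ,p} w^ℓ / ℓ!`. -/
def familySeries (n : ℕ) (p : ℝ) (w : ℂ) : ℂ :=
  ∑' l : ℕ, (familyCoeff n p l : ℂ) / (l.factorial : ℂ) * w ^ l

theorem exists_familyCoeff_le (n : ℕ) (p : ℝ) :
    ∃ R : ℝ, 0 ≤ R ∧ ∀ l, familyCoeff n p l ≤ R ^ l := by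
  have hlim : Filter.Tendsto (fun l : ℕ => ((n : ℝ) + (l : ℝ)) / ((n : ℝ) + p + (l : ℝ)))
      Filter.atTop (𝓝 1) := by
    have h1 : Filter.Tendsto (fun l : ℕ => (n : ℝ) + p + (l : ℝ)) Filter.atTop Filter.atTop :=
      Filter.tendsto_atTop_add_const_left _ _ tendsto_natCast_atTop_atTop
    have h2 : Filter.Tendsto (fun l : ℕ => 1 - p / ((n : ℝ) + p + (l : ℝ)))
        Filter.atTop (𝓝 (1 - 0)) := tendsto_const_nhds.sub (h1.const_div_atTop p)
    rw [sub_zero] at h2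
    refine h2.congr' ?_
    filter_upwards [h1.eventually_gt_atTop 0] with l hl
    field_simp
    ring
  obtain ⟨M, hM⟩ := hlim.abs.bddAbove_range
  have hM' : ∀ l : ℕ, |((n : ℝ) + (l : ℝ)) / ((n : ℝ) + p + (l : ℝ))| ≤ M :=
    fun l => hM ⟨l, rfl⟩
  have hM0 : 0 ≤ M := (abs_nonneg _).trans (hM' 0)
  have key : ∀ l : ℕ, |(ascPochhammer ℝ l).eval (n : ℝ) /
      (ascPochhammer ℝ l).eval ((n : ℝ) + p)| ≤ M ^ l := by
    intro l
    induction l with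
    | zero => simp
    | succ l ih =>
      rw [ascPochhammer_succ_eval, ascPochhammer_succ_eval, mul_div_mul_comm, abs_mul, pow_succ]
      exact mul_le_mul ih (hM' l) (abs_nonneg _) (pow_nonneg hM0 l)
  refine ⟨√M, Real.sqrt_nonneg _, fun l => ?_⟩
  refine Real.sqrt_le_iff.2 ⟨by positivity, ?_⟩
  rw [← pow_mul, mul_comm l 2, pow_mul, Real.sq_sqrt hM0]
  exact (le_abs_self _).trans (key l)

theorem differentiable_familySeries (n : ℕ) (p : ℝ) : Differentiable ℂ (familySeries n p) := by
  obtain ⟨R, hR, hc⟩ := exists_familyCoeff_le n p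
  intro w
  have hd : DifferentiableOn ℂ (familySeries n p) (Metric.ball (0 : ℂ) (‖w‖ + 1)) := by
    refine Complex.differentiableOn_tsum_of_summable_norm
      (u := fun l : ℕ => (R * (‖w‖ + 1)) ^ l / (l.factorial : ℝ))
      (Real.summable_pow_div_factorial _) (fun l => ?_) Metric.isOpen_ball (fun l v hv => ?_)
    · exact ((differentiable_id.pow l).const_mul _).differentiableOn
    · have hv' : ‖v‖ ≤ ‖w‖ + 1 := by simpa using (Metric.mem_ball.1 hv).le
      have h0 : 0 ≤ familyCoeff n p l := Real.sqrt_nonneg _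
      rw [norm_mul, norm_div, norm_pow, Complex.norm_natCast, Complex.norm_real,
        Real.norm_of_nonneg h0, mul_pow, div_mul_eq_mul_div]
      gcongr
      exact hc l
  exact hd.differentiableAt (Metric.isOpen_ball.mem_nhds (by simp))

/-- The function `K_p(·, z)` on the sphere, `K_p(x, z) = ∑ (c_{ℓ,p} / ℓ!) (x · z / ħ)^ℓ`. -/
def familyFun (n : ℕ) [NeZero n] (p ħ : ℝ) (z : Cn n) : Smooth n :=
  ⟨fun x => familySeries n p (dot (x : Cn n) z / (ħ : ℂ)), by
    have h1 : ContDiff ℝ ∞ (familySeries n p) :=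
      (differentiable_familySeries n p).contDiff.restrict_scalars ℝ
    have h2 : ContDiff ℝ ∞ (fun x : Cn n => dot x z / (ħ : ℂ)) := by
      unfold dot
      refine ContDiff.div_const (ContDiff.sum fun s _ => ?_) _
      have h3 : ContDiff ℂ ∞ (fun x : Cn n => x s) :=
        (EuclideanSpace.proj (𝕜 := ℂ) s : Cn n →L[ℂ] ℂ).contDiff
      exact (h3.restrict_scalars ℝ).mul contDiff_const
    exact (h1.comp h2).contMDiff.comp contMDiff_coe_sphere⟩

/-- The covariant symbol `⟨A K_p(·,z), K_p(·,z)⟩ / ⟨K_p(·,z), K_p(·,z)⟩` of an operator `A`. -/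
def covariantSymbol {n : ℕ} [NeZero n] (p ħ : ℝ) (A : Smooth n →ₗ[ℂ] Smooth n) (z : Cn n) : ℂ :=
  sphereInner (A (familyFun n p ħ z) : CSphere n → ℂ) (familyFun n p ħ z : CSphere n → ℂ) /
    sphereInner (familyFun n p ħ z : CSphere n → ℂ) (familyFun n p ħ z : CSphere n → ℂ)

/-! ### Semiclassical symbols and operators on `ℝᵈ` -/

/-- The bracket `⟨ξ⟩ = √(1 + |ξ|²)`. -/
def bracket {d : ℕ} (ξ : EuclideanSpace ℝ (Fin d)) : ℝ := √(1 + ‖ξ‖ ^ 2)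

/-- The symbol class `S(⟨ξ⟩^m)`: functions `a(b, ξ; ħ)`, `ħ ∈ (0, ħ₀]`, smooth in `(b, ξ)`, all of
whose derivatives are `O(⟨ξ⟩^m)` uniformly in `(b, ξ, ħ)`. -/
def IsSymbol {d : ℕ} (ħ₀ m : ℝ)
    (a : ℝ → EuclideanSpace ℝ (Fin d) → EuclideanSpace ℝ (Fin d) → ℂ) : Prop :=
  (∀ ħ ∈ Set.Ioc 0 ħ₀, ContDiff ℝ ∞ (Function.uncurry (a ħ))) ∧
  ∀ k : ℕ, ∃ C : ℝ, ∀ ħ ∈ Set.Ioc 0 ħ₀, ∀ b ξ,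
    ‖iteratedFDeriv ℝ k (Function.uncurry (a ħ)) (b, ξ)‖ ≤ C * bracket ξ ^ m

/-- `a` is a classical symbol in `S(⟨ξ⟩^m)`, asymptotically equivalent to `∑ ħ^j a^(j)` with symbols
`a^(j)` that do not depend on `ħ`, the leading one not identically zero. -/
structure IsClassicalSymbol {d : ℕ} (ħ₀ m : ℝ)
    (a : ℝ → EuclideanSpace ℝ (Fin d) → EuclideanSpace ℝ (Fin d) → ℂ)
    (aj : ℕ → EuclideanSpace ℝ (Fin d) → EuclideanSpace ℝ (Fin d) → ℂ) : Prop where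
  isSymbol : IsSymbol ħ₀ m a
  isSymbol_coeff : ∀ j, IsSymbol ħ₀ m (fun _ => aj j)
  leading_ne_zero : ∃ b ξ, aj 0 b ξ ≠ 0
  asymptotic : ∀ N k : ℕ, ∃ ħN ∈ Set.Ioc 0 ħ₀, ∃ C : ℝ, ∀ ħ ∈ Set.Ioc 0 ħN, ∀ b ξ,
    ‖iteratedFDeriv ℝ k (fun y : EuclideanSpace ℝ (Fin d) × EuclideanSpace ℝ (Fin d) =>
        a ħ y.1 y.2 - ∑ j ∈ Finset.range (N + 1), (ħ : ℂ) ^ j * aj j y.1 y.2) (b, ξ)‖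
      ≤ C * ħ ^ N * bracket ξ ^ m

/-- The operator `L(ξ, ħ D_c) = (1 + ħ ξ · D_c) / (1 + |ξ|²)` with `D_c = -i ∂_c`. -/
def regularizer {d : ℕ} (ħ : ℝ) (ξ : EuclideanSpace ℝ (Fin d))
    (F : EuclideanSpace ℝ (Fin d) → ℂ) : EuclideanSpace ℝ (Fin d) → ℂ :=
  fun c => (F c + (ħ : ℂ) * (-Complex.I * fderiv ℝ F c ξ)) / ((1 + ‖ξ‖ ^ 2 : ℝ) : ℂ)

/-- The `t`-quantization of `a`, with the integrand regularized by `k` applications of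
`L(ξ, ħ D_c)`:
`(2πħ)^(-d) ∫∫ exp(i (b - c)·ξ / ħ) L(ξ, ħ D_c)^k (a((1-t) b + t c, ξ) f(c)) dξ dc`. -/
def quantization {d : ℕ} (t ħ : ℝ) (k : ℕ)
    (a : EuclideanSpace ℝ (Fin d) → EuclideanSpace ℝ (Fin d) → ℂ)
    (f : EuclideanSpace ℝ (Fin d) → ℂ) (b : EuclideanSpace ℝ (Fin d)) : ℂ :=
  (1 / ((2 * Real.pi * ħ) ^ d : ℝ) : ℂ) *
    ∫ c : EuclideanSpace ℝ (Fin d), ∫ ξ : EuclideanSpace ℝ (Fin d),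
      Complex.exp (Complex.I * ((⟪b - c, ξ⟫_ℝ / ħ : ℝ) : ℂ)) *
        ((regularizer ħ ξ)^[k] (fun c' => a ((1 - t) • b + t • c') ξ * f c')) c

/-! ### Semiclassical pseudo-differential operators on the sphere -/

/-- Charts of the sphere. -/
abbrev Chart (n : ℕ) : Type := OpenPartialHomeomorph (CSphere n) (Model n)

/-- A smooth atlas of the sphere, for its usual smooth structure. -/
structure IsSmoothAtlas {n : ℕ} [NeZero n] (𝓕 : Set (Chart n)) : Prop where
  subset_maximalAtlas : 𝓕 ⊆ IsManifold.maximalAtlas (𝓡 (2 * n - 1)) ∞ (CSphere n)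
  covers : ∀ x : CSphere n, ∃ κ ∈ 𝓕, x ∈ κ.source

/-- The cotangent space of the sphere at `x`. -/
abbrev Cotangent {n : ℕ} [NeZero n] (x : CSphere n) : Type :=
  TangentSpace (𝓡 (2 * n - 1)) x →L[ℝ] ℝ

/-- The covector `(κ⁻¹)^* η = η ∘ (dκ_x)⁻¹` on `ℝ^(2n-1)` that a covector `η` at `x` becomes in the
chart `κ`, written in coordinates. -/
def chartCovector {n : ℕ} [NeZero n] (κ : Chart n) (x : CSphere n) (η : Cotangent x) : Model n :=
  WithLp.toLp 2 fun j =>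
    η ((mfderiv (𝓡 (2 * n - 1)) (𝓡 (2 * n - 1)) κ x).inverse (EuclideanSpace.single j (1 : ℝ)))

/-- The function `(κ⁻¹)^* f`, extended by zero outside of the range of the chart `κ`. -/
def chartPush {n : ℕ} (κ : Chart n) (f : CSphere n → ℂ) : Model n → ℂ :=
  κ.target.indicator (fun b => f (κ.symm b))

/-- The covector at `x` that a vector `w` of `ℂⁿ = ℝ²ⁿ` represents: `v ↦ Re (v · w)` on vectors `v`
tangent to the sphere at `x`. -/
def covectorOf {n : ℕ} [NeZero n] (x : CSphere n) (w : Cn n) : Cotangent x :=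
  (innerSL ℝ w).comp (mfderiv (𝓡 (2 * n - 1)) 𝓘(ℝ, Cn n) ((↑) : CSphere n → Cn n) x)

/-- The conditions on a family `A_ħ`, `ħ ∈ (0, ħ₀]`, of linear operators on `C^∞(Sⁿ)` to be a
semiclassical pseudo-differential operator of order zero with respect to the atlas `𝓕`, with the
exponent `m`, the quantization parameter `t`, the local symbols `a κ ∼ ∑ ħ^j aj κ j`. -/
structure IsSemiclassicalPDOWith {n : ℕ} [NeZero n] (𝓕 : Set (Chart n))
    (A : ℝ → Smooth n →ₗ[ℂ] Smooth n) (ħ₀ m t : ℝ)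
    (a : Chart n → ℝ → Model n → Model n → ℂ)
    (aj : Chart n → ℕ → Model n → Model n → ℂ) : Prop where
  classical : ∀ κ ∈ 𝓕, IsClassicalSymbol ħ₀ m (a κ) (aj κ)
  /-- In each chart, `Φ A_ħ (Ψ u) = Φ κ^* Op(a_κ) (κ⁻¹)^* (Ψ u)`. The value of `Op(a_κ)` is the same
  for all admissible numbers `k` of regularizations. -/
  local_form : ∀ κ ∈ 𝓕, ∀ Φ Ψ u : Smooth n,
    tsupport (Φ : CSphere n → ℂ) ⊆ κ.source → tsupport (Ψ : CSphere n → ℂ) ⊆ κ.source →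
    ∀ k : ℕ, m + ((2 * n - 1 : ℕ) : ℝ) < k → ∀ ħ ∈ Set.Ioc 0 ħ₀, ∀ x : CSphere n,
      (Φ : CSphere n → ℂ) x * (A ħ (Ψ * u) : CSphere n → ℂ) x =
        (Φ : CSphere n → ℂ) x *
          quantization t ħ k (a κ ħ) (chartPush κ ((Ψ * u : Smooth n) : CSphere n → ℂ)) (κ x)
  /-- Off the diagonal, `A_ħ` is `O(ħ^∞)` in `L²`. -/
  pseudolocal : ∀ Φ₁ Φ₂ : Smooth n,
    Disjoint (tsupport (Φ₁ : CSphere n → ℂ)) (tsupport (Φ₂ : CSphere n → ℂ)) →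
    ∀ N : ℕ, ∃ ħN ∈ Set.Ioc 0 ħ₀, ∃ C : ℝ, ∀ ħ ∈ Set.Ioc 0 ħN, ∀ u : Smooth n,
      sphereNorm ((Φ₁ * A ħ (Φ₂ * u) : Smooth n) : CSphere n → ℂ) ≤
        C * ħ ^ N * sphereNorm (u : CSphere n → ℂ)
  /-- The leading symbols in overlapping charts transform as functions of covectors. -/
  compatible : ∀ κ ∈ 𝓕, ∀ ν ∈ 𝓕, ∀ x ∈ κ.source ∩ ν.source, ∀ η : Cotangent x,
    aj κ 0 (κ x) (chartCovector κ x η) = aj ν 0 (ν x) (chartCovector ν x η)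

/-- The family `A_ħ` is a semiclassical pseudo-differential operator of order zero on the sphere,
with respect to the atlas `𝓕`, and its principal symbol is the function `σ` on the cotangent
bundle. -/
def HasPrincipalSymbol {n : ℕ} [NeZero n] (𝓕 : Set (Chart n))
    (A : ℝ → Smooth n →ₗ[ℂ] Smooth n) (σ : (x : CSphere n) → Cotangent x → ℂ) : Prop :=
  ∃ ħ₀ > 0, ∃ m : ℝ, ∃ t ∈ Set.Icc (0 : ℝ) 1, ∃ a aj,
    IsSemiclassicalPDOWith 𝓕 A ħ₀ m t a aj ∧
    ∀ κ ∈ 𝓕, ∀ x ∈ κ.source, ∀ η : Cotangent x, σ x η = aj κ 0 (κ x) (chartCovector κ x η)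

/-- The point `z / |z|` of the sphere. -/
def direction {n : ℕ} (z : Cn n) (hz : z ≠ 0) : CSphere n :=
  ⟨(‖z‖⁻¹ : ℝ) • z, by simp [norm_smul, hz]⟩

end SphereEgorov

end

noncomputable section

namespace SphereEgorov

/-! ### Symbol classes with values in a normed space -/

/-! Put μ = |z|, x₀ = z/|z|, λ = μ/ħ. Then K = K_p(·, z) is F(λ x·x₀) with F(w) = ∑ c_k w^k / k!.
For p = 0, F = exp, and since Re (x·x₀) = 1 - |x - x₀|²/2, |K|² is e^{2λ} times the Gaussian e^{-λ|x
- x₀|²}: K lives at distance ħ^{1/2} from x₀. Its phase is μ Im(x·x₀)/ħ, so near x₀ the operator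
ħD_j acts on K as multiplication by ξ₀_j, where ξ₀ is the covector v ↦ Im(v·z). In phase space K
thus occupies a region of diameter ħ^{1/2} around (x₀, ξ₀), and the operator reduces to the value of
its symbol there. The corrections of size ħ^{1/2} cancel by symmetry, which leaves O(ħ).

No stationary phase is used. By Hadamard's lemma (`SymbolBound.exists_expansion`) a symbol is its
value at (b₀, ξ₀) plus coordinates of b - b₀ and ξ - ξ₀ times symbols. Integration by parts turns
this into an expansion of operators (`pseudo_expansion`), in which the factors become multiplication
by (c - b₀)_i and application of ħD_j - ξ₀_j. Either factor gains ħ^{1/2} on K, so after two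
expansions (`Localized.exists_expansion`) only the value and the first order terms with constant
coefficients remain. Errors are bounded by pairings ⟨Op(a)f, g⟩, which for a symbol of any order are
controlled by finitely many derivatives (ħ∂)^α f and by g in L² (`SymbolBound.exists_pairing_le`).
The predicate `Localized` does the bookkeeping of powers of ħ^{1/2}.

Three facts about K are needed. The fourth moment of |x - x₀| against |K|² is O(λ^{-2}‖K‖²): a
Gaussian estimate for p = 0, transferred to p = -1 by linearizing the coefficient √(1 + k/(n-1)) at
k = λ (`exists_integral_pow_four_egf_le`). A derivative of F shifts the coefficients, and
consecutive shifts differ by O(λ^{-1}‖K‖) in norm, because distinct powers of x·x₀ are orthogonal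
(`SlowGrowth.exists_integral_shift_sub_le`). Finally, the reflection in the real line through x₀
preserves |K|, so functions vanishing at x₀ have averages O(ħ) and not only O(ħ^{1/2})
(`Concentrates.exists_integral_vanishing_le`).

The main terms are integrated on the sphere itself, so charts enter only through inequalities and no
Jacobian has to be computed. A partition of unity and pseudolocality reduce the theorem to a single
chart (`IsSemiclassicalPDOWith.isSmall_localized`). -/

/-- The Euclidean space `ℝᵈ`. -/
abbrev Vec (d : ℕ) : Type := EuclideanSpace ℝ (Fin d)

section Symbols

variable {d : ℕ} {U V W : Type*} [NormedAddCommGroup U] [NormedSpace ℝ U]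
  [NormedAddCommGroup V] [NormedSpace ℝ V] [NormedAddCommGroup W] [NormedSpace ℝ W]

theorem one_le_bracket (ξ : Vec d) : 1 ≤ bracket ξ := by
  unfold bracket
  exact Real.one_le_sqrt.2 (by nlinarith [sq_nonneg ‖ξ‖])

theorem bracket_pos (ξ : Vec d) : 0 < bracket ξ := lt_of_lt_of_le one_pos (one_le_bracket ξ)

theorem bracket_sq (ξ : Vec d) : bracket ξ ^ 2 = 1 + ‖ξ‖ ^ 2 :=
  Real.sq_sqrt (by positivity)

theorem norm_le_bracket (ξ : Vec d) : ‖ξ‖ ≤ bracket ξ := by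
  unfold bracket
  exact Real.le_sqrt_of_sq_le (by linarith)

theorem bracket_le_one_add (ξ : Vec d) : bracket ξ ≤ 1 + ‖ξ‖ :=
  Real.sqrt_le_iff.2 ⟨by positivity, by nlinarith [norm_nonneg ξ]⟩

theorem one_add_le_bracket (ξ : Vec d) : 1 + ‖ξ‖ ≤ 2 * bracket ξ := by
  linarith [one_le_bracket ξ, norm_le_bracket ξ]

/-- Families `A ħ`, `ħ ∈ S`, of functions on phase space with values in `V` whose derivatives of
order at most `N` are `O(⟨ξ⟩^m)`. -/
def SymbolBound (S : Set ℝ) (N : ℕ∞) (m : ℝ) (A : ℝ → Vec d × Vec d → V) : Prop :=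
  (∀ ħ ∈ S, ContDiff ℝ N (A ħ)) ∧
  ∀ k : ℕ, (k : ℕ∞) ≤ N → ∃ C : ℝ, ∀ ħ ∈ S, ∀ w, ‖iteratedFDeriv ℝ k (A ħ) w‖ ≤ C * bracket w.2 ^ m

theorem isSymbol_iff_symbolBound {ħ₀ m : ℝ} {a : ℝ → Vec d → Vec d → ℂ} :
    IsSymbol ħ₀ m a ↔ SymbolBound (Set.Ioc 0 ħ₀) ⊤ m (fun ħ => Function.uncurry (a ħ)) := by
  unfold IsSymbol SymbolBound
  refine and_congr Iff.rfl ?_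
  simp only [le_top, forall_true_left, Prod.forall]

variable {S : Set ℝ} {N : ℕ∞} {m m' : ℝ} {A : ℝ → Vec d × Vec d → V}

namespace SymbolBound

theorem exists_nonneg (h : SymbolBound S N m A) (k : ℕ) (hk : (k : ℕ∞) ≤ N) :
    ∃ C : ℝ, 0 ≤ C ∧ ∀ ħ ∈ S, ∀ w, ‖iteratedFDeriv ℝ k (A ħ) w‖ ≤ C * bracket w.2 ^ m := by
  obtain ⟨C, hC⟩ := h.2 k hk
  refine ⟨max C 0, le_max_right _ _, fun ħ hħ w => (hC ħ hħ w).trans ?_⟩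
  have := Real.rpow_nonneg (bracket_pos w.2).le m
  gcongr
  exact le_max_left _ _

theorem mono_set {S' : Set ℝ} (h : SymbolBound S N m A) (hS : S' ⊆ S) : SymbolBound S' N m A :=
  ⟨fun ħ hħ => h.1 ħ (hS hħ), fun k hk => (h.2 k hk).imp fun _ hC ħ hħ => hC ħ (hS hħ)⟩

theorem mono_order (h : SymbolBound S N m A) (hm : m ≤ m') : SymbolBound S N m' A := by
  refine ⟨h.1, fun k hk => ?_⟩
  obtain ⟨C, hC0, hC⟩ := h.exists_nonneg k hk
  refine ⟨C, fun ħ hħ w => (hC ħ hħ w).trans ?_⟩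
  gcongr
  exact one_le_bracket _

theorem mono_smooth {N' : ℕ∞} (h : SymbolBound S N m A) (hN : N' ≤ N) : SymbolBound S N' m A :=
  ⟨fun ħ hħ => (h.1 ħ hħ).of_le (mod_cast hN), fun k hk => h.2 k (hk.trans hN)⟩

theorem congr {B : ℝ → Vec d × Vec d → V} (h : SymbolBound S N m A) (hAB : ∀ ħ ∈ S, A ħ = B ħ) :
    SymbolBound S N m B :=
  ⟨fun ħ hħ => hAB ħ hħ ▸ h.1 ħ hħ, fun k hk => (h.2 k hk).imp fun _ hC ħ hħ w =>
    hAB ħ hħ ▸ hC ħ hħ w⟩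

theorem norm_le (h : SymbolBound S N m A) :
    ∃ C : ℝ, 0 ≤ C ∧ ∀ ħ ∈ S, ∀ w, ‖A ħ w‖ ≤ C * bracket w.2 ^ m := by
  obtain ⟨C, h0, hC⟩ := h.exists_nonneg 0 (zero_le)
  exact ⟨C, h0, fun ħ hħ w => by simpa using hC ħ hħ w⟩

/-- Makes induction on the number of derivatives possible: a class of functions closed under
differentiation needs only its sup bound. -/
theorem of_fderiv {N : ℕ} (hA : ∀ ħ ∈ S, Differentiable ℝ (A ħ))
    (h0 : ∃ C : ℝ, ∀ ħ ∈ S, ∀ w, ‖A ħ w‖ ≤ C * bracket w.2 ^ m)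
    (h1 : SymbolBound S N m (fun ħ => fderiv ℝ (A ħ))) : SymbolBound S (N + 1 : ℕ) m A := by
  refine ⟨fun ħ hħ => ?_, fun k hk => ?_⟩
  · have : ContDiff ℝ ((N : WithTop ℕ∞) + 1) (A ħ) := by
      refine contDiff_succ_iff_fderiv.2 ⟨hA ħ hħ, fun h => ?_, by simpa using h1.1 ħ hħ⟩
      exact absurd h (by simp)
    simpa using this
  · cases k with
    | zero => exact h0.imp fun C hC ħ hħ w => by simpa using hC ħ hħ w
    | succ k =>
      obtain ⟨C, hC⟩ := h1.2 k (by
        have : k + 1 ≤ N + 1 := by exact_mod_cast hk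
        exact_mod_cast Nat.le_of_succ_le_succ this)
      exact ⟨C, fun ħ hħ w => by rw [← norm_iteratedFDeriv_fderiv]; exact hC ħ hħ w⟩

theorem fderiv (h : SymbolBound S ⊤ m A) : SymbolBound S ⊤ m (fun ħ => fderiv ℝ (A ħ)) := by
  refine ⟨fun ħ hħ => ?_, fun k _ => ?_⟩
  · exact (h.1 ħ hħ).fderiv_right (m := ∞) (by simp)
  · exact (h.2 (k + 1) le_top).imp fun C hC ħ hħ w => by
      rw [norm_iteratedFDeriv_fderiv]; exact hC ħ hħ w

theorem top_iff : SymbolBound S ⊤ m A ↔ ∀ N : ℕ, SymbolBound S N m A := by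
  refine ⟨fun h N => h.mono_smooth le_top, fun h => ⟨fun ħ hħ => ?_, fun k _ => (h k).2 k le_rfl⟩⟩
  exact contDiff_infty.2 fun N => (h N).1 ħ hħ

theorem clm_apply (h : SymbolBound S N m A) (L : V →L[ℝ] W) :
    SymbolBound S N m (fun ħ w => L (A ħ w)) := by
  refine ⟨fun ħ hħ => L.contDiff.comp (h.1 ħ hħ), fun k hk => ?_⟩
  obtain ⟨C, hC⟩ := h.2 k hk
  refine ⟨‖L‖ * C, fun ħ hħ w => ?_⟩
  refine (L.norm_iteratedFDeriv_comp_left (h.1 ħ hħ).contDiffAt (mod_cast hk)).trans ?_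
  rw [mul_assoc]
  gcongr
  exact hC ħ hħ w

theorem bilinear (L : V →L[ℝ] W →L[ℝ] U) {B : ℝ → Vec d × Vec d → W} (h : SymbolBound S N m A)
    (h' : SymbolBound S N m' B) : SymbolBound S N (m + m') (fun ħ w => L (A ħ w) (B ħ w)) := by
  refine ⟨fun ħ hħ => ?_, fun k hk => ?_⟩
  · exact (L.contDiff.comp (h.1 ħ hħ)).clm_apply (h'.1 ħ hħ)
  · have hle : ∀ i ≤ k, (i : ℕ∞) ≤ N := fun i hi => le_trans (mod_cast hi) hk
    choose! C hC0 hC using fun i (hi : i ≤ k) => h.exists_nonneg i (hle i hi)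
    choose! D hD0 hD using fun i (hi : i ≤ k) => h'.exists_nonneg i (hle i hi)
    refine ⟨‖L‖ * ∑ i ∈ Finset.range (k + 1), (k.choose i) * C i * D (k - i), fun ħ hħ w => ?_⟩
    refine (L.norm_iteratedFDeriv_le_of_bilinear (h.1 ħ hħ) (h'.1 ħ hħ) w (mod_cast hk)).trans ?_
    rw [mul_assoc, Finset.sum_mul]
    refine mul_le_mul_of_nonneg_left (Finset.sum_le_sum fun i hi => ?_) (by positivity)
    have hi' : i ≤ k := Nat.lt_succ_iff.1 (Finset.mem_range.1 hi)
    rw [Real.rpow_add (bracket_pos _)]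
    have e1 := hC i hi' ħ hħ w
    have e2 := hD (k - i) (Nat.sub_le _ _) ħ hħ w
    have := mul_le_mul e1 e2 (norm_nonneg _) ((norm_nonneg _).trans e1)
    calc _ = (k.choose i : ℝ) * (‖iteratedFDeriv ℝ i (A ħ) w‖ *
          ‖iteratedFDeriv ℝ (k - i) (B ħ) w‖) := by ring
      _ ≤ (k.choose i : ℝ) * _ := mul_le_mul_of_nonneg_left this (by positivity)
      _ = _ := by ring

theorem add {B : ℝ → Vec d × Vec d → V} (h : SymbolBound S N m A) (h' : SymbolBound S N m B) :
    SymbolBound S N m (fun ħ w => A ħ w + B ħ w) := by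
  refine ⟨fun ħ hħ => (h.1 ħ hħ).add (h'.1 ħ hħ), fun k hk => ?_⟩
  obtain ⟨C, hC⟩ := h.2 k hk
  obtain ⟨D, hD⟩ := h'.2 k hk
  refine ⟨C + D, fun ħ hħ w => ?_⟩
  have := iteratedFDeriv_add_apply (x := w) (i := k)
    ((h.1 ħ hħ).contDiffAt.of_le (mod_cast hk)) ((h'.1 ħ hħ).contDiffAt.of_le (mod_cast hk))
  change ‖iteratedFDeriv ℝ k (A ħ + B ħ) w‖ ≤ _
  rw [this, add_mul]
  exact (norm_add_le _ _).trans (add_le_add (hC ħ hħ w) (hD ħ hħ w))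

theorem const_zero_order (v : V) :
    SymbolBound S N 0 (fun _ _ => v : ℝ → Vec d × Vec d → V) := by
  refine ⟨fun ħ _ => contDiff_const, fun k _ => ⟨‖v‖, fun ħ _ w => ?_⟩⟩
  rcases k with _ | k
  · simp
  · simp [iteratedFDeriv_const_of_ne (𝕜 := ℝ) (Nat.succ_ne_zero k) v]

/-- Multiplication by a bounded function of `ħ`. -/
theorem smul_param {K : ℝ} {c : ℝ → ℂ} {A : ℝ → Vec d × Vec d → ℂ} (h : SymbolBound S N m A)
    (hc : ∀ ħ ∈ S, ‖c ħ‖ ≤ K) : SymbolBound S N m (fun ħ w => c ħ * A ħ w) := by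
  refine ⟨fun ħ hħ => contDiff_const.mul (h.1 ħ hħ), fun k hk => ?_⟩
  obtain ⟨C, hC0, hC⟩ := h.exists_nonneg k hk
  refine ⟨K * C, fun ħ hħ w => ?_⟩
  have := iteratedFDeriv_const_smul_apply (𝕜 := ℝ) (a := c ħ) (x := w) (i := k)
    ((h.1 ħ hħ).contDiffAt.of_le (mod_cast hk))
  change ‖iteratedFDeriv ℝ k (c ħ • A ħ) w‖ ≤ _
  rw [this, norm_smul, mul_assoc]
  exact mul_le_mul (hc ħ hħ) (hC ħ hħ w) (norm_nonneg _) ((norm_nonneg _).trans (hc ħ hħ))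

theorem mul {A B : ℝ → Vec d × Vec d → ℂ} (h : SymbolBound S N m A)
    (h' : SymbolBound S N m' B) : SymbolBound S N (m + m') (fun ħ w => A ħ w * B ħ w) :=
  bilinear (ContinuousLinearMap.mul ℝ ℂ) h h'

end SymbolBound

/-- Covectors as a symbol of order one. -/
theorem symbolBound_snd : SymbolBound S N 1 (fun _ w => w.2 : ℝ → Vec d × Vec d → Vec d) := by
  refine ⟨fun ħ _ => contDiff_snd, fun k _ => ⟨1, fun ħ _ w => ?_⟩⟩
  simp only [Real.rpow_one, one_mul]
  rcases k with _ | k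
  · simpa using norm_le_bracket w.2
  · rw [← norm_iteratedFDeriv_fderiv]
    have : fderiv ℝ (fun w : Vec d × Vec d => w.2) = fun _ => ContinuousLinearMap.snd ℝ _ _ := by
      ext1 w; exact (ContinuousLinearMap.snd ℝ (Vec d) (Vec d)).fderiv
    rw [this]
    rcases k with _ | k
    · simp only [norm_iteratedFDeriv_zero]
      exact (ContinuousLinearMap.norm_snd_le ℝ _ _).trans (one_le_bracket _)
    · rw [iteratedFDeriv_const_of_ne (Nat.succ_ne_zero k)]
      simpa using (bracket_pos w.2).le

/-- The weight `⟨ξ⟩^(-2)` is a symbol of order `-2`. -/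
theorem symbolBound_inv_one_add_sq :
    SymbolBound S N (-2) (fun _ w => (1 + ‖w.2‖ ^ 2)⁻¹ : ℝ → Vec d × Vec d → ℝ) := by
  refine SymbolBound.mono_smooth (N := ⊤) (SymbolBound.top_iff.2 fun N => ?_) le_top
  have hpos : ∀ w : Vec d × Vec d, 1 + ‖w.2‖ ^ 2 ≠ 0 := fun w => by positivity
  have hsm : ContDiff ℝ ∞ (fun w : Vec d × Vec d => 1 + ‖w.2‖ ^ 2) :=
    contDiff_const.add (contDiff_snd.norm_sq ℝ)
  have hnorm : ∀ w : Vec d × Vec d, (1 + ‖w.2‖ ^ 2)⁻¹ = bracket w.2 ^ (-2 : ℝ) := fun w => by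
    rw [Real.rpow_neg (bracket_pos _).le, ← bracket_sq]; norm_num
  have h0 : ∃ C : ℝ, ∀ ħ ∈ S, ∀ w : Vec d × Vec d,
      ‖(1 + ‖w.2‖ ^ 2)⁻¹‖ ≤ C * bracket w.2 ^ (-2 : ℝ) :=
    ⟨1, fun _ _ w => by rw [← hnorm, one_mul, Real.norm_of_nonneg (by positivity)]⟩
  induction N with
  | zero =>
    refine ⟨fun ħ _ => (hsm.inv hpos).of_le (by simp), fun k hk => ?_⟩
    obtain rfl : k = 0 := by simpa using hk
    exact h0.imp fun C hC ħ hħ w => by simpa using hC ħ hħ w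
  | succ N ih =>
    refine SymbolBound.of_fderiv (fun ħ _ => (hsm.inv hpos).differentiable (by simp)) h0 ?_
    -- The derivative of the weight is its square times a symbol of order one. With the induction
    -- hypothesis used twice this has order -3, better than the required -2.
    have e : ∀ w : Vec d × Vec d, fderiv ℝ (fun w : Vec d × Vec d => (1 + ‖w.2‖ ^ 2)⁻¹) w =
        (1 + ‖w.2‖ ^ 2)⁻¹ • ((1 + ‖w.2‖ ^ 2)⁻¹ • ((-2 : ℝ) •
          (innerSL ℝ w.2).comp (ContinuousLinearMap.snd ℝ (Vec d) (Vec d)))) := fun w => by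
      have h1 : HasFDerivAt (fun w : Vec d × Vec d => 1 + ‖w.2‖ ^ 2)
          (2 • (innerSL ℝ w.2).comp (ContinuousLinearMap.snd ℝ (Vec d) (Vec d))) w :=
        (hasFDerivAt_snd.norm_sq).const_add 1
      have h2 := (hasDerivAt_inv (hpos w)).comp_hasFDerivAt w h1
      refine (h2.fderiv).trans ?_
      ext v
      · simp
      · simp; field_simp
    have hfun : (fun _ : ℝ => fderiv ℝ (fun w : Vec d × Vec d => (1 + ‖w.2‖ ^ 2)⁻¹)) =
        fun _ w => (1 + ‖w.2‖ ^ 2)⁻¹ • ((1 + ‖w.2‖ ^ 2)⁻¹ • ((-2 : ℝ) •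
          (innerSL ℝ w.2).comp (ContinuousLinearMap.snd ℝ (Vec d) (Vec d)))) :=
      funext fun _ => funext e
    rw [hfun]
    have h1 : SymbolBound S N 1 (fun _ w => (-2 : ℝ) •
        (innerSL ℝ w.2).comp (ContinuousLinearMap.snd ℝ (Vec d) (Vec d)) :
          ℝ → Vec d × Vec d → _) :=
      symbolBound_snd.clm_apply ((-2 : ℝ) • (ContinuousLinearMap.compL ℝ (Vec d × Vec d) (Vec d)
        ℝ).flip (ContinuousLinearMap.snd ℝ (Vec d) (Vec d)) ∘L (innerSL ℝ))
    have h2 := (ih.bilinear (ContinuousLinearMap.lsmul ℝ ℝ)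
      (ih.bilinear (ContinuousLinearMap.lsmul ℝ ℝ) h1))
    exact SymbolBound.mono_order h2 (by norm_num)

end Symbols

/-! ### Hadamard's lemma for symbols -/

section Hadamard

variable {d : ℕ} {V : Type*} [NormedAddCommGroup V] [NormedSpace ℝ V]

theorem bracket_segment_le (ξ₀ ξ : Vec d) {s : ℝ} (hs : s ∈ Set.Icc (0 : ℝ) 1) :
    bracket (ξ₀ + s • (ξ - ξ₀)) ≤ bracket ξ₀ * bracket ξ := by
  have h1 : ‖ξ₀ + s • (ξ - ξ₀)‖ ≤ max ‖ξ₀‖ ‖ξ‖ := by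
    have e : ξ₀ + s • (ξ - ξ₀) = (1 - s) • ξ₀ + s • ξ := by module
    rw [e]
    refine (norm_add_le _ _).trans ?_
    rw [norm_smul, norm_smul, Real.norm_of_nonneg hs.1, Real.norm_of_nonneg (by linarith [hs.2])]
    have := mul_le_mul_of_nonneg_left (le_max_left ‖ξ₀‖ ‖ξ‖) (by linarith [hs.2] : 0 ≤ 1 - s)
    have := mul_le_mul_of_nonneg_left (le_max_right ‖ξ₀‖ ‖ξ‖) hs.1
    nlinarith
  have h2 : bracket (ξ₀ + s • (ξ - ξ₀)) ≤ max (bracket ξ₀) (bracket ξ) := by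
    rcases le_max_iff.1 h1 with h | h
    · exact le_max_of_le_left (Real.sqrt_le_sqrt (by gcongr))
    · exact le_max_of_le_right (Real.sqrt_le_sqrt (by gcongr))
  refine h2.trans (max_le ?_ ?_)
  · exact le_mul_of_one_le_right (bracket_pos _).le (one_le_bracket _)
  · exact le_mul_of_one_le_left (bracket_pos _).le (one_le_bracket _)

/-- For `m < 0` the weight may be far larger inside a segment than at its ends, since the segment
can pass near the origin; hence `|m|`. The loss of order is harmless, because the pairing estimates
accept symbols of any order. -/
theorem bracket_segment_rpow_le (ξ₀ ξ : Vec d) {s : ℝ} (hs : s ∈ Set.Icc (0 : ℝ) 1) (m : ℝ) :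
    bracket (ξ₀ + s • (ξ - ξ₀)) ^ m ≤ bracket ξ₀ ^ |m| * bracket ξ ^ |m| := by
  rw [← Real.mul_rpow (bracket_pos _).le (bracket_pos _).le]
  refine (Real.rpow_le_rpow_of_exponent_le (one_le_bracket _) (le_abs_self m)).trans ?_
  exact Real.rpow_le_rpow (bracket_pos _).le (bracket_segment_le _ _ hs) (abs_nonneg m)

/-- The average `∫₀¹ s^k B (w₀ + s (w - w₀)) ds` along segments. -/
def segmentAverage (w₀ : Vec d × Vec d) (k : ℕ) (B : Vec d × Vec d → V) (w : Vec d × Vec d) : V :=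
  ∫ s in (0 : ℝ)..1, s ^ k • B (w₀ + s • (w - w₀))

variable {S : Set ℝ} {m : ℝ}

theorem SymbolBound.segment_norm_le {A : ℝ → Vec d × Vec d → V} (h : SymbolBound S ⊤ m A)
    (w₀ : Vec d × Vec d) : ∃ C : ℝ, 0 ≤ C ∧ ∀ ħ ∈ S, ∀ k : ℕ, ∀ s ∈ Set.Icc (0 : ℝ) 1, ∀ w,
      ‖s ^ k • A ħ (w₀ + s • (w - w₀))‖ ≤ C * bracket w.2 ^ |m| := by
  obtain ⟨C, hC0, hC⟩ := h.norm_le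
  refine ⟨C * bracket w₀.2 ^ |m|, by have := bracket_pos w₀.2; positivity,
    fun ħ hħ k s hs w => ?_⟩
  have h1 : ‖s ^ k‖ ≤ 1 := by
    rw [norm_pow]; exact pow_le_one₀ (norm_nonneg _) (by
      rw [Real.norm_of_nonneg hs.1]; exact hs.2)
  rw [norm_smul]
  calc _ ≤ 1 * (C * bracket (w₀ + s • (w - w₀)).2 ^ m) := by
        gcongr
        exact hC ħ hħ _
    _ ≤ _ := by
        rw [one_mul, mul_assoc]
        exact mul_le_mul_of_nonneg_left (bracket_segment_rpow_le _ _ hs m) hC0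

theorem SymbolBound.norm_segmentAverage_le {A : ℝ → Vec d × Vec d → V} (h : SymbolBound S ⊤ m A)
    (w₀ : Vec d × Vec d) (k : ℕ) : ∃ C : ℝ, ∀ ħ ∈ S, ∀ w,
      ‖segmentAverage w₀ k (A ħ) w‖ ≤ C * bracket w.2 ^ |m| := by
  obtain ⟨C, hC0, hC⟩ := h.segment_norm_le w₀
  refine ⟨C, fun ħ hħ w => ?_⟩
  refine (intervalIntegral.norm_integral_le_of_norm_le_const (C := C * bracket w.2 ^ |m|)
    fun s hs => ?_).trans (by simp)
  rw [Set.uIoc_of_le zero_le_one] at hs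
  exact hC ħ hħ k s ⟨hs.1.le, hs.2⟩ w

theorem continuous_segment {B : Vec d × Vec d → V} (hB : Continuous B) (w₀ w : Vec d × Vec d)
    (k : ℕ) : Continuous fun s : ℝ => s ^ k • B (w₀ + s • (w - w₀)) := by
  fun_prop

/-- Each derivative in the endpoint brings out one factor `s`. This is why averages carry the weight
`s ^ k`: the family of all such averages is closed under differentiation. -/
theorem SymbolBound.hasFDerivAt_segmentAverage {A : ℝ → Vec d × Vec d → V}
    (h : SymbolBound S ⊤ m A) (w₀ : Vec d × Vec d) (k : ℕ) {ħ : ℝ} (hħ : ħ ∈ S)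
    (w : Vec d × Vec d) : HasFDerivAt (segmentAverage w₀ k (A ħ))
      (segmentAverage w₀ (k + 1) (_root_.fderiv ℝ (A ħ)) w) w := by
  have hA := h.1 ħ hħ
  have hA1 : Differentiable ℝ (A ħ) := hA.differentiable (by simp)
  have hA2 : Continuous (_root_.fderiv ℝ (A ħ)) := hA.continuous_fderiv (by simp)
  obtain ⟨C, hC0, hC⟩ := h.fderiv.segment_norm_le w₀
  refine intervalIntegral.hasFDerivAt_integral_of_dominated_of_fderiv_le
    (F := fun w s => s ^ k • A ħ (w₀ + s • (w - w₀)))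
    (F' := fun w s => s ^ (k + 1) • _root_.fderiv ℝ (A ħ) (w₀ + s • (w - w₀)))
    (bound := fun _ => C * (2 + ‖w.2‖) ^ |m|) (Metric.ball_mem_nhds w one_pos)
    (Filter.Eventually.of_forall fun v =>
      (continuous_segment hA.continuous w₀ v k).aestronglyMeasurable)
    ((continuous_segment hA.continuous w₀ w k).intervalIntegrable _ _)
    (continuous_segment hA2 w₀ w (k + 1)).aestronglyMeasurable
    (Filter.Eventually.of_forall fun s hs v hv => ?_) (by simp)
    (Filter.Eventually.of_forall fun s hs v hv => ?_)
  · rw [Set.uIoc_of_le zero_le_one] at hs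
    refine (hC ħ hħ (k + 1) s ⟨hs.1.le, hs.2⟩ v).trans ?_
    have h1 : ‖v.2‖ ≤ ‖w.2‖ + 1 := by
      have h2 : ‖v.2 - w.2‖ ≤ ‖v - w‖ := norm_snd_le (v - w)
      have h3 : ‖v - w‖ < 1 := by simpa [dist_eq_norm] using hv
      linarith [norm_le_norm_add_norm_sub' v.2 w.2]
    have h2 : bracket v.2 ≤ 2 + ‖w.2‖ := by linarith [bracket_le_one_add v.2]
    have := (bracket_pos v.2).le
    gcongr
  · have h1 : HasFDerivAt (fun v : Vec d × Vec d => w₀ + s • (v - w₀))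
        (s • ContinuousLinearMap.id ℝ (Vec d × Vec d)) v :=
      (((hasFDerivAt_id v).sub_const w₀).const_smul s).const_add w₀
    have h2 := ((hA1 (w₀ + s • (v - w₀))).hasFDerivAt.comp v h1).const_smul (s ^ k)
    refine h2.congr_fderiv ?_
    ext u <;> simp [pow_succ, mul_smul]

theorem SymbolBound.segmentAverage {A : ℝ → Vec d × Vec d → V}
    (h : SymbolBound S ⊤ m A) (w₀ : Vec d × Vec d) (k : ℕ) :
    SymbolBound S ⊤ |m| (fun ħ => segmentAverage w₀ k (A ħ)) := by
  refine SymbolBound.top_iff.2 fun N => ?_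
  induction N generalizing V k with
  | zero =>
    refine ⟨fun ħ hħ => ?_, fun j hj => ?_⟩
    · exact contDiff_zero.2 (continuous_iff_continuousAt.2 fun w =>
        (h.hasFDerivAt_segmentAverage w₀ k hħ w).continuousAt)
    · obtain rfl : j = 0 := by simpa using hj
      exact (h.norm_segmentAverage_le w₀ k).imp fun C hC ħ hħ w => by simpa using hC ħ hħ w
  | succ N ih =>
    refine SymbolBound.of_fderiv
      (fun ħ hħ w => (h.hasFDerivAt_segmentAverage w₀ k hħ w).differentiableAt)
      (h.norm_segmentAverage_le w₀ k) ((ih h.fderiv (k + 1)).congr fun ħ hħ => ?_)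
    exact funext fun w => (h.hasFDerivAt_segmentAverage w₀ k hħ w).fderiv.symm

/-- The fundamental theorem of calculus along the segment from `w₀` to `w`. -/
theorem eq_add_segmentAverage_fderiv {A : Vec d × Vec d → ℂ} (hA : ContDiff ℝ ∞ A)
    (w₀ w : Vec d × Vec d) :
    A w = A w₀ + segmentAverage w₀ 0 (fderiv ℝ A) w (w - w₀) := by
  have hA1 : Differentiable ℝ A := hA.differentiable (by simp)
  have hA2 : Continuous (fderiv ℝ A) := hA.continuous_fderiv (by simp)
  have hder : ∀ s : ℝ, HasDerivAt (fun s : ℝ => A (w₀ + s • (w - w₀)))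
      (fderiv ℝ A (w₀ + s • (w - w₀)) (w - w₀)) s := fun s => by
    have h1 : HasDerivAt (fun s : ℝ => w₀ + s • (w - w₀)) (w - w₀) s := by
      simpa using ((hasDerivAt_id s).smul_const (w - w₀)).const_add w₀
    exact (hA1 _).hasFDerivAt.comp_hasDerivAt s h1
  have hc : Continuous fun s : ℝ => fderiv ℝ A (w₀ + s • (w - w₀)) := by fun_prop
  have h1 := intervalIntegral.integral_eq_sub_of_hasDerivAt (a := 0) (b := 1)
    (fun s _ => hder s) ((hc.clm_apply continuous_const).intervalIntegrable _ _)
  have h2 := ContinuousLinearMap.intervalIntegral_apply (hc.intervalIntegrable (μ := MeasureTheory.volume) 0 1) (w - w₀)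
  simp only [zero_smul, one_smul, add_zero, add_sub_cancel] at h1
  simp only [SphereEgorov.segmentAverage, pow_zero, one_smul]
  rw [h2, h1]
  ring

/-- First order expansion of a symbol, in coordinates. -/
theorem SymbolBound.exists_expansion {A : ℝ → Vec d × Vec d → ℂ} (h : SymbolBound S ⊤ m A)
    (w₀ : Vec d × Vec d) : ∃ α β : Fin d → ℝ → Vec d × Vec d → ℂ,
      (∀ i, SymbolBound S ⊤ |m| (α i)) ∧ (∀ i, SymbolBound S ⊤ |m| (β i)) ∧
      ∀ ħ ∈ S, ∀ w, A ħ w = A ħ w₀ + ∑ i, (((w.1 - w₀.1) i : ℝ) : ℂ) * α i ħ w +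
        ∑ i, (((w.2 - w₀.2) i : ℝ) : ℂ) * β i ħ w := by
  have hs := h.fderiv.segmentAverage w₀ 0
  refine ⟨fun i ħ w => SphereEgorov.segmentAverage w₀ 0 (_root_.fderiv ℝ (A ħ)) w (EuclideanSpace.single i 1, 0),
    fun i ħ w => SphereEgorov.segmentAverage w₀ 0 (_root_.fderiv ℝ (A ħ)) w (0, EuclideanSpace.single i 1),
    fun i => hs.clm_apply (ContinuousLinearMap.apply ℝ ℂ _),
    fun i => hs.clm_apply (ContinuousLinearMap.apply ℝ ℂ _), fun ħ hħ w => ?_⟩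
  rw [eq_add_segmentAverage_fderiv (h.1 ħ hħ) w₀ w]
  have hexp : ∀ v : Vec d, v = ∑ i, v i • EuclideanSpace.single i (1 : ℝ) := fun v => by
    ext j; simp [Finset.sum_apply, Pi.single_apply]
  have e1 : ∀ (L : Vec d × Vec d →L[ℝ] ℂ) (v : Vec d), L (v, 0) =
      ∑ i, ((v i : ℝ) : ℂ) * L (EuclideanSpace.single i 1, 0) := fun L v => by
    have : (v, (0 : Vec d)) = ContinuousLinearMap.inl ℝ _ _ v := rfl
    rw [this, ← ContinuousLinearMap.comp_apply]
    conv_lhs => rw [hexp v]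
    simp [-PiLp.toLp_single, map_sum]
  have e2 : ∀ (L : Vec d × Vec d →L[ℝ] ℂ) (v : Vec d), L (0, v) =
      ∑ i, ((v i : ℝ) : ℂ) * L (0, EuclideanSpace.single i 1) := fun L v => by
    have : ((0 : Vec d), v) = ContinuousLinearMap.inr ℝ _ _ v := rfl
    rw [this, ← ContinuousLinearMap.comp_apply]
    conv_lhs => rw [hexp v]
    simp [map_sum]
  have e3 : w - w₀ = (w.1 - w₀.1, 0) + (0, w.2 - w₀.2) := by ext <;> simp
  conv_lhs => rw [e3, map_add, e1, e2]
  rw [add_assoc]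

end Hadamard

/-! ### Oscillatory integrals -/

section Oscillatory

open MeasureTheory

variable {d : ℕ}

/-- The plane wave `exp(i (b - c)·ξ / ħ)`. -/
def wave (ħ : ℝ) (b ξ c : Vec d) : ℂ := Complex.exp (Complex.I * ((⟪b - c, ξ⟫_ℝ / ħ : ℝ) : ℂ))

theorem norm_wave (ħ : ℝ) (b ξ c : Vec d) : ‖wave ħ b ξ c‖ = 1 := by
  rw [wave, mul_comm]; exact Complex.norm_exp_ofReal_mul_I _

theorem contDiff_wave (ħ : ℝ) (b ξ : Vec d) : ContDiff ℝ ∞ (wave ħ b ξ) := by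
  unfold wave
  refine Complex.contDiff_exp.comp (contDiff_const.mul (Complex.ofRealCLM.contDiff.comp ?_))
  exact ((contDiff_const.sub contDiff_id).inner ℝ contDiff_const).div_const _

theorem continuous_wave (ħ : ℝ) (b : Vec d) :
    Continuous fun p : Vec d × Vec d => wave ħ b p.2 p.1 := by
  unfold wave
  fun_prop

theorem fderiv_wave (ħ : ℝ) (b ξ c v : Vec d) :
    fderiv ℝ (wave ħ b ξ) c v = -(Complex.I * ((⟪v, ξ⟫_ℝ / ħ : ℝ) : ℂ)) * wave ħ b ξ c := by
  have h1 : HasFDerivAt (fun c : Vec d => ⟪b - c, ξ⟫_ℝ / ħ)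
      (-(ħ⁻¹ • innerSL ℝ ξ)) c := by
    have h2 : (fun c : Vec d => ⟪b - c, ξ⟫_ℝ / ħ) =
        fun c => ⟪b, ξ⟫_ℝ / ħ - (ħ⁻¹ • innerSL ℝ ξ) c := by
      ext c
      simp [inner_sub_left, real_inner_comm ξ c]
      ring
    rw [h2]
    exact (ħ⁻¹ • innerSL ℝ ξ).hasFDerivAt.const_sub _
  have h3 := ((Complex.ofRealCLM.hasFDerivAt.comp c h1).const_mul Complex.I).cexp
  have h4 : fderiv ℝ (wave ħ b ξ) c = _ := h3.fderiv
  rw [h4]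
  simp [wave, real_inner_comm ξ v]
  ring

/-- Smooth functions with compact support. -/
def IsTest (f : Vec d → ℂ) : Prop := ContDiff ℝ ∞ f ∧ HasCompactSupport f

theorem IsTest.integrable {f : Vec d → ℂ} (hf : IsTest f) : Integrable f :=
  hf.1.continuous.integrable_of_hasCompactSupport hf.2

theorem IsTest.mul_left {f g : Vec d → ℂ} (hf : IsTest f) (hg : ContDiff ℝ ∞ g) :
    IsTest (fun c => g c * f c) :=
  ⟨hg.mul hf.1, hf.2.mul_left⟩

theorem IsTest.add {f g : Vec d → ℂ} (hf : IsTest f) (hg : IsTest g) :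
    IsTest (fun c => f c + g c) :=
  ⟨hf.1.add hg.1, hf.2.add hg.2⟩

theorem IsTest.sum {ι : Type*} (s : Finset ι) {f : ι → Vec d → ℂ} (hf : ∀ i ∈ s, IsTest (f i)) :
    IsTest (fun c => ∑ i ∈ s, f i c) := by
  classical
  induction s using Finset.induction_on with
  | empty => exact ⟨contDiff_const, HasCompactSupport.zero⟩
  | insert i s hi ih =>
    simp only [Finset.sum_insert hi]
    exact (hf i (by simp)).add (ih fun j hj => hf j (by simp [hj]))

theorem IsTest.fderiv_apply {f : Vec d → ℂ} (hf : IsTest f) (v : Vec d) :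
    IsTest (fun c => fderiv ℝ f c v) :=
  ⟨(hf.1.fderiv_right (m := ∞) (by simp)).clm_apply contDiff_const, hf.2.fderiv_apply ℝ v⟩

/-- The scaled partial derivative `ħ ∂ᵢ`. -/
def scaledDeriv (ħ : ℝ) (i : Fin d) (f : Vec d → ℂ) (c : Vec d) : ℂ :=
  (ħ : ℂ) * fderiv ℝ f c (EuclideanSpace.single i 1)

theorem IsTest.scaledDeriv {f : Vec d → ℂ} (hf : IsTest f) (ħ : ℝ) (i : Fin d) :
    IsTest (scaledDeriv ħ i f) :=
  (hf.fderiv_apply _).mul_left contDiff_const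

theorem IsTest.regularizer {f : Vec d → ℂ} (hf : IsTest f) (ħ : ℝ) (ξ : Vec d) :
    IsTest (regularizer ħ ξ f) := by
  have h : SphereEgorov.regularizer ħ ξ f = fun c => ((1 + ‖ξ‖ ^ 2 : ℝ) : ℂ)⁻¹ *
      (f c + (ħ * -Complex.I) * fderiv ℝ f c ξ) := by
    ext c; unfold SphereEgorov.regularizer; ring
  rw [h]
  exact (hf.add ((hf.fderiv_apply ξ).mul_left contDiff_const)).mul_left contDiff_const

theorem regularizer_add {f g : Vec d → ℂ} (hf : IsTest f) (hg : IsTest g) (ħ : ℝ) (ξ : Vec d) :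
    regularizer ħ ξ (fun c => f c + g c) =
      fun c => regularizer ħ ξ f c + regularizer ħ ξ g c := by
  ext c
  unfold regularizer
  rw [fderiv_fun_add ((hf.1.differentiable (by simp)) c) ((hg.1.differentiable (by simp)) c)]
  simp only [add_apply]
  ring

theorem regularizer_iterate_add {f g : Vec d → ℂ} (hf : IsTest f) (hg : IsTest g) (ħ : ℝ)
    (ξ : Vec d) (k : ℕ) : (regularizer ħ ξ)^[k] (fun c => f c + g c) =
      fun c => (regularizer ħ ξ)^[k] f c + (regularizer ħ ξ)^[k] g c := by
  induction k generalizing f g with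
  | zero => rfl
  | succ k ih =>
    simp only [Function.iterate_succ_apply]
    rw [regularizer_add hf hg, ih (hf.regularizer ħ ξ) (hg.regularizer ħ ξ)]

theorem regularizer_iterate_sum {ι : Type*} (s : Finset ι) {f : ι → Vec d → ℂ}
    (hf : ∀ i ∈ s, IsTest (f i)) (ħ : ℝ) (ξ : Vec d) (k : ℕ) :
    (regularizer ħ ξ)^[k] (fun c => ∑ i ∈ s, f i c) =
      fun c => ∑ i ∈ s, (regularizer ħ ξ)^[k] (f i) c := by
  classical
  induction s using Finset.induction_on with
  | empty =>
    simp only [Finset.sum_empty]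
    have : regularizer ħ ξ (fun _ : Vec d => (0 : ℂ)) = fun _ => 0 := by
      ext c; simp [regularizer]
    exact Function.iterate_fixed this k
  | insert i s hi ih =>
    simp only [Finset.sum_insert hi]
    rw [regularizer_iterate_add (hf i (by simp)) (IsTest.sum s fun j hj => hf j (by simp [hj])),
      ih fun j hj => hf j (by simp [hj])]

/-- As a function of `c` the wave satisfies ħ ξ·D_c (wave) = -|ξ|² wave, so the transposed operator
(1 - ħ ξ·D_c)/(1 + |ξ|²) fixes it. Integrating by parts therefore removes the regularizer. -/
theorem integral_wave_mul_regularizer {G : Vec d → ℂ} (hG : IsTest G) {ħ : ℝ} (hħ : ħ ≠ 0)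
    (b ξ : Vec d) :
    ∫ c, wave ħ b ξ c * regularizer ħ ξ G c = ∫ c, wave ħ b ξ c * G c := by
  have hw := contDiff_wave ħ b ξ
  have i1 := (hG.mul_left hw).integrable
  have i2 := ((hG.fderiv_apply ξ).mul_left hw).integrable
  have i3 : Integrable fun c => fderiv ℝ (wave ħ b ξ) c ξ * G c :=
    (hG.mul_left ((hw.fderiv_right (m := ∞) (by simp)).clm_apply contDiff_const)).integrable
  have ibp := integral_mul_fderiv_eq_neg_fderiv_mul_of_integrable i3 i2 i1
    (fun c _ => hw.differentiable (by simp) c) (fun c _ => hG.1.differentiable (by simp) c)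
  have e1 : ∀ c, fderiv ℝ (wave ħ b ξ) c ξ * G c =
      (-(Complex.I * ((‖ξ‖ ^ 2 / ħ : ℝ) : ℂ))) * (wave ħ b ξ c * G c) := fun c => by
    rw [fderiv_wave, real_inner_self_eq_norm_sq]; ring
  simp only [e1] at ibp
  rw [integral_const_mul] at ibp
  have e2 : ∀ c, wave ħ b ξ c * regularizer ħ ξ G c = ((1 + ‖ξ‖ ^ 2 : ℝ) : ℂ)⁻¹ *
      (wave ħ b ξ c * G c + (ħ * -Complex.I) * (wave ħ b ξ c * fderiv ℝ G c ξ)) := fun c => by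
    unfold regularizer; ring
  simp only [e2]
  rw [integral_const_mul, integral_add i1 (i2.const_mul _), integral_const_mul, ibp]
  have h1 : ((1 + ‖ξ‖ ^ 2 : ℝ) : ℂ) ≠ 0 := by exact_mod_cast (by positivity : (1 + ‖ξ‖ ^ 2) ≠ 0)
  have h2 : (ħ : ℂ) ≠ 0 := by exact_mod_cast hħ
  rw [inv_mul_eq_iff_eq_mul₀ h1]
  push_cast
  field_simp
  linear_combination (-(‖ξ‖ : ℂ) ^ 2 * ∫ c, wave ħ b ξ c * G c) * Complex.I_sq

/-- Decay of the oscillatory integral of a smooth function with integrable derivatives. -/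
theorem exists_norm_integral_wave_le (d : ℕ) : ∃ C₀ : ℝ, 0 ≤ C₀ ∧ ∀ (g : Vec d → ℂ) (C : ℝ), 0 ≤ C →
    ContDiff ℝ ∞ g →
    (∀ j ≤ d + 1, ∀ ξ, ‖iteratedFDeriv ℝ j g ξ‖ ≤ C * (1 + ‖ξ‖) ^ (-(d + 1 : ℝ))) →
    ∀ u : Vec d, ‖∫ ξ, Complex.exp (Complex.I * ((⟪u, ξ⟫_ℝ : ℝ) : ℂ)) * g ξ‖ ≤
      C₀ * C * (1 + ‖u‖) ^ (-(d + 1 : ℝ)) := by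
  set T : ℝ := ∫ ξ : Vec d, (1 + ‖ξ‖) ^ (-(d + 1 : ℝ)) with hT
  have hint : Integrable fun ξ : Vec d => (1 + ‖ξ‖) ^ (-(d + 1 : ℝ)) :=
    integrable_one_add_norm (by simp)
  have hT0 : 0 ≤ T := integral_nonneg fun ξ => by positivity
  refine ⟨2 ^ (d + 1) * (T + (2 * Real.pi) ^ (d + 1) * (2 ^ (d + 1) * ((d + 2) * T))), by positivity,
    fun g C hC hg hb u => ?_⟩
  have hj : ∀ j ≤ d + 1, Integrable (fun ξ => ‖iteratedFDeriv ℝ j g ξ‖) ∧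
      ∫ ξ, ‖iteratedFDeriv ℝ j g ξ‖ ≤ C * T := fun j hj => by
    have hi : Integrable (fun ξ => ‖iteratedFDeriv ℝ j g ξ‖) := by
      refine (hint.const_mul C).mono'
        ((hg.continuous_iteratedFDeriv (by exact_mod_cast le_top)).norm.aestronglyMeasurable)
        (Filter.Eventually.of_forall fun ξ => ?_)
      simpa using hb j hj ξ
    refine ⟨hi, (integral_mono hi (hint.const_mul C) fun ξ => hb j hj ξ).trans ?_⟩
    rw [integral_const_mul]
  -- The frequency at which the Fourier transform with kernel exp(-2πi⟨ξ, w⟩) becomes the given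
  -- integral.
  set w : Vec d := (-(2 * Real.pi)⁻¹) • u with hw
  have hF : ∫ ξ, Complex.exp (Complex.I * ((⟪u, ξ⟫_ℝ : ℝ) : ℂ)) * g ξ =
      FourierTransform.fourier g w := by
    rw [Real.fourier_eq']
    congr 1 with ξ
    rw [smul_eq_mul, hw, inner_smul_right, real_inner_comm u ξ, mul_comm Complex.I]
    congr 4
    field_simp
  have hwn : ‖u‖ = 2 * Real.pi * ‖w‖ := by
    rw [hw, norm_smul, norm_neg, Real.norm_of_nonneg (by positivity)]
    field_simp
  rw [hF]
  set I := ‖FourierTransform.fourier g w‖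
  have b0 : I ≤ C * T := by
    rw [show I = ‖FourierTransform.fourier g w‖ from rfl, ← hF]
    refine (norm_integral_le_integral_norm _).trans ((le_of_eq ?_).trans (hj 0 (by omega)).2)
    congr 1 with ξ
    rw [norm_mul, mul_comm Complex.I, Complex.norm_exp_ofReal_mul_I, one_mul, norm_iteratedFDeriv_zero]
  -- Derivatives of `g` become powers of the frequency; `d + 1` of them give a decay that is
  -- integrable in dimension `d`.
  have b1 : ‖w‖ ^ (d + 1) * I ≤ 2 ^ (d + 1) * ((d + 2) * (C * T)) := by
    have := Real.pow_mul_norm_iteratedFDeriv_fourier_le (K := 0) (N := (d + 1 : ℕ)) (f := g)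
      (hg.of_le (by exact_mod_cast le_top)) (fun k n hk hn => by
        obtain rfl : k = 0 := by simpa using hk
        simpa using (hj n (by exact_mod_cast hn)).1) (k := 0) (n := d + 1) le_rfl le_rfl w
    simp only [norm_iteratedFDeriv_zero, pow_zero, one_mul, zero_add, Finset.range_one,
      Nat.cast_zero, mul_zero] at this
    refine this.trans ?_
    gcongr
    rw [Finset.sum_product]
    simp only [Finset.sum_singleton, pow_zero, one_mul]
    refine (Finset.sum_le_sum fun j hj' => (hj j (by have := Finset.mem_range.1 hj'; omega)).2).trans ?_
    simp
    linarith
  have b2 : ‖u‖ ^ (d + 1) * I ≤ (2 * Real.pi) ^ (d + 1) * (2 ^ (d + 1) * ((d + 2) * (C * T))) := by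
    rw [hwn, mul_pow, mul_assoc]
    gcongr
  have b3 : (1 + ‖u‖) ^ (d + 1) ≤ 2 ^ (d + 1) * (1 + ‖u‖ ^ (d + 1)) := by
    have h1 : (1 + ‖u‖) ^ (d + 1) ≤ (2 * max 1 ‖u‖) ^ (d + 1) := by
      gcongr
      linarith [le_max_left 1 ‖u‖, le_max_right 1 ‖u‖]
    rw [mul_pow] at h1
    refine h1.trans ?_
    gcongr
    rcases max_cases 1 ‖u‖ with h | h
    · rw [h.1]; simp
    · rw [h.1]; linarith
  have h1 : (0 : ℝ) < (1 + ‖u‖) ^ (d + 1) := by positivity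
  rw [Real.rpow_neg (by positivity), show (d + 1 : ℝ) = ((d + 1 : ℕ) : ℝ) by push_cast; rfl,
    Real.rpow_natCast, ← div_eq_mul_inv, le_div_iff₀ h1]
  have hI : 0 ≤ I := norm_nonneg _
  calc I * (1 + ‖u‖) ^ (d + 1) ≤ I * (2 ^ (d + 1) * (1 + ‖u‖ ^ (d + 1))) := by gcongr
    _ = 2 ^ (d + 1) * (I + ‖u‖ ^ (d + 1) * I) := by ring
    _ ≤ 2 ^ (d + 1) * (C * T + (2 * Real.pi) ^ (d + 1) * (2 ^ (d + 1) * ((d + 2) * (C * T)))) := by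
      gcongr
    _ = _ := by ring

end Oscillatory

/-! ### Lowering the order of a symbol by integration by parts -/

section Reduction

open MeasureTheory

variable {d : ℕ}

/-- The amplitude `A(b_t, ξ) f(c)`, `b_t = (1 - t) b + t c`, of the `t`-quantization of `A`. -/
def amplitude (t : ℝ) (A : Vec d × Vec d → ℂ) (f : Vec d → ℂ) (b ξ c : Vec d) : ℂ :=
  A ((1 - t) • b + t • c, ξ) * f c

theorem contDiff_slice {A : Vec d × Vec d → ℂ} (hA : ContDiff ℝ ∞ A) (t : ℝ) (b ξ : Vec d) :
    ContDiff ℝ ∞ fun c : Vec d => A ((1 - t) • b + t • c, ξ) :=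
  hA.comp (f := fun c : Vec d => ((1 - t) • b + t • c, ξ)) (by fun_prop)

theorem isTest_amplitude {A : Vec d × Vec d → ℂ} (hA : ContDiff ℝ ∞ A) {f : Vec d → ℂ}
    (hf : IsTest f) (t : ℝ) (b ξ : Vec d) : IsTest (amplitude t A f b ξ) :=
  hf.mul_left (contDiff_slice hA t b ξ)

theorem fderiv_slice {A : Vec d × Vec d → ℂ} (hA : ContDiff ℝ ∞ A) (t : ℝ) (b ξ c v : Vec d) :
    fderiv ℝ (fun c : Vec d => A ((1 - t) • b + t • c, ξ)) c v =
      t * fderiv ℝ A ((1 - t) • b + t • c, ξ) (v, 0) := by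
  have h1 : HasFDerivAt (fun c : Vec d => ((1 - t) • b + t • c, ξ))
      ((t • ContinuousLinearMap.id ℝ (Vec d)).prod 0) c :=
    (((hasFDerivAt_id c).const_smul t).const_add _).prodMk (hasFDerivAt_const ξ c)
  have h2 := (hA.differentiable (by simp) ((1 - t) • b + t • c, ξ)).hasFDerivAt.comp c h1
  have h3 : fderiv ℝ (fun c : Vec d => A ((1 - t) • b + t • c, ξ)) c = _ := h2.fderiv
  rw [h3]
  have : (t • v, (0 : Vec d)) = t • (v, (0 : Vec d)) := by simp
  change fderiv ℝ A ((1 - t) • b + t • c, ξ) (t • v, 0) = _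
  rw [this, map_smul, Complex.real_smul]

/-- The coefficient of `f` in the regularized amplitude. -/
def reducedSymbol (t ħ : ℝ) (A : Vec d × Vec d → ℂ) (w : Vec d × Vec d) : ℂ :=
  (1 + ‖w.2‖ ^ 2)⁻¹ • (A w + (-Complex.I * (ħ * t)) * fderiv ℝ A w (w.2, 0))

/-- The coefficient of `ħ ∂ᵢ f` in the regularized amplitude. -/
def reducedSymbolDeriv (i : Fin d) (A : Vec d × Vec d → ℂ) (w : Vec d × Vec d) : ℂ :=
  (1 + ‖w.2‖ ^ 2)⁻¹ • (-Complex.I * (((w.2 i : ℝ) : ℂ) * A w))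

theorem sum_apply_single (L : Vec d →L[ℝ] ℂ) (v : Vec d) :
    L v = ∑ i, ((v i : ℝ) : ℂ) * L (EuclideanSpace.single i 1) := by
  have hexp : v = ∑ i, v i • EuclideanSpace.single i (1 : ℝ) := by
    ext j; simp [Finset.sum_apply, Pi.single_apply]
  conv_lhs => rw [hexp]
  simp [map_sum]

/-- By the Leibniz rule the derivative falls either on the symbol, through `b_t` and hence with a
factor `t`, or on `f`. The result is again a sum of amplitudes, so the step can be iterated. -/
theorem regularizer_amplitude {A : Vec d × Vec d → ℂ} (hA : ContDiff ℝ ∞ A) {f : Vec d → ℂ}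
    (hf : IsTest f) (t ħ : ℝ) (b ξ : Vec d) :
    regularizer ħ ξ (amplitude t A f b ξ) = fun c =>
      amplitude t (reducedSymbol t ħ A) f b ξ c +
        ∑ i, amplitude t (reducedSymbolDeriv i A) (scaledDeriv ħ i f) b ξ c := by
  ext c
  have h1 := (contDiff_slice hA t b ξ).differentiable (by simp) c
  have h2 := hf.1.differentiable (by simp) c
  have h3 : fderiv ℝ (amplitude t A f b ξ) c ξ =
      A ((1 - t) • b + t • c, ξ) * fderiv ℝ f c ξ +
        f c * (t * fderiv ℝ A ((1 - t) • b + t • c, ξ) (ξ, 0)) := by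
    have := fderiv_fun_mul h1 h2
    unfold amplitude
    rw [this, ← fderiv_slice hA]
    simp
  unfold regularizer
  rw [h3, sum_apply_single (fderiv ℝ f c) ξ]
  simp only [amplitude, reducedSymbol, reducedSymbolDeriv, scaledDeriv, Complex.real_smul,
    Complex.ofReal_inv]
  have h4 : ∀ i : Fin d, ((1 + ‖ξ‖ ^ 2 : ℝ) : ℂ)⁻¹ * (-Complex.I * (((ξ i : ℝ) : ℂ) *
      A ((1 - t) • b + t • c, ξ))) * (ħ * fderiv ℝ f c (EuclideanSpace.single i 1)) =
      (((1 + ‖ξ‖ ^ 2 : ℝ) : ℂ)⁻¹ * (-Complex.I * ħ * A ((1 - t) • b + t • c, ξ))) *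
        (((ξ i : ℝ) : ℂ) * fderiv ℝ f c (EuclideanSpace.single i 1)) := fun i => by ring
  simp only [h4, ← Finset.mul_sum]
  ring

variable {S : Set ℝ} {m : ℝ} {A : ℝ → Vec d × Vec d → ℂ}

theorem SymbolBound.coord_mul (h : SymbolBound S ⊤ m A) (i : Fin d) :
    SymbolBound S ⊤ (m + 1) (fun ħ w => ((w.2 i : ℝ) : ℂ) * A ħ w) := by
  have h1 : SymbolBound S ⊤ 1 (fun _ w => ((w.2 i : ℝ) : ℂ) : ℝ → Vec d × Vec d → ℂ) :=
    symbolBound_snd.clm_apply (Complex.ofRealCLM.comp (EuclideanSpace.proj i : Vec d →L[ℝ] ℝ))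
  rw [add_comm]
  exact h1.mul h

/-- The coordinate of ξ costs one order and the weight ⟨ξ⟩^{-2} gains two. -/
theorem SymbolBound.reducedSymbolDeriv (h : SymbolBound S ⊤ m A) (i : Fin d) :
    SymbolBound S ⊤ (m - 1) (fun ħ => reducedSymbolDeriv i (A ħ)) := by
  have h1 := (h.coord_mul i).smul_param (c := fun _ => -Complex.I) (K := 1) (by simp)
  exact (symbolBound_inv_one_add_sq.bilinear (ContinuousLinearMap.lsmul ℝ ℝ) h1).mono_order
    (by linarith)

/-- The worst term is ħ t ξ·∂_b A, of order `m + 1` before the weight is applied; its factor ħ t is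
bounded by `ħ₀`. -/
theorem SymbolBound.reducedSymbol {ħ₀ : ℝ} (h : SymbolBound (Set.Ioc 0 ħ₀) ⊤ m A) {t : ℝ}
    (ht : t ∈ Set.Icc (0 : ℝ) 1) :
    SymbolBound (Set.Ioc 0 ħ₀) ⊤ (m - 1) (fun ħ => reducedSymbol t ħ (A ħ)) := by
  have h1 : SymbolBound (Set.Ioc 0 ħ₀) ⊤ (m + 1)
      (fun ħ w => _root_.fderiv ℝ (A ħ) w (w.2, 0)) :=
    h.fderiv.bilinear ((ContinuousLinearMap.compL ℝ (Vec d) (Vec d × Vec d) ℂ).flip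
      (ContinuousLinearMap.inl ℝ (Vec d) (Vec d))) symbolBound_snd
  have h2 := h1.smul_param (c := fun ħ => -Complex.I * (ħ * t)) (K := ħ₀) fun ħ hħ => by
    rw [norm_mul, norm_neg, Complex.norm_I, one_mul, norm_mul, Complex.norm_real,
      Complex.norm_real, Real.norm_of_nonneg hħ.1.le, Real.norm_of_nonneg ht.1]
    nlinarith [hħ.1, hħ.2, ht.1, ht.2]
  have h3 := (h.mono_order (by linarith : m ≤ m + 1)).add h2
  exact (symbolBound_inv_one_add_sq.bilinear (ContinuousLinearMap.lsmul ℝ ℝ) h3).mono_order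
    (by linarith)

/-- The sum of the absolute values of the derivatives `(ħ∂)^α f`, `|α| ≤ k`, with repetitions. -/
def derivSum (ħ : ℝ) : ℕ → (Vec d → ℂ) → Vec d → ℝ
  | 0, f, c => ‖f c‖
  | k + 1, f, c => derivSum ħ k f c + ∑ i, derivSum ħ k (scaledDeriv ħ i f) c

theorem derivSum_nonneg (ħ : ℝ) (k : ℕ) (f : Vec d → ℂ) (c : Vec d) : 0 ≤ derivSum ħ k f c := by
  induction k generalizing f with
  | zero => exact norm_nonneg _
  | succ k ih => exact add_nonneg (ih f) (Finset.sum_nonneg fun i _ => ih _)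

theorem continuous_derivSum (ħ : ℝ) (k : ℕ) {f : Vec d → ℂ} (hf : IsTest f) :
    Continuous (derivSum ħ k f) := by
  induction k generalizing f with
  | zero => exact hf.1.continuous.norm
  | succ k ih => exact (ih hf).add (continuous_finsetSum _ fun i _ => ih (hf.scaledDeriv ħ i))

theorem hasCompactSupport_derivSum (ħ : ℝ) (k : ℕ) {f : Vec d → ℂ} (hf : IsTest f) :
    HasCompactSupport (derivSum ħ k f) := by
  induction k generalizing f with
  | zero => exact hf.2.norm
  | succ k ih =>
    refine (ih hf).add ?_
    have : ∀ s : Finset (Fin d), HasCompactSupport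
        (fun c => ∑ i ∈ s, derivSum ħ k (scaledDeriv ħ i f) c) := fun s => by
      classical
      induction s using Finset.induction_on with
      | empty => exact HasCompactSupport.zero
      | insert i s hi ih' =>
        simp only [Finset.sum_insert hi]
        exact (ih (hf.scaledDeriv ħ i)).add ih'
    exact this _

/-- The weight `(1 + |b - c| / ħ)^(-(d+1))`. -/
def decay (ħ : ℝ) (b c : Vec d) : ℝ := (1 + ‖b - c‖ / ħ) ^ (-(d + 1 : ℝ))

theorem decay_nonneg {ħ : ℝ} (hħ : 0 < ħ) (b c : Vec d) : 0 ≤ decay ħ b c := by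
  unfold decay; positivity

theorem continuous_decay {ħ : ℝ} (hħ : 0 < ħ) (b : Vec d) : Continuous (decay ħ b) := by
  unfold decay
  refine Continuous.rpow_const (by fun_prop) fun c => Or.inl ?_
  positivity

theorem integrable_decay_mul {ħ : ℝ} (hħ : 0 < ħ) (b : Vec d) (k : ℕ) {f : Vec d → ℂ}
    (hf : IsTest f) : Integrable fun c => decay ħ b c * derivSum ħ k f c :=
  ((continuous_decay hħ b).mul (continuous_derivSum ħ k hf)).integrable_of_hasCompactSupport
    (hasCompactSupport_derivSum ħ k hf).mul_left

/-- The inner integral `∫ exp(i (b - c)·ξ / ħ) A(b_t, ξ) f(c) dc`. -/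
def innerIntegral (t ħ : ℝ) (A : Vec d × Vec d → ℂ) (f : Vec d → ℂ) (b ξ : Vec d) : ℂ :=
  ∫ c, wave ħ b ξ c * amplitude t A f b ξ c

theorem integrable_wave_mul_amplitude {A : Vec d × Vec d → ℂ} (hA : ContDiff ℝ ∞ A)
    {f : Vec d → ℂ} (hf : IsTest f) (t ħ : ℝ) (b ξ : Vec d) :
    Integrable fun c => wave ħ b ξ c * amplitude t A f b ξ c :=
  ((isTest_amplitude hA hf t b ξ).mul_left (contDiff_wave ħ b ξ)).integrable

/-- For fixed ξ only the integral over `c` is involved, and its integrand has compact support, so no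
decay in ξ is required. -/
theorem innerIntegral_eq_reduced {A : Vec d × Vec d → ℂ} (hA : ContDiff ℝ ∞ A)
    {ħ : ℝ} (hħ : ħ ≠ 0) {t : ℝ} (h1 : ContDiff ℝ ∞ (reducedSymbol t ħ A))
    (h2 : ∀ i, ContDiff ℝ ∞ (reducedSymbolDeriv i A)) {f : Vec d → ℂ} (hf : IsTest f)
    (b ξ : Vec d) :
    innerIntegral t ħ A f b ξ = innerIntegral t ħ (reducedSymbol t ħ A) f b ξ +
      ∑ i, innerIntegral t ħ (reducedSymbolDeriv i A) (scaledDeriv ħ i f) b ξ := by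
  unfold innerIntegral
  rw [← integral_wave_mul_regularizer (isTest_amplitude hA hf t b ξ) hħ,
    regularizer_amplitude hA hf]
  simp only [mul_add, Finset.mul_sum]
  rw [integral_add (integrable_wave_mul_amplitude h1 hf t ħ b ξ)
    (integrable_finsetSum _ fun i _ =>
      integrable_wave_mul_amplitude (h2 i) (hf.scaledDeriv ħ i) t ħ b ξ),
    integral_finsetSum _ fun i _ =>
      integrable_wave_mul_amplitude (h2 i) (hf.scaledDeriv ħ i) t ħ b ξ]

end Reduction

/-! ### Absolute convergence of the quantization and its independence of the regularization -/

section Quantization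

open MeasureTheory

variable {d : ℕ}

theorem bracket_rpow_le {m : ℝ} (hm : m ≤ -(d + 1 : ℝ)) (ξ : Vec d) :
    bracket ξ ^ m ≤ 2 ^ (d + 1 : ℝ) * (1 + ‖ξ‖) ^ (-(d + 1 : ℝ)) := by
  have h1 : bracket ξ ^ m ≤ bracket ξ ^ (-(d + 1 : ℝ)) :=
    Real.rpow_le_rpow_of_exponent_le (one_le_bracket ξ) hm
  refine h1.trans ?_
  have h2 : (1 + ‖ξ‖) / 2 ≤ bracket ξ := by linarith [one_add_le_bracket ξ]
  have h3 : (0 : ℝ) < (1 + ‖ξ‖) / 2 := by positivity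
  refine (Real.rpow_le_rpow_of_nonpos h3 h2 (by linarith [(Nat.cast_nonneg d : (0 : ℝ) ≤ d)])).trans
    (le_of_eq ?_)
  rw [Real.div_rpow (by positivity) (by norm_num), Real.rpow_neg (by norm_num : (0 : ℝ) ≤ 2),
    div_inv_eq_mul, mul_comm]

theorem norm_iteratedFDeriv_slice_le {A : Vec d × Vec d → ℂ} (hA : ContDiff ℝ ∞ A) (y ξ : Vec d)
    (j : ℕ) : ‖iteratedFDeriv ℝ j (fun ξ => A (y, ξ)) ξ‖ ≤ ‖iteratedFDeriv ℝ j A (y, ξ)‖ := by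
  have h1 : (fun ξ => A (y, ξ)) =
      (fun w => A ((y, 0) + w)) ∘ (ContinuousLinearMap.inr ℝ (Vec d) (Vec d)) := by
    ext ξ; simp
  have hA' : ContDiff ℝ ∞ fun w => A ((y, 0) + w) := hA.comp (contDiff_const.add contDiff_id)
  rw [h1, ContinuousLinearMap.iteratedFDeriv_comp_right _ hA' _ (by exact_mod_cast le_top),
    iteratedFDeriv_comp_add_left]
  refine (ContinuousMultilinearMap.norm_compContinuousLinearMap_le _ _).trans ?_
  have h2 : ‖ContinuousLinearMap.inr ℝ (Vec d) (Vec d)‖ ≤ 1 :=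
    ContinuousLinearMap.opNorm_le_bound _ zero_le_one fun v => by simp
  have h3 : ∏ _i : Fin j, ‖ContinuousLinearMap.inr ℝ (Vec d) (Vec d)‖ ≤ 1 :=
    Finset.prod_le_one (fun _ _ => norm_nonneg _) fun _ _ => h2
  refine (mul_le_of_le_one_right (norm_nonneg _) h3).trans ?_
  simp

/-- The regularized integrand of the quantization. -/
def regularizedIntegrand (t ħ : ℝ) (k : ℕ) (A : Vec d × Vec d → ℂ) (f : Vec d → ℂ) (b : Vec d)
    (p : Vec d × Vec d) : ℂ :=
  wave ħ b p.2 p.1 * (regularizer ħ p.2)^[k] (amplitude t A f b p.2) p.1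

/-- Absolute convergence, independence of the regularization, and the size of the quantization of
a symbol of order at most `k - d - 1`. -/
structure QuantizationBound (t ħ : ℝ) (k : ℕ) (A : Vec d × Vec d → ℂ) (f : Vec d → ℂ) (b : Vec d)
    (C : ℝ) : Prop where
  integrable : Integrable (regularizedIntegrand t ħ k A f b) (volume.prod volume)
  integral_eq : ∫ c, ∫ ξ, regularizedIntegrand t ħ k A f b (c, ξ) = ∫ ξ, innerIntegral t ħ A f b ξ
  integrable_inner : Integrable (innerIntegral t ħ A f b)
  norm_le : ‖∫ ξ, innerIntegral t ħ A f b ξ‖ ≤ C * ∫ c, decay ħ b c * derivSum ħ k f c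

theorem integrable_regularizedIntegrand_zero {A : Vec d × Vec d → ℂ} (hA : Continuous A)
    {f : Vec d → ℂ} (hf : IsTest f) {t ħ m C : ℝ} (hm : m ≤ -(d + 1 : ℝ)) (hC0 : 0 ≤ C)
    (hC : ∀ w, ‖A w‖ ≤ C * bracket w.2 ^ m) (b : Vec d) :
    Integrable (regularizedIntegrand t ħ 0 A f b) (volume.prod volume) := by
  have h1 : Integrable (fun ξ : Vec d => (1 + ‖ξ‖) ^ (-(d + 1 : ℝ))) :=
    integrable_one_add_norm (by simp)
  have h2 := (hf.integrable.norm.mul_prod h1).const_mul (C * 2 ^ (d + 1 : ℝ))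
  refine h2.mono' ?_ (Filter.Eventually.of_forall fun p => ?_)
  · refine Continuous.aestronglyMeasurable ?_
    refine (continuous_wave ħ b).mul ?_
    simp only [Function.iterate_zero, id_eq]
    unfold amplitude
    exact (hA.comp (by fun_prop)).mul (hf.1.continuous.comp continuous_fst)
  · simp only [regularizedIntegrand, Function.iterate_zero, id_eq, amplitude, norm_mul, norm_wave,
      one_mul]
    calc _ ≤ (C * (2 ^ (d + 1 : ℝ) * (1 + ‖p.2‖) ^ (-(d + 1 : ℝ)))) * ‖f p.1‖ := by
          gcongr
          exact (hC _).trans (mul_le_mul_of_nonneg_left (bracket_rpow_le hm p.2) hC0)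
      _ = _ := by ring

/-- At order at most -(d+1) the double integral converges absolutely, so Fubini applies. Integrating
over ξ first gives a kernel that is an oscillatory integral at frequency (b - c)/ħ, hence is bounded
by `decay`. -/
theorem quantizationBound_zero {ħ₀ m : ℝ} {A : ℝ → Vec d × Vec d → ℂ}
    (h : SymbolBound (Set.Ioc 0 ħ₀) ⊤ m A) (hm : m ≤ -(d + 1 : ℝ)) (t : ℝ) :
    ∃ C : ℝ, 0 ≤ C ∧ ∀ ħ ∈ Set.Ioc 0 ħ₀, ∀ f : Vec d → ℂ, IsTest f → ∀ b,
      QuantizationBound t ħ 0 (A ħ) f b C := by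
  obtain ⟨C₀, hC₀, hker⟩ := exists_norm_integral_wave_le d
  obtain ⟨C₁, hC₁, hA⟩ := h.norm_le
  choose D hD0 hD using fun j : ℕ => h.exists_nonneg j le_top
  set K : ℝ := ∑ j ∈ Finset.range (d + 2), D j with hK
  have hK0 : 0 ≤ K := Finset.sum_nonneg fun j _ => hD0 j
  have hDK : ∀ j ≤ d + 1, D j ≤ K := fun j hj =>
    Finset.single_le_sum (f := D) (fun i _ => hD0 i) (Finset.mem_range.2 (by omega))
  refine ⟨C₀ * (K * 2 ^ (d + 1 : ℝ)), by positivity, fun ħ hħ f hf b => ?_⟩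
  have hint := integrable_regularizedIntegrand_zero (t := t) (ħ := ħ) (h.1 ħ hħ).continuous hf hm
    hC₁ (hA ħ hħ) b
  have hsw : ∫ c, ∫ ξ, regularizedIntegrand t ħ 0 (A ħ) f b (c, ξ) =
      ∫ ξ, innerIntegral t ħ (A ħ) f b ξ := integral_integral_swap hint
  refine ⟨hint, hsw, hint.integral_prod_right, ?_⟩
  rw [← hsw, ← integral_const_mul]
  refine norm_integral_le_of_norm_le ((integrable_decay_mul hħ.1 b 0 hf).const_mul _)
    (Filter.Eventually.of_forall fun c => ?_)
  have e1 : ∀ ξ, regularizedIntegrand t ħ 0 (A ħ) f b (c, ξ) = f c *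
      (Complex.exp (Complex.I * ((⟪(ħ⁻¹ : ℝ) • (b - c), ξ⟫_ℝ : ℝ) : ℂ)) *
        A ħ ((1 - t) • b + t • c, ξ)) := fun ξ => by
    simp only [regularizedIntegrand, Function.iterate_zero, id_eq, amplitude, wave]
    rw [real_inner_smul_left, div_eq_inv_mul]
    ring
  simp only [e1]
  rw [integral_const_mul, norm_mul]
  have h2 := hker (fun ξ => A ħ ((1 - t) • b + t • c, ξ)) (K * 2 ^ (d + 1 : ℝ)) (by positivity)
    ((h.1 ħ hħ).comp (f := fun ξ : Vec d => ((1 - t) • b + t • c, ξ)) (by fun_prop))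
    (fun j hj ξ => by
      refine (norm_iteratedFDeriv_slice_le (h.1 ħ hħ) _ ξ j).trans ((hD j ħ hħ _).trans ?_)
      rw [mul_assoc]
      have := Real.rpow_nonneg (bracket_pos ξ).le m
      exact mul_le_mul (hDK j hj) (bracket_rpow_le hm ξ) this hK0) ((ħ⁻¹ : ℝ) • (b - c))
  have e2 : (1 + ‖(ħ⁻¹ : ℝ) • (b - c)‖) ^ (-(d + 1 : ℝ)) = decay ħ b c := by
    rw [norm_smul, norm_inv, Real.norm_of_nonneg hħ.1.le, ← div_eq_inv_mul, decay]
  rw [e2] at h2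
  simp only [derivSum]
  calc _ ≤ ‖f c‖ * (C₀ * (K * 2 ^ (d + 1 : ℝ)) * decay ħ b c) := by gcongr
    _ = _ := by ring

/-- Induction on `k`: one regularization replaces a symbol of order `m` by symbols of order `m - 1`,
at the price of one derivative ħ∂ of `f`. Integrating over `c` first makes the ξ-integral converge
without any regularization, which yields the description `pseudo` of the operator that does not
involve `k`. -/
theorem exists_quantizationBound {ħ₀ t : ℝ} (ht : t ∈ Set.Icc (0 : ℝ) 1) (k : ℕ) :
    ∀ {m : ℝ} {A : ℝ → Vec d × Vec d → ℂ}, SymbolBound (Set.Ioc 0 ħ₀) ⊤ m A →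
      m + (d + 1 : ℝ) ≤ k →
    ∃ C : ℝ, 0 ≤ C ∧ ∀ ħ ∈ Set.Ioc 0 ħ₀, ∀ f : Vec d → ℂ, IsTest f → ∀ b,
      QuantizationBound t ħ k (A ħ) f b C := by
  induction k with
  | zero =>
    intro m A h hm
    exact quantizationBound_zero h (by simp at hm; linarith) t
  | succ k ih =>
    intro m A h hm
    have h1 := h.reducedSymbol ht
    have h2 := fun i => h.reducedSymbolDeriv i
    push_cast at hm
    obtain ⟨C, hC0, hC⟩ := ih h1 (by linarith)
    choose D hD0 hD using fun i => ih (h2 i) (by linarith)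
    refine ⟨C + ∑ i, D i, add_nonneg hC0 (Finset.sum_nonneg fun i _ => hD0 i),
      fun ħ hħ f hf b => ?_⟩
    have q := hC ħ hħ f hf b
    have r := fun i => hD i ħ hħ _ (hf.scaledDeriv ħ i) b
    have eJ : ∀ ξ, innerIntegral t ħ (A ħ) f b ξ = innerIntegral t ħ (reducedSymbol t ħ (A ħ)) f b ξ +
        ∑ i, innerIntegral t ħ (reducedSymbolDeriv i (A ħ)) (scaledDeriv ħ i f) b ξ := fun ξ =>
      innerIntegral_eq_reduced (h.1 ħ hħ) hħ.1.ne' (h1.1 ħ hħ) (fun i => (h2 i).1 ħ hħ) hf b ξ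
    have eR : ∀ p, regularizedIntegrand t ħ (k + 1) (A ħ) f b p =
        regularizedIntegrand t ħ k (reducedSymbol t ħ (A ħ)) f b p +
        ∑ i, regularizedIntegrand t ħ k (reducedSymbolDeriv i (A ħ)) (scaledDeriv ħ i f) b p := by
      intro p
      have t2 : ∀ i, IsTest (amplitude t (reducedSymbolDeriv i (A ħ)) (scaledDeriv ħ i f) b p.2) :=
        fun i => isTest_amplitude ((h2 i).1 ħ hħ) (hf.scaledDeriv ħ i) t b p.2
      simp only [regularizedIntegrand, Function.iterate_succ_apply]
      rw [regularizer_amplitude (h.1 ħ hħ) hf, regularizer_iterate_add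
        (isTest_amplitude (h1.1 ħ hħ) hf t b p.2) (IsTest.sum _ fun i _ => t2 i),
        regularizer_iterate_sum _ fun i _ => t2 i, mul_add, Finset.mul_sum]
    have iJ : Integrable (innerIntegral t ħ (A ħ) f b) := by
      rw [funext eJ]
      exact q.integrable_inner.add (integrable_finsetSum _ fun i _ => (r i).integrable_inner)
    have sJ : ∫ ξ, innerIntegral t ħ (A ħ) f b ξ =
        (∫ ξ, innerIntegral t ħ (reducedSymbol t ħ (A ħ)) f b ξ) +
        ∑ i, ∫ ξ, innerIntegral t ħ (reducedSymbolDeriv i (A ħ)) (scaledDeriv ħ i f) b ξ := by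
      simp only [eJ]
      rw [integral_add q.integrable_inner
        (integrable_finsetSum _ fun i _ => (r i).integrable_inner),
        integral_finsetSum _ fun i _ => (r i).integrable_inner]
    have iR : Integrable (regularizedIntegrand t ħ (k + 1) (A ħ) f b) (volume.prod volume) := by
      rw [funext eR]
      exact q.integrable.add (integrable_finsetSum _ fun i _ => (r i).integrable)
    refine ⟨iR, ?_, iJ, ?_⟩
    · rw [sJ, ← q.integral_eq, ← integral_prod _ iR, ← integral_prod _ q.integrable]
      simp only [eR]
      rw [integral_add q.integrable (integrable_finsetSum _ fun i _ => (r i).integrable),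
        integral_finsetSum _ fun i _ => (r i).integrable]
      congr 1
      refine Finset.sum_congr rfl fun i _ => ?_
      rw [← (r i).integral_eq, ← integral_prod _ (r i).integrable]
    · rw [sJ]
      have i0 := integrable_decay_mul hħ.1 b k hf
      have i1 := fun i => integrable_decay_mul hħ.1 b k (hf.scaledDeriv ħ i)
      have e3 : ∫ c, decay ħ b c * derivSum ħ (k + 1) f c = (∫ c, decay ħ b c * derivSum ħ k f c) +
          ∑ i, ∫ c, decay ħ b c * derivSum ħ k (scaledDeriv ħ i f) c := by
        simp only [derivSum, mul_add, Finset.mul_sum]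
        rw [integral_add i0 (integrable_finsetSum _ fun i _ => i1 i),
          integral_finsetSum _ fun i _ => i1 i]
      have p0 : 0 ≤ ∫ c, decay ħ b c * derivSum ħ k f c :=
        integral_nonneg fun c => mul_nonneg (decay_nonneg hħ.1 b c) (derivSum_nonneg _ _ _ _)
      have p1 : ∀ i, 0 ≤ ∫ c, decay ħ b c * derivSum ħ k (scaledDeriv ħ i f) c := fun i =>
        integral_nonneg fun c => mul_nonneg (decay_nonneg hħ.1 b c) (derivSum_nonneg _ _ _ _)
      rw [e3]
      refine (norm_add_le _ _).trans ?_
      have hS : ∀ i, D i ≤ C + ∑ i, D i := fun i =>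
        (Finset.single_le_sum (f := D) (fun j _ => hD0 j) (Finset.mem_univ i)).trans
          (le_add_of_nonneg_left hC0)
      rw [mul_add, Finset.mul_sum]
      refine add_le_add (q.norm_le.trans (mul_le_mul_of_nonneg_right
        (le_add_of_nonneg_right (Finset.sum_nonneg fun i _ => hD0 i)) p0)) ?_
      refine (norm_sum_le _ _).trans (Finset.sum_le_sum fun i _ => ?_)
      exact (r i).norm_le.trans (mul_le_mul_of_nonneg_right (hS i) (p1 i))

/-- The `t`-quantization of the symbol `A`. -/
def pseudo (t ħ : ℝ) (A : Vec d × Vec d → ℂ) (f : Vec d → ℂ) (b : Vec d) : ℂ :=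
  (1 / ((2 * Real.pi * ħ) ^ d : ℝ) : ℂ) * ∫ ξ, innerIntegral t ħ A f b ξ

theorem QuantizationBound.quantization_eq {t ħ C : ℝ} {k : ℕ} {a : Vec d → Vec d → ℂ}
    {f : Vec d → ℂ} {b : Vec d} (h : QuantizationBound t ħ k (Function.uncurry a) f b C) :
    quantization t ħ k a f b = pseudo t ħ (Function.uncurry a) f b := by
  rw [pseudo, ← h.integral_eq]
  rfl

end Quantization

/-! ### Pairing estimates for symbols of arbitrary order -/

section Pairing

open MeasureTheory

variable {d : ℕ}

/-- Schur's test for convolution operators. -/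
theorem lintegral_convolution_mul_le {D u v : Vec d → ENNReal} (hD : Measurable D)
    (hu : Measurable u) (hv : Measurable v) :
    ∫⁻ b, (∫⁻ c, D (b - c) * u c) * v b ≤
      (∫⁻ y, D y) * ((∫⁻ c, u c ^ 2) ^ (1 / 2 : ℝ) * (∫⁻ b, v b ^ 2) ^ (1 / 2 : ℝ)) := by
  -- After the substitution `y = b - c`, Tonelli moves `y` outside; for each `y` the integral over
  -- `b` is bounded by Cauchy–Schwarz and translation invariance.
  have h1 : ∀ b, (∫⁻ c, D (b - c) * u c) * v b = ∫⁻ y, D y * (u (b - y) * v b) := fun b => by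
    rw [← lintegral_sub_left_eq_self (fun c => D (b - c) * u c) b, ← lintegral_mul_const _
      (by fun_prop)]
    simp [mul_assoc]
  simp only [h1]
  rw [lintegral_lintegral_swap (by fun_prop)]
  rw [← lintegral_mul_const _ hD]
  refine lintegral_mono fun y => ?_
  rw [lintegral_const_mul _ (by fun_prop)]
  gcongr
  have h2 := ENNReal.lintegral_mul_le_Lp_mul_Lq volume Real.HolderConjugate.two_two
    (f := fun b => u (b - y)) (g := v) (by fun_prop) hv.aemeasurable
  refine h2.trans (le_of_eq ?_)
  simp only [ENNReal.rpow_two]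
  rw [lintegral_sub_right_eq_self (fun b => u b ^ 2) y]

/-- The factor `ħ ^ d` cancels the prefactor (2πħ)^{-d} of the quantization, so the pairing bounds
are uniform in ħ. -/
theorem lintegral_decay_le (d : ℕ) : ∃ T : ℝ, 0 ≤ T ∧ ∀ ħ : ℝ, 0 < ħ →
    ∫⁻ y : Vec d, ENNReal.ofReal ((1 + ‖y‖ / ħ) ^ (-(d + 1 : ℝ))) = ENNReal.ofReal (ħ ^ d * T) := by
  have hint : Integrable fun ξ : Vec d => (1 + ‖ξ‖) ^ (-(d + 1 : ℝ)) :=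
    integrable_one_add_norm (by simp)
  refine ⟨∫ ξ : Vec d, (1 + ‖ξ‖) ^ (-(d + 1 : ℝ)), integral_nonneg fun ξ => by positivity,
    fun ħ hħ => ?_⟩
  have e : ∀ y : Vec d, (1 + ‖y‖ / ħ) ^ (-(d + 1 : ℝ)) =
      (fun ξ : Vec d => (1 + ‖ξ‖) ^ (-(d + 1 : ℝ))) (ħ⁻¹ • y) := fun y => by
    simp only [norm_smul, norm_inv, Real.norm_of_nonneg hħ.le, ← div_eq_inv_mul]
  simp only [e]
  have e2 := Measure.integral_comp_smul volume
    (fun ξ : Vec d => (1 + ‖ξ‖) ^ (-(d + 1 : ℝ))) ħ⁻¹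
  rw [← ofReal_integral_eq_lintegral_ofReal, e2]
  · congr 1
    rw [finrank_euclideanSpace_fin, inv_pow, inv_inv, abs_of_nonneg (by positivity), smul_eq_mul]
  · exact (integrable_comp_smul_iff volume _ (inv_ne_zero hħ.ne')).2 hint
  · exact Filter.Eventually.of_forall fun y => by positivity

/-- A crude substitute for L² boundedness: `k = ⌈m + d + 1⌉₊` scaled derivatives of `f` are spent to
make the kernel integrable, and Schur's test does the rest. Losing derivatives is acceptable because
all (ħ∂)^α of the functions to be inserted have comparable size. -/
theorem SymbolBound.exists_pairing_le {ħ₀ t m : ℝ} (ht : t ∈ Set.Icc (0 : ℝ) 1)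
    {A : ℝ → Vec d × Vec d → ℂ} (h : SymbolBound (Set.Ioc 0 ħ₀) ⊤ m A) :
    ∃ (k : ℕ) (C : ℝ), 0 ≤ C ∧ ∀ ħ ∈ Set.Ioc 0 ħ₀, ∀ f : Vec d → ℂ, IsTest f →
      ∀ v : Vec d → ℂ, Continuous v →
      ∫⁻ b, ‖pseudo t ħ (A ħ) f b‖ₑ * ‖v b‖ₑ ≤ ENNReal.ofReal C *
        ((∫⁻ c, ENNReal.ofReal (derivSum ħ k f c) ^ 2) ^ (1 / 2 : ℝ) *
          (∫⁻ b, ‖v b‖ₑ ^ 2) ^ (1 / 2 : ℝ)) := by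
  obtain ⟨C, hC0, hC⟩ := exists_quantizationBound ht _ h (Nat.le_ceil (m + (d + 1 : ℝ)))
  obtain ⟨T, hT0, hT⟩ := lintegral_decay_le d
  refine ⟨⌈m + (d + 1 : ℝ)⌉₊, C * T / (2 * Real.pi) ^ d, by positivity, fun ħ hħ f hf v hv => ?_⟩
  have hħ0 := hħ.1
  set k := ⌈m + (d + 1 : ℝ)⌉₊
  have h1 : ∀ b, ‖pseudo t ħ (A ħ) f b‖ₑ ≤ ENNReal.ofReal (C / (2 * Real.pi * ħ) ^ d) *
      ∫⁻ c, ENNReal.ofReal ((1 + ‖b - c‖ / ħ) ^ (-(d + 1 : ℝ))) *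
        ENNReal.ofReal (derivSum ħ k f c) := fun b => by
    have h2 : ‖pseudo t ħ (A ħ) f b‖ ≤ C / (2 * Real.pi * ħ) ^ d *
        ∫ c, decay ħ b c * derivSum ħ k f c := by
      rw [pseudo, norm_mul]
      have := (hC ħ hħ f hf b).norm_le
      have e : ‖(1 / ((2 * Real.pi * ħ) ^ d : ℝ) : ℂ)‖ = 1 / (2 * Real.pi * ħ) ^ d := by
        rw [norm_div, norm_one, Complex.norm_real, Real.norm_of_nonneg (by positivity)]
      rw [e]
      calc _ ≤ 1 / (2 * Real.pi * ħ) ^ d * (C * ∫ c, decay ħ b c * derivSum ħ k f c) := by gcongr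
        _ = _ := by ring
    rw [← ofReal_norm]
    refine (ENNReal.ofReal_le_ofReal h2).trans ?_
    rw [ENNReal.ofReal_mul (by positivity), ofReal_integral_eq_lintegral_ofReal
      (integrable_decay_mul hħ0 b k hf) (Filter.Eventually.of_forall fun c =>
        mul_nonneg (decay_nonneg hħ0 b c) (derivSum_nonneg _ _ _ _))]
    gcongr with c
    rw [← ENNReal.ofReal_mul (by positivity)]
    rfl
  have hD : Measurable fun y : Vec d => ENNReal.ofReal ((1 + ‖y‖ / ħ) ^ (-(d + 1 : ℝ))) := by
    fun_prop
  have hu : Measurable fun c => ENNReal.ofReal (derivSum ħ k f c) :=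
    (continuous_derivSum ħ k hf).measurable.ennreal_ofReal
  have hv' : Measurable fun b => ‖v b‖ₑ := hv.measurable.enorm
  calc ∫⁻ b, ‖pseudo t ħ (A ħ) f b‖ₑ * ‖v b‖ₑ
      ≤ ∫⁻ b, ENNReal.ofReal (C / (2 * Real.pi * ħ) ^ d) *
        ((∫⁻ c, ENNReal.ofReal ((1 + ‖b - c‖ / ħ) ^ (-(d + 1 : ℝ))) *
          ENNReal.ofReal (derivSum ħ k f c)) * ‖v b‖ₑ) := by
        refine lintegral_mono fun b => ?_
        rw [← mul_assoc]
        gcongr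
        exact h1 b
    _ ≤ ENNReal.ofReal (C / (2 * Real.pi * ħ) ^ d) * (ENNReal.ofReal (ħ ^ d * T) * _) := by
        rw [lintegral_const_mul' _ _ ENNReal.ofReal_ne_top, ← hT ħ hħ0]
        gcongr
        exact lintegral_convolution_mul_le hD hu hv'
    _ = _ := by
        rw [← mul_assoc, ← ENNReal.ofReal_mul (by positivity)]
        congr 2
        rw [mul_pow]
        field_simp

end Pairing

/-! ### First order expansion of the quantization -/

section Expansion

open MeasureTheory

variable {d : ℕ}

theorem SymbolBound.integrable_innerIntegral {ħ₀ t m : ℝ} (ht : t ∈ Set.Icc (0 : ℝ) 1)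
    {A : ℝ → Vec d × Vec d → ℂ} (h : SymbolBound (Set.Ioc 0 ħ₀) ⊤ m A) {ħ : ℝ}
    (hħ : ħ ∈ Set.Ioc 0 ħ₀) {f : Vec d → ℂ} (hf : IsTest f) (b : Vec d) :
    Integrable (innerIntegral t ħ (A ħ) f b) := by
  obtain ⟨C, -, hC⟩ := exists_quantizationBound ht _ h (Nat.le_ceil (m + (d + 1 : ℝ)))
  exact (hC ħ hħ f hf b).integrable_inner

/-- This is Fourier inversion: the inner integral at ξ is exp(i b·ξ/ħ) times the Fourier transform
of `f` at ξ/(2πħ). -/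
theorem pseudo_const {t ħ : ℝ} (ht : t ∈ Set.Icc (0 : ℝ) 1) (hħ : 0 < ħ) (z : ℂ) {f : Vec d → ℂ}
    (hf : IsTest f) (b : Vec d) : pseudo t ħ (fun _ => z) f b = z * f b := by
  have hint : Integrable (innerIntegral t ħ (fun _ => (1 : ℂ)) f b) :=
    (SymbolBound.const_zero_order (S := Set.Ioc 0 ħ) (1 : ℂ)).integrable_innerIntegral ht
      ⟨hħ, le_rfl⟩ hf b
  set F := FourierTransform.fourier f with hF
  set R : ℝ := (2 * Real.pi * ħ)⁻¹ with hR
  have hR0 : 0 < R := by positivity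
  have e1 : ∀ ξ, innerIntegral t ħ (fun _ => (1 : ℂ)) f b ξ =
      (fun w => Complex.exp (((2 * Real.pi * ⟪w, b⟫_ℝ : ℝ) : ℂ) * Complex.I) * F w) (R • ξ) := by
    intro ξ
    simp only [innerIntegral, amplitude, one_mul, hF]
    rw [Real.fourier_eq', ← integral_const_mul]
    congr 1 with c
    rw [smul_eq_mul, ← mul_assoc, ← Complex.exp_add, wave]
    congr 2
    rw [inner_sub_left, inner_smul_left, inner_smul_right, real_inner_comm ξ b]
    simp only [hR]
    push_cast
    simp only [starRingEnd_apply, star_trivial]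
    push_cast
    have : (ħ : ℂ) ≠ 0 := by exact_mod_cast hħ.ne'
    have : (Real.pi : ℂ) ≠ 0 := by exact_mod_cast Real.pi_ne_zero
    field_simp
    ring
  -- Up to a phase and a dilation `F` is the inner integral of a symbol of order zero, whose
  -- integrability is already known from the regularization.
  have hFint : Integrable F := by
    have h1 : Integrable (fun w => Complex.exp (((2 * Real.pi * ⟪w, b⟫_ℝ : ℝ) : ℂ) * Complex.I) *
        F w) := by
      rw [← integrable_comp_smul_iff volume _ hR0.ne', ← funext e1]
      exact hint
    have h2 := h1.norm
    refine (integrable_norm_iff ?_).1 (h2.congr (Filter.Eventually.of_forall fun w => ?_))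
    · have : Continuous F := VectorFourier.fourierIntegral_continuous
        Real.continuous_fourierChar continuous_inner hf.integrable
      exact this.aestronglyMeasurable
    · simp only
      rw [norm_mul, Complex.norm_exp_ofReal_mul_I, one_mul]
  have inv : FourierTransformInv.fourierInv F b = f b := by
    rw [hF, hf.1.continuous.fourierInv_fourier_eq hf.integrable hFint]
  have e2 : ∀ ξ, innerIntegral t ħ (fun _ => z) f b ξ =
      z * innerIntegral t ħ (fun _ => (1 : ℂ)) f b ξ := fun ξ => by
    simp only [innerIntegral, amplitude, one_mul]
    rw [← integral_const_mul]
    congr 1 with c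
    ring
  rw [pseudo]
  simp only [e2]
  rw [integral_const_mul]
  rw [funext e1, Measure.integral_comp_smul, ← inv, Real.fourierInv_eq']
  simp only [smul_eq_mul]
  rw [finrank_euclideanSpace_fin, abs_of_nonneg (by positivity), Complex.real_smul]
  have : ((2 * Real.pi * ħ) ^ d : ℝ) ≠ 0 := by positivity
  have h3 : (((R ^ d)⁻¹ : ℝ) : ℂ) = (((2 * Real.pi * ħ) ^ d : ℝ) : ℂ) := by
    rw [hR, inv_pow, inv_inv]
  have h4 : (((2 * Real.pi * ħ) ^ d : ℝ) : ℂ) ≠ 0 := by exact_mod_cast this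
  rw [h3]
  field_simp
  simp only [mul_comm Complex.I]

/-- The operator `ħ Dⱼ - ξ₀ⱼ`. -/
def shiftedDeriv (ħ : ℝ) (ξ₀ : Vec d) (j : Fin d) (f : Vec d → ℂ) (c : Vec d) : ℂ :=
  -Complex.I * scaledDeriv ħ j f c - ((ξ₀ j : ℝ) : ℂ) * f c

theorem IsTest.shiftedDeriv {f : Vec d → ℂ} (hf : IsTest f) (ħ : ℝ) (ξ₀ : Vec d) (j : Fin d) :
    IsTest (shiftedDeriv ħ ξ₀ j f) := by
  have h1 := ((hf.scaledDeriv ħ j).mul_left (contDiff_const (c := -Complex.I))).add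
    (hf.mul_left (contDiff_const (c := -((ξ₀ j : ℝ) : ℂ))))
  have e : SphereEgorov.shiftedDeriv ħ ξ₀ j f = fun c =>
      -Complex.I * SphereEgorov.scaledDeriv ħ j f c + -((ξ₀ j : ℝ) : ℂ) * f c := by
    ext c
    simp only [SphereEgorov.shiftedDeriv]; ring
  exact e ▸ h1

/-- Multiplication by the coordinate `(c - b₀)ᵢ`. -/
def coordMul (b₀ : Vec d) (i : Fin d) (f : Vec d → ℂ) (c : Vec d) : ℂ :=
  (((c - b₀) i : ℝ) : ℂ) * f c

theorem contDiff_coord (b₀ : Vec d) (i : Fin d) :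
    ContDiff ℝ ∞ fun c : Vec d => (((c - b₀) i : ℝ) : ℂ) :=
  Complex.ofRealCLM.contDiff.comp
    ((EuclideanSpace.proj i : Vec d →L[ℝ] ℝ).contDiff.comp (contDiff_id.sub contDiff_const))

theorem IsTest.coordMul {f : Vec d → ℂ} (hf : IsTest f) (b₀ : Vec d) (i : Fin d) :
    IsTest (coordMul b₀ i f) :=
  hf.mul_left (contDiff_coord b₀ i)

/-- The symbol `-i ∂_{yⱼ} A`. -/
def baseDeriv (j : Fin d) (A : Vec d × Vec d → ℂ) (w : Vec d × Vec d) : ℂ :=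
  -Complex.I * fderiv ℝ A w (EuclideanSpace.single j 1, 0)

theorem SymbolBound.baseDeriv {S : Set ℝ} {m : ℝ} {A : ℝ → Vec d × Vec d → ℂ}
    (h : SymbolBound S ⊤ m A) (j : Fin d) : SymbolBound S ⊤ m (fun ħ => baseDeriv j (A ħ)) :=
  (h.fderiv.clm_apply (ContinuousLinearMap.apply ℝ ℂ
    ((EuclideanSpace.single j 1, 0) : Vec d × Vec d))).smul_param
      (c := fun _ => -Complex.I) (K := 1) (by simp)

/-- Since ξ_j times the wave is -ħD_{c_j} of the wave, integration by parts moves ħD_j to the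
amplitude. It acts on `f`, giving `shiftedDeriv`, and on the symbol through `b_t`, giving the term
with ħ t. -/
theorem innerIntegral_coord_mul {A : Vec d × Vec d → ℂ} (hA : ContDiff ℝ ∞ A) {ħ : ℝ} (hħ : ħ ≠ 0)
    (t : ℝ) {f : Vec d → ℂ} (hf : IsTest f) (b ξ ξ₀ : Vec d) (j : Fin d) :
    (((ξ - ξ₀) j : ℝ) : ℂ) * innerIntegral t ħ A f b ξ =
      innerIntegral t ħ A (shiftedDeriv ħ ξ₀ j f) b ξ +
        ħ * t * innerIntegral t ħ (baseDeriv j A) f b ξ := by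
  set e : Vec d := EuclideanSpace.single j 1
  have hw := contDiff_wave ħ b ξ
  have hG := isTest_amplitude hA hf t b ξ
  have i1 := (hG.mul_left hw).integrable
  have i2 := ((hG.fderiv_apply e).mul_left hw).integrable
  have i3 : Integrable fun c => fderiv ℝ (wave ħ b ξ) c e * amplitude t A f b ξ c :=
    (hG.mul_left ((hw.fderiv_right (m := ∞) (by simp)).clm_apply contDiff_const)).integrable
  have ibp := integral_mul_fderiv_eq_neg_fderiv_mul_of_integrable i3 i2 i1
    (fun c _ => hw.differentiable (by simp) c) (fun c _ => hG.1.differentiable (by simp) c)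
  have hinner : ⟪e, ξ⟫_ℝ = ξ j := by
    rw [EuclideanSpace.inner_single_left]; simp
  have e1 : ∀ c, fderiv ℝ (wave ħ b ξ) c e * amplitude t A f b ξ c =
      (-(Complex.I * ((ξ j / ħ : ℝ) : ℂ))) * (wave ħ b ξ c * amplitude t A f b ξ c) := fun c => by
    rw [fderiv_wave, hinner]; ring
  simp only [e1] at ibp
  rw [integral_const_mul] at ibp
  have hb : ContDiff ℝ ∞ (baseDeriv j A) :=
    contDiff_const.mul ((hA.fderiv_right (m := ∞) (by simp)).clm_apply contDiff_const)
  have j1 := integrable_wave_mul_amplitude hA (hf.shiftedDeriv ħ ξ₀ j) t ħ b ξ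
  have j2 := integrable_wave_mul_amplitude hb hf t ħ b ξ
  have e2 : ∀ c, wave ħ b ξ c * amplitude t A (shiftedDeriv ħ ξ₀ j f) b ξ c +
      (ħ * t) * (wave ħ b ξ c * amplitude t (baseDeriv j A) f b ξ c) =
      (-Complex.I * ħ) * (wave ħ b ξ c * fderiv ℝ (amplitude t A f b ξ) c e) +
        (-((ξ₀ j : ℝ) : ℂ)) * (wave ħ b ξ c * amplitude t A f b ξ c) := fun c => by
    have h1 := (contDiff_slice hA t b ξ).differentiable (by simp) c
    have h2 := hf.1.differentiable (by simp) c
    have h3 : fderiv ℝ (amplitude t A f b ξ) c e =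
        A ((1 - t) • b + t • c, ξ) * fderiv ℝ f c e +
          f c * (t * fderiv ℝ A ((1 - t) • b + t • c, ξ) (e, 0)) := by
      have := fderiv_fun_mul h1 h2
      unfold amplitude
      rw [this, ← fderiv_slice hA]
      simp
    rw [h3]
    simp only [amplitude, shiftedDeriv, baseDeriv, scaledDeriv, e]
    ring
  unfold innerIntegral
  have e3 := integral_congr_ae (μ := volume) (Filter.Eventually.of_forall e2)
  rw [integral_add j1 (j2.const_mul _), integral_add (i2.const_mul _) (i1.const_mul _),
    integral_const_mul, integral_const_mul, integral_const_mul, ibp] at e3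
  rw [e3]
  have : (ħ : ℂ) ≠ 0 := by exact_mod_cast hħ
  simp only [PiLp.sub_apply]
  push_cast
  field_simp
  linear_combination ((ξ j : ℂ) * ∫ c, wave ħ b ξ c * amplitude t A f b ξ c) * Complex.I_sq

/-- Because b_t - b₀ = (1 - t)(b - b₀) + t(c - b₀): the first part leaves the integral, the second
is absorbed by `f`. -/
theorem innerIntegral_base_mul {A : Vec d × Vec d → ℂ} (hA : ContDiff ℝ ∞ A) (ħ : ℝ)
    (t : ℝ) {f : Vec d → ℂ} (hf : IsTest f) (b ξ b₀ : Vec d) (i : Fin d) :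
    innerIntegral t ħ (fun w => (((w.1 - b₀) i : ℝ) : ℂ) * A w) f b ξ =
      (1 - t) * (((b - b₀) i : ℝ) : ℂ) * innerIntegral t ħ A f b ξ +
        t * innerIntegral t ħ A (coordMul b₀ i f) b ξ := by
  unfold innerIntegral
  rw [← integral_const_mul, ← integral_const_mul, ← integral_add
    ((integrable_wave_mul_amplitude hA hf t ħ b ξ).const_mul _)
    ((integrable_wave_mul_amplitude hA (hf.coordMul b₀ i) t ħ b ξ).const_mul _)]
  congr 1 with c
  simp only [amplitude, coordMul, PiLp.sub_apply, PiLp.add_apply, PiLp.smul_apply, smul_eq_mul]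
  push_cast
  ring

/-- First order expansion of the quantization of a symbol at a point of phase space. -/
theorem pseudo_expansion {ħ₀ t m' : ℝ} (ht : t ∈ Set.Icc (0 : ℝ) 1)
    {A : ℝ → Vec d × Vec d → ℂ}
    {α β : Fin d → ℝ → Vec d × Vec d → ℂ} {w₀ : Vec d × Vec d}
    (hα : ∀ i, SymbolBound (Set.Ioc 0 ħ₀) ⊤ m' (α i))
    (hβ : ∀ i, SymbolBound (Set.Ioc 0 ħ₀) ⊤ m' (β i))
    (heq : ∀ ħ ∈ Set.Ioc 0 ħ₀, ∀ w, A ħ w = A ħ w₀ + ∑ i, (((w.1 - w₀.1) i : ℝ) : ℂ) * α i ħ w +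
        ∑ i, (((w.2 - w₀.2) i : ℝ) : ℂ) * β i ħ w)
    {ħ : ℝ} (hħ : ħ ∈ Set.Ioc 0 ħ₀) {f : Vec d → ℂ} (hf : IsTest f) (b : Vec d) :
    pseudo t ħ (A ħ) f b = A ħ w₀ * f b +
      ∑ i, ((1 - t) * (((b - w₀.1) i : ℝ) : ℂ) * pseudo t ħ (α i ħ) f b +
        t * pseudo t ħ (α i ħ) (coordMul w₀.1 i f) b) +
      ∑ i, (pseudo t ħ (β i ħ) (shiftedDeriv ħ w₀.2 i f) b +
        ħ * t * pseudo t ħ (baseDeriv i (β i ħ)) f b) := by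
  have iα := fun i => (hα i).integrable_innerIntegral ht hħ hf b
  have iα' := fun i => (hα i).integrable_innerIntegral ht hħ (hf.coordMul w₀.1 i) b
  have iβ := fun i => (hβ i).integrable_innerIntegral ht hħ (hf.shiftedDeriv ħ w₀.2 i) b
  have iβ' := fun i => ((hβ i).baseDeriv i).integrable_innerIntegral ht hħ hf b
  have ic : Integrable (innerIntegral t ħ (fun _ => A ħ w₀) f b) :=
    (SymbolBound.const_zero_order (S := Set.Ioc 0 ħ) (A ħ w₀)).integrable_innerIntegral ht
      ⟨hħ.1, le_rfl⟩ hf b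
  have cα := fun i => (hα i).1 ħ hħ
  have cβ := fun i => (hβ i).1 ħ hħ
  have key : ∀ ξ, innerIntegral t ħ (A ħ) f b ξ = innerIntegral t ħ (fun _ => A ħ w₀) f b ξ +
      ∑ i, ((1 - t) * (((b - w₀.1) i : ℝ) : ℂ) * innerIntegral t ħ (α i ħ) f b ξ +
        t * innerIntegral t ħ (α i ħ) (coordMul w₀.1 i f) b ξ) +
      ∑ i, (innerIntegral t ħ (β i ħ) (shiftedDeriv ħ w₀.2 i f) b ξ +
        ħ * t * innerIntegral t ħ (baseDeriv i (β i ħ)) f b ξ) := fun ξ => by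
    -- Read backwards, the two multiplication rules restore the factors ξ - ξ₀ and b_t - b₀, and the
    -- claim becomes the pointwise expansion of the symbol.
    simp only [← innerIntegral_coord_mul (cβ _) hħ.1.ne' t hf b ξ,
      ← innerIntegral_base_mul (cα _) ħ t hf b ξ w₀.1]
    have k1 := integrable_wave_mul_amplitude (A := fun _ : Vec d × Vec d => A ħ w₀)
      contDiff_const hf t ħ b ξ
    have k2 := fun i => integrable_wave_mul_amplitude
      (A := fun w => (((w.1 - w₀.1) i : ℝ) : ℂ) * α i ħ w)
      (((contDiff_coord w₀.1 i).comp contDiff_fst).mul (cα i)) hf t ħ b ξ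
    have k3 := fun i => (integrable_wave_mul_amplitude (cβ i) hf t ħ b ξ).const_mul
      (((ξ - w₀.2) i : ℝ) : ℂ)
    have k12 : Integrable (fun c => wave ħ b ξ c * amplitude t (fun _ => A ħ w₀) f b ξ c +
        ∑ i, wave ħ b ξ c *
          amplitude t (fun w => (((w.1 - w₀.1) i : ℝ) : ℂ) * α i ħ w) f b ξ c) :=
      k1.add (integrable_finsetSum _ fun i _ => k2 i)
    unfold innerIntegral
    simp only [← integral_const_mul]
    rw [← integral_finsetSum _ fun i _ => k2 i, ← integral_finsetSum _ fun i _ => k3 i,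
      ← integral_add k1 (integrable_finsetSum _ fun i _ => k2 i),
      ← integral_add k12 (integrable_finsetSum _ fun i _ => k3 i)]
    congr 1 with c
    simp only [amplitude]
    rw [heq ħ hħ]
    simp only [add_mul, mul_add, Finset.sum_mul, Finset.mul_sum]
    congr 1
    refine Finset.sum_congr rfl fun i _ => by ring
  have kα := fun i => (iα i).const_mul ((1 - t) * (((b - w₀.1) i : ℝ) : ℂ))
  have kα' := fun i => (iα' i).const_mul (t : ℂ)
  have kβ' := fun i => (iβ' i).const_mul (ħ * t : ℂ)
  have uα : ∀ i, Integrable (fun ξ => (1 - t) * (((b - w₀.1) i : ℝ) : ℂ) *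
      innerIntegral t ħ (α i ħ) f b ξ + t * innerIntegral t ħ (α i ħ) (coordMul w₀.1 i f) b ξ) :=
    fun i => (kα i).add (kα' i)
  have uβ : ∀ i, Integrable (fun ξ => innerIntegral t ħ (β i ħ) (shiftedDeriv ħ w₀.2 i f) b ξ +
      ħ * t * innerIntegral t ħ (baseDeriv i (β i ħ)) f b ξ) := fun i => (iβ i).add (kβ' i)
  have s1 : Integrable (fun ξ => ∑ i, ((1 - t) * (((b - w₀.1) i : ℝ) : ℂ) *
      innerIntegral t ħ (α i ħ) f b ξ + t * innerIntegral t ħ (α i ħ) (coordMul w₀.1 i f) b ξ)) :=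
    integrable_finsetSum _ fun i _ => uα i
  have s2 : Integrable (fun ξ => ∑ i, (innerIntegral t ħ (β i ħ) (shiftedDeriv ħ w₀.2 i f) b ξ +
        ħ * t * innerIntegral t ħ (baseDeriv i (β i ħ)) f b ξ)) :=
    integrable_finsetSum _ fun i _ => uβ i
  have s0 := pseudo_const (d := d) ht hħ.1 (A ħ w₀) hf b
  have hI : ∫ ξ, innerIntegral t ħ (A ħ) f b ξ = (∫ ξ, innerIntegral t ħ (fun _ => A ħ w₀) f b ξ) +
      ∑ i, ((1 - t) * (((b - w₀.1) i : ℝ) : ℂ) * (∫ ξ, innerIntegral t ħ (α i ħ) f b ξ) +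
        t * ∫ ξ, innerIntegral t ħ (α i ħ) (coordMul w₀.1 i f) b ξ) +
      ∑ i, ((∫ ξ, innerIntegral t ħ (β i ħ) (shiftedDeriv ħ w₀.2 i f) b ξ) +
        ħ * t * ∫ ξ, innerIntegral t ħ (baseDeriv i (β i ħ)) f b ξ) := by
    have s12 : Integrable (fun ξ => innerIntegral t ħ (fun _ => A ħ w₀) f b ξ +
        ∑ i, ((1 - t) * (((b - w₀.1) i : ℝ) : ℂ) * innerIntegral t ħ (α i ħ) f b ξ +
          t * innerIntegral t ħ (α i ħ) (coordMul w₀.1 i f) b ξ)) := ic.add s1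
    simp only [key]
    rw [integral_add s12 s2, integral_add ic s1,
      integral_finsetSum _ fun i _ => uα i,
      integral_finsetSum _ fun i _ => uβ i]
    congr 1
    · congr 1
      refine Finset.sum_congr rfl fun i _ => ?_
      rw [← integral_const_mul, ← integral_const_mul, ← integral_add (kα i) (kα' i)]
    · refine Finset.sum_congr rfl fun i _ => ?_
      rw [← integral_const_mul, ← integral_add (iβ i) (kβ' i)]
  rw [← s0]
  simp only [pseudo]
  rw [hI]
  simp only [mul_add, Finset.mul_sum]
  congr 1
  · congr 1
    refine Finset.sum_congr rfl fun i _ => by ring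
  · refine Finset.sum_congr rfl fun i _ => by ring

end Expansion

/-! ### The surface measure -/

section SurfaceMeasure

open MeasureTheory
open scoped Pointwise

variable {n : ℕ}

instance [NeZero n] : Nontrivial (Cn n) :=
  Module.nontrivial_of_finrank_pos (R := ℝ) (by rw [(finrankFact n).out]; omega)

/-- The map of the sphere induced by a real linear isometry. -/
def sphereMap (U : Cn n ≃ₗᵢ[ℝ] Cn n) (x : CSphere n) : CSphere n :=
  ⟨U x, by simp⟩

theorem continuous_sphereMap (U : Cn n ≃ₗᵢ[ℝ] Cn n) : Continuous (sphereMap U) :=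
  (U.continuous.comp continuous_subtype_val).subtype_mk _

/-- The surface measure is defined through volumes of cones, and a real linear isometry carries
cones to cones while preserving volume. -/
theorem measurePreserving_sphereMap (U : Cn n ≃ₗᵢ[ℝ] Cn n) :
    MeasurePreserving (sphereMap U) (surfaceMeasure n) (surfaceMeasure n) := by
  refine ⟨(continuous_sphereMap U).measurable, ?_⟩
  unfold surfaceMeasure
  rw [Measure.map_smul]
  congr 1
  refine Measure.ext fun s hs => ?_
  rw [Measure.map_apply (continuous_sphereMap U).measurable hs, Measure.toSphere_apply' _ hs,
    Measure.toSphere_apply' _ ((continuous_sphereMap U).measurable hs)]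
  congr 1
  have h1 : Set.Ioo (0 : ℝ) 1 • ((↑) '' (sphereMap U ⁻¹' s) : Set (Cn n)) =
      U ⁻¹' (Set.Ioo (0 : ℝ) 1 • ((↑) '' s : Set (Cn n))) := by
    ext y
    simp only [Set.mem_smul, Set.mem_image, Set.mem_preimage]
    constructor
    · rintro ⟨r, hr, _, ⟨x, hx, rfl⟩, rfl⟩
      exact ⟨r, hr, _, ⟨_, hx, rfl⟩, by simp [sphereMap]⟩
    · rintro ⟨r, hr, _, ⟨x, hx, rfl⟩, h⟩
      refine ⟨r, hr, _, ⟨⟨U.symm x, by simp⟩, ?_, rfl⟩, ?_⟩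
      · simpa [sphereMap] using hx
      · rw [← U.symm_apply_apply y, ← h]; simp
  rw [h1]
  exact U.measurePreserving.measure_preimage_equiv (f := U.toHomeomorph.toMeasurableEquiv) _

instance [NeZero n] : IsProbabilityMeasure (surfaceMeasure n) := by
  refine ⟨?_⟩
  unfold surfaceMeasure
  rw [Measure.smul_apply, smul_eq_mul]
  refine ENNReal.inv_mul_cancel ?_ (measure_ne_top _ _)
  rw [Ne, Measure.measure_univ_eq_zero]
  exact Measure.toSphere_ne_zero _

theorem integral_sphereMap (U : Cn n ≃ₗᵢ[ℝ] Cn n) {V : Type*} [NormedAddCommGroup V]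
    [NormedSpace ℝ V] (φ : CSphere n → V) :
    ∫ x, φ (sphereMap U x) ∂(surfaceMeasure n) = ∫ x, φ x ∂(surfaceMeasure n) := by
  refine (measurePreserving_sphereMap U).integral_comp ?_ φ
  have hinj : Function.Injective (sphereMap U) := fun x y h => by
    have : U x = U y := congrArg Subtype.val h
    exact Subtype.ext (U.injective this)
  exact ((continuous_sphereMap U).isClosedEmbedding hinj).measurableEmbedding

/-- Volumes of cones over pieces of an immersed hypersurface transversal to the radial direction
are comparable with volumes in the parameter domain. -/
theorem exists_volume_cone_bounds {d : ℕ} (hd : Module.finrank ℝ (Cn n) = d + 1) {T : Set (Vec d)}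
    (hT : IsOpen T) {X : Vec d → Cn n} (hX : ContDiffOn ℝ ∞ X T) (hinj : Set.InjOn X T)
    (hnorm : ∀ b ∈ T, ‖X b‖ = 1) (himm : ∀ b ∈ T, Function.Injective (fderiv ℝ X b))
    {K : Set (Vec d)} (hK : IsCompact K) (hKT : K ⊆ T) :
    ∃ c C : NNReal, c ≠ 0 ∧ ∀ B ⊆ K, MeasurableSet B →
      c * volume B ≤ (volume : Measure (Cn n)) (Set.Ioo (0 : ℝ) 1 • (X '' B)) ∧
      (volume : Measure (Cn n)) (Set.Ioo (0 : ℝ) 1 • (X '' B)) ≤ C * volume B := by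
  classical
  -- A linear identification of the parameter space with the target, so that the change of variables
  -- formula for self-maps applies. Its distortion is a constant, absorbed in the Haar factor `s`.
  let Λ : (ℝ × Vec d) ≃L[ℝ] Cn n := ContinuousLinearEquiv.ofFinrankEq (by
    rw [hd, Module.finrank_prod, finrank_euclideanSpace_fin, Module.finrank_self, add_comm])
  let ν : Measure (ℝ × Vec d) := (volume : Measure ℝ).prod (volume : Measure (Vec d))
  have : ν.IsAddHaarMeasure := inferInstanceAs (((volume : Measure ℝ).prod
    (volume : Measure (Vec d))).IsAddHaarMeasure)
  let μ : Measure (Cn n) := ν.map Λ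
  have : μ.IsAddHaarMeasure := Λ.isAddHaarMeasure_map ν
  set s := Measure.addHaarScalarFactor (volume : Measure (Cn n)) μ with hs
  have hs0 : s ≠ 0 := (Measure.addHaarScalarFactor_pos_of_isAddHaarMeasure _ _).ne'
  have hvol : (volume : Measure (Cn n)) = s • μ :=
    Measure.isAddLeftInvariant_eq_smul (volume : Measure (Cn n)) μ
  -- the cone map and its derivative
  let G : ℝ × Vec d → Cn n := fun p => p.1 • X p.2
  let DG : ℝ × Vec d → (ℝ × Vec d) →L[ℝ] Cn n := fun p =>
    p.1 • (fderiv ℝ X p.2).comp (ContinuousLinearMap.snd ℝ ℝ (Vec d)) +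
      (ContinuousLinearMap.fst ℝ ℝ (Vec d)).smulRight (X p.2)
  have hXd : ∀ b ∈ T, HasFDerivAt X (fderiv ℝ X b) b := fun b hb =>
    ((hX.differentiableOn (by simp)).differentiableAt (hT.mem_nhds hb)).hasFDerivAt
  have hG : ∀ p : ℝ × Vec d, p.2 ∈ T → HasFDerivAt G (DG p) p := fun p hp =>
    hasFDerivAt_fst.smul ((hXd p.2 hp).comp p hasFDerivAt_snd)
  have hDGcont : ContinuousOn DG (Set.univ ×ˢ T) := by
    have h1 : ContinuousOn (fderiv ℝ X) T := hX.continuousOn_fderiv_of_isOpen hT (by simp)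
    have h2 : ContinuousOn (fun p : ℝ × Vec d => fderiv ℝ X p.2) (Set.univ ×ˢ T) :=
      h1.comp continuousOn_snd fun p hp => hp.2
    have h3 : ContinuousOn (fun p : ℝ × Vec d => X p.2) (Set.univ ×ˢ T) :=
      hX.continuousOn.comp continuousOn_snd fun p hp => hp.2
    refine (continuousOn_fst.smul (h2.clm_comp continuousOn_const)).add ?_
    exact ((ContinuousLinearMap.smulRightL ℝ (ℝ × Vec d) (Cn n)
      (ContinuousLinearMap.fst ℝ ℝ (Vec d))).continuous.comp_continuousOn h3)
  -- Differentiating |X|² = 1. The radial direction is therefore transversal to the image of the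
  -- derivative, which makes the Jacobian of (r, b) ↦ r X(b) nonzero for r > 0.
  have horth : ∀ b ∈ T, ∀ v, ⟪X b, fderiv ℝ X b v⟫_ℝ = 0 := fun b hb v => by
    have h1 := (hXd b hb).norm_sq
    have h2 : (fun b => ‖X b‖ ^ 2) =ᶠ[𝓝 b] fun _ => 1 := by
      filter_upwards [hT.mem_nhds hb] with c hc
      rw [hnorm c hc, one_pow]
    have h3 := h1.unique ((hasFDerivAt_const (1 : ℝ) b).congr_of_eventuallyEq h2)
    have h4 := congrArg (fun L => L v) h3
    simpa using h4
  let J : ℝ × Vec d → ℝ := fun p => |((DG p).comp (Λ.symm : Cn n →L[ℝ] ℝ × Vec d)).det|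
  have hJcont : ContinuousOn J (Set.univ ×ˢ T) :=
    (ContinuousLinearMap.continuous_det.comp_continuousOn
      (hDGcont.clm_comp continuousOn_const)).abs
  have hJpos : ∀ p : ℝ × Vec d, 0 < p.1 → p.2 ∈ T → 0 < J p := fun p hp1 hp2 => by
    refine abs_pos.2 ?_
    have hi : Function.Injective ((DG p).comp (Λ.symm : Cn n →L[ℝ] ℝ × Vec d)) := by
      refine Function.Injective.comp (g := DG p) ?_ Λ.symm.injective
      refine (injective_iff_map_eq_zero (DG p)).2 fun q hq => ?_
      have hq' : p.1 • fderiv ℝ X p.2 q.2 + q.1 • X p.2 = 0 := hq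
      have h1 : q.1 = 0 := by
        have := congrArg (fun y => ⟪X p.2, y⟫_ℝ) hq'
        simpa [inner_add_right, inner_smul_right, horth p.2 hp2, hnorm p.2 hp2] using this
      rw [h1, zero_smul, add_zero, smul_eq_zero] at hq'
      have h2 : q.2 = 0 := himm p.2 hp2 (by rw [hq'.resolve_left hp1.ne', map_zero])
      exact Prod.ext h1 h2
    exact (LinearEquiv.isUnit_det' (LinearEquiv.ofInjectiveEndo _ hi)).ne_zero
  have hGinj : Set.InjOn G (Set.Ioi 0 ×ˢ T) := by
    rintro ⟨r, b⟩ ⟨hr, hb⟩ ⟨r', b'⟩ ⟨hr', hb'⟩ h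
    have h' : r • X b = r' • X b' := h
    have h1 : r = r' := by
      have := congrArg norm h'
      simp only [norm_smul, hnorm b hb, hnorm b' hb', mul_one] at this
      rwa [Real.norm_of_nonneg (le_of_lt hr), Real.norm_of_nonneg (le_of_lt hr')] at this
    subst h1
    have h2 : X b = X b' := smul_right_injective _ (ne_of_gt hr) h'
    exact Prod.ext rfl (hinj hb hb' h2)
  have himage : ∀ (I : Set ℝ), I ⊆ Set.Ioi 0 → MeasurableSet I → ∀ B ⊆ K, MeasurableSet B →
      μ (I • (X '' B)) = ∫⁻ p in I ×ˢ B, ENNReal.ofReal (J p) ∂ν := by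
    intro I hI hIm B hB hBm
    have e1 : I • (X '' B) = (G ∘ Λ.symm) '' (Λ '' (I ×ˢ B)) := by
      rw [← Set.image_comp]
      ext y
      simp only [Set.mem_smul, Set.mem_image, Function.comp_apply,
        ContinuousLinearEquiv.symm_apply_apply, Set.mem_prod, Prod.exists]
      constructor
      · rintro ⟨r, hr, _, ⟨b, hb, rfl⟩, rfl⟩
        exact ⟨r, b, ⟨hr, hb⟩, rfl⟩
      · rintro ⟨r, b, ⟨hr, hb⟩, rfl⟩
        exact ⟨r, hr, _, ⟨b, hb, rfl⟩, rfl⟩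
    have hm : MeasurableSet (Λ '' (I ×ˢ B)) :=
      Λ.toHomeomorph.measurableEmbedding.measurableSet_image.2 (hIm.prod hBm)
    rw [e1, ← lintegral_abs_det_fderiv_eq_addHaar_image μ hm
      (f' := fun y => (DG (Λ.symm y)).comp (Λ.symm : Cn n →L[ℝ] ℝ × Vec d))]
    · have e2 : ν.restrict (I ×ˢ B) = ν.restrict (Λ ⁻¹' (Λ '' (I ×ˢ B))) := by
        rw [Set.preimage_image_eq _ Λ.injective]
      have e3 : μ.restrict (Λ '' (I ×ˢ B)) = (ν.restrict (I ×ˢ B)).map Λ := by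
        rw [e2, Measure.restrict_map Λ.continuous.measurable hm]
      rw [e3]
      refine (Λ.toHomeomorph.measurableEmbedding.lintegral_map _).trans ?_
      refine lintegral_congr fun p => ?_
      simp [J]
    · rintro _ ⟨p, hp, rfl⟩
      refine HasFDerivAt.hasFDerivWithinAt ?_
      refine HasFDerivAt.comp _ ?_ Λ.symm.hasFDerivAt
      exact hG _ (by simpa using hKT (hB hp.2))
    · refine Set.InjOn.comp (t := Set.Ioi 0 ×ˢ T) hGinj Λ.symm.injective.injOn ?_
      rintro _ ⟨p, hp, rfl⟩
      simpa using ⟨hI hp.1, hKT (hB hp.2)⟩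
  -- bounds of the Jacobian
  obtain ⟨C, hC⟩ : ∃ C : ℝ, ∀ p ∈ Set.Icc (0 : ℝ) 1 ×ˢ K, J p ≤ C := by
    obtain ⟨C, hC⟩ := ((isCompact_Icc.prod hK).image_of_continuousOn
      (hJcont.mono fun p hp => ⟨trivial, hKT hp.2⟩)).bddAbove
    exact ⟨C, fun p hp => hC ⟨p, hp, rfl⟩⟩
  -- The Jacobian may degenerate at r = 0, so the lower bound uses only radii in [1/2, 1]; half of
  -- the cone is enough.
  obtain ⟨c, hc0, hc⟩ : ∃ c : ℝ, 0 < c ∧ ∀ p ∈ Set.Icc (1 / 2 : ℝ) 1 ×ˢ K, c ≤ J p := by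
    rcases K.eq_empty_or_nonempty with rfl | hne
    · exact ⟨1, one_pos, fun p hp => absurd hp.2 (by simp)⟩
    · obtain ⟨q, hq, hmin⟩ := (isCompact_Icc.prod hK).exists_isMinOn
        ((Set.nonempty_Icc.2 (by norm_num : (1 / 2 : ℝ) ≤ 1)).prod hne)
        (hJcont.mono fun p hp => ⟨trivial, hKT hp.2⟩)
      exact ⟨J q, hJpos q (lt_of_lt_of_le (by norm_num) hq.1.1) (hKT hq.2), fun p hp => hmin hp⟩
  refine ⟨s * (c.toNNReal * 2⁻¹), s * C.toNNReal, ?_, fun B hB hBm => ⟨?_, ?_⟩⟩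
  · refine mul_ne_zero hs0 (mul_ne_zero ?_ (by norm_num))
    simpa using hc0
  · have h1 : (c.toNNReal : ENNReal) * (2⁻¹ * volume B) ≤ μ (Set.Ioo (0 : ℝ) 1 • (X '' B)) := by
      calc (c.toNNReal : ENNReal) * (2⁻¹ * volume B)
          = ∫⁻ p in Set.Ioo (1 / 2 : ℝ) 1 ×ˢ B, (c.toNNReal : ENNReal) ∂ν := by
            rw [setLIntegral_const, Measure.prod_prod, Real.volume_Ioo]
            congr 2
            rw [show (1 - 1 / 2 : ℝ) = 2⁻¹ by norm_num, ENNReal.ofReal_inv_of_pos (by norm_num)]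
            norm_num
        _ ≤ ∫⁻ p in Set.Ioo (1 / 2 : ℝ) 1 ×ˢ B, ENNReal.ofReal (J p) ∂ν := by
            refine setLIntegral_mono' (measurableSet_Ioo.prod hBm) fun p hp => ?_
            exact ENNReal.ofReal_le_ofReal (hc p ⟨⟨hp.1.1.le, hp.1.2.le⟩, hB hp.2⟩)
        _ = μ (Set.Ioo (1 / 2 : ℝ) 1 • (X '' B)) :=
            (himage _ (fun r hr => lt_trans (by norm_num) hr.1) measurableSet_Ioo B hB hBm).symm
        _ ≤ _ := measure_mono (Set.smul_subset_smul_right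
            (Set.Ioo_subset_Ioo_left (by norm_num)))
    rw [hvol, Measure.smul_apply]
    change _ ≤ (s : ENNReal) * _
    refine le_trans (le_of_eq ?_) (mul_le_mul_right h1 (s : ENNReal))
    push_cast
    ring
  · rw [hvol, Measure.smul_apply]
    change (s : ENNReal) * _ ≤ _
    rw [himage _ (fun r hr => hr.1) measurableSet_Ioo B hB hBm]
    push_cast
    rw [mul_assoc]
    gcongr
    calc ∫⁻ p in Set.Ioo (0 : ℝ) 1 ×ˢ B, ENNReal.ofReal (J p) ∂ν
        ≤ ∫⁻ p in Set.Ioo (0 : ℝ) 1 ×ˢ B, (C.toNNReal : ENNReal) ∂ν := by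
          refine setLIntegral_mono' (measurableSet_Ioo.prod hBm) fun p hp => ?_
          exact ENNReal.ofReal_le_ofReal (hC p ⟨⟨hp.1.1.le, hp.1.2.le⟩, hB hp.2⟩)
      _ = _ := by
          rw [setLIntegral_const, Measure.prod_prod, Real.volume_Ioo]
          simp

end SurfaceMeasure

/-! ### Smooth charts of the sphere -/

section Charts

open MeasureTheory
open scoped Pointwise

variable {n : ℕ}

/-- Charts of the maximal smooth atlas of the sphere. -/
abbrev IsSmoothChart [NeZero n] (κ : Chart n) : Prop :=
  κ ∈ IsManifold.maximalAtlas (𝓡 (2 * n - 1)) ∞ (CSphere n)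

/-- The inverse of a chart as a map to `ℂⁿ`. -/
def chartMap {n : ℕ} (κ : Chart n) (b : Model n) : Cn n := (κ.symm b : Cn n)

theorem norm_chartMap (κ : Chart n) (b : Model n) : ‖chartMap κ b‖ = 1 := by
  simp [chartMap]

theorem injOn_chartMap (κ : Chart n) : Set.InjOn (chartMap κ) κ.target := fun _ hb _ hb' h =>
  κ.symm.injOn hb hb' (Subtype.ext h)

theorem chartMap_apply {κ : Chart n} {x : CSphere n} (hx : x ∈ κ.source) :
    chartMap κ (κ x) = x := by
  rw [chartMap, κ.left_inv hx]

variable [NeZero n]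

theorem contDiffOn_chartMap {κ : Chart n} (hκ : IsSmoothChart κ) :
    ContDiffOn ℝ ∞ (chartMap κ) κ.target := by
  rw [← contMDiffOn_iff_contDiffOn]
  exact contMDiff_coe_sphere.comp_contMDiffOn (contMDiffOn_symm_of_mem_maximalAtlas hκ)

theorem mdifferentiable_chart {κ : Chart n} (hκ : IsSmoothChart κ) :
    OpenPartialHomeomorph.MDifferentiable (𝓡 (2 * n - 1)) (𝓡 (2 * n - 1)) κ :=
  ⟨(contMDiffOn_of_mem_maximalAtlas hκ).mdifferentiableOn (by simp),
    (contMDiffOn_symm_of_mem_maximalAtlas hκ).mdifferentiableOn (by simp)⟩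

theorem fderiv_chartMap {κ : Chart n} (hκ : IsSmoothChart κ) {b : Model n} (hb : b ∈ κ.target) :
    fderiv ℝ (chartMap κ) b =
      (mfderiv (𝓡 (2 * n - 1)) 𝓘(ℝ, Cn n) ((↑) : CSphere n → Cn n) (κ.symm b)).comp
        (mfderiv (𝓡 (2 * n - 1)) (𝓡 (2 * n - 1)) κ.symm b) := by
  rw [← mfderiv_eq_fderiv]
  exact mfderiv_comp b (contMDiff_coe_sphere (m := ∞) _ |>.mdifferentiableAt (by simp))
    ((mdifferentiable_chart hκ).mdifferentiableAt_symm hb)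

theorem injective_fderiv_chartMap {κ : Chart n} (hκ : IsSmoothChart κ) {b : Model n}
    (hb : b ∈ κ.target) : Function.Injective (fderiv ℝ (chartMap κ) b) := by
  rw [fderiv_chartMap hκ hb]
  have h1 : Function.Injective
      (mfderiv (𝓡 (2 * n - 1)) 𝓘(ℝ, Cn n) ((↑) : CSphere n → Cn n) (κ.symm b)) := by
    have := injective_mvfderiv_subtypeVal_sphere (n := 2 * n - 1) (κ.symm b)
    exact this
  have h2 := (mdifferentiable_chart hκ).comp_symm_deriv hb
  refine Function.Injective.comp (g := (mfderiv (𝓡 (2 * n - 1)) 𝓘(ℝ, Cn n)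
    ((↑) : CSphere n → Cn n) (κ.symm b))) h1 ?_
  exact Function.LeftInverse.injective fun v => congrArg (fun L => L v) h2

/-- The coordinates of a covector of `ℝ²ⁿ` in a chart. -/
theorem chartCovector_covectorOf {κ : Chart n} (hκ : IsSmoothChart κ) {x : CSphere n}
    (hx : x ∈ κ.source) (w : Cn n) (j : Fin (2 * n - 1)) :
    chartCovector κ x (covectorOf x w) j =
      ⟪w, fderiv ℝ (chartMap κ) (κ x) (EuclideanSpace.single j 1)⟫_ℝ := by
  have hd := mdifferentiable_chart hκ
  have hinv : (mfderiv (𝓡 (2 * n - 1)) (𝓡 (2 * n - 1)) κ x).inverse =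
      mfderiv (𝓡 (2 * n - 1)) (𝓡 (2 * n - 1)) κ.symm (κ x) := by
    refine ContinuousLinearMap.inverse_eq ?_ (hd.symm_comp_deriv hx)
    have := hd.comp_symm_deriv (κ.map_source hx)
    rwa [κ.left_inv hx] at this
  have h1 := fderiv_chartMap hκ (κ.map_source hx)
  rw [κ.left_inv hx] at h1
  rw [h1]
  simp only [chartCovector, covectorOf]
  rw [hinv]
  rfl

/-- The surface measure of a set is a fixed multiple of the volume of the cone over it, so the
bounds for cones apply. Two-sided constants suffice, as charts are used for estimates only. -/
theorem exists_measure_bounds {κ : Chart n} (hκ : IsSmoothChart κ) {K : Set (Model n)}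
    (hK : IsCompact K) (hKT : K ⊆ κ.target) :
    ∃ C : NNReal, ∀ B ⊆ K, MeasurableSet B →
      volume B ≤ C * surfaceMeasure n (κ.symm '' B) ∧
      surfaceMeasure n (κ.symm '' B) ≤ C * volume B := by
  obtain ⟨c, C, hc, hcC⟩ := exists_volume_cone_bounds (finrankFact n).out κ.open_target
    (contDiffOn_chartMap hκ) (injOn_chartMap κ) (fun b _ => norm_chartMap κ b)
    (fun b hb => injective_fderiv_chartMap hκ hb) hK hKT
  set τ : Measure (CSphere n) := (volume : Measure (Cn n)).toSphere with hτ
  have hτ0 : τ Set.univ ≠ 0 := by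
    rw [Ne, Measure.measure_univ_eq_zero]; exact Measure.toSphere_ne_zero _
  have hτt : τ Set.univ ≠ ⊤ := measure_ne_top _ _
  obtain ⟨u, hu⟩ : ∃ u : NNReal, (u : ENNReal) = τ Set.univ := ⟨_, ENNReal.coe_toNNReal hτt⟩
  have hu0 : u ≠ 0 := by
    rintro rfl; exact hτ0 hu.symm
  -- The real dimension of the ambient space, which is the factor in the definition of `toSphere`.
  set D : NNReal := (2 * n - 1 : ℕ) + 1 with hD
  have hD0 : D ≠ 0 := by positivity
  refine ⟨u⁻¹ * (D * C) + u * (D * c)⁻¹, fun B hB hBm => ?_⟩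
  have hBm' : MeasurableSet (κ.symm '' B) :=
    hBm.image_of_continuousOn_injOn (κ.continuousOn_symm.mono (hB.trans hKT))
      (κ.symm.injOn.mono (hB.trans hKT))
  have e1 : surfaceMeasure n (κ.symm '' B) =
      ((u⁻¹ * D : NNReal) : ENNReal) * (volume : Measure (Cn n)) (Set.Ioo (0 : ℝ) 1 • (chartMap κ '' B)) := by
    rw [surfaceMeasure, Measure.smul_apply, Measure.toSphere_apply' _ hBm', Set.image_image,
      (finrankFact n).out, smul_eq_mul, ← mul_assoc, ← hτ, ← hu]
    push_cast
    rw [ENNReal.coe_inv hu0]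
    congr 1
    rw [hD]
    push_cast
    rfl
  obtain ⟨h1, h2⟩ := hcC B hB hBm
  rw [e1]
  constructor
  · calc volume B = ((u * (D * c)⁻¹ : NNReal) : ENNReal) * (((u⁻¹ * D : NNReal) : ENNReal) * (c * volume B)) := by
          rw [← mul_assoc, ← mul_assoc, ← ENNReal.coe_mul, ← ENNReal.coe_mul]
          have : u * (D * c)⁻¹ * (u⁻¹ * D) * c = 1 := by
            field_simp
          rw [this]; simp
      _ ≤ _ := by
          gcongr
          exact le_add_of_nonneg_left zero_le
  · calc _ ≤ ((u⁻¹ * D : NNReal) : ENNReal) * (C * volume B) := by gcongr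
      _ = ((u⁻¹ * (D * C) : NNReal) : ENNReal) * volume B := by push_cast; ring
      _ ≤ _ := by
          gcongr
          exact le_add_of_nonneg_right zero_le

/-- Comparison of surface integrals with integrals in a chart. -/
theorem exists_lintegral_bounds {κ : Chart n} (hκ : IsSmoothChart κ) {K : Set (Model n)}
    (hK : IsCompact K) (hKT : K ⊆ κ.target) :
    ∃ C : NNReal, (∀ φ : CSphere n → ENNReal,
        ∫⁻ x in κ.symm '' K, φ x ∂(surfaceMeasure n) ≤ C * ∫⁻ b in K, φ (κ.symm b)) ∧
      ∀ φ : CSphere n → ENNReal, Measurable φ →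
        ∫⁻ b in K, φ (κ.symm b) ≤ C * ∫⁻ x, φ x ∂(surfaceMeasure n) := by
  obtain ⟨C, hC⟩ := exists_measure_bounds hκ hK hKT
  have hKm := hK.measurableSet
  have hcont : ContinuousOn κ.symm K := κ.continuousOn_symm.mono hKT
  have hae : AEMeasurable κ.symm (volume.restrict K) := hcont.aemeasurable hKm
  set lam : Measure (CSphere n) := (volume.restrict K).map κ.symm with hlam
  have hpre : ∀ s, MeasurableSet s → MeasurableSet (K ∩ κ.symm ⁻¹' s) := fun s hs => by
    have h1 := (continuousOn_iff_continuous_domRestrict.1 hcont).measurable hs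
    have h2 := hKm.subtype_image h1
    rwa [Set.domRestrict_eq, Set.preimage_comp, Subtype.image_preimage_coe] at h2
  have hlams : ∀ s, MeasurableSet s → lam s = volume (K ∩ κ.symm ⁻¹' s) := fun s hs => by
    rw [hlam, Measure.map_apply_of_aemeasurable hae hs,
      Measure.restrict_apply' hKm, Set.inter_comm]
  refine ⟨C, fun φ => ?_, fun φ hφ => ?_⟩
  · have hle : (surfaceMeasure n).restrict (κ.symm '' K) ≤ C • lam := by
      refine Measure.le_iff.2 fun s hs => ?_
      rw [Measure.restrict_apply hs, Measure.smul_apply, hlams s hs]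
      have e : s ∩ κ.symm '' K = κ.symm '' (K ∩ κ.symm ⁻¹' s) := by
        rw [Set.image_inter_preimage, Set.inter_comm]
      rw [e]
      exact (hC _ Set.inter_subset_left (hpre s hs)).2
    calc _ ≤ ∫⁻ x, φ x ∂(C • lam) := lintegral_mono' hle le_rfl
      _ = C * ∫⁻ x, φ x ∂lam := by rw [lintegral_smul_measure]; rfl
      _ ≤ _ := by
        gcongr
        exact lintegral_map_le _ _
  · have hle : lam ≤ C • surfaceMeasure n := by
      refine Measure.le_iff.2 fun s hs => ?_
      rw [Measure.smul_apply, hlams s hs]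
      refine ((hC _ Set.inter_subset_left (hpre s hs)).1).trans ?_
      change _ ≤ (C : ENNReal) * _
      gcongr
      rintro _ ⟨b, hb, rfl⟩
      exact hb.2
    calc _ = ∫⁻ x, φ x ∂lam := (lintegral_map' hφ.aemeasurable hae).symm
      _ ≤ ∫⁻ x, φ x ∂(C • surfaceMeasure n) := lintegral_mono' hle le_rfl
      _ = _ := by rw [lintegral_smul_measure]; rfl

/-- Near `b₀` this follows from the injectivity of the derivative; on the rest of `K` the quotient
is continuous on a compact set, with a denominator that does not vanish because the chart map is
injective. -/
theorem exists_norm_sub_le_chartMap {κ : Chart n} (hκ : IsSmoothChart κ) {K : Set (Model n)}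
    (hK : IsCompact K) (hKT : K ⊆ κ.target) {b₀ : Model n} (hb₀ : b₀ ∈ κ.target) :
    ∃ C : ℝ, 0 < C ∧ ∀ b ∈ K, ‖b - b₀‖ ≤ C * ‖chartMap κ b - chartMap κ b₀‖ := by
  have hX := contDiffOn_chartMap hκ
  have hder : HasFDerivAt (chartMap κ) (fderiv ℝ (chartMap κ) b₀) b₀ :=
    ((hX.differentiableOn (by simp)).differentiableAt (κ.open_target.mem_nhds hb₀)).hasFDerivAt
  obtain ⟨C, hC⟩ := (hder.isTheta_sub (LinearMap.isClosedEmbedding_of_injective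
    (f := (fderiv ℝ (chartMap κ) b₀ : Model n →ₗ[ℝ] Cn n))
    (LinearMap.ker_eq_bot.2 (injective_fderiv_chartMap hκ hb₀))).isInducing).isBigO_symm.bound
  obtain ⟨ε, hε, hball⟩ := Metric.eventually_nhds_iff.1 hC
  have hK' : IsCompact (K \ Metric.ball b₀ ε) := hK.diff Metric.isOpen_ball
  have hcont : ContinuousOn (fun b => ‖b - b₀‖ / ‖chartMap κ b - chartMap κ b₀‖)
      (K \ Metric.ball b₀ ε) := by
    refine ContinuousOn.div (by fun_prop)
      ((hX.continuousOn.mono (Set.sdiff_subset.trans hKT)).sub continuousOn_const).norm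
      fun b hb => ?_
    rw [norm_ne_zero_iff, sub_ne_zero]
    intro h
    have := injOn_chartMap κ (hKT hb.1) hb₀ h
    exact hb.2 (this ▸ Metric.mem_ball_self hε)
  obtain ⟨D, hD⟩ := (hK'.image_of_continuousOn hcont).bddAbove
  refine ⟨max (max C D) 1, by positivity, fun b hb => ?_⟩
  by_cases hbε : b ∈ Metric.ball b₀ ε
  · refine (hball hbε).trans ?_
    gcongr
    exact (le_max_left _ _).trans (le_max_left _ _)
  · have h1 : ‖b - b₀‖ / ‖chartMap κ b - chartMap κ b₀‖ ≤ D := hD ⟨b, ⟨hb, hbε⟩, rfl⟩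
    have h2 : chartMap κ b - chartMap κ b₀ ≠ 0 := by
      rw [sub_ne_zero]
      intro h
      have := injOn_chartMap κ (hKT hb) hb₀ h
      exact hbε (this ▸ Metric.mem_ball_self hε)
    rw [div_le_iff₀ (norm_pos_iff.2 h2)] at h1
    refine h1.trans ?_
    gcongr
    exact (le_max_right _ _).trans (le_max_left _ _)

end Charts

/-! ### Exponential generating functions -/

section GeneratingFunctions

/-- Sequences of at most exponential growth. -/
def ExpGrowth (c : ℕ → ℝ) : Prop := ∃ M R : ℝ, 0 ≤ M ∧ 0 ≤ R ∧ ∀ k, |c k| ≤ M * R ^ k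

/-- The exponential generating function `∑ c_k w^k / k!`. -/
def egf (c : ℕ → ℝ) (w : ℂ) : ℂ := ∑' k : ℕ, (c k : ℂ) / (k.factorial : ℂ) * w ^ k

variable {c e : ℕ → ℝ}

theorem expGrowth_const (a : ℝ) : ExpGrowth fun _ => a :=
  ⟨|a|, 1, abs_nonneg _, zero_le_one, fun k => by simp⟩

theorem expGrowth_natCast : ExpGrowth fun k => (k : ℝ) :=
  ⟨1, 2, zero_le_one, zero_le_two, fun k => by
    rw [Nat.abs_cast, one_mul]; exact_mod_cast (Nat.lt_two_pow_self).le⟩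

theorem ExpGrowth.add (hc : ExpGrowth c) (he : ExpGrowth e) : ExpGrowth fun k => c k + e k := by
  obtain ⟨M, R, hM, hR, h⟩ := hc
  obtain ⟨M', R', hM', hR', h'⟩ := he
  refine ⟨M + M', max R R', by positivity, le_max_of_le_left hR, fun k => ?_⟩
  refine (abs_add_le _ _).trans ?_
  rw [add_mul]
  refine add_le_add ((h k).trans ?_) ((h' k).trans ?_)
  · gcongr; exact le_max_left _ _
  · gcongr; exact le_max_right _ _

theorem ExpGrowth.mul (hc : ExpGrowth c) (he : ExpGrowth e) : ExpGrowth fun k => c k * e k := by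
  obtain ⟨M, R, hM, hR, h⟩ := hc
  obtain ⟨M', R', hM', hR', h'⟩ := he
  refine ⟨M * M', R * R', by positivity, by positivity, fun k => ?_⟩
  rw [abs_mul, mul_pow]
  calc |c k| * |e k| ≤ (M * R ^ k) * (M' * R' ^ k) :=
        mul_le_mul (h k) (h' k) (abs_nonneg _) (by positivity)
    _ = _ := by ring

theorem ExpGrowth.const_mul (hc : ExpGrowth c) (a : ℝ) : ExpGrowth fun k => a * c k :=
  (expGrowth_const a).mul hc

theorem ExpGrowth.sub (hc : ExpGrowth c) (he : ExpGrowth e) : ExpGrowth fun k => c k - e k := by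
  simpa [sub_eq_add_neg] using hc.add (he.const_mul (-1))

theorem ExpGrowth.shift (hc : ExpGrowth c) (l : ℕ) : ExpGrowth fun k => c (k + l) := by
  obtain ⟨M, R, hM, hR, h⟩ := hc
  refine ⟨M * R ^ l, R, by positivity, hR, fun k => ?_⟩
  rw [mul_assoc, ← pow_add, add_comm l k]
  exact h _

theorem ExpGrowth.summable (hc : ExpGrowth c) {ρ : ℝ} (hρ : 0 ≤ ρ) :
    Summable fun k : ℕ => |c k| / (k.factorial : ℝ) * ρ ^ k := by
  obtain ⟨M, R, hM, hR, h⟩ := hc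
  refine Summable.of_nonneg_of_le (fun k => by positivity) (fun k => ?_)
    ((Real.summable_pow_div_factorial (R * ρ)).mul_left M)
  rw [mul_pow, mul_div_assoc', ← mul_assoc, div_mul_eq_mul_div]
  gcongr
  exact h k

theorem norm_egf_term (c : ℕ → ℝ) (k : ℕ) (w : ℂ) :
    ‖(c k : ℂ) / (k.factorial : ℂ) * w ^ k‖ = |c k| / (k.factorial : ℝ) * ‖w‖ ^ k := by
  rw [norm_mul, norm_div, norm_pow, Complex.norm_natCast, Complex.norm_real, Real.norm_eq_abs]

theorem ExpGrowth.hasSum (hc : ExpGrowth c) (w : ℂ) :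
    HasSum (fun k : ℕ => (c k : ℂ) / (k.factorial : ℂ) * w ^ k) (egf c w) := by
  refine Summable.hasSum (Summable.of_norm ?_)
  simp_rw [norm_egf_term]
  exact hc.summable (norm_nonneg w)

theorem egf_one (w : ℂ) : egf (fun _ => 1) w = Complex.exp w := by
  rw [Complex.exp_eq_exp_ℂ, NormedSpace.exp_eq_tsum_div, egf]
  refine tsum_congr fun k => ?_
  push_cast
  ring

theorem egf_add (hc : ExpGrowth c) (he : ExpGrowth e) (w : ℂ) :
    egf (fun k => c k + e k) w = egf c w + egf e w := by
  rw [← ((hc.hasSum w).add (he.hasSum w)).tsum_eq, egf]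
  exact tsum_congr fun k => by push_cast; ring

theorem egf_const_mul (hc : ExpGrowth c) (a : ℝ) (w : ℂ) :
    egf (fun k => a * c k) w = a * egf c w := by
  rw [← ((hc.hasSum w).mul_left (a : ℂ)).tsum_eq, egf]
  exact tsum_congr fun k => by push_cast; ring

theorem egf_sub (hc : ExpGrowth c) (he : ExpGrowth e) (w : ℂ) :
    egf (fun k => c k - e k) w = egf c w - egf e w := by
  rw [← ((hc.hasSum w).sub (he.hasSum w)).tsum_eq, egf]
  exact tsum_congr fun k => by push_cast; ring

/-- The coefficient k/k! is 1/(k-1)! and the term k = 0 vanishes. -/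
theorem egf_natCast_mul (hc : ExpGrowth c) (w : ℂ) :
    egf (fun k => k * c k) w = w * egf (fun k => c (k + 1)) w := by
  have h := (expGrowth_natCast.mul hc).hasSum w
  rw [← hasSum_nat_add_iff' 1] at h
  have h2 := ((hc.shift 1).hasSum w).mul_left w
  have h3 := h.unique (h2.congr_fun (g := _) ?_)
  · simpa using h3
  · intro k
    rw [Nat.factorial_succ]
    have : ((k : ℂ) + 1) ≠ 0 := by exact_mod_cast Nat.succ_ne_zero k
    push_cast
    field_simp
    ring

theorem ExpGrowth.hasDerivAt_egf (hc : ExpGrowth c) (w : ℂ) :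
    HasDerivAt (egf c) (egf (fun k => c (k + 1)) w) w := by
  have hw : w ∈ Metric.ball (0 : ℂ) (‖w‖ + 1) := by simp
  have hb : ∀ v ∈ Metric.ball (0 : ℂ) (‖w‖ + 1), ‖v‖ ≤ ‖w‖ + 1 := fun v hv => by
    simpa using (Metric.mem_ball.1 hv).le
  have hle : ∀ (e : ℕ → ℝ) (k : ℕ), ∀ v ∈ Metric.ball (0 : ℂ) (‖w‖ + 1),
      ‖(e k : ℂ) / (k.factorial : ℂ) * v ^ k‖ ≤ |e k| / (k.factorial : ℝ) * (‖w‖ + 1) ^ k :=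
    fun e k v hv => by
      rw [norm_egf_term]
      gcongr
      exact hb v hv
  have hd := Complex.hasSum_deriv_of_summable_norm
    (F := fun k v => (c k : ℂ) / (k.factorial : ℂ) * v ^ k)
    (u := fun k : ℕ => |c k| / (k.factorial : ℝ) * (‖w‖ + 1) ^ k)
    (hc.summable (by positivity))
    (fun k => ((differentiable_id.pow k).const_mul _).differentiableOn) Metric.isOpen_ball
    (fun k v hv => hle c k v hv) hw
  have hdiff := Complex.differentiableOn_tsum_of_summable_norm
    (F := fun k v => (c k : ℂ) / (k.factorial : ℂ) * v ^ k)
    (u := fun k : ℕ => |c k| / (k.factorial : ℝ) * (‖w‖ + 1) ^ k)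
    (hc.summable (by positivity))
    (fun k => ((differentiable_id.pow k).const_mul _).differentiableOn) Metric.isOpen_ball
    (fun k v hv => hle c k v hv)
  have h1 : HasDerivAt (egf c) (deriv (egf c) w) w :=
    (hdiff.differentiableAt (Metric.isOpen_ball.mem_nhds hw)).hasDerivAt
  convert h1 using 1
  rw [← hasSum_nat_add_iff' 1] at hd
  have h2 := (hc.shift 1).hasSum w
  have h3 := h2.unique (hd.congr_fun (g := _) ?_)
  · rw [h3]
    simp
    rfl
  · intro k
    have : ((k : ℂ) + 1) ≠ 0 := by exact_mod_cast Nat.succ_ne_zero k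
    simp only [deriv_const_mul_field', differentiableAt_fun_id, deriv_fun_pow, deriv_id'']
    rw [Nat.factorial_succ]
    push_cast
    field_simp

theorem ExpGrowth.differentiable_egf (hc : ExpGrowth c) : Differentiable ℂ (egf c) := fun w =>
  (hc.hasDerivAt_egf w).differentiableAt

theorem ExpGrowth.continuous_egf (hc : ExpGrowth c) : Continuous (egf c) :=
  hc.differentiable_egf.continuous

theorem ExpGrowth.contDiff_egf (hc : ExpGrowth c) : ContDiff ℝ ∞ (egf c) :=
  hc.differentiable_egf.contDiff.restrict_scalars ℝ

theorem egf_conj (c : ℕ → ℝ) (w : ℂ) : egf c (conj w) = conj (egf c w) := by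
  rw [egf, egf, Complex.conj_tsum]
  exact tsum_congr fun k => by simp

theorem expGrowth_familyCoeff (n : ℕ) (p : ℝ) : ExpGrowth (familyCoeff n p) := by
  obtain ⟨R, hR, h⟩ := exists_familyCoeff_le n p
  refine ⟨1, R, zero_le_one, hR, fun k => ?_⟩
  rw [one_mul, abs_of_nonneg (a := familyCoeff n p k) (Real.sqrt_nonneg _)]
  exact h k

theorem familySeries_eq_egf (n : ℕ) (p : ℝ) : familySeries n p = egf (familyCoeff n p) := rfl

theorem familyCoeff_zero {n : ℕ} (hn : 2 ≤ n) (k : ℕ) : familyCoeff n 0 k = 1 := by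
  have : (ascPochhammer ℝ k).eval (n : ℝ) ≠ 0 := (ascPochhammer_pos k _ (by positivity)).ne'
  rw [familyCoeff, add_zero, div_self this, Real.sqrt_one]

/-- The quotient (n)_k/(n-1)_k telescopes to (n - 1 + k)/(n - 1). -/
theorem familyCoeff_neg_one {n : ℕ} (hn : 2 ≤ n) (k : ℕ) :
    familyCoeff n (-1) k = √(1 + k / ((n : ℝ) - 1)) := by
  have hn1 : (0 : ℝ) < (n : ℝ) + -1 := by
    have : (2 : ℝ) ≤ n := by exact_mod_cast hn
    linarith
  rw [familyCoeff]
  congr 1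
  rw [div_eq_iff (ascPochhammer_pos k _ hn1).ne', ← sub_eq_add_neg]
  rw [← sub_eq_add_neg] at hn1
  induction k with
  | zero => simp
  | succ k ih =>
    rw [ascPochhammer_succ_eval, ascPochhammer_succ_eval, ih]
    push_cast
    field_simp
    ring

/-- The growth conditions on the coefficients of the families `K_p`. -/
structure SlowGrowth (c : ℕ → ℝ) : Prop where
  zero_eq : c 0 = 1
  le_succ : ∀ k, c k ≤ c (k + 1)
  succ_le : ∀ k, c (k + 1) ≤ 2 * c k
  succ_sub_le : ∀ k : ℕ, c (k + 1) - c k ≤ c k / (k + 1)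

theorem slowGrowth_familyCoeff {n : ℕ} (hn : 2 ≤ n) {p : ℝ} (hp : p = 0 ∨ p = -1) :
    SlowGrowth (familyCoeff n p) := by
  rcases hp with rfl | rfl
  · constructor
    · simp [familyCoeff_zero hn]
    all_goals intro k; simp only [familyCoeff_zero hn]
    · rfl
    · norm_num
    · rw [sub_self]; positivity
  · have ha : (1 : ℝ) ≤ (n : ℝ) - 1 := by
      have : (2 : ℝ) ≤ n := by exact_mod_cast hn
      linarith
    set a : ℝ := (n : ℝ) - 1
    have ha0 : 0 < a := by linarith
    -- Already the ratio of the radicands is at most 1 + 1/(k+1), thanks to `a ≥ 1`, that is, n ≥ 2.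
    -- The square of this factor is then more than enough.
    have key : ∀ k : ℕ, √(1 + ((k + 1 : ℕ) : ℝ) / a) ≤
        (1 + 1 / ((k : ℝ) + 1)) * √(1 + k / a) := fun k => by
      have h1 : (1 : ℝ) ≤ 1 + 1 / ((k : ℝ) + 1) := by
        have : (0 : ℝ) ≤ 1 / ((k : ℝ) + 1) := by positivity
        linarith
      rw [Real.sqrt_le_left (by positivity), mul_pow, Real.sq_sqrt (by positivity)]
      have h2 : 1 + ((k + 1 : ℕ) : ℝ) / a ≤ (1 + 1 / ((k : ℝ) + 1)) * (1 + k / a) := by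
        push_cast
        rw [← sub_nonneg]
        have : (1 + 1 / ((k : ℝ) + 1)) * (1 + k / a) - (1 + ((k : ℝ) + 1) / a) =
            (a - 1) / (((k : ℝ) + 1) * a) := by field_simp; ring
        rw [this]
        exact div_nonneg (by linarith) (by positivity)
      refine h2.trans ?_
      gcongr
      nlinarith
    constructor
    · rw [familyCoeff_neg_one hn]; simp
    all_goals intro k; simp only [familyCoeff_neg_one hn]
    · gcongr; simp
    · refine (key k).trans ?_
      gcongr
      have : 1 / ((k : ℝ) + 1) ≤ 1 := by
        rw [div_le_one (by positivity)]; linarith [(Nat.cast_nonneg k : (0 : ℝ) ≤ k)]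
      linarith
    · have := key k
      have e : (1 + 1 / ((k : ℝ) + 1)) * √(1 + k / a) =
        √(1 + k / a) + √(1 + k / a) / ((k : ℝ) + 1) := by ring
      linarith

theorem SlowGrowth.pos (hc : SlowGrowth c) (k : ℕ) : 1 ≤ c k := by
  induction k with
  | zero => exact hc.zero_eq.ge
  | succ k ih => exact ih.trans (hc.le_succ k)

theorem SlowGrowth.shift_le (hc : SlowGrowth c) (l k : ℕ) : c (k + l) ≤ 2 ^ l * c k := by
  induction l with
  | zero => simp
  | succ l ih =>
    have := hc.succ_le (k + l)
    rw [pow_succ]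
    have h2 : c (k + (l + 1)) ≤ 2 * c (k + l) := this
    linarith

theorem SlowGrowth.expGrowth (hc : SlowGrowth c) : ExpGrowth c :=
  ⟨1, 2, zero_le_one, zero_le_two, fun k => by
    have := hc.shift_le k 0
    rw [zero_add, hc.zero_eq] at this
    rw [abs_of_nonneg (zero_le_one.trans (hc.pos k))]
    linarith⟩

end GeneratingFunctions

/-! ### Moments of the functions `x ↦ x · x₀` on the sphere -/

section Moments

open MeasureTheory

variable {n : ℕ}

theorem dot_eq_inner (x z : Cn n) : dot x z = inner ℂ z x := by
  simp [dot, PiLp.inner_apply]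

theorem continuous_dot (z : Cn n) : Continuous fun x : CSphere n => dot (x : Cn n) z := by
  simp only [dot_eq_inner]
  fun_prop

theorem norm_dot_le (x x₀ : CSphere n) : ‖dot (x : Cn n) x₀‖ ≤ 1 := by
  rw [dot_eq_inner]
  exact (norm_inner_le_norm _ _).trans (by simp)

theorem re_dot (x x₀ : CSphere n) :
    (dot (x : Cn n) x₀).re = 1 - ‖(x : Cn n) - x₀‖ ^ 2 / 2 := by
  have h := @norm_sub_sq ℂ (Cn n) _ _ _ (x₀ : Cn n) (x : Cn n)
  rw [dot_eq_inner, norm_sub_rev, h]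
  simp
  ring

theorem norm_dot_sub_one_le (x x₀ : CSphere n) :
    ‖dot (x : Cn n) x₀ - 1‖ ≤ ‖(x : Cn n) - x₀‖ := by
  have h : dot (x : Cn n) x₀ - 1 = inner ℂ (x₀ : Cn n) ((x : Cn n) - x₀) := by
    rw [dot_eq_inner, inner_sub_right]
    simp
  rw [h]
  exact (norm_inner_le_norm _ _).trans (by simp)

theorem norm_sub_sphere_le_two (x x₀ : CSphere n) : ‖(x : Cn n) - x₀‖ ≤ 2 := by
  refine (norm_sub_le _ _).trans ?_
  simp; norm_num

/-- The function `x ↦ lam (x · x₀)`. -/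
def scaledDot (x₀ : CSphere n) (lam : ℝ) (x : CSphere n) : ℂ := lam * dot (x : Cn n) x₀

theorem continuous_scaledDot (x₀ : CSphere n) (lam : ℝ) : Continuous (scaledDot x₀ lam) :=
  continuous_const.mul (continuous_dot _)

theorem norm_scaledDot_le (x₀ : CSphere n) {lam : ℝ} (hlam : 0 ≤ lam) (x : CSphere n) :
    ‖scaledDot x₀ lam x‖ ≤ lam := by
  rw [scaledDot, norm_mul, Complex.norm_real, Real.norm_of_nonneg hlam]
  exact mul_le_of_le_one_right hlam (norm_dot_le x x₀)

theorem re_scaledDot (x₀ : CSphere n) (lam : ℝ) (x : CSphere n) :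
    (scaledDot x₀ lam x).re = lam * (1 - ‖(x : Cn n) - x₀‖ ^ 2 / 2) := by
  rw [scaledDot, Complex.re_ofReal_mul, re_dot]

theorem norm_scaledDot_sub_le (x₀ : CSphere n) {lam : ℝ} (hlam : 0 ≤ lam) (x : CSphere n) :
    ‖scaledDot x₀ lam x - lam‖ ≤ lam * ‖(x : Cn n) - x₀‖ := by
  have : scaledDot x₀ lam x - lam = lam * (dot (x : Cn n) x₀ - 1) := by rw [scaledDot]; ring
  rw [this, norm_mul, Complex.norm_real, Real.norm_of_nonneg hlam]
  gcongr
  exact norm_dot_sub_one_le x x₀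

variable {c e : ℕ → ℝ}

/-- Multiplication by a number of modulus one, as a real linear isometry. -/
def phaseIsometry (a : ℂ) (ha : ‖a‖ = 1) : Cn n ≃ₗᵢ[ℝ] Cn n where
  toLinearEquiv := (LinearEquiv.smulOfNeZero ℂ (Cn n) a
    (norm_ne_zero_iff.1 (by rw [ha]; exact one_ne_zero))).restrictScalars ℝ
  norm_map' x := by
    change ‖a • x‖ = ‖x‖
    rw [norm_smul, ha, one_mul]

theorem scaledDot_phaseIsometry (x₀ : CSphere n) (lam : ℝ) (a : ℂ) (ha : ‖a‖ = 1) (x : CSphere n) :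
    scaledDot x₀ lam (sphereMap (phaseIsometry a ha) x) = a * scaledDot x₀ lam x := by
  have : ((sphereMap (phaseIsometry a ha) x : CSphere n) : Cn n) = a • (x : Cn n) := rfl
  rw [scaledDot, this, dot_eq_inner, inner_smul_right, scaledDot, dot_eq_inner]
  ring

/-- The squared norm of `(lam (x · x₀))^k / k!`. -/
def powerWeight (x₀ : CSphere n) (lam : ℝ) (k : ℕ) : ℝ :=
  (∫ x, ‖scaledDot x₀ lam x‖ ^ (2 * k) ∂(surfaceMeasure n)) / (k.factorial : ℝ) ^ 2

theorem powerWeight_nonneg (x₀ : CSphere n) (lam : ℝ) (k : ℕ) : 0 ≤ powerWeight x₀ lam k :=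
  div_nonneg (integral_nonneg fun _ => by positivity) (by positivity)

/-- The measure is invariant under multiplication by a phase e^{iθ}, which multiplies the integrand
by e^{i(k-j)θ}; the choice θ = π/(k-j) makes this factor -1. -/
theorem integral_pow_mul_conj_pow_eq_zero (x₀ : CSphere n) (lam : ℝ) {k j : ℕ} (hkj : k ≠ j) :
    ∫ x, scaledDot x₀ lam x ^ k * conj (scaledDot x₀ lam x ^ j) ∂(surfaceMeasure n) = 0 := by
  set θ : ℝ := Real.pi / ((k : ℝ) - j) with hθ
  have hne : (k : ℝ) - j ≠ 0 := sub_ne_zero.2 (by exact_mod_cast hkj)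
  set a : ℂ := Complex.exp (θ * Complex.I) with ha
  have han : ‖a‖ = 1 := Complex.norm_exp_ofReal_mul_I θ
  have hfac : a ^ k * conj (a ^ j) = -1 := by
    rw [ha, map_pow, ← Complex.exp_conj, ← Complex.exp_nat_mul, ← Complex.exp_nat_mul,
      ← Complex.exp_add, ← Complex.exp_pi_mul_I]
    congr 1
    simp only [map_mul, Complex.conj_ofReal, Complex.conj_I]
    have : (θ : ℂ) * ((k : ℂ) - j) = Real.pi := by
      rw [hθ]
      have : ((k : ℂ) - j) ≠ 0 := by exact_mod_cast hne
      push_cast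
      field_simp
    linear_combination Complex.I * this
  have h := integral_sphereMap (phaseIsometry a han)
    fun x : CSphere n => scaledDot x₀ lam x ^ k * conj (scaledDot x₀ lam x ^ j)
  have h2 : ∀ x : CSphere n, (scaledDot x₀ lam (sphereMap (phaseIsometry a han) x) ^ k *
      conj (scaledDot x₀ lam (sphereMap (phaseIsometry a han) x) ^ j)) =
      -(scaledDot x₀ lam x ^ k * conj (scaledDot x₀ lam x ^ j)) := fun x => by
    rw [scaledDot_phaseIsometry, mul_pow, mul_pow, map_mul]
    linear_combination (scaledDot x₀ lam x ^ k * conj (scaledDot x₀ lam x ^ j)) * hfac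
  simp_rw [h2, integral_neg] at h
  exact self_eq_neg.1 h.symm

variable [NeZero n]

theorem integrable_of_continuous {V : Type*} [NormedAddCommGroup V] {φ : CSphere n → V}
    (hφ : Continuous φ) : Integrable φ (surfaceMeasure n) :=
  hφ.integrable_of_hasCompactSupport (HasCompactSupport.of_compactSpace φ)

instance : (surfaceMeasure n).IsOpenPosMeasure := by
  unfold surfaceMeasure
  refine ((volume : Measure (Cn n)).toSphere).isOpenPosMeasure_smul ?_
  exact ENNReal.inv_ne_zero.2 (measure_ne_top _ _)

theorem powerWeight_zero (x₀ : CSphere n) (lam : ℝ) : powerWeight x₀ lam 0 = 1 := by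
  simp [powerWeight]

theorem ExpGrowth.hasSum_integral (hc : ExpGrowth c) (x₀ : CSphere n) {lam : ℝ} (hlam : 0 ≤ lam)
    {g : CSphere n → ℂ} (hg : Continuous g) :
    HasSum (fun k => (c k : ℂ) / (k.factorial : ℂ) *
      ∫ x, scaledDot x₀ lam x ^ k * g x ∂(surfaceMeasure n))
      (∫ x, egf c (scaledDot x₀ lam x) * g x ∂(surfaceMeasure n)) := by
  obtain ⟨M, hM⟩ := (isCompact_range hg.norm).bddAbove
  have hM' : ∀ x, ‖g x‖ ≤ M := fun x => hM ⟨x, rfl⟩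
  have hw := continuous_scaledDot x₀ lam
  have h := hasSum_integral_of_summable_integral_norm (μ := surfaceMeasure n)
    (F := fun k x => (c k : ℂ) / (k.factorial : ℂ) * scaledDot x₀ lam x ^ k * g x)
    (fun k => integrable_of_continuous (by fun_prop)) ?_
  · simp_rw [tsum_mul_right, mul_assoc, integral_const_mul] at h
    simpa only [mul_assoc, egf] using h
  · refine Summable.of_nonneg_of_le (fun k => integral_nonneg fun _ => norm_nonneg _) (fun k => ?_)
      ((hc.summable hlam).mul_right M)
    calc ∫ x, ‖(c k : ℂ) / (k.factorial : ℂ) * scaledDot x₀ lam x ^ k * g x‖ ∂(surfaceMeasure n)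
        ≤ ∫ _, |c k| / (k.factorial : ℝ) * lam ^ k * M ∂(surfaceMeasure n) := by
          refine integral_mono (integrable_of_continuous (by fun_prop)) (integrable_const _)
            fun x => ?_
          simp only [norm_mul _ (g x), norm_egf_term]
          gcongr
          · exact norm_scaledDot_le x₀ hlam x
          · exact hM' x
      _ = _ := by simp

/-- Parseval's identity: distinct powers of x·x₀ are orthogonal, so only the diagonal terms survive.
-/
theorem ExpGrowth.hasSum_inner (hc : ExpGrowth c) (he : ExpGrowth e) (x₀ : CSphere n) {lam : ℝ}
    (hlam : 0 ≤ lam) :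
    HasSum (fun k => ((c k * e k * powerWeight x₀ lam k : ℝ) : ℂ))
      (∫ x, egf c (scaledDot x₀ lam x) * conj (egf e (scaledDot x₀ lam x)) ∂(surfaceMeasure n)) := by
  have hw := continuous_scaledDot x₀ lam
  have hk : ∀ k, ∫ x, scaledDot x₀ lam x ^ k * conj (egf e (scaledDot x₀ lam x))
      ∂(surfaceMeasure n) = (e k : ℂ) / (k.factorial : ℂ) *
        ∫ x, ‖scaledDot x₀ lam x‖ ^ (2 * k) ∂(surfaceMeasure n) := fun k => by
    have h := he.hasSum_integral x₀ hlam (g := fun x => conj (scaledDot x₀ lam x ^ k))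
      (by fun_prop)
    have h0 : ∀ j, j ≠ k → (e j : ℂ) / (j.factorial : ℂ) *
        ∫ x, scaledDot x₀ lam x ^ j * conj (scaledDot x₀ lam x ^ k) ∂(surfaceMeasure n) = 0 :=
      fun j hj => by rw [integral_pow_mul_conj_pow_eq_zero x₀ lam hj, mul_zero]
    have h1 := h.unique (hasSum_single k h0)
    have h2 := congrArg conj h1
    rw [← integral_conj] at h2
    simp only [map_mul, Complex.conj_conj, map_div₀, Complex.conj_ofReal, Complex.conj_natCast]
      at h2
    rw [← integral_conj] at h2
    have e1 : ∀ x, scaledDot x₀ lam x ^ k * conj (egf e (scaledDot x₀ lam x)) =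
        conj (egf e (scaledDot x₀ lam x)) * scaledDot x₀ lam x ^ k := fun x => mul_comm _ _
    have e2 : ∀ x, conj (scaledDot x₀ lam x ^ k * conj (scaledDot x₀ lam x ^ k)) =
        ((‖scaledDot x₀ lam x‖ ^ (2 * k) : ℝ) : ℂ) := fun x => by
      rw [map_mul, Complex.conj_conj, Complex.conj_mul', norm_pow]
      push_cast
      ring
    simp_rw [e2, integral_complex_ofReal] at h2
    simp_rw [e1]
    exact h2
  have h := hc.hasSum_integral x₀ hlam (g := fun x => conj (egf e (scaledDot x₀ lam x)))
    (by have := he.continuous_egf; fun_prop)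
  refine h.congr_fun fun k => ?_
  rw [hk, powerWeight]
  push_cast
  ring

theorem ExpGrowth.hasSum_norm_sq (hc : ExpGrowth c) (x₀ : CSphere n) {lam : ℝ} (hlam : 0 ≤ lam) :
    HasSum (fun k => c k ^ 2 * powerWeight x₀ lam k)
      (∫ x, ‖egf c (scaledDot x₀ lam x)‖ ^ 2 ∂(surfaceMeasure n)) := by
  have h := hc.hasSum_inner hc x₀ hlam
  simp_rw [Complex.mul_conj'] at h
  rw [← Complex.hasSum_ofReal, ← integral_complex_ofReal]
  simpa only [Complex.ofReal_pow, pow_two, Complex.ofReal_mul] using h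

/-- By orthogonality the norms depend only on the sizes of the coefficients, hence are monotone in
them. -/
theorem integral_norm_egf_le (hc : ExpGrowth c) (he : ExpGrowth e) (x₀ : CSphere n) {lam : ℝ}
    (hlam : 0 ≤ lam) {C : ℝ} (h : ∀ k, c k ^ 2 ≤ C * e k ^ 2) :
    ∫ x, ‖egf c (scaledDot x₀ lam x)‖ ^ 2 ∂(surfaceMeasure n) ≤
      C * ∫ x, ‖egf e (scaledDot x₀ lam x)‖ ^ 2 ∂(surfaceMeasure n) := by
  refine hasSum_le (fun k => ?_) (hc.hasSum_norm_sq x₀ hlam)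
    ((he.hasSum_norm_sq x₀ hlam).mul_left C)
  rw [← mul_assoc]
  exact mul_le_mul_of_nonneg_right (h k) (powerWeight_nonneg _ _ _)

/-- Chebyshev's correlation inequality. With m the mean of X, the product (X^k - m^k)(X - m) is
nonnegative because both factors have the same sign; integrate it. -/
theorem integral_mul_integral_pow_le {X : CSphere n → ℝ} (hX : Continuous X) (hX0 : ∀ x, 0 ≤ X x)
    (k : ℕ) :
    (∫ x, X x ∂(surfaceMeasure n)) * (∫ x, X x ^ k ∂(surfaceMeasure n)) ≤
      ∫ x, X x ^ (k + 1) ∂(surfaceMeasure n) := by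
  obtain ⟨m, hm⟩ : ∃ m, m = ∫ x, X x ∂(surfaceMeasure n) := ⟨_, rfl⟩
  have hm0 : 0 ≤ m := hm ▸ integral_nonneg hX0
  have i1 : Integrable X (surfaceMeasure n) := integrable_of_continuous hX
  have i2 : Integrable (fun x => X x ^ k) (surfaceMeasure n) :=
    integrable_of_continuous (hX.pow k)
  have i3 : Integrable (fun x => X x ^ (k + 1)) (surfaceMeasure n) :=
    integrable_of_continuous (hX.pow (k + 1))
  have h : ∫ x, (m * X x ^ k + m ^ k * X x) ∂(surfaceMeasure n) ≤
      ∫ x, (X x ^ (k + 1) + m ^ k * m) ∂(surfaceMeasure n) := by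
    refine integral_mono ((i2.const_mul m).add (i1.const_mul _)) (i3.add (integrable_const _))
      fun x => ?_
    have e1 : X x ^ (k + 1) + m ^ k * m - (m * X x ^ k + m ^ k * X x) =
      (X x ^ k - m ^ k) * (X x - m) := by ring
    refine sub_nonneg.1 (le_of_le_of_eq ?_ e1.symm)
    have := hX0 x
    rcases le_total m (X x) with h | h
    · exact mul_nonneg (sub_nonneg.2 (by gcongr)) (sub_nonneg.2 h)
    · exact mul_nonneg_of_nonpos_of_nonpos (sub_nonpos.2 (by gcongr)) (sub_nonpos.2 h)
  rw [integral_add (i2.const_mul m) (i1.const_mul _), integral_add i3 (integrable_const _),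
    integral_const_mul, integral_const_mul, ← hm, integral_const, probReal_univ, one_smul] at h
  rw [← hm]
  linarith

/-- The correlation inequality for X = |λ x·x₀|², whose mean is λ²γ. The point is that one factor
1/(k+1) in the coefficients is worth a factor λ^{-1} in norm. -/
theorem exists_powerWeight_le (x₀ : CSphere n) :
    ∃ C : ℝ, 0 ≤ C ∧ ∀ lam > 0, ∀ k : ℕ,
      powerWeight x₀ lam k / ((k : ℝ) + 1) ^ 2 ≤ C * lam⁻¹ ^ 2 * powerWeight x₀ lam (k + 1) := by
  set γ := ∫ x, ‖dot (x : Cn n) x₀‖ ^ 2 ∂(surfaceMeasure n) with hγ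
  have hγ0 : 0 < γ := by
    have hcont : Continuous fun x : CSphere n => ‖dot (x : Cn n) x₀‖ ^ 2 :=
      (continuous_dot _).norm.pow 2
    refine hcont.integral_pos_of_hasCompactSupport_nonneg_nonzero
      (HasCompactSupport.of_compactSpace _) (fun x => by positivity) (x := x₀) ?_
    rw [dot_eq_inner]
    simp
  refine ⟨γ⁻¹, by positivity, fun lam hlam k => ?_⟩
  have h := integral_mul_integral_pow_le (X := fun x => ‖scaledDot x₀ lam x‖ ^ 2)
    ((continuous_scaledDot x₀ lam).norm.pow 2) (fun x => by positivity) k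
  simp_rw [← pow_mul] at h
  have e1 : ∫ x, ‖scaledDot x₀ lam x‖ ^ 2 ∂(surfaceMeasure n) = lam ^ 2 * γ := by
    rw [hγ, ← integral_const_mul]
    refine integral_congr_ae (Filter.Eventually.of_forall fun x => ?_)
    simp [scaledDot, mul_pow]
  rw [e1] at h
  rw [powerWeight, powerWeight, Nat.factorial_succ]
  push_cast
  have e2 : γ⁻¹ * lam⁻¹ ^ 2 * ((∫ x, ‖scaledDot x₀ lam x‖ ^ (2 * (k + 1)) ∂(surfaceMeasure n)) /
      (((k : ℝ) + 1) * (k.factorial : ℝ)) ^ 2) = (lam ^ 2 * γ)⁻¹ *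
      (∫ x, ‖scaledDot x₀ lam x‖ ^ (2 * (k + 1)) ∂(surfaceMeasure n)) /
      (((k : ℝ) + 1) * (k.factorial : ℝ)) ^ 2 := by
    rw [mul_inv, inv_pow]; ring
  rw [e2, div_div, ← mul_pow, mul_comm (k.factorial : ℝ)]
  gcongr
  rw [inv_mul_eq_div, le_div_iff₀ (by positivity), mul_comm]
  exact h

/-- The squared norm of the function `x ↦ egf c (lam (x · x₀))`. -/
def egfMass (c : ℕ → ℝ) (x₀ : CSphere n) (lam : ℝ) : ℝ :=
  ∫ x, ‖egf c (scaledDot x₀ lam x)‖ ^ 2 ∂(surfaceMeasure n)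

theorem SlowGrowth.one_le_egfMass (hc : SlowGrowth c) (x₀ : CSphere n) {lam : ℝ} (hlam : 0 ≤ lam) :
    1 ≤ egfMass c x₀ lam := by
  have h := le_hasSum (hc.expGrowth.hasSum_norm_sq x₀ hlam) 0
    fun k _ => mul_nonneg (sq_nonneg _) (powerWeight_nonneg _ _ _)
  rwa [hc.zero_eq, powerWeight_zero, one_pow, one_mul] at h

theorem SlowGrowth.integral_shift_le (hc : SlowGrowth c) (x₀ : CSphere n) {lam : ℝ}
    (hlam : 0 ≤ lam) (l : ℕ) :
    ∫ x, ‖egf (fun k => c (k + l)) (scaledDot x₀ lam x)‖ ^ 2 ∂(surfaceMeasure n) ≤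
      (2 ^ l) ^ 2 * egfMass c x₀ lam := by
  refine integral_norm_egf_le (hc.expGrowth.shift l) hc.expGrowth x₀ hlam fun k => ?_
  rw [← mul_pow]
  have := zero_le_one.trans (hc.pos (k + l))
  gcongr
  exact hc.shift_le l k

/-- The differences of the coefficients are at most 2^l c_{k+1}/(k+1). The gain 1/(k+1) is converted
into λ^{-1} by `exists_powerWeight_le`, which shifts the index by one, and the resulting sum lacks
only the term k = 0 of the mass. This is what allows differentiated families to be replaced by
undifferentiated ones up to O(ħ). -/
theorem SlowGrowth.exists_integral_shift_sub_le (hc : SlowGrowth c) (x₀ : CSphere n) (l : ℕ) :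
    ∃ C : ℝ, 0 ≤ C ∧ ∀ lam > 0,
      ∫ x, ‖egf (fun k => c (k + (l + 1))) (scaledDot x₀ lam x) -
        egf (fun k => c (k + l)) (scaledDot x₀ lam x)‖ ^ 2 ∂(surfaceMeasure n) ≤
      C * lam⁻¹ ^ 2 * egfMass c x₀ lam := by
  obtain ⟨C, hC, h⟩ := exists_powerWeight_le x₀
  refine ⟨(2 ^ l) ^ 2 * C, by positivity, fun lam hlam => ?_⟩
  have hg := (hc.expGrowth.shift (l + 1)).sub (hc.expGrowth.shift l)
  have h1 := hg.hasSum_norm_sq x₀ hlam.le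
  have h2 := hc.expGrowth.hasSum_norm_sq x₀ hlam.le
  have hnn : ∀ k, 0 ≤ c k ^ 2 * powerWeight x₀ lam k := fun k =>
    mul_nonneg (sq_nonneg _) (powerWeight_nonneg _ _ _)
  have h3 := (hasSum_nat_add_iff' (f := fun k => c k ^ 2 * powerWeight x₀ lam k) 1).2 h2
  simp_rw [egf_sub (hc.expGrowth.shift (l + 1)) (hc.expGrowth.shift l)] at h1
  have h4 := hasSum_le (fun k => ?_) h1 (h3.mul_left ((2 ^ l) ^ 2 * C * lam⁻¹ ^ 2))
  · refine h4.trans (mul_le_mul_of_nonneg_left ?_ (by positivity))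
    rw [egfMass, sub_le_self_iff]
    exact Finset.sum_nonneg fun k _ => hnn k
  · have hpos := fun k => zero_le_one.trans (hc.pos k)
    have hd : c (k + (l + 1)) - c (k + l) ≤ 2 ^ l * c (k + 1) / ((k : ℝ) + 1) := by
      refine (hc.succ_sub_le (k + l)).trans ?_
      have h5 : c (k + l) ≤ 2 ^ l * c (k + 1) := (hc.shift_le l k).trans
        (mul_le_mul_of_nonneg_left (hc.le_succ k) (by positivity))
      have := hpos (k + 1)
      gcongr
      linarith [(Nat.cast_nonneg l : (0 : ℝ) ≤ l)]
    have hd0 : 0 ≤ c (k + (l + 1)) - c (k + l) := sub_nonneg.2 (hc.le_succ _)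
    calc (c (k + (l + 1)) - c (k + l)) ^ 2 * powerWeight x₀ lam k
        ≤ (2 ^ l * c (k + 1) / ((k : ℝ) + 1)) ^ 2 * powerWeight x₀ lam k := by
          have := powerWeight_nonneg x₀ lam k
          gcongr
      _ = (2 ^ l * c (k + 1)) ^ 2 * (powerWeight x₀ lam k / ((k : ℝ) + 1) ^ 2) := by
          rw [div_pow]; ring
      _ ≤ (2 ^ l * c (k + 1)) ^ 2 * (C * lam⁻¹ ^ 2 * powerWeight x₀ lam (k + 1)) := by
          gcongr
          exact h lam hlam k
      _ = _ := by ring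

end Moments

/-! ### Gaussian moments on the sphere -/

section GaussianMoments

open MeasureTheory

variable {n : ℕ}

/-- The integral of the Gaussian `exp (-lam |x - x₀|²)` over the sphere. -/
def gaussMass (x₀ : CSphere n) (lam : ℝ) : ℝ :=
  ∫ x, Real.exp (-lam * ‖(x : Cn n) - x₀‖ ^ 2) ∂(surfaceMeasure n)

theorem exists_exp_neg_le {δ : ℝ} (hδ : 0 < δ) (d : ℕ) :
    ∃ C : ℝ, 0 ≤ C ∧ ∀ s : ℝ, 1 ≤ s → Real.exp (-s ^ 2 * δ ^ 2) ≤ C * s⁻¹ ^ d := by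
  refine ⟨d.factorial / (δ ^ 2) ^ d, by positivity, fun s hs => ?_⟩
  have hs0 : 0 < s := by linarith
  have h := Real.pow_div_factorial_le_exp (s ^ 2 * δ ^ 2) (by positivity) d
  have h1 : s ^ d ≤ (s ^ 2) ^ d := by
    gcongr
    nlinarith
  rw [neg_mul, Real.exp_neg, inv_pow, inv_eq_one_div, div_le_iff₀ (Real.exp_pos _)]
  calc (1 : ℝ) = d.factorial / (δ ^ 2) ^ d * (s ^ d)⁻¹ *
        (s ^ d * (δ ^ 2) ^ d / d.factorial) := by
        have : (0 : ℝ) < d.factorial := by positivity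
        field_simp
    _ ≤ d.factorial / (δ ^ 2) ^ d * (s ^ d)⁻¹ * ((s ^ 2) ^ d * (δ ^ 2) ^ d / d.factorial) := by
        gcongr
    _ = d.factorial / (δ ^ 2) ^ d * (s ^ d)⁻¹ * ((s ^ 2 * δ ^ 2) ^ d / d.factorial) := by
        rw [mul_pow (s ^ 2)]
    _ ≤ _ := by gcongr

theorem lintegral_gaussian_scale {d : ℕ} (b₀ : Vec d) {s : ℝ} (hs : 0 < s) (a : ℝ) :
    ∫⁻ b, ENNReal.ofReal (Real.exp (-s ^ 2 * (a * ‖b - b₀‖ ^ 2))) =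
      ENNReal.ofReal (s⁻¹ ^ d) * ∫⁻ b : Vec d, ENNReal.ofReal (Real.exp (-(a * ‖b‖ ^ 2))) := by
  set g : Vec d → ENNReal := fun b => ENNReal.ofReal (Real.exp (-(a * ‖b‖ ^ 2))) with hg
  have h1 : ∀ b, ENNReal.ofReal (Real.exp (-s ^ 2 * (a * ‖b - b₀‖ ^ 2))) = g (s • (b - b₀)) := by
    intro b
    rw [hg]
    simp only [norm_smul, Real.norm_of_nonneg hs.le]
    congr 2
    ring
  simp_rw [h1]
  rw [lintegral_sub_right_eq_self (fun b => g (s • b)) b₀]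
  have h2 : Measurable g := by fun_prop
  have h3 := lintegral_map (μ := (volume : Measure (Vec d))) h2 (measurable_const_smul s)
  rw [← h3, Measure.map_addHaar_smul _ hs.ne', lintegral_smul_measure, finrank_euclideanSpace_fin,
    abs_of_pos (by positivity), inv_pow]
  rfl

theorem lintegral_gaussian_ne_top {d : ℕ} {a : ℝ} (ha : 0 < a) :
    ∫⁻ b : Vec d, ENNReal.ofReal (Real.exp (-(a * ‖b‖ ^ 2))) ≠ ⊤ := by
  have h := GaussianFourier.integrable_cexp_neg_mul_sq_norm_add (V := Vec d) (b := (a : ℂ))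
    (by simpa using ha) 0 0
  have h2 : Integrable fun b : Vec d => Real.exp (-(a * ‖b‖ ^ 2)) := by
    refine h.norm.congr (Filter.Eventually.of_forall fun b => ?_)
    simp only [Complex.norm_exp]
    congr 1
    norm_cast
    simp
  exact (hasFiniteIntegral_iff_ofReal (Filter.Eventually.of_forall fun b =>
    (Real.exp_pos _).le)).1 h2.2 |>.ne

variable [NeZero n]

theorem isSmoothChart_chartAt (x₀ : CSphere n) : IsSmoothChart (chartAt (Model n) x₀) :=
  IsManifold.chart_mem_maximalAtlas x₀

/-- In a chart |x - x₀| is bounded below by a multiple of |b - b₀|, and scaling the Gaussian on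
ℝ^{2n-1} gives the power of `s`. Away from `x₀` the integrand is exponentially small. -/
theorem exists_gaussMass_le (x₀ : CSphere n) :
    ∃ C : ℝ, 0 ≤ C ∧ ∀ s : ℝ, 1 ≤ s → gaussMass x₀ (s ^ 2) ≤ C * s⁻¹ ^ (2 * n - 1) := by
  set κ := chartAt (Model n) x₀
  have hκ : IsSmoothChart κ := isSmoothChart_chartAt x₀
  have hx : x₀ ∈ κ.source := mem_chart_source _ x₀
  have hb : κ x₀ ∈ κ.target := κ.map_source hx
  obtain ⟨ρ, hρ, hρT⟩ := Metric.nhds_basis_closedBall.mem_iff.1 (κ.open_target.mem_nhds hb)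
  set K := Metric.closedBall (κ x₀) ρ
  have hK : IsCompact K := isCompact_closedBall _ _
  obtain ⟨C₁, hC₁, hnorm⟩ := exists_norm_sub_le_chartMap hκ hK hρT hb
  obtain ⟨C₂, hC₂, -⟩ := exists_lintegral_bounds hκ hK hρT
  rw [chartMap_apply hx] at hnorm
  have hSm : MeasurableSet (κ.symm '' K) :=
    (hK.image_of_continuousOn (κ.continuousOn_symm.mono hρT)).measurableSet
  obtain ⟨δ, hδ, hfar⟩ : ∃ δ > 0, ∀ x : CSphere n, x ∉ κ.symm '' K → δ ≤ ‖(x : Cn n) - x₀‖ := by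
    have : κ.symm '' K ∈ 𝓝 x₀ := by
      have h1 : κ.source ∩ κ ⁻¹' K ∈ 𝓝 x₀ :=
        Filter.inter_mem (κ.open_source.mem_nhds hx)
          ((κ.continuousAt hx).preimage_mem_nhds (Metric.closedBall_mem_nhds _ hρ))
      refine Filter.mem_of_superset h1 fun x hx => ⟨κ x, hx.2, κ.left_inv hx.1⟩
    obtain ⟨δ, hδ, hball⟩ := Metric.mem_nhds_iff.1 this
    refine ⟨δ, hδ, fun x hxK => ?_⟩
    by_contra! hlt
    refine hxK (hball ?_)
    rwa [Metric.mem_ball, Subtype.dist_eq, dist_eq_norm]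
  obtain ⟨C₃, hC₃, hexp⟩ := exists_exp_neg_le hδ (2 * n - 1)
  set G := ∫⁻ b : Model n, ENNReal.ofReal (Real.exp (-((C₁ ^ 2)⁻¹ * ‖b‖ ^ 2)))
  have hG : G ≠ ⊤ := lintegral_gaussian_ne_top (by positivity)
  refine ⟨C₂ * G.toReal + C₃, by positivity, fun s hs => ?_⟩
  have hs0 : 0 < s := by linarith
  have hint : Integrable (fun x : CSphere n => Real.exp (-s ^ 2 * ‖(x : Cn n) - x₀‖ ^ 2))
    (surfaceMeasure n) := integrable_of_continuous (by fun_prop)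
  rw [← ENNReal.ofReal_le_ofReal_iff (by positivity), gaussMass,
    ofReal_integral_eq_lintegral_ofReal hint (Filter.Eventually.of_forall fun x => by positivity),
    ← lintegral_add_compl _ hSm, add_mul, ENNReal.ofReal_add (by positivity) (by positivity)]
  refine add_le_add ?_ ?_
  · refine (hC₂ _).trans ?_
    rw [mul_assoc, ENNReal.ofReal_mul (by positivity), ENNReal.ofReal_coe_nnreal, mul_comm G.toReal,
      ENNReal.ofReal_mul (by positivity), ENNReal.ofReal_toReal hG,
      ← lintegral_gaussian_scale (κ x₀) hs0]
    refine mul_le_mul_right ?_ _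
    refine (setLIntegral_mono' hK.measurableSet fun b hb => ?_).trans (setLIntegral_le_lintegral K _)
    refine ENNReal.ofReal_le_ofReal (Real.exp_le_exp.2 ?_)
    rw [neg_mul, neg_mul, neg_le_neg_iff]
    gcongr
    have h2 := hnorm b hb
    rw [inv_mul_le_iff₀ (by positivity), ← mul_pow]
    gcongr
    exact h2
  · calc ∫⁻ x in (κ.symm '' K)ᶜ, ENNReal.ofReal (Real.exp (-s ^ 2 * ‖(x : Cn n) - x₀‖ ^ 2))
          ∂(surfaceMeasure n)
        ≤ ∫⁻ x in (κ.symm '' K)ᶜ, ENNReal.ofReal (C₃ * s⁻¹ ^ (2 * n - 1)) ∂(surfaceMeasure n) := by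
          refine setLIntegral_mono' hSm.compl fun x hx => ?_
          refine ENNReal.ofReal_le_ofReal (le_trans (Real.exp_le_exp.2 ?_) (hexp s hs))
          rw [neg_mul, neg_mul, neg_le_neg_iff]
          gcongr
          exact hfar x hx
      _ ≤ _ := by
          rw [setLIntegral_const]
          exact mul_le_of_le_one_right' prob_le_one

theorem exists_le_gaussMass (x₀ : CSphere n) :
    ∃ c : ℝ, 0 < c ∧ ∀ s : ℝ, 1 ≤ s → c * s⁻¹ ^ (2 * n - 1) ≤ gaussMass x₀ (s ^ 2) := by
  set κ := chartAt (Model n) x₀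
  have hκ : IsSmoothChart κ := isSmoothChart_chartAt x₀
  have hx : x₀ ∈ κ.source := mem_chart_source _ x₀
  have hb : κ x₀ ∈ κ.target := κ.map_source hx
  obtain ⟨L, t, ht, hL⟩ := (((contDiffOn_chartMap hκ).contDiffAt
    (κ.open_target.mem_nhds hb)).of_le (by simp)).exists_lipschitzOnWith
  obtain ⟨ρ, hρ, hρT⟩ := Metric.nhds_basis_closedBall.mem_iff.1
    (Filter.inter_mem ht (κ.open_target.mem_nhds hb))
  set K := Metric.closedBall (κ x₀) ρ
  have hK : IsCompact K := isCompact_closedBall _ _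
  obtain ⟨C, hC⟩ := exists_measure_bounds hκ hK (hρT.trans Set.inter_subset_right)
  -- With this radius the chart map sends the ball of radius r/s into distance 1/s of `x₀`, where
  -- the Gaussian is at least e^{-1}.
  set r := min ρ ((L : ℝ) + 1)⁻¹ with hr
  have hr0 : 0 < r := lt_min hρ (by positivity)
  set ϖ := (volume : Measure (Model n)).real (Metric.closedBall 0 1)
  have hϖ : 0 < ϖ := by
    refine ENNReal.toReal_pos (Metric.measure_closedBall_pos _ _ one_pos).ne' ?_
    exact (isCompact_closedBall _ _).measure_ne_top
  refine ⟨Real.exp (-1) * ((C : ℝ) + 1)⁻¹ * (r ^ (2 * n - 1) * ϖ), by positivity, fun s hs => ?_⟩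
  have hs0 : 0 < s := by linarith
  set B := Metric.closedBall (κ x₀) (r / s) with hB
  have hBK : B ⊆ K := Metric.closedBall_subset_closedBall
    ((div_le_self hr0.le hs).trans (min_le_left _ _))
  have hBm : MeasurableSet B := Metric.isClosed_closedBall.measurableSet
  have hSm : MeasurableSet (κ.symm '' B) := ((isCompact_closedBall _ _).image_of_continuousOn
    (κ.continuousOn_symm.mono (hBK.trans (hρT.trans Set.inter_subset_right)))).measurableSet
  have h1 := (hC B hBK hBm).1
  rw [hB, Measure.addHaar_closedBall' _ _ (by positivity), finrank_euclideanSpace_fin, ← hB] at h1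
  have h2 := ENNReal.toReal_mono (by finiteness) h1
  rw [ENNReal.toReal_mul, ENNReal.toReal_mul, ENNReal.toReal_ofReal (by positivity),
    ENNReal.coe_toReal] at h2
  have h3 : (r / s) ^ (2 * n - 1) * ϖ ≤ ((C : ℝ) + 1) * (surfaceMeasure n).real (κ.symm '' B) := by
    refine h2.trans ?_
    change (C : ℝ) * (surfaceMeasure n).real (κ.symm '' B) ≤ _
    gcongr
    linarith
  have hint : Integrable (fun x : CSphere n => Real.exp (-s ^ 2 * ‖(x : Cn n) - x₀‖ ^ 2))
    (surfaceMeasure n) := integrable_of_continuous (by fun_prop)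
  have h4 : Real.exp (-1) * (surfaceMeasure n).real (κ.symm '' B) ≤ gaussMass x₀ (s ^ 2) := by
    calc Real.exp (-1) * (surfaceMeasure n).real (κ.symm '' B)
        = ∫ x in κ.symm '' B, Real.exp (-1) ∂(surfaceMeasure n) := by
          rw [setIntegral_const, smul_eq_mul, mul_comm]
      _ ≤ ∫ x in κ.symm '' B, Real.exp (-s ^ 2 * ‖(x : Cn n) - x₀‖ ^ 2) ∂(surfaceMeasure n) := by
          refine setIntegral_mono_on (integrable_const _).integrableOn hint.integrableOn hSm ?_
          rintro _ ⟨b, hb', rfl⟩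
          refine Real.exp_le_exp.2 ?_
          have h5 := hL.dist_le_mul b (hρT (hBK hb')).1 (κ x₀) (mem_of_mem_nhds ht)
          rw [dist_eq_norm, chartMap_apply hx] at h5
          have h6 : ‖((κ.symm b : CSphere n) : Cn n) - x₀‖ ≤ s⁻¹ := by
            refine h5.trans ?_
            calc (L : ℝ) * dist b (κ x₀) ≤ (L + 1) * (((L : ℝ) + 1)⁻¹ / s) := by
                  gcongr
                  · linarith
                  · exact (Metric.mem_closedBall.1 hb').trans
                      (by gcongr; exact min_le_right _ _)
              _ = s⁻¹ := by field_simp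
          rw [neg_mul, neg_le_neg_iff]
          calc s ^ 2 * ‖((κ.symm b : CSphere n) : Cn n) - x₀‖ ^ 2 ≤ s ^ 2 * s⁻¹ ^ 2 := by gcongr
            _ = 1 := by field_simp
      _ ≤ _ := setIntegral_le_integral hint (Filter.Eventually.of_forall fun x => by positivity)
  refine le_trans ?_ h4
  rw [mul_assoc, mul_assoc]
  gcongr
  rw [inv_mul_le_iff₀ (by positivity)]
  refine le_trans (le_of_eq ?_) h3
  rw [div_pow, inv_pow]
  ring

/-- Half of the exponent absorbs the power: (λr²)^j e^{-λr²/2} is bounded. What remains is a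
Gaussian with parameter λ/2. -/
theorem exists_integral_pow_mul_gaussian_le (x₀ : CSphere n) (j : ℕ) :
    ∃ C : ℝ, 0 ≤ C ∧ ∀ lam : ℝ, 2 ≤ lam →
      ∫ x, ‖(x : Cn n) - x₀‖ ^ (2 * j) * Real.exp (-lam * ‖(x : Cn n) - x₀‖ ^ 2)
        ∂(surfaceMeasure n) ≤ C * lam⁻¹ ^ j * gaussMass x₀ lam := by
  obtain ⟨C, hC, hup⟩ := exists_gaussMass_le x₀
  obtain ⟨c, hc, hlow⟩ := exists_le_gaussMass x₀
  refine ⟨j.factorial * 2 ^ j * (C / c * 2 ^ (2 * n - 1)), by positivity, fun lam hlam => ?_⟩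
  have hl0 : 0 < lam := by linarith
  -- The matching upper and lower bounds show that halving the parameter changes the mass by a
  -- bounded factor only.
  have hdouble : gaussMass x₀ (lam / 2) ≤ C / c * 2 ^ (2 * n - 1) * gaussMass x₀ lam := by
    have h1 : 1 ≤ √(lam / 2) := Real.one_le_sqrt.2 (by linarith)
    have h2 : 1 ≤ √lam := Real.one_le_sqrt.2 (by linarith)
    have h3 := hup _ h1
    have h4 := hlow _ h2
    rw [Real.sq_sqrt (by linarith)] at h3 h4
    have h5 : (√(lam / 2))⁻¹ ≤ 2 * (√lam)⁻¹ := by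
      have hs0 : 0 < √lam := by positivity
      rw [Real.sqrt_div hl0.le, inv_div, div_eq_mul_inv]
      gcongr
      rw [Real.sqrt_le_left (by norm_num)]
      norm_num
    calc gaussMass x₀ (lam / 2) ≤ C * (2 * (√lam)⁻¹) ^ (2 * n - 1) :=
          h3.trans (by gcongr)
      _ = C / c * 2 ^ (2 * n - 1) * (c * (√lam)⁻¹ ^ (2 * n - 1)) := by
          rw [mul_pow]; field_simp
      _ ≤ _ := by gcongr
  have hpt : ∀ x : CSphere n,
      ‖(x : Cn n) - x₀‖ ^ (2 * j) * Real.exp (-lam * ‖(x : Cn n) - x₀‖ ^ 2) ≤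
      j.factorial * 2 ^ j * lam⁻¹ ^ j * Real.exp (-(lam / 2) * ‖(x : Cn n) - x₀‖ ^ 2) := fun x => by
    set r := ‖(x : Cn n) - x₀‖
    have h := Real.pow_div_factorial_le_exp (lam / 2 * r ^ 2) (by positivity) j
    rw [div_le_iff₀ (by positivity)] at h
    have e1 : Real.exp (-(lam / 2) * r ^ 2) =
        Real.exp (lam / 2 * r ^ 2) * Real.exp (-lam * r ^ 2) := by
      rw [← Real.exp_add]; congr 1; ring
    have e2 : r ^ (2 * j) = 2 ^ j * lam⁻¹ ^ j * (lam / 2 * r ^ 2) ^ j := by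
      rw [pow_mul, ← mul_pow, ← mul_pow]; congr 1; field_simp
    rw [e1, e2]
    calc 2 ^ j * lam⁻¹ ^ j * (lam / 2 * r ^ 2) ^ j * Real.exp (-lam * r ^ 2)
        ≤ 2 ^ j * lam⁻¹ ^ j * (Real.exp (lam / 2 * r ^ 2) * j.factorial) *
          Real.exp (-lam * r ^ 2) := by gcongr
      _ = _ := by ring
  calc _ ≤ ∫ x : CSphere n, j.factorial * 2 ^ j * lam⁻¹ ^ j *
        Real.exp (-(lam / 2) * ‖(x : Cn n) - x₀‖ ^ 2) ∂(surfaceMeasure n) :=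
        integral_mono (integrable_of_continuous (by fun_prop))
          (integrable_of_continuous (by fun_prop)) hpt
    _ = j.factorial * 2 ^ j * lam⁻¹ ^ j * gaussMass x₀ (lam / 2) := by
        rw [integral_const_mul]; rfl
    _ ≤ j.factorial * 2 ^ j * lam⁻¹ ^ j * (C / c * 2 ^ (2 * n - 1) * gaussMass x₀ lam) := by
        gcongr
    _ = _ := by ring

end GaussianMoments

/-! ### Concentration of the families `K_p` -/

section Concentration

open MeasureTheory

variable {n : ℕ}

theorem norm_exp_scaledDot_sq (x₀ : CSphere n) (lam : ℝ) (x : CSphere n) :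
    ‖Complex.exp (scaledDot x₀ lam x)‖ ^ 2 =
      Real.exp (2 * lam) * Real.exp (-lam * ‖(x : Cn n) - x₀‖ ^ 2) := by
  rw [Complex.norm_exp, re_scaledDot, ← Real.exp_nat_mul, ← Real.exp_add]
  congr 1
  push_cast
  ring

/-- The error is exactly -(√u - √v)²/(2√v), and |√u - √v| = |u - v|/(√u + √v) ≤ |u - v|/√v. -/
theorem abs_sqrt_sub_linear_le {u v : ℝ} (hu : 0 ≤ u) (hv : 0 < v) :
    |√u - √v - (u - v) / (2 * √v)| ≤ (u - v) ^ 2 / (2 * √v ^ 3) := by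
  have hs : 0 < √v := Real.sqrt_pos.2 hv
  have ht : 0 ≤ √u := Real.sqrt_nonneg u
  have e : u - v = (√u - √v) * (√u + √v) := by
    have h1 := Real.sq_sqrt hu
    have h2 := Real.sq_sqrt hv.le
    linear_combination -h1 + h2
  rw [e]
  have e2 : √u - √v - (√u - √v) * (√u + √v) / (2 * √v) = -((√u - √v) ^ 2 / (2 * √v)) := by
    field_simp
    ring
  rw [e2, abs_neg, abs_of_nonneg (by positivity), div_le_div_iff₀ (by positivity) (by positivity)]
  have h3 : √v ^ 2 ≤ (√u + √v) ^ 2 := by gcongr; linarith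
  have h4 : 0 ≤ (√u - √v) ^ 2 * (2 * √v) := by positivity
  nlinarith

variable [NeZero n] {c : ℕ → ℝ}

theorem exists_integral_pow_mul_exp_le (x₀ : CSphere n) (j : ℕ) :
    ∃ C : ℝ, 0 ≤ C ∧ ∀ lam : ℝ, 2 ≤ lam →
      ∫ x, ‖(x : Cn n) - x₀‖ ^ (2 * j) * ‖Complex.exp (scaledDot x₀ lam x)‖ ^ 2
        ∂(surfaceMeasure n) ≤
      C * lam⁻¹ ^ j * ∫ x, ‖Complex.exp (scaledDot x₀ lam x)‖ ^ 2 ∂(surfaceMeasure n) := by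
  obtain ⟨C, hC, h⟩ := exists_integral_pow_mul_gaussian_le x₀ j
  refine ⟨C, hC, fun lam hlam => ?_⟩
  simp_rw [norm_exp_scaledDot_sq, mul_left_comm _ (Real.exp (2 * lam)), integral_const_mul]
  rw [mul_left_comm]
  gcongr
  exact h lam hlam

theorem egf_sq_sub (lam : ℝ) (w : ℂ) :
    egf (fun k => ((k : ℝ) - lam) ^ 2) w = ((w - lam) ^ 2 + w) * Complex.exp w := by
  have h1 := expGrowth_const 1
  have hk := expGrowth_natCast
  have e1 : egf (fun k => (k : ℝ)) w = w * Complex.exp w := by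
    have := egf_natCast_mul h1 w
    simpa [egf_one] using this
  have e2 : egf (fun k => (k : ℝ) * k) w = (w ^ 2 + w) * Complex.exp w := by
    rw [egf_natCast_mul hk]
    have : (fun k : ℕ => ((k + 1 : ℕ) : ℝ)) = fun k : ℕ => (k : ℝ) + 1 := by
      funext k; push_cast; rfl
    rw [this, egf_add hk h1, e1, egf_one]
    ring
  have e3 : (fun k : ℕ => ((k : ℝ) - lam) ^ 2) =
      fun k : ℕ => ((k : ℝ) * k + (-2 * lam) * k) + lam ^ 2 * 1 := by
    funext k; ring
  rw [e3, egf_add ((hk.mul hk).add (hk.const_mul _)) (h1.const_mul _),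
    egf_add (hk.mul hk) (hk.const_mul _), egf_const_mul hk, egf_const_mul h1, e1, e2, egf_one]
  push_cast
  ring

/-- The square roots `√(1 + k / a)`. -/
def sqrtCoeff (a : ℝ) (k : ℕ) : ℝ := √(1 + k / a)

/-- The squares 1 + k/a of the coefficients are linear in k. By Parseval the mass is therefore
‖e^w‖² + a^{-1} Re⟨w e^w, e^w⟩ with w = λ x·x₀, and Re w = λ(1 - |x - x₀|²/2) is close to λ on
average. -/
theorem exists_le_egfMass_sqrtCoeff {a : ℝ} (ha : 0 < a) (hg : ExpGrowth (sqrtCoeff a))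
    (x₀ : CSphere n) :
    ∃ L : ℝ, 2 ≤ L ∧ ∀ lam : ℝ, L ≤ lam →
      (1 + lam / a) / 2 * ∫ x, ‖Complex.exp (scaledDot x₀ lam x)‖ ^ 2 ∂(surfaceMeasure n) ≤
        egfMass (sqrtCoeff a) x₀ lam := by
  obtain ⟨C, hC, h⟩ := exists_integral_pow_mul_exp_le x₀ 1
  -- For λ ≥ C the second moment is at most the mass itself, so it takes away no more than half of
  -- the leading term.
  refine ⟨max 2 C, le_max_left _ _, fun lam hlam => ?_⟩
  have h2 : 2 ≤ lam := (le_max_left _ _).trans hlam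
  have hl0 : 0 < lam := by linarith
  have hl := h lam h2
  set X := ∫ x, ‖Complex.exp (scaledDot x₀ lam x)‖ ^ 2 ∂(surfaceMeasure n) with hX
  have hX0 : 0 ≤ X := integral_nonneg fun _ => by positivity
  have hone := expGrowth_const 1
  have hw := continuous_scaledDot x₀ lam
  have s1 := hone.hasSum_norm_sq x₀ hl0.le
  have s2 := (expGrowth_natCast).hasSum_inner hone x₀ hl0.le
  have s3 := hg.hasSum_norm_sq x₀ hl0.le
  simp only [egf_one, one_pow, one_mul, ← hX] at s1
  have hI : ∫ x, egf (fun k => (k : ℝ)) (scaledDot x₀ lam x) *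
      conj (egf (fun _ => 1) (scaledDot x₀ lam x)) ∂(surfaceMeasure n) =
      ∫ x, scaledDot x₀ lam x * ((‖Complex.exp (scaledDot x₀ lam x)‖ ^ 2 : ℝ) : ℂ)
        ∂(surfaceMeasure n) := by
    refine integral_congr_ae (Filter.Eventually.of_forall fun x => ?_)
    have := egf_natCast_mul hone (scaledDot x₀ lam x)
    simp only [mul_one] at this
    simp only [this, egf_one, mul_assoc, Complex.mul_conj']
    push_cast
    rfl
  rw [hI] at s2
  have s4 := Complex.hasSum_re s2
  have hre : (∫ x, scaledDot x₀ lam x * ((‖Complex.exp (scaledDot x₀ lam x)‖ ^ 2 : ℝ) : ℂ)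
        ∂(surfaceMeasure n)).re = lam * X - lam / 2 *
        ∫ x, ‖(x : Cn n) - x₀‖ ^ (2 * 1) * ‖Complex.exp (scaledDot x₀ lam x)‖ ^ 2
        ∂(surfaceMeasure n) := by
    have hint := integrable_of_continuous (n := n) (φ := fun x => scaledDot x₀ lam x *
      ((‖Complex.exp (scaledDot x₀ lam x)‖ ^ 2 : ℝ) : ℂ)) (by fun_prop)
    have := integral_re hint
    simp only [RCLike.re_eq_complex_re] at this
    rw [← this, hX, ← integral_const_mul, ← integral_const_mul, ← integral_sub]
    · refine integral_congr_ae (Filter.Eventually.of_forall fun x => ?_)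
      simp only [Complex.re_mul_ofReal, re_scaledDot]
      ring
    · exact integrable_of_continuous (by fun_prop)
    · exact integrable_of_continuous (by fun_prop)
  rw [hre] at s4
  simp only [mul_one, Complex.ofReal_re] at s4
  have s5 := s1.add (s4.mul_left a⁻¹)
  have s6 := s3.unique (s5.congr_fun fun k => ?_)
  · rw [egfMass, s6]
    set Y := ∫ x, ‖(x : Cn n) - x₀‖ ^ 2 * ‖Complex.exp (scaledDot x₀ lam x)‖ ^ 2
        ∂(surfaceMeasure n)
    have hY : lam * Y ≤ lam * X := by
      have h3 : Y ≤ C * lam⁻¹ ^ 1 * X := hl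
      have h4 : C * lam⁻¹ ≤ 1 := by
        rw [← div_eq_mul_inv, div_le_one hl0]; exact (le_max_right _ _).trans hlam
      rw [pow_one] at h3
      gcongr
      exact h3.trans (mul_le_of_le_one_left hX0 h4)
    have e : X + a⁻¹ * (lam * X - lam / 2 * Y) - (1 + lam / a) / 2 * X =
        X / 2 + a⁻¹ / 2 * (lam * X - lam * Y) := by field_simp; ring
    have h5 : 0 ≤ a⁻¹ / 2 * (lam * X - lam * Y) :=
      mul_nonneg (by positivity) (sub_nonneg.2 hY)
    linarith
  · rw [sqrtCoeff, Real.sq_sqrt (by positivity)]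
    ring

/-- The coefficients are linearized at k = λ, where the terms of e^w concentrate. The linear part
turns into a multiplier of e^w of modulus at most 2√(1 + λ/a), to which the Gaussian moments apply;
the quadratic remainder is estimated in norm by Parseval, without the weight. -/
theorem exists_integral_pow_four_sqrtCoeff_le {a : ℝ} (ha : 0 < a) (hg : ExpGrowth (sqrtCoeff a))
    (x₀ : CSphere n) :
    ∃ C L : ℝ, 0 ≤ C ∧ 2 ≤ L ∧ ∀ lam : ℝ, L ≤ lam →
      ∫ x, ‖(x : Cn n) - x₀‖ ^ 4 * ‖egf (sqrtCoeff a) (scaledDot x₀ lam x)‖ ^ 2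
        ∂(surfaceMeasure n) ≤ C * lam⁻¹ ^ 2 * egfMass (sqrtCoeff a) x₀ lam := by
  obtain ⟨C, hC, h⟩ := exists_integral_pow_mul_exp_le x₀ 2
  obtain ⟨L, hL, hmass⟩ := exists_le_egfMass_sqrtCoeff ha hg x₀
  refine ⟨2 * (8 * C + 8 * (2 * C + 2)), L, by positivity, hL, fun lam hlam => ?_⟩
  have h2 : 2 ≤ lam := hL.trans hlam
  have hl0 : 0 < lam := by linarith
  have hl := h lam h2
  have hm := hmass lam hlam
  have hw := continuous_scaledDot x₀ lam
  obtain ⟨X, hX⟩ : ∃ X, X = ∫ x, ‖Complex.exp (scaledDot x₀ lam x)‖ ^ 2 ∂(surfaceMeasure n) :=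
    ⟨_, rfl⟩
  rw [← hX] at hl hm
  have hX0 : 0 ≤ X := hX ▸ integral_nonneg fun _ => by positivity
  set v := 1 + lam / a with hv
  have hv1 : 1 ≤ v := by rw [hv]; linarith [div_pos hl0 ha]
  have hv0 : 0 < v := by linarith
  set q := √v with hq
  have hq0 : 0 < q := Real.sqrt_pos.2 hv0
  have hqv : q ^ 2 = v := Real.sq_sqrt hv0.le
  -- Taylor's formula for √(1 + k/a) at k = λ, with q = √(1 + λ/a); the factors 1 are there to match
  -- the linearity rules of `egf`.
  set rem : ℕ → ℝ := fun k => sqrtCoeff a k - (q * 1 + (2 * a * q)⁻¹ * (k - lam * 1)) with hrem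
  have hk := expGrowth_natCast
  have hone := expGrowth_const 1
  have hlin : ExpGrowth fun k : ℕ => q * 1 + (2 * a * q)⁻¹ * ((k : ℝ) - lam * 1) :=
    (hone.const_mul q).add ((hk.sub (hone.const_mul lam)).const_mul _)
  have hremg : ExpGrowth rem := hg.sub hlin
  have hrem_le : ∀ k : ℕ, rem k ^ 2 ≤ (2 * a ^ 2 * q ^ 3)⁻¹ ^ 2 * ((((k : ℝ) - lam) ^ 2)) ^ 2 := by
    intro k
    rw [← mul_pow, ← sq_abs]
    gcongr
    have h3 := abs_sqrt_sub_linear_le (u := 1 + k / a) (by positivity) hv0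
    rw [← hq] at h3
    have e1 : 1 + (k : ℝ) / a - v = (k - lam) / a := by rw [hv]; ring
    rw [e1] at h3
    have e2 : rem k = √(1 + k / a) - q - ((k : ℝ) - lam) / a / (2 * q) := by
      simp only [hrem, sqrtCoeff]; field_simp; ring
    rw [e2]
    refine h3.trans (le_of_eq ?_)
    field_simp
  have hsq : ExpGrowth fun k : ℕ => ((k : ℝ) - lam) ^ 2 := by
    have := (hk.sub (expGrowth_const lam)).mul (hk.sub (expGrowth_const lam))
    simpa only [pow_two] using this
  have i1 := integral_norm_egf_le hremg hsq x₀ hl0.le hrem_le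
  have hr2 := fun x : CSphere n => norm_sub_sphere_le_two x x₀
  -- This generating function equals ((w - λ)² + w)e^w. As |w - λ| ≤ λ|x - x₀|, the square of its
  -- modulus is at most (2λ⁴|x - x₀|⁴ + 2λ²)|e^w|², and the fourth moment is O(λ^{-2}).
  have i2 : ∫ x, ‖egf (fun k : ℕ => ((k : ℝ) - lam) ^ 2) (scaledDot x₀ lam x)‖ ^ 2
      ∂(surfaceMeasure n) ≤ (2 * C + 2) * lam ^ 2 * X := by
    calc _ ≤ ∫ x, (2 * lam ^ 4 * (‖(x : Cn n) - x₀‖ ^ (2 * 2) *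
          ‖Complex.exp (scaledDot x₀ lam x)‖ ^ 2) +
          2 * lam ^ 2 * ‖Complex.exp (scaledDot x₀ lam x)‖ ^ 2) ∂(surfaceMeasure n) := by
          have hc := hsq.continuous_egf
          refine integral_mono (integrable_of_continuous (by fun_prop))
            (integrable_of_continuous (by fun_prop)) fun x => ?_
          simp only [egf_sq_sub, norm_mul, mul_pow]
          have h3 : ‖(scaledDot x₀ lam x - lam) ^ 2 + scaledDot x₀ lam x‖ ≤
              lam ^ 2 * ‖(x : Cn n) - x₀‖ ^ 2 + lam := by
            refine (norm_add_le _ _).trans (add_le_add ?_ (norm_scaledDot_le x₀ hl0.le x))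
            rw [norm_pow, ← mul_pow]
            gcongr
            exact norm_scaledDot_sub_le x₀ hl0.le x
          calc _ ≤ (lam ^ 2 * ‖(x : Cn n) - x₀‖ ^ 2 + lam) ^ 2 *
                ‖Complex.exp (scaledDot x₀ lam x)‖ ^ 2 := by gcongr
            _ ≤ (2 * lam ^ 4 * ‖(x : Cn n) - x₀‖ ^ (2 * 2) + 2 * lam ^ 2) *
                ‖Complex.exp (scaledDot x₀ lam x)‖ ^ 2 := by
                gcongr
                exact sub_nonneg.1 (le_of_le_of_eq
                  (sq_nonneg (lam ^ 2 * ‖(x : Cn n) - x₀‖ ^ 2 - lam)) (by ring))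
            _ = _ := by ring
      _ = 2 * lam ^ 4 * (∫ x, ‖(x : Cn n) - x₀‖ ^ (2 * 2) *
          ‖Complex.exp (scaledDot x₀ lam x)‖ ^ 2 ∂(surfaceMeasure n)) + 2 * lam ^ 2 * X := by
          rw [integral_add (integrable_of_continuous (by fun_prop))
            (integrable_of_continuous (by fun_prop)), integral_const_mul, integral_const_mul, hX]
      _ ≤ 2 * lam ^ 4 * (C * lam⁻¹ ^ 2 * X) + 2 * lam ^ 2 * X := by gcongr
      _ = _ := by field_simp
  have hdec : ∀ w : ℂ, egf (sqrtCoeff a) w =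
      (q + (2 * a * q)⁻¹ * (w - lam)) * Complex.exp w + egf rem w := fun w => by
    have e0 : sqrtCoeff a = fun k => (q * 1 + (2 * a * q)⁻¹ * (k - lam * 1)) + rem k := by
      funext k; rw [hrem]; ring
    have e1 : egf (fun k : ℕ => (k : ℝ)) w = w * Complex.exp w := by
      have := egf_natCast_mul hone w
      simpa [egf_one] using this
    rw [e0, egf_add hlin hremg, egf_add (hone.const_mul q)
      ((hk.sub (hone.const_mul lam)).const_mul _), egf_const_mul hone,
      egf_const_mul (hk.sub (hone.const_mul lam)), egf_sub hk (hone.const_mul lam),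
      egf_const_mul hone, e1, egf_one]
    push_cast
    ring
  have hpt : ∀ x : CSphere n, ‖(x : Cn n) - x₀‖ ^ 4 *
      ‖egf (sqrtCoeff a) (scaledDot x₀ lam x)‖ ^ 2 ≤
      8 * v * (‖(x : Cn n) - x₀‖ ^ (2 * 2) * ‖Complex.exp (scaledDot x₀ lam x)‖ ^ 2) +
      32 * ‖egf rem (scaledDot x₀ lam x)‖ ^ 2 := fun x => by
    set r := ‖(x : Cn n) - x₀‖ with hr
    have hr0 : 0 ≤ r := norm_nonneg _
    have hr2' : r ≤ 2 := hr2 x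
    have h3 : ‖(q : ℂ) + (2 * a * q)⁻¹ * (scaledDot x₀ lam x - lam)‖ ≤ 2 * q := by
      have h4 := norm_scaledDot_sub_le x₀ hl0.le x
      calc _ ≤ q + (2 * a * q)⁻¹ * (lam * 2) := by
            refine (norm_add_le _ _).trans (add_le_add ?_ ?_)
            · rw [Complex.norm_real, Real.norm_of_nonneg hq0.le]
            · rw [norm_mul, Complex.norm_real, Real.norm_of_nonneg (by positivity)]
              gcongr
              exact h4.trans (by gcongr)
        _ = q + (lam / a) / q := by field_simp
        _ ≤ q + q ^ 2 / q := by
            gcongr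
            rw [hqv, hv]; linarith
        _ = 2 * q := by field_simp; ring
    have h6 : ‖egf (sqrtCoeff a) (scaledDot x₀ lam x)‖ ≤
        2 * q * ‖Complex.exp (scaledDot x₀ lam x)‖ + ‖egf rem (scaledDot x₀ lam x)‖ := by
      rw [hdec]
      refine (norm_add_le _ _).trans ?_
      rw [norm_mul]
      gcongr
    set E := ‖Complex.exp (scaledDot x₀ lam x)‖
    set R := ‖egf rem (scaledDot x₀ lam x)‖
    have hr4 : r ^ 4 ≤ 16 := by
      calc r ^ 4 ≤ 2 ^ 4 := by gcongr
        _ = 16 := by norm_num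
    calc r ^ 4 * ‖egf (sqrtCoeff a) (scaledDot x₀ lam x)‖ ^ 2
        ≤ r ^ 4 * (2 * q * E + R) ^ 2 := by gcongr
      _ ≤ r ^ 4 * (2 * (2 * q * E) ^ 2 + 2 * R ^ 2) := by
          gcongr
          nlinarith [sq_nonneg (2 * q * E - R)]
      _ = 8 * q ^ 2 * (r ^ (2 * 2) * E ^ 2) + 2 * r ^ 4 * R ^ 2 := by ring
      _ ≤ _ := by
          rw [hqv]
          have : 2 * r ^ 4 ≤ 32 := by linarith
          gcongr
  have hcF := hg.continuous_egf
  have hcR := hremg.continuous_egf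
  calc _ ≤ ∫ x, (8 * v * (‖(x : Cn n) - x₀‖ ^ (2 * 2) *
        ‖Complex.exp (scaledDot x₀ lam x)‖ ^ 2) +
        32 * ‖egf rem (scaledDot x₀ lam x)‖ ^ 2) ∂(surfaceMeasure n) :=
        integral_mono (integrable_of_continuous (by fun_prop))
          (integrable_of_continuous (by fun_prop)) hpt
    _ = 8 * v * (∫ x, ‖(x : Cn n) - x₀‖ ^ (2 * 2) *
        ‖Complex.exp (scaledDot x₀ lam x)‖ ^ 2 ∂(surfaceMeasure n)) +
        32 * ∫ x, ‖egf rem (scaledDot x₀ lam x)‖ ^ 2 ∂(surfaceMeasure n) := by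
        rw [integral_add (integrable_of_continuous (by fun_prop))
            (integrable_of_continuous (by fun_prop)), integral_const_mul, integral_const_mul]
    _ ≤ 8 * v * (C * lam⁻¹ ^ 2 * X) +
        32 * ((2 * a ^ 2 * q ^ 3)⁻¹ ^ 2 * ((2 * C + 2) * lam ^ 2 * X)) := by
        gcongr
        exact i1.trans (by gcongr)
    -- Both terms are written relative to v X, which is at most twice the mass; since a v = a + λ ≥
    -- λ, each of them is O(λ^{-2}).
    _ = 8 * C * lam⁻¹ ^ 2 * (v * X) + 8 * (2 * C + 2) * ((a * v)⁻¹ ^ 4 * lam ^ 2) * (v * X) := by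
        have e1 : (2 * a ^ 2 * q ^ 3)⁻¹ ^ 2 = (4 * a ^ 4 * v ^ 3)⁻¹ := by
          rw [← hqv]; field_simp; ring
        rw [e1]
        field_simp
        ring
    _ ≤ 8 * C * lam⁻¹ ^ 2 * (v * X) + 8 * (2 * C + 2) * (lam⁻¹ ^ 4 * lam ^ 2) * (v * X) := by
        have : lam ≤ a * v := by rw [hv]; field_simp; linarith
        gcongr
    _ = 2 * (8 * C + 8 * (2 * C + 2)) * lam⁻¹ ^ 2 * (v / 2 * X) := by field_simp
    _ ≤ _ := by gcongr

theorem exists_integral_pow_four_egf_le (hn : 2 ≤ n) {p : ℝ} (hp : p = 0 ∨ p = -1)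
    (x₀ : CSphere n) :
    ∃ C L : ℝ, 0 ≤ C ∧ 2 ≤ L ∧ ∀ lam : ℝ, L ≤ lam →
      ∫ x, ‖(x : Cn n) - x₀‖ ^ 4 * ‖egf (familyCoeff n p) (scaledDot x₀ lam x)‖ ^ 2
        ∂(surfaceMeasure n) ≤ C * lam⁻¹ ^ 2 * egfMass (familyCoeff n p) x₀ lam := by
  rcases hp with rfl | rfl
  · obtain ⟨C, hC, h⟩ := exists_integral_pow_mul_exp_le x₀ 2
    have e : familyCoeff n 0 = fun _ => 1 := funext fun k => familyCoeff_zero hn k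
    refine ⟨C, 2, hC, le_rfl, fun lam hlam => ?_⟩
    simpa [e, egfMass, egf_one] using h lam hlam
  · have ha : (0 : ℝ) < (n : ℝ) - 1 := by
      have : (2 : ℝ) ≤ n := by exact_mod_cast hn
      linarith
    have e : familyCoeff n (-1) = sqrtCoeff ((n : ℝ) - 1) :=
      funext fun k => familyCoeff_neg_one hn k
    have hg := expGrowth_familyCoeff n (-1)
    rw [e] at hg ⊢
    exact exists_integral_pow_four_sqrtCoeff_le ha hg x₀

end Concentration

/-! ### Moments of the shifted families and averages of functions vanishing at the center -/

section ConcentrationConsequences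

open MeasureTheory

variable {n : ℕ}

/-- Coefficient sequences whose generating functions, restricted to the sphere, concentrate at
`x₀`. -/
structure Concentrates [NeZero n] (c : ℕ → ℝ) (x₀ : CSphere n) : Prop extends SlowGrowth c where
  moment : ∃ C L : ℝ, 0 ≤ C ∧ 2 ≤ L ∧ ∀ lam : ℝ, L ≤ lam →
      ∫ x, ‖(x : Cn n) - x₀‖ ^ 4 * ‖egf c (scaledDot x₀ lam x)‖ ^ 2
        ∂(surfaceMeasure n) ≤ C * lam⁻¹ ^ 2 * egfMass c x₀ lam

theorem concentrates_familyCoeff [NeZero n] (hn : 2 ≤ n) {p : ℝ} (hp : p = 0 ∨ p = -1)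
    (x₀ : CSphere n) : Concentrates (familyCoeff n p) x₀ where
  toSlowGrowth := slowGrowth_familyCoeff hn hp
  moment := exists_integral_pow_four_egf_le hn hp x₀

/-- The generating function of the sequence shifted by `l`. -/
def egfShift (c : ℕ → ℝ) (l : ℕ) (w : ℂ) : ℂ := egf (fun k => c (k + l)) w

/-- The derivative is Lipschitz near `b₀`; apply the mean value inequality on the ball of radius |b
- b₀|. -/
theorem exists_norm_taylor_le {E V : Type*} [NormedAddCommGroup E] [NormedSpace ℝ E]
    [NormedAddCommGroup V] [NormedSpace ℝ V] {G : E → V} {b₀ : E} (hG : ContDiffAt ℝ 2 G b₀) :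
    ∃ C : ℝ, 0 ≤ C ∧ ∀ᶠ b in 𝓝 b₀, ‖G b - G b₀ - fderiv ℝ G b₀ (b - b₀)‖ ≤ C * ‖b - b₀‖ ^ 2 := by
  obtain ⟨L, t, ht, hL⟩ := (hG.fderiv_right (m := 1) (by norm_num)).exists_lipschitzOnWith
  have hd : ∀ᶠ b in 𝓝 b₀, DifferentiableAt ℝ G b := by
    filter_upwards [hG.eventually (by simp)] with b hb
    exact hb.differentiableAt (by simp)
  obtain ⟨ρ, hρ, hball⟩ := Metric.eventually_nhds_iff_ball.1 (hd.and ht)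
  refine ⟨L, L.2, Metric.eventually_nhds_iff_ball.2 ⟨ρ, hρ, fun b hb => ?_⟩⟩
  have hsub : Metric.closedBall b₀ ‖b - b₀‖ ⊆ Metric.ball b₀ ρ := fun y hy => by
    rw [mem_ball_iff_norm] at hb ⊢
    exact (mem_closedBall_iff_norm.1 hy).trans_lt hb
  have := (convex_closedBall b₀ ‖b - b₀‖).norm_image_sub_le_of_norm_fderiv_le' (𝕜 := ℝ)
    (f := G) (φ := fderiv ℝ G b₀) (C := L * ‖b - b₀‖) (x := b₀) (y := b)
    (fun y hy => (hball y (hsub hy)).1) (fun y hy => ?_)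
    (Metric.mem_closedBall_self (norm_nonneg _)) (by simp [dist_eq_norm])
  · rw [pow_two, ← mul_assoc]
    exact this
  · have h1 := hL.dist_le_mul y (hball y (hsub hy)).2 b₀ (mem_of_mem_nhds ht)
    rw [dist_eq_norm, dist_eq_norm] at h1
    refine h1.trans ?_
    gcongr
    exact mem_closedBall_iff_norm.1 hy

variable {c : ℕ → ℝ} {x₀ : CSphere n}

theorem egfShift_zero (c : ℕ → ℝ) : egfShift c 0 = egf c := rfl

theorem SlowGrowth.continuous_egfShift (hc : SlowGrowth c) (l : ℕ) : Continuous (egfShift c l) :=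
  (hc.expGrowth.shift l).continuous_egf

theorem norm_egf_conj (c : ℕ → ℝ) (w : ℂ) : ‖egf c (conj w)‖ = ‖egf c w‖ := by
  rw [egf_conj, Complex.norm_conj]

/-- The reflection of the sphere through the real line spanned by `x₀`. -/
def sphereReflection (x₀ : CSphere n) : Cn n ≃ₗᵢ[ℝ] Cn n := (ℝ ∙ (x₀ : Cn n)).reflection

theorem real_inner_eq_re_inner_complex (x y : Cn n) : ⟪x, y⟫_ℝ = (inner ℂ x y).re := by
  simp only [PiLp.inner_apply, Complex.re_sum]
  rfl

theorem sphereReflection_apply (x₀ : CSphere n) (x : Cn n) :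
    sphereReflection x₀ x = (2 * ⟪(x₀ : Cn n), x⟫_ℝ) • (x₀ : Cn n) - x := by
  rw [sphereReflection, Submodule.reflection_apply,
    Submodule.starProjection_unit_singleton ℝ (by simp : ‖(x₀ : Cn n)‖ = 1), mul_smul]
  simp [two_smul]

/-- The reflection fixes `x₀` and negates its real orthogonal complement, which contains i x₀; so it
preserves Re (x·x₀) and changes the sign of Im (x·x₀). As the coefficients are real, |K| is
invariant. -/
theorem scaledDot_sphereReflection (x₀ : CSphere n) (lam : ℝ) (x : CSphere n) :
    scaledDot x₀ lam (sphereMap (sphereReflection x₀) x) = conj (scaledDot x₀ lam x) := by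
  have h1 : ((sphereMap (sphereReflection x₀) x : CSphere n) : Cn n) =
    (2 * ⟪(x₀ : Cn n), (x : Cn n)⟫_ℝ) • (x₀ : Cn n) - x := sphereReflection_apply x₀ x
  have h2 : ⟪(x₀ : Cn n), (x : Cn n)⟫_ℝ = (inner ℂ (x₀ : Cn n) (x : Cn n)).re :=
    real_inner_eq_re_inner_complex _ _
  have h3 : inner ℂ (x₀ : Cn n) (x₀ : Cn n) = 1 := by
    rw [inner_self_eq_norm_sq_to_K]; simp
  rw [scaledDot, scaledDot, h1, h2, dot_eq_inner, dot_eq_inner, inner_sub_right,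
    ← Complex.coe_smul, inner_smul_right, h3, map_mul, Complex.conj_ofReal]
  congr 1
  generalize inner ℂ (x₀ : Cn n) (x : Cn n) = u
  apply Complex.ext
  · simp only [Complex.sub_re, Complex.mul_re, Complex.ofReal_re, Complex.one_re, Complex.conj_re,
      Complex.ofReal_im, Complex.one_im]
    ring
  · simp

variable [NeZero n]

/-- Induction on the shift: passing from `l` to `l + 1` adds a difference of squared norm O(λ^{-2}),
for which the weight is simply bounded by 16. -/
theorem Concentrates.exists_integral_pow_four_le (hc : Concentrates c x₀) (l : ℕ) :
    ∃ C : ℝ, 0 ≤ C ∧ ∀ lam : ℝ, 2 ≤ lam →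
      ∫ x, ‖(x : Cn n) - x₀‖ ^ 4 * ‖egfShift c l (scaledDot x₀ lam x)‖ ^ 2
        ∂(surfaceMeasure n) ≤ C * lam⁻¹ ^ 2 * egfMass c x₀ lam := by
  have hcont := hc.continuous_egfShift
  have hr4 : ∀ x : CSphere n, ‖(x : Cn n) - x₀‖ ^ 4 ≤ 16 := fun x => by
    calc ‖(x : Cn n) - x₀‖ ^ 4 ≤ 2 ^ 4 := by gcongr; exact norm_sub_sphere_le_two x x₀
      _ = 16 := by norm_num
  induction l with
  | zero =>
    obtain ⟨C, L, hC, hL, h⟩ := hc.moment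
    refine ⟨C + 16 * L ^ 2, by positivity, fun lam hlam => ?_⟩
    have hl0 : 0 < lam := by linarith
    have hm := zero_le_one.trans (hc.one_le_egfMass x₀ hl0.le)
    have hw := continuous_scaledDot x₀ lam
    have hc0 := hcont 0
    rw [egfShift_zero] at hc0 ⊢
    rcases le_total L lam with h1 | h1
    · refine (h lam h1).trans ?_
      gcongr
      linarith [sq_nonneg L]
    -- Below the threshold `L` the factor λ^{-2} is at least L^{-2}, so the trivial bound suffices.
    · calc _ ≤ ∫ x, 16 * ‖egf c (scaledDot x₀ lam x)‖ ^ 2 ∂(surfaceMeasure n) := by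
            refine integral_mono (integrable_of_continuous (by fun_prop))
              (integrable_of_continuous (by fun_prop)) fun x => ?_
            exact mul_le_mul_of_nonneg_right (hr4 x) (by positivity)
        _ = 16 * (lam * lam⁻¹) ^ 2 * egfMass c x₀ lam := by
            rw [integral_const_mul, mul_inv_cancel₀ hl0.ne', one_pow, mul_one, egfMass]
        _ ≤ 16 * (L * lam⁻¹) ^ 2 * egfMass c x₀ lam := by gcongr
        _ ≤ (C + 16 * L ^ 2) * lam⁻¹ ^ 2 * egfMass c x₀ lam := by
            rw [mul_pow, ← mul_assoc]
            gcongr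
            linarith
  | succ l ih =>
    obtain ⟨C, hC, h⟩ := ih
    obtain ⟨C', hC', h'⟩ := hc.exists_integral_shift_sub_le x₀ l
    refine ⟨2 * C + 32 * C', by positivity, fun lam hlam => ?_⟩
    have hl0 : 0 < lam := by linarith
    have hw := continuous_scaledDot x₀ lam
    have h0 := hcont l
    have h1 := hcont (l + 1)
    calc _ ≤ ∫ x, (2 * (‖(x : Cn n) - x₀‖ ^ 4 * ‖egfShift c l (scaledDot x₀ lam x)‖ ^ 2) +
          32 * ‖egfShift c (l + 1) (scaledDot x₀ lam x) - egfShift c l (scaledDot x₀ lam x)‖ ^ 2)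
          ∂(surfaceMeasure n) := by
          refine integral_mono (integrable_of_continuous (by fun_prop))
              (integrable_of_continuous (by fun_prop)) fun x => ?_
          set r := ‖(x : Cn n) - x₀‖
          set u := egfShift c l (scaledDot x₀ lam x)
          set v := egfShift c (l + 1) (scaledDot x₀ lam x)
          have h2 : ‖v‖ ≤ ‖u‖ + ‖v - u‖ := by
            calc ‖v‖ = ‖u + (v - u)‖ := by congr 1; ring
              _ ≤ _ := norm_add_le _ _
          calc r ^ 4 * ‖v‖ ^ 2 ≤ r ^ 4 * (‖u‖ + ‖v - u‖) ^ 2 := by gcongr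
            _ ≤ r ^ 4 * (2 * ‖u‖ ^ 2 + 2 * ‖v - u‖ ^ 2) := by
                gcongr
                nlinarith [sq_nonneg (‖u‖ - ‖v - u‖)]
            _ = 2 * (r ^ 4 * ‖u‖ ^ 2) + 2 * r ^ 4 * ‖v - u‖ ^ 2 := by ring
            _ ≤ _ := by
                have : 2 * r ^ 4 ≤ 32 := by linarith [hr4 x]
                gcongr
      _ = 2 * (∫ x, ‖(x : Cn n) - x₀‖ ^ 4 * ‖egfShift c l (scaledDot x₀ lam x)‖ ^ 2
            ∂(surfaceMeasure n)) + 32 * ∫ x, ‖egfShift c (l + 1) (scaledDot x₀ lam x) -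
              egfShift c l (scaledDot x₀ lam x)‖ ^ 2 ∂(surfaceMeasure n) := by
          rw [integral_add (integrable_of_continuous (by fun_prop))
            (integrable_of_continuous (by fun_prop)), integral_const_mul, integral_const_mul]
      _ ≤ 2 * (C * lam⁻¹ ^ 2 * egfMass c x₀ lam) + 32 * (C' * lam⁻¹ ^ 2 * egfMass c x₀ lam) := by
          gcongr
          · exact h lam hlam
          · exact h' lam hl0
      _ = _ := by ring

theorem Concentrates.exists_integral_pow_le (hc : Concentrates c x₀) (l : ℕ) {s : ℕ} (hs : s ≤ 2) :
    ∃ C : ℝ, 0 ≤ C ∧ ∀ lam : ℝ, 2 ≤ lam →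
      ∫ x, ‖(x : Cn n) - x₀‖ ^ (2 * s) * ‖egfShift c l (scaledDot x₀ lam x)‖ ^ 2
        ∂(surfaceMeasure n) ≤ C * lam⁻¹ ^ s * egfMass c x₀ lam := by
  obtain ⟨C, hC, h⟩ := hc.exists_integral_pow_four_le l
  have hcont := hc.continuous_egfShift l
  have h0 : ∀ lam : ℝ, 2 ≤ lam → ∫ x, ‖egfShift c l (scaledDot x₀ lam x)‖ ^ 2
        ∂(surfaceMeasure n) ≤ (2 ^ l) ^ 2 * egfMass c x₀ lam := fun lam hlam =>
    hc.integral_shift_le x₀ (by linarith) l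
  interval_cases s
  · exact ⟨(2 ^ l) ^ 2, by positivity, fun lam hlam => by simpa using h0 lam hlam⟩
  · refine ⟨(C + (2 ^ l) ^ 2) / 2, by positivity, fun lam hlam => ?_⟩
    have hl0 : 0 < lam := by linarith
    have hw := continuous_scaledDot x₀ lam
    calc _ ≤ ∫ x, (lam / 2 * (‖(x : Cn n) - x₀‖ ^ 4 * ‖egfShift c l (scaledDot x₀ lam x)‖ ^ 2) +
          lam⁻¹ / 2 * ‖egfShift c l (scaledDot x₀ lam x)‖ ^ 2) ∂(surfaceMeasure n) := by
          refine integral_mono (integrable_of_continuous (by fun_prop))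
            (integrable_of_continuous (by fun_prop)) fun x => ?_
          set r := ‖(x : Cn n) - x₀‖
          -- The second moment interpolates between the fourth and the zeroth, by completing the
          -- square with weights λ and λ^{-1}.
          have h1 : r ^ (2 * 1) ≤ lam / 2 * r ^ 4 + lam⁻¹ / 2 := by
            have e : lam / 2 * r ^ 4 + lam⁻¹ / 2 - r ^ (2 * 1) =
              lam⁻¹ / 2 * (lam * r ^ 2 - 1) ^ 2 := by field_simp; ring
            have : 0 ≤ lam⁻¹ / 2 * (lam * r ^ 2 - 1) ^ 2 := by positivity
            linarith
          refine (mul_le_mul_of_nonneg_right h1 (by positivity)).trans (le_of_eq ?_)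
          ring
      _ = lam / 2 * (∫ x, ‖(x : Cn n) - x₀‖ ^ 4 * ‖egfShift c l (scaledDot x₀ lam x)‖ ^ 2
            ∂(surfaceMeasure n)) +
          lam⁻¹ / 2 * ∫ x, ‖egfShift c l (scaledDot x₀ lam x)‖ ^ 2 ∂(surfaceMeasure n) := by
          rw [integral_add (integrable_of_continuous (by fun_prop))
            (integrable_of_continuous (by fun_prop)), integral_const_mul, integral_const_mul]
      _ ≤ lam / 2 * (C * lam⁻¹ ^ 2 * egfMass c x₀ lam) +
          lam⁻¹ / 2 * ((2 ^ l) ^ 2 * egfMass c x₀ lam) := by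
          gcongr
          · exact h lam hlam
          · exact h0 lam hlam
      _ = _ := by field_simp
  · exact ⟨C, hC, h⟩

/-- Functions that are linear at `x₀` up to second order have small averages. -/
theorem Concentrates.exists_integral_linear_le (hc : Concentrates c x₀) {φ : CSphere n → ℂ}
    (hφ : Continuous φ) (T : Cn n →L[ℝ] ℂ) {B : ℝ}
    (hB : ∀ x : CSphere n, ‖φ x - T (x - x₀)‖ ≤ B * ‖(x : Cn n) - x₀‖ ^ 2) :
    ∃ C : ℝ, 0 ≤ C ∧ ∀ lam : ℝ, 2 ≤ lam →
      ‖∫ x, φ x * ((‖egf c (scaledDot x₀ lam x)‖ ^ 2 : ℝ) : ℂ) ∂(surfaceMeasure n)‖ ≤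
        C * lam⁻¹ * egfMass c x₀ lam := by
  obtain ⟨C, hC, h⟩ := hc.exists_integral_pow_le 0 (s := 1) (by norm_num)
  refine ⟨(|B| + ‖T x₀‖ / 2) * C, by positivity, fun lam hlam => ?_⟩
  have hl0 : 0 < lam := by linarith
  have hw := continuous_scaledDot x₀ lam
  have hcont : Continuous (egf c) := hc.continuous_egfShift 0
  set g : CSphere n → ℝ := fun x => ‖egf c (scaledDot x₀ lam x)‖ ^ 2 with hg
  have hgc : Continuous g := by fun_prop
  have hg0 : ∀ x, 0 ≤ g x := fun x => by positivity
  set M := ∫ x, ‖(x : Cn n) - x₀‖ ^ 2 * g x ∂(surfaceMeasure n) with hM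
  have hMle : M ≤ C * lam⁻¹ * egfMass c x₀ lam := by simpa [egfShift_zero] using h lam hlam
  -- The reflection sends x - x₀ to -(x - x₀) - |x - x₀|² x₀ and preserves the weight `g`. Comparing
  -- the two integrals expresses the linear average through the second moment.
  have e1 : ∫ x : CSphere n, T (x - x₀) * (g x : ℂ) ∂(surfaceMeasure n) = -(T x₀ / 2) * M := by
    have h1 := integral_sphereMap (sphereReflection x₀)
      fun x : CSphere n => T (x - x₀) * (g x : ℂ)
    have h2 : ∀ x : CSphere n, T ((sphereMap (sphereReflection x₀) x : Cn n) - x₀) *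
        (g (sphereMap (sphereReflection x₀) x) : ℂ) =
        -(T x₀ * ((‖(x : Cn n) - x₀‖ ^ 2 * g x : ℝ) : ℂ)) - T (x - x₀) * (g x : ℂ) := fun x => by
      have h3 : g (sphereMap (sphereReflection x₀) x) = g x := by
        simp only [hg, scaledDot_sphereReflection, norm_egf_conj]
      have h4 : ((sphereMap (sphereReflection x₀) x : CSphere n) : Cn n) - x₀ =
          -((‖(x : Cn n) - x₀‖ ^ 2) • (x₀ : Cn n)) - (x - x₀) := by
        have h5 : ((sphereMap (sphereReflection x₀) x : CSphere n) : Cn n) =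
          (2 * ⟪(x₀ : Cn n), (x : Cn n)⟫_ℝ) • (x₀ : Cn n) - x := sphereReflection_apply x₀ x
        have h6 : ⟪(x₀ : Cn n), (x : Cn n)⟫_ℝ = 1 - ‖(x : Cn n) - x₀‖ ^ 2 / 2 := by
          rw [← re_dot, dot_eq_inner, real_inner_eq_re_inner_complex]
        rw [h5, h6]
        module
      rw [h3, h4, map_sub, map_neg, map_smul, Complex.real_smul]
      push_cast
      ring
    simp_rw [h2] at h1
    rw [integral_sub (integrable_of_continuous (by fun_prop))
      (integrable_of_continuous (by fun_prop)), integral_neg, integral_const_mul,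
      integral_complex_ofReal, ← hM] at h1
    linear_combination (-1 / 2 : ℂ) * h1
  have e2 : ∫ x, φ x * (g x : ℂ) ∂(surfaceMeasure n) =
      ∫ x : CSphere n, (φ x - T (x - x₀)) * (g x : ℂ) ∂(surfaceMeasure n) +
        -(T x₀ / 2) * M := by
    rw [← e1, ← integral_add (integrable_of_continuous (by fun_prop))
      (integrable_of_continuous (by fun_prop))]
    exact integral_congr_ae (Filter.Eventually.of_forall fun x => by ring)
  have hM0 : 0 ≤ M := integral_nonneg fun x => mul_nonneg (by positivity) (hg0 x)
  change ‖∫ x, φ x * (g x : ℂ) ∂(surfaceMeasure n)‖ ≤ _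
  rw [e2]
  have h7 : ‖∫ x : CSphere n, (φ x - T (x - x₀)) * (g x : ℂ) ∂(surfaceMeasure n)‖ ≤ |B| * M := by
    rw [hM, ← integral_const_mul]
    refine norm_integral_le_of_norm_le (integrable_of_continuous (by fun_prop))
      (Filter.Eventually.of_forall fun x => ?_)
    rw [norm_mul, Complex.norm_real, Real.norm_of_nonneg (hg0 x), ← mul_assoc]
    refine mul_le_mul_of_nonneg_right ((hB x).trans ?_) (hg0 x)
    gcongr
    exact le_abs_self B
  have h8 : ‖-(T x₀ / 2) * (M : ℂ)‖ = ‖T x₀‖ / 2 * M := by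
    rw [norm_mul, norm_neg, norm_div, Complex.norm_real, Real.norm_of_nonneg hM0]
    simp
  calc _ ≤ |B| * M + ‖T x₀‖ / 2 * M := (norm_add_le _ _).trans (by rw [h8]; gcongr)
    _ = (|B| + ‖T x₀‖ / 2) * M := by ring
    _ ≤ (|B| + ‖T x₀‖ / 2) * (C * lam⁻¹ * egfMass c x₀ lam) := by gcongr
    _ = _ := by ring

/-- A continuous function that vanishes at `x₀` and is smooth near `x₀` in a chart has small
averages. -/
theorem Concentrates.exists_integral_vanishing_le (hc : Concentrates c x₀) {φ : CSphere n → ℂ}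
    (hφ : Continuous φ) {κ : Chart n} (hκ : IsSmoothChart κ) (hx : x₀ ∈ κ.source)
    (hsm : ContDiffAt ℝ 2 (fun b => φ (κ.symm b)) (κ x₀)) (h0 : φ x₀ = 0) :
    ∃ C : ℝ, 0 ≤ C ∧ ∀ lam : ℝ, 2 ≤ lam →
      ‖∫ x, φ x * ((‖egf c (scaledDot x₀ lam x)‖ ^ 2 : ℝ) : ℂ) ∂(surfaceMeasure n)‖ ≤
        C * lam⁻¹ * egfMass c x₀ lam := by
  have hb := κ.map_source hx
  have hX : ContDiffAt ℝ 2 (chartMap κ) (κ x₀) :=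
    ((contDiffOn_chartMap hκ).contDiffAt (κ.open_target.mem_nhds hb)).of_le
      (WithTop.coe_le_coe.2 le_top)
  set D := fderiv ℝ (chartMap κ) (κ x₀)
  obtain ⟨P, hP⟩ := (D : Model n →ₗ[ℝ] Cn n).exists_leftInverse_of_injective
    (LinearMap.ker_eq_bot.2 (injective_fderiv_chartMap hκ hb))
  have hP' : ∀ v, P (D v) = v := fun v => LinearMap.congr_fun hP v
  -- A linear map of the ambient space whose pullback by the chart map has the same differential as
  -- φ at the center. Hence φ - T(x - x₀) vanishes to second order there.
  set T : Cn n →L[ℝ] ℂ := (fderiv ℝ (fun b => φ (κ.symm b)) (κ x₀)).comp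
    (LinearMap.toContinuousLinearMap P) with hT
  obtain ⟨C₁, hC₁, h1⟩ := exists_norm_taylor_le hsm
  obtain ⟨C₂, hC₂, h2⟩ := exists_norm_taylor_le hX
  obtain ⟨ρ, hρ, hball⟩ := Metric.nhds_basis_closedBall.mem_iff.1
    ((h1.and h2).and (κ.open_target.mem_nhds hb))
  obtain ⟨C₃, hC₃, h3⟩ := exists_norm_sub_le_chartMap hκ (isCompact_closedBall (κ x₀) ρ)
    (fun b hb => (hball hb).2) hb
  have hnear : ∀ b ∈ Metric.closedBall (κ x₀) ρ, ‖φ (κ.symm b) - T ((κ.symm b : Cn n) - x₀)‖ ≤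
      (C₁ + ‖T‖ * C₂) * C₃ ^ 2 * ‖(κ.symm b : Cn n) - x₀‖ ^ 2 := fun b hb' => by
    obtain ⟨⟨h4, h5⟩, -⟩ := hball hb'
    have h6 := h3 b hb'
    rw [chartMap_apply hx] at h5 h6
    rw [κ.left_inv hx, h0, sub_zero] at h4
    change ‖φ (κ.symm b) - T (chartMap κ b - x₀)‖ ≤ _ * ‖chartMap κ b - x₀‖ ^ 2
    have h7 : φ (κ.symm b) - T (chartMap κ b - x₀) =
        (φ (κ.symm b) - fderiv ℝ (fun b => φ (κ.symm b)) (κ x₀) (b - κ x₀)) -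
          T (chartMap κ b - x₀ - D (b - κ x₀)) := by
      have h8 : T (D (b - κ x₀)) = fderiv ℝ (fun b => φ (κ.symm b)) (κ x₀) (b - κ x₀) := by
        rw [hT]
        exact congrArg _ (hP' _)
      rw [map_sub T _ (D _), h8]
      ring
    rw [h7]
    calc _ ≤ C₁ * ‖b - κ x₀‖ ^ 2 + ‖T‖ * (C₂ * ‖b - κ x₀‖ ^ 2) :=
          (norm_sub_le _ _).trans (add_le_add h4 ((T.le_opNorm _).trans (by gcongr)))
      _ = (C₁ + ‖T‖ * C₂) * ‖b - κ x₀‖ ^ 2 := by ring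
      _ ≤ (C₁ + ‖T‖ * C₂) * (C₃ * ‖chartMap κ b - x₀‖) ^ 2 := by gcongr
      _ = _ := by ring
  obtain ⟨δ, hδ, hfar⟩ : ∃ δ > 0, ∀ x : CSphere n, x ∉ κ.symm '' Metric.closedBall (κ x₀) ρ →
      δ ≤ ‖(x : Cn n) - x₀‖ := by
    have : κ.symm '' Metric.closedBall (κ x₀) ρ ∈ 𝓝 x₀ := by
      have h1 : κ.source ∩ κ ⁻¹' Metric.closedBall (κ x₀) ρ ∈ 𝓝 x₀ :=
        Filter.inter_mem (κ.open_source.mem_nhds hx)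
          ((κ.continuousAt hx).preimage_mem_nhds (Metric.closedBall_mem_nhds _ hρ))
      refine Filter.mem_of_superset h1 fun x hx => ⟨κ x, hx.2, κ.left_inv hx.1⟩
    obtain ⟨δ, hδ, hball⟩ := Metric.mem_nhds_iff.1 this
    refine ⟨δ, hδ, fun x hxK => ?_⟩
    by_contra! hlt
    refine hxK (hball ?_)
    rwa [Metric.mem_ball, Subtype.dist_eq, dist_eq_norm]
  obtain ⟨M, hM⟩ := (isCompact_range (X := CSphere n) (f := fun x => ‖φ x - T (x - x₀)‖)
    (by fun_prop)).bddAbove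
  -- The second constant covers the points at distance at least δ, where boundedness is enough.
  refine hc.exists_integral_linear_le hφ T (B := max ((C₁ + ‖T‖ * C₂) * C₃ ^ 2) (M / δ ^ 2))
    fun x => ?_
  by_cases hxK : x ∈ κ.symm '' Metric.closedBall (κ x₀) ρ
  · obtain ⟨b, hb', rfl⟩ := hxK
    refine (hnear b hb').trans ?_
    gcongr
    exact le_max_left _ _
  · have h8 : ‖φ x - T (x - x₀)‖ ≤ M := hM ⟨x, rfl⟩
    have h9 := hfar x hxK
    have hM0 : 0 ≤ M := (norm_nonneg _).trans h8
    calc _ ≤ M := h8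
      _ = M / δ ^ 2 * δ ^ 2 := by field_simp
      _ ≤ _ := by
          gcongr
          exact le_max_right _ _

end ConcentrationConsequences

/-! ### Localized families in a chart -/

section LocalizedFamilies

open MeasureTheory

variable {n : ℕ} {κ : Chart n} {x₀ : CSphere n} {c : ℕ → ℝ}

/-- Smooth functions with compact support in the range of a chart. -/
structure IsCutoff (κ : Chart n) (h : Model n → ℂ) : Prop where
  contDiff : ContDiff ℝ ∞ h
  hasCompactSupport : HasCompactSupport h
  subset : tsupport h ⊆ κ.target

theorem IsCutoff.isTest {h : Model n → ℂ} (hh : IsCutoff κ h) : IsTest h :=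
  ⟨hh.contDiff, hh.hasCompactSupport⟩

theorem IsCutoff.mul {h g : Model n → ℂ} (hh : IsCutoff κ h) (hg : ContDiffOn ℝ ∞ g κ.target) :
    IsCutoff κ (fun b => h b * g b) where
  contDiff := by
    refine contDiff_iff_contDiffAt.2 fun b => ?_
    by_cases hb : b ∈ tsupport h
    · exact hh.contDiff.contDiffAt.mul (hg.contDiffAt (κ.open_target.mem_nhds (hh.subset hb)))
    · have h0 : (fun b => h b * g b) =ᶠ[𝓝 b] fun _ => 0 := by
        filter_upwards [notMem_tsupport_iff_eventuallyEq.1 hb] with y hy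
        rw [hy]; simp
      exact contDiffAt_const.congr_of_eventuallyEq h0
  hasCompactSupport := hh.hasCompactSupport.mul_right
  subset := (closure_mono (Function.support_mul_subset_left h g)).trans hh.subset

theorem IsCutoff.fderiv_apply {h : Model n → ℂ} (hh : IsCutoff κ h) (v : Model n) :
    IsCutoff κ (fun b => fderiv ℝ h b v) where
  contDiff := (hh.isTest.fderiv_apply v).1
  hasCompactSupport := (hh.isTest.fderiv_apply v).2
  subset := by
    refine (closure_minimal ?_ (isClosed_tsupport h)).trans hh.subset
    intro b hb
    by_contra hb'
    refine hb ?_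
    have : fderiv ℝ h b = 0 := by
      have := (notMem_tsupport_iff_eventuallyEq.1 hb').fderiv_eq (𝕜 := ℝ)
      rw [this]
      exact fderiv_const_apply _
    change fderiv ℝ h b v = 0
    rw [this]; rfl

/-- The coordinate expression of `egfShift c l (lam (x · x₀))`. -/
def egfChart (c : ℕ → ℝ) (κ : Chart n) (x₀ : CSphere n) (lam : ℝ) (l : ℕ) (b : Model n) : ℂ :=
  egfShift c l (scaledDot x₀ lam (κ.symm b))

/-- The partial derivatives of `x · x₀` in a chart. -/
def dotGrad (κ : Chart n) (x₀ : CSphere n) (i : Fin (2 * n - 1)) (b : Model n) : ℂ :=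
  fderiv ℝ (fun b => dot (chartMap κ b) x₀) b (EuclideanSpace.single i 1)

/-- The partial derivative of a function. -/
def partialDeriv (i : Fin (2 * n - 1)) (h : Model n → ℂ) (b : Model n) : ℂ :=
  fderiv ℝ h b (EuclideanSpace.single i 1)

theorem IsCutoff.isCutoff_partialDeriv {h : Model n → ℂ} (hh : IsCutoff κ h) (i : Fin (2 * n - 1)) :
    IsCutoff κ (partialDeriv i h) := hh.fderiv_apply _

/-! ### Derivatives of the families in a chart -/

section Smoothness

variable [NeZero n] (hκ : IsSmoothChart κ)
include hκ

theorem contDiffOn_dot_chartMap (x₀ : CSphere n) :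
    ContDiffOn ℝ ∞ (fun b => dot (chartMap κ b) x₀) κ.target := by
  simp only [dot_eq_inner]
  exact (((innerSL ℂ (x₀ : Cn n)).restrictScalars ℝ).contDiff.comp_contDiffOn
    (contDiffOn_chartMap hκ))

theorem contDiffOn_dotGrad (x₀ : CSphere n) (i : Fin (2 * n - 1)) :
    ContDiffOn ℝ ∞ (dotGrad κ x₀ i) κ.target :=
  ((contDiffOn_dot_chartMap hκ x₀).fderiv_of_isOpen κ.open_target (by simp)).clm_apply
    contDiffOn_const

theorem contDiffOn_egfChart (hc : SlowGrowth c) (x₀ : CSphere n) (lam : ℝ) (l : ℕ) :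
    ContDiffOn ℝ ∞ (egfChart c κ x₀ lam l) κ.target :=
  (hc.expGrowth.shift l).contDiff_egf.comp_contDiffOn
    (contDiffOn_const.mul (contDiffOn_dot_chartMap hκ x₀))

theorem fderiv_egfChart (hc : SlowGrowth c) (x₀ : CSphere n) (lam : ℝ) (l : ℕ) {b : Model n}
    (hb : b ∈ κ.target) (i : Fin (2 * n - 1)) :
    fderiv ℝ (egfChart c κ x₀ lam l) b (EuclideanSpace.single i 1) =
      lam * dotGrad κ x₀ i b * egfChart c κ x₀ lam (l + 1) b := by
  have h1 : HasFDerivAt (fun b => dot (chartMap κ b) x₀)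
      (fderiv ℝ (fun b => dot (chartMap κ b) x₀) b) b :=
    (((contDiffOn_dot_chartMap hκ x₀).contDiffAt (κ.open_target.mem_nhds hb)).differentiableAt
      (by simp)).hasFDerivAt
  have h2 := ((hc.expGrowth.shift l).hasDerivAt_egf
    (scaledDot x₀ lam (κ.symm b))).hasFDerivAt.restrictScalars ℝ
  have h3 := h2.comp b (h1.const_mul (lam : ℂ))
  have h4 : HasFDerivAt (egfChart c κ x₀ lam l) _ b := h3
  have h5 : (fun k => c (k + 1 + l)) = fun k => c (k + (l + 1)) := by
    funext k; congr 1; omega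
  rw [h4.fderiv, h5]
  simp [dotGrad, egfChart, egfShift]

/-- The factor λ = μ/ħ from the chain rule cancels the ħ, while the coefficients of the generating
function are shifted by one. -/
theorem IsCutoff.scaledDeriv_mul {h : Model n → ℂ} (hh : IsCutoff κ h) (hc : SlowGrowth c)
    (x₀ : CSphere n) {ħ : ℝ} (hħ : ħ ≠ 0) (μ : ℝ) (l : ℕ) (i : Fin (2 * n - 1)) (b : Model n) :
    scaledDeriv ħ i (fun b => h b * egfChart c κ x₀ (μ / ħ) l b) b =
      ħ * (partialDeriv i h b * egfChart c κ x₀ (μ / ħ) l b) +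
        h b * (μ * dotGrad κ x₀ i b) * egfChart c κ x₀ (μ / ħ) (l + 1) b := by
  by_cases hb : b ∈ tsupport h
  · have hT := hh.subset hb
    have h1 : DifferentiableAt ℝ h b := hh.contDiff.differentiable (by simp) b
    have h2 : DifferentiableAt ℝ (egfChart c κ x₀ (μ / ħ) l) b :=
      ((contDiffOn_egfChart hκ hc x₀ (μ / ħ) l).contDiffAt
        (κ.open_target.mem_nhds hT)).differentiableAt (by simp)
    have hħ' : (ħ : ℂ) ≠ 0 := by exact_mod_cast hħ
    rw [scaledDeriv, fderiv_fun_mul h1 h2]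
    simp only [add_apply, smul_apply, smul_eq_mul]
    rw [fderiv_egfChart hκ hc x₀ _ l hT i, partialDeriv]
    push_cast
    field_simp
    ring
  · have h1 := notMem_tsupport_iff_eventuallyEq.1 hb
    have h2 : (fun b => h b * egfChart c κ x₀ (μ / ħ) l b) =ᶠ[𝓝 b] fun _ => 0 := by
      filter_upwards [h1] with y hy
      rw [hy]; simp
    have h3 : partialDeriv i h b = 0 := by
      rw [partialDeriv, h1.fderiv_eq]
      simp
    rw [scaledDeriv, h2.fderiv_eq, h3, h1.eq_of_nhds]
    simp

end Smoothness

/-- Families `f_ħ` of functions in a chart of size `O(ħ^(s/2))` relative to the functions `K_p`,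
together with all their derivatives `ħ ∂`. -/
inductive Localized (κ : Chart n) (x₀ : CSphere n) (c : ℕ → ℝ) (μ : ℝ) :
    ℕ → (ℝ → Model n → ℂ) → Prop
  -- The exponent stops at 2 because in L² it calls for the fourth moment of the distance, the
  -- highest one available.
  | base {h : Model n → ℂ} (hh : IsCutoff κ h) (l : ℕ) {s : ℕ} (hs : s ≤ 2) {C : ℝ}
      (hC : ∀ b ∈ κ.target, ‖h b‖ ≤ C * ‖chartMap κ b - x₀‖ ^ s) :
      Localized κ x₀ c μ s fun ħ b => h b * egfChart c κ x₀ (μ / ħ) l b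
  -- Consecutive shifts differ by O(ħ) relative to K, the size of order 2.
  | diff {h : Model n → ℂ} (hh : IsCutoff κ h) (l : ℕ) :
      Localized κ x₀ c μ 2 fun ħ b =>
        h b * egfChart c κ x₀ (μ / ħ) (l + 1) b - h b * egfChart c κ x₀ (μ / ħ) l b
  | add {s : ℕ} {f g : ℝ → Model n → ℂ} (hf : Localized κ x₀ c μ s f)
      (hg : Localized κ x₀ c μ s g) : Localized κ x₀ c μ s fun ħ b => f ħ b + g ħ b
  | scale {s : ℕ} {f : ℝ → Model n → ℂ} (hf : Localized κ x₀ c μ s f) :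
      Localized κ x₀ c μ (s + 2) fun ħ b => ħ * f ħ b
  | weaken {s s' : ℕ} {f : ℝ → Model n → ℂ} (hf : Localized κ x₀ c μ s f) (h : s' ≤ s) :
      Localized κ x₀ c μ s' f
  | congr {s : ℕ} {f g : ℝ → Model n → ℂ} (hf : Localized κ x₀ c μ s f)
      (h : ∀ ħ > 0, ∀ b, g ħ b = f ħ b) : Localized κ x₀ c μ s g

theorem IsCutoff.exists_norm_le {h : Model n → ℂ} (hh : IsCutoff κ h) : ∃ C : ℝ, ∀ b, ‖h b‖ ≤ C :=
  hh.hasCompactSupport.exists_bound_of_continuous hh.contDiff.continuous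

theorem IsCutoff.localized_zero {h : Model n → ℂ} (hh : IsCutoff κ h) (x₀ : CSphere n)
    (c : ℕ → ℝ) (μ : ℝ) (l : ℕ) :
    Localized κ x₀ c μ 0 fun ħ b => h b * egfChart c κ x₀ (μ / ħ) l b := by
  obtain ⟨C, hC⟩ := hh.exists_norm_le
  exact .base hh l (by norm_num) (C := C) fun b _ => by simpa using hC b

variable {μ : ℝ} {s : ℕ} {f g : ℝ → Model n → ℂ}

theorem Localized.mul_smooth (hf : Localized κ x₀ c μ s f) {q : Model n → ℂ}
    (hq : ContDiff ℝ ∞ q) : Localized κ x₀ c μ s fun ħ b => q b * f ħ b := by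
  induction hf with
  | @base h hh l s hs C hC =>
    have hh' := hh.mul hq.contDiffOn
    obtain ⟨B, hB⟩ := hh.hasCompactSupport.exists_bound_of_continuousOn hq.continuous.continuousOn
    have hB' : ∀ b ∈ κ.target, ‖h b * q b‖ ≤ C * max B 0 * ‖chartMap κ b - x₀‖ ^ s := by
      intro b hb
      by_cases hb' : b ∈ tsupport h
      · have := hC b hb
        rw [norm_mul]
        calc ‖h b‖ * ‖q b‖ ≤ (C * ‖chartMap κ b - x₀‖ ^ s) * max B 0 :=
              mul_le_mul this ((hB b hb').trans (le_max_left _ _)) (norm_nonneg _)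
                ((norm_nonneg _).trans this)
          _ = _ := by ring
      · have h1 := hC b hb
        rw [image_eq_zero_of_notMem_tsupport hb'] at h1 ⊢
        simp only [norm_zero, zero_mul] at h1 ⊢
        rw [mul_right_comm]
        exact mul_nonneg h1 (le_max_right _ _)
    exact (Localized.base hh' l hs hB').congr fun ħ _ b => by ring
  | diff hh l => exact (Localized.diff (hh.mul hq.contDiffOn) l).congr fun ħ _ b => by ring
  | add _ _ h1 h2 => exact (h1.add h2).congr fun ħ _ b => by ring
  | scale _ h1 => exact h1.scale.congr fun ħ _ b => by ring
  | weaken _ h h1 => exact h1.weaken h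
  | congr _ h h1 => exact h1.congr fun ħ hħ b => by rw [h ħ hħ]

theorem Localized.const_mul (hf : Localized κ x₀ c μ s f) (a : ℂ) :
    Localized κ x₀ c μ s fun ħ b => a * f ħ b := hf.mul_smooth contDiff_const

theorem Localized.sub (hf : Localized κ x₀ c μ s f) (hg : Localized κ x₀ c μ s g) :
    Localized κ x₀ c μ s fun ħ b => f ħ b - g ħ b :=
  (hf.add (hg.const_mul (-1))).congr fun ħ _ b => by ring

theorem Localized.coordMul_zero (hf : Localized κ x₀ c μ s f) (b₀ : Model n)
    (i : Fin (2 * n - 1)) : Localized κ x₀ c μ s fun ħ => coordMul b₀ i (f ħ) :=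
  hf.mul_smooth (contDiff_coord b₀ i)

/-- A coordinate vanishing at the center is O(|x - x₀|) on the support of the cutoff, which raises
the exponent of a basic family by one. Families of order 2 cannot improve further, hence `s ≤ 1`. -/
theorem Localized.coordMul [NeZero n] (hκ : IsSmoothChart κ) (hx : x₀ ∈ κ.source)
    (hf : Localized κ x₀ c μ s f) (hs : s ≤ 1) (i : Fin (2 * n - 1)) :
    Localized κ x₀ c μ (s + 1) fun ħ => coordMul (κ x₀) i (f ħ) := by
  induction hf with
  | @base h hh l s hs2 C hC =>
    have hh' := hh.mul (contDiff_coord (κ x₀) i).contDiffOn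
    obtain ⟨B, hB, hle⟩ := exists_norm_sub_le_chartMap hκ hh.hasCompactSupport hh.subset
      (κ.map_source hx)
    rw [chartMap_apply hx] at hle
    have hB' : ∀ b ∈ κ.target, ‖h b * (((b - κ x₀) i : ℝ) : ℂ)‖ ≤
        C * B * ‖chartMap κ b - x₀‖ ^ (s + 1) := by
      intro b hb
      have h1 := hC b hb
      by_cases hb' : b ∈ tsupport h
      · rw [norm_mul, Complex.norm_real]
        calc ‖h b‖ * ‖(b - κ x₀) i‖ ≤ (C * ‖chartMap κ b - x₀‖ ^ s) *
              (B * ‖chartMap κ b - x₀‖) :=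
              mul_le_mul h1 ((PiLp.norm_apply_le _ i).trans (hle b hb')) (norm_nonneg _)
                ((norm_nonneg _).trans h1)
          _ = _ := by ring
      · rw [image_eq_zero_of_notMem_tsupport hb'] at h1 ⊢
        simp only [norm_zero, zero_mul] at h1 ⊢
        have : C * B * ‖chartMap κ b - x₀‖ ^ (s + 1) =
          (C * ‖chartMap κ b - x₀‖ ^ s) * (B * ‖chartMap κ b - x₀‖) := by ring
        rw [this]
        positivity
    exact (Localized.base hh' l (by omega) hB').congr fun ħ _ b => by
      simp only [SphereEgorov.coordMul]; ring
  | diff => omega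
  | add _ _ h1 h2 =>
    exact ((h1 hs).add (h2 hs)).congr fun ħ _ b => by simp only [SphereEgorov.coordMul]; ring
  | scale => omega
  -- If the order was really lowered, the spare order already covers the claim and boundedness of
  -- the coordinate is enough; the induction hypothesis could be out of its range there.
  | @weaken s s' f hf h h1 =>
    rcases h.eq_or_lt with rfl | h'
    · exact h1 hs
    · exact (hf.weaken h').coordMul_zero (κ x₀) i
  | congr _ h h1 =>
    exact (h1 hs).congr fun ħ hħ b => by simp only [SphereEgorov.coordMul, h ħ hħ]

section

variable [NeZero n] (hκ : IsSmoothChart κ) (hc : SlowGrowth c)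
include hκ hc

theorem Localized.isTest (hf : Localized κ x₀ c μ s f) {ħ : ℝ} (hħ : 0 < ħ) : IsTest (f ħ) := by
  induction hf with
  | base hh l => exact (hh.mul (contDiffOn_egfChart hκ hc x₀ _ l)).isTest
  | diff hh l =>
    have h1 := (hh.mul (contDiffOn_egfChart hκ hc x₀ (μ / ħ) (l + 1))).isTest
    have h2 := ((hh.mul (contDiffOn_egfChart hκ hc x₀ (μ / ħ) l)).isTest).mul_left
      (contDiff_const (c := (-1 : ℂ)))
    convert h1.add h2 using 1
    funext b
    ring
  | add _ _ h1 h2 => exact h1.add h2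
  | scale _ h1 => exact h1.mul_left contDiff_const
  | weaken _ _ h1 => exact h1
  | congr _ h h1 =>
    convert h1 using 1
    funext b
    exact h ħ hħ b

/-- Scaled derivatives do not lower the order. This pays for the derivatives lost in the pairing
estimate. -/
theorem Localized.scaledDeriv (hf : Localized κ x₀ c μ s f) (i : Fin (2 * n - 1)) :
    Localized κ x₀ c μ s fun ħ => scaledDeriv ħ i (f ħ) := by
  induction hf with
  | @base h hh l s hs C hC =>
    have h1 := ((hh.isCutoff_partialDeriv i).localized_zero x₀ c μ l).scale.weaken hs
    have hg : ContDiffOn ℝ ∞ (fun b => (μ : ℂ) * dotGrad κ x₀ i b) κ.target :=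
      contDiffOn_const.mul (contDiffOn_dotGrad hκ x₀ i)
    obtain ⟨B, hB⟩ := hh.hasCompactSupport.exists_bound_of_continuousOn
      (hg.continuousOn.mono hh.subset)
    have hB' : ∀ b ∈ κ.target, ‖h b * (μ * dotGrad κ x₀ i b)‖ ≤
        C * max B 0 * ‖chartMap κ b - x₀‖ ^ s := by
      intro b hb
      have h1 := hC b hb
      by_cases hb' : b ∈ tsupport h
      · rw [norm_mul]
        calc _ ≤ (C * ‖chartMap κ b - x₀‖ ^ s) * max B 0 :=
              mul_le_mul h1 ((hB b hb').trans (le_max_left _ _)) (norm_nonneg _)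
                ((norm_nonneg _).trans h1)
          _ = _ := by ring
      · rw [image_eq_zero_of_notMem_tsupport hb'] at h1 ⊢
        simp only [norm_zero, zero_mul] at h1 ⊢
        rw [mul_right_comm]
        exact mul_nonneg h1 (le_max_right _ _)
    exact (h1.add (.base (hh.mul hg) (l + 1) hs hB')).congr fun ħ hħ b =>
      hh.scaledDeriv_mul hκ hc x₀ hħ.ne' μ l i b
  | @diff h hh l =>
    have hg : ContDiffOn ℝ ∞ (fun b => (μ : ℂ) * dotGrad κ x₀ i b) κ.target :=
      contDiffOn_const.mul (contDiffOn_dotGrad hκ x₀ i)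
    have h1 := (Localized.diff (x₀ := x₀) (c := c) (μ := μ) (hh.isCutoff_partialDeriv i) l).scale.weaken
      (show 2 ≤ 2 + 2 by norm_num)
    refine (h1.add (.diff (hh.mul hg) (l + 1))).congr fun ħ hħ b => ?_
    have h2 := hh.scaledDeriv_mul hκ hc x₀ hħ.ne' μ (l + 1) i b
    have h3 := hh.scaledDeriv_mul hκ hc x₀ hħ.ne' μ l i b
    have d1 := (hh.mul (contDiffOn_egfChart hκ hc x₀ (μ / ħ) (l + 1))).contDiff.differentiable
      (by simp) b
    have d2 := (hh.mul (contDiffOn_egfChart hκ hc x₀ (μ / ħ) l)).contDiff.differentiable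
      (by simp) b
    rw [SphereEgorov.scaledDeriv] at h2 h3 ⊢
    rw [fderiv_fun_sub d1 d2, sub_apply, mul_sub, h2, h3]
    ring
  | @add s f g hf hg h1 h2 =>
    refine (h1.add h2).congr fun ħ hħ b => ?_
    have d1 := (hf.isTest hκ hc hħ).1.differentiable (by simp) b
    have d2 := (hg.isTest hκ hc hħ).1.differentiable (by simp) b
    simp only [SphereEgorov.scaledDeriv]
    rw [fderiv_fun_add d1 d2, add_apply]
    ring
  | @scale s f hf h1 =>
    refine h1.scale.congr fun ħ hħ b => ?_
    have d1 := (hf.isTest hκ hc hħ).1.differentiable (by simp) b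
    simp only [SphereEgorov.scaledDeriv]
    rw [fderiv_const_mul d1, smul_apply, smul_eq_mul]
  | weaken _ h h1 => exact h1.weaken h
  | @congr s f g hf h h1 =>
    refine h1.congr fun ħ hħ b => ?_
    rw [show g ħ = f ħ from funext (h ħ hħ)]

theorem Localized.shiftedDeriv_zero (hf : Localized κ x₀ c μ s f) (ξ₀ : Model n)
    (i : Fin (2 * n - 1)) : Localized κ x₀ c μ s fun ħ => shiftedDeriv ħ ξ₀ i (f ħ) :=
  ((hf.scaledDeriv hκ hc i).const_mul (-Complex.I)).sub (hf.const_mul ((ξ₀ i : ℝ) : ℂ))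

/-- The order improves if the covector is the differential of the phase of `K_p` at `x₀`. -/
theorem Localized.shiftedDeriv (hx : x₀ ∈ κ.source) {ξ₀ : Model n}
    (hξ : ∀ i, ((ξ₀ i : ℝ) : ℂ) = -Complex.I * (μ * dotGrad κ x₀ i (κ x₀)))
    (hf : Localized κ x₀ c μ s f) (hs : s ≤ 1) (i : Fin (2 * n - 1)) :
    Localized κ x₀ c μ (s + 1) fun ħ => shiftedDeriv ħ ξ₀ i (f ħ) := by
  induction hf with
  | @base h hh l s hs2 C hC =>
    have hg : ContDiffOn ℝ ∞ (fun b => -Complex.I * (μ * dotGrad κ x₀ i b)) κ.target :=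
      contDiffOn_const.mul (contDiffOn_const.mul (contDiffOn_dotGrad hκ x₀ i))
    -- With G = -iμ ∂_i(x·x₀) and K_l the shifted families, (ħD_i - ξ₀_i)(h K_l) = -iħ(∂_i h)K_l +
    -- hG(K_{l+1} - K_l) + h(G - ξ₀_i)K_l. The first two terms have order 2, and in the third the
    -- coefficient gains one power of the distance.
    have h1 := (((hh.isCutoff_partialDeriv i).localized_zero x₀ c μ l).scale.const_mul
      (-Complex.I)).weaken (show s + 1 ≤ 0 + 2 by omega)
    have h2 := (Localized.diff (x₀ := x₀) (c := c) (μ := μ) (hh.mul hg) l).weaken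
      (show s + 1 ≤ 2 by omega)
    have hq : ContDiffOn ℝ ∞ (fun b => -Complex.I * (μ * dotGrad κ x₀ i b) - ((ξ₀ i : ℝ) : ℂ))
      κ.target := hg.sub contDiffOn_const
    have hb₀ := κ.map_source hx
    -- the new coefficient vanishes at the base point
    obtain ⟨B, hB0, hB⟩ : ∃ B : ℝ, 0 ≤ B ∧ ∀ b ∈ tsupport h,
        ‖-Complex.I * (μ * dotGrad κ x₀ i b) - ((ξ₀ i : ℝ) : ℂ)‖ ≤ B * ‖b - κ x₀‖ := by
      obtain ⟨L, t, ht, hL⟩ := ((hq.contDiffAt (κ.open_target.mem_nhds hb₀)).of_le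
        (show (1 : WithTop ℕ∞) ≤ ∞ by simp)).exists_lipschitzOnWith
      obtain ⟨ρ, hρ, hball⟩ := Metric.mem_nhds_iff.1 ht
      obtain ⟨M, hM⟩ := hh.hasCompactSupport.exists_bound_of_continuousOn
        (hq.continuousOn.mono hh.subset)
      refine ⟨max L (M / ρ), le_max_of_le_left L.2, fun b hb => ?_⟩
      by_cases hbρ : b ∈ Metric.ball (κ x₀) ρ
      · have h3 := hL.dist_le_mul b (hball hbρ) (κ x₀) (mem_of_mem_nhds ht)
        rw [dist_eq_norm, dist_eq_norm, hξ i, sub_self, sub_zero, ← hξ i] at h3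
        refine h3.trans ?_
        gcongr
        exact le_max_left _ _
      · have h3 : ρ ≤ ‖b - κ x₀‖ := by simpa [dist_eq_norm] using hbρ
        have hM0 : 0 ≤ M := (norm_nonneg _).trans (hM b hb)
        calc _ ≤ M := hM b hb
          _ = M / ρ * ρ := by field_simp
          _ ≤ _ := by gcongr; exact le_max_right _ _
    obtain ⟨D, hD, hle⟩ := exists_norm_sub_le_chartMap hκ hh.hasCompactSupport hh.subset hb₀
    rw [chartMap_apply hx] at hle
    have hB' : ∀ b ∈ κ.target,
        ‖h b * (-Complex.I * (μ * dotGrad κ x₀ i b) - ((ξ₀ i : ℝ) : ℂ))‖ ≤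
        C * (B * D) * ‖chartMap κ b - x₀‖ ^ (s + 1) := by
      intro b hb
      have h1 := hC b hb
      by_cases hb' : b ∈ tsupport h
      · rw [norm_mul]
        calc _ ≤ (C * ‖chartMap κ b - x₀‖ ^ s) * (B * (D * ‖chartMap κ b - x₀‖)) :=
              mul_le_mul h1 ((hB b hb').trans (mul_le_mul_of_nonneg_left (hle b hb') hB0))
                (norm_nonneg _) ((norm_nonneg _).trans h1)
          _ = _ := by ring
      · rw [image_eq_zero_of_notMem_tsupport hb'] at h1 ⊢
        simp only [norm_zero, zero_mul] at h1 ⊢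
        have : C * (B * D) * ‖chartMap κ b - x₀‖ ^ (s + 1) =
          (C * ‖chartMap κ b - x₀‖ ^ s) * (B * D * ‖chartMap κ b - x₀‖) := by ring
        rw [this]
        positivity
    refine ((h1.add h2).add (.base (hh.mul hq) l (by omega) hB')).congr fun ħ hħ b => ?_
    simp only [SphereEgorov.shiftedDeriv]
    rw [hh.scaledDeriv_mul hκ hc x₀ hħ.ne' μ l i b]
    ring
  | diff => omega
  | @add s f g hf hg h1 h2 =>
    refine ((h1 hs).add (h2 hs)).congr fun ħ hħ b => ?_
    have d1 := (hf.isTest hκ hc hħ).1.differentiable (by simp) b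
    have d2 := (hg.isTest hκ hc hħ).1.differentiable (by simp) b
    simp only [SphereEgorov.shiftedDeriv, SphereEgorov.scaledDeriv]
    rw [fderiv_fun_add d1 d2, add_apply]
    ring
  | scale => omega
  | @weaken s s' f hf h h1 =>
    rcases h.eq_or_lt with rfl | h'
    · exact h1 hs
    · exact (hf.weaken h').shiftedDeriv_zero hκ hc ξ₀ i
  | @congr s f g hf h h1 =>
    refine (h1 hs).congr fun ħ hħ b => ?_
    rw [show g ħ = f ħ from funext (h ħ hħ)]

end

end LocalizedFamilies

/-! ### L² bounds of localized families -/

section SquareBounds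

open MeasureTheory

/-- Families with squared `L²` norms bounded by a multiple of `m`. -/
def SqBound {d : ℕ} (S : Set ℝ) (m : ℝ → ENNReal) (u : ℝ → Vec d → ENNReal) : Prop :=
  (∀ ħ ∈ S, Measurable (u ħ)) ∧ ∃ C : NNReal, ∀ ħ ∈ S, ∫⁻ b, u ħ b ^ 2 ≤ C * m ħ

theorem SqBound.add {d : ℕ} {S : Set ℝ} {m : ℝ → ENNReal} {u v : ℝ → Vec d → ENNReal}
    (hu : SqBound S m u) (hv : SqBound S m v) : SqBound S m fun ħ b => u ħ b + v ħ b := by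
  obtain ⟨mu, C, hC⟩ := hu
  obtain ⟨mv, C', hC'⟩ := hv
  refine ⟨fun ħ hħ => (mu ħ hħ).add (mv ħ hħ), 4 * (C + C'), fun ħ hħ => ?_⟩
  have hsq : ∀ a b : ENNReal, (a + b) ^ 2 ≤ 4 * (a ^ 2 + b ^ 2) := fun a b => by
    have h1 : a + b ≤ 2 * max a b := by
      rw [two_mul]; exact add_le_add (le_max_left _ _) (le_max_right _ _)
    calc (a + b) ^ 2 ≤ (2 * max a b) ^ 2 := by gcongr
      _ = 4 * max a b ^ 2 := by rw [mul_pow]; norm_num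
      _ ≤ _ := by
        gcongr
        rcases le_total a b with h | h
        · rw [max_eq_right h]; exact le_add_of_nonneg_left zero_le
        · rw [max_eq_left h]; exact le_add_of_nonneg_right zero_le
  calc ∫⁻ b, (u ħ b + v ħ b) ^ 2 ≤ ∫⁻ b, 4 * (u ħ b ^ 2 + v ħ b ^ 2) :=
        lintegral_mono fun b => hsq _ _
    _ = 4 * ((∫⁻ b, u ħ b ^ 2) + ∫⁻ b, v ħ b ^ 2) := by
        rw [lintegral_const_mul' _ _ (by norm_num), lintegral_add_left ((mu ħ hħ).pow_const 2)]
    _ ≤ 4 * (C * m ħ + C' * m ħ) := by gcongr; exacts [hC ħ hħ, hC' ħ hħ]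
    _ = _ := by push_cast; ring

theorem SqBound.sum {d : ℕ} {S : Set ℝ} {m : ℝ → ENNReal} {ι : Type*} (T : Finset ι)
    {u : ι → ℝ → Vec d → ENNReal} (hu : ∀ i ∈ T, SqBound S m (u i)) :
    SqBound S m fun ħ b => ∑ i ∈ T, u i ħ b := by
  classical
  induction T using Finset.induction_on with
  | empty => exact ⟨fun ħ _ => by simp, 0, fun ħ _ => by simp⟩
  | insert a T ha ih =>
    simp_rw [Finset.sum_insert ha]
    exact (hu a (Finset.mem_insert_self a T)).add
      (ih fun i hi => hu i (Finset.mem_insert_of_mem hi))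

variable {n : ℕ} [NeZero n] {κ : Chart n} {x₀ : CSphere n} {c : ℕ → ℝ} {μ : ℝ} {s s' : ℕ}
  {f g : ℝ → Model n → ℂ}

/-- The scale `ħ^s ‖K‖²`. -/
def massScale (c : ℕ → ℝ) (x₀ : CSphere n) (μ : ℝ) (s : ℕ) (ħ : ℝ) : ENNReal :=
  ENNReal.ofReal (ħ ^ s * egfMass c x₀ (μ / ħ))

theorem exists_lintegral_sq_le (hκ : IsSmoothChart κ) {K : Set (Model n)} (hK : IsCompact K)
    (hKT : K ⊆ κ.target) :
    ∃ C : NNReal, ∀ (q : Model n → ℂ) (ψ : CSphere n → ℝ), Continuous ψ → (∀ x, 0 ≤ ψ x) →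
      (∀ b ∉ K, q b = 0) → (∀ b ∈ K, ‖q b‖ ^ 2 ≤ ψ (κ.symm b)) →
      ∫⁻ b, ‖q b‖ₑ ^ 2 ≤ C * ENNReal.ofReal (∫ x, ψ x ∂(surfaceMeasure n)) := by
  obtain ⟨C, -, hC⟩ := exists_lintegral_bounds hκ hK hKT
  refine ⟨C, fun q ψ hψ hψ0 hq hle => ?_⟩
  have h0 : ∫⁻ b, ‖q b‖ₑ ^ 2 = ∫⁻ b in K, ‖q b‖ₑ ^ 2 := by
    rw [← lintegral_indicator hK.measurableSet]
    refine lintegral_congr fun b => ?_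
    by_cases hb : b ∈ K
    · rw [Set.indicator_of_mem hb]
    · rw [Set.indicator_of_notMem hb, hq b hb]; simp
  rw [h0, ofReal_integral_eq_lintegral_ofReal (integrable_of_continuous hψ)
    (Filter.Eventually.of_forall hψ0)]
  refine le_trans (setLIntegral_mono' hK.measurableSet fun b hb => ?_)
    (hC _ (hψ.measurable.ennreal_ofReal))
  rw [← ofReal_norm, ← ENNReal.ofReal_pow (norm_nonneg _)]
  exact ENNReal.ofReal_le_ofReal (hle b hb)

/-- Basic families are controlled by the moments of the distance, differences by the estimate for
consecutive shifts. The condition `2 * ħ₀ ≤ μ` keeps λ = μ/ħ ≥ 2, where the moment bounds hold. -/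
theorem Localized.sqBound (hκ : IsSmoothChart κ) (hc : Concentrates c x₀) (hμ : 0 < μ) {ħ₀ : ℝ}
    (hħ₀ : 2 * ħ₀ ≤ μ) (hf : Localized κ x₀ c μ s f) :
    SqBound (Set.Ioc 0 ħ₀) (massScale c x₀ μ s) fun ħ b => ‖f ħ b‖ₑ := by
  refine ⟨fun ħ hħ => (hf.isTest hκ hc.toSlowGrowth hħ.1).1.continuous.enorm.measurable, ?_⟩
  have hlam : ∀ ħ ∈ Set.Ioc 0 ħ₀, 2 ≤ μ / ħ := fun ħ hħ => by
    rw [le_div_iff₀ hħ.1]; linarith [hħ.2]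
  have hmass : ∀ ħ ∈ Set.Ioc 0 ħ₀, 0 ≤ egfMass c x₀ (μ / ħ) := fun ħ hħ =>
    zero_le_one.trans (hc.one_le_egfMass x₀ (by linarith [hlam ħ hħ]))
  induction hf with
  | @base h hh l s hs C hC =>
    obtain ⟨C₁, h1⟩ := exists_lintegral_sq_le hκ hh.hasCompactSupport hh.subset
    obtain ⟨C₂, hC₂, h2⟩ := hc.exists_integral_pow_le l hs
    refine ⟨C₁ * (C ^ 2 * (C₂ * μ⁻¹ ^ s)).toNNReal, fun ħ hħ => ?_⟩
    have hw := continuous_scaledDot x₀ (μ / ħ)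
    have hce := hc.continuous_egfShift l
    refine (h1 _ (fun x => C ^ 2 * (‖(x : Cn n) - x₀‖ ^ (2 * s) *
      ‖egfShift c l (scaledDot x₀ (μ / ħ) x)‖ ^ 2)) (by fun_prop) (fun x => by positivity)
      (fun b hb => ?_) (fun b hb => ?_)).trans ?_
    · beta_reduce
      rw [image_eq_zero_of_notMem_tsupport hb, zero_mul]
    · beta_reduce
      rw [norm_mul, mul_pow ‖h b‖, pow_mul', ← mul_assoc, ← mul_pow C]
      have h3 := hC b (hh.subset hb)
      have h4 : ‖h b‖ ^ 2 ≤ (C * ‖chartMap κ b - x₀‖ ^ s) ^ 2 := by gcongr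
      exact mul_le_mul_of_nonneg_right h4 (sq_nonneg _)
    · push_cast
      rw [massScale, mul_assoc, integral_const_mul]
      gcongr
      change _ ≤ ENNReal.ofReal _ * _
      rw [← ENNReal.ofReal_mul (by positivity)]
      refine ENNReal.ofReal_le_ofReal ?_
      refine (mul_le_mul_of_nonneg_left (h2 _ (hlam ħ hħ)) (sq_nonneg C)).trans (le_of_eq ?_)
      rw [inv_div, div_pow, inv_pow]
      field_simp
  | @diff h hh l =>
    obtain ⟨C₁, h1⟩ := exists_lintegral_sq_le hκ hh.hasCompactSupport hh.subset
    obtain ⟨C₂, hC₂, h2⟩ := hc.exists_integral_shift_sub_le x₀ l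
    obtain ⟨M, hM⟩ := hh.exists_norm_le
    refine ⟨C₁ * (M ^ 2 * (C₂ * μ⁻¹ ^ 2)).toNNReal, fun ħ hħ => ?_⟩
    have hw := continuous_scaledDot x₀ (μ / ħ)
    have hce := hc.continuous_egfShift l
    have hce' := hc.continuous_egfShift (l + 1)
    refine (h1 _ (fun x => M ^ 2 * ‖egfShift c (l + 1) (scaledDot x₀ (μ / ħ) x) -
      egfShift c l (scaledDot x₀ (μ / ħ) x)‖ ^ 2) (by fun_prop) (fun x => by positivity)
      (fun b hb => ?_) (fun b hb => ?_)).trans ?_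
    · beta_reduce
      rw [image_eq_zero_of_notMem_tsupport hb]; simp
    · beta_reduce
      rw [← mul_sub, norm_mul, mul_pow]
      gcongr
      · exact hM b
      · rfl
    · push_cast
      rw [massScale, mul_assoc, integral_const_mul]
      gcongr
      change _ ≤ ENNReal.ofReal _ * _
      rw [← ENNReal.ofReal_mul (by positivity)]
      refine ENNReal.ofReal_le_ofReal ?_
      refine (mul_le_mul_of_nonneg_left (h2 _ (by linarith [hlam ħ hħ])) (sq_nonneg M)).trans
        (le_of_eq ?_)
      rw [inv_div, div_pow, inv_pow]
      field_simp
  | add hf hg h1 h2 =>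
    have m1 : SqBound (Set.Ioc 0 ħ₀) _ _ :=
      ⟨fun ħ hħ => (hf.isTest hκ hc.toSlowGrowth hħ.1).1.continuous.enorm.measurable, h1⟩
    have m2 : SqBound (Set.Ioc 0 ħ₀) _ _ :=
      ⟨fun ħ hħ => (hg.isTest hκ hc.toSlowGrowth hħ.1).1.continuous.enorm.measurable, h2⟩
    obtain ⟨C, hC⟩ := (m1.add m2).2
    refine ⟨C, fun ħ hħ => (lintegral_mono fun b => ?_).trans (hC ħ hħ)⟩
    gcongr
    exact enorm_add_le _ _
  | @scale s f hf h1 =>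
    obtain ⟨C, hC⟩ := h1
    refine ⟨C, fun ħ hħ => ?_⟩
    have e : ∀ b, ‖(ħ : ℂ) * f ħ b‖ₑ ^ 2 = ENNReal.ofReal (ħ ^ 2) * ‖f ħ b‖ₑ ^ 2 := fun b => by
      rw [enorm_mul, mul_pow, ← ofReal_norm (ħ : ℂ), Complex.norm_real,
        Real.norm_of_nonneg hħ.1.le, ENNReal.ofReal_pow hħ.1.le]
    simp_rw [e]
    rw [lintegral_const_mul' _ _ ENNReal.ofReal_ne_top]
    refine (mul_le_mul_right (hC ħ hħ) _).trans (le_of_eq ?_)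
    rw [massScale, massScale, mul_left_comm, ← ENNReal.ofReal_mul (by positivity)]
    congr 2
    ring
  | @weaken s s' f hf h h1 =>
    obtain ⟨C, hC⟩ := h1
    refine ⟨C * (ħ₀ ^ (s - s')).toNNReal, fun ħ hħ => (hC ħ hħ).trans ?_⟩
    push_cast
    rw [mul_assoc]
    gcongr
    change _ ≤ ENNReal.ofReal _ * _
    rw [massScale, massScale, ← ENNReal.ofReal_mul (by have := hħ.1.trans_le hħ.2; positivity)]
    refine ENNReal.ofReal_le_ofReal ?_
    rw [← mul_assoc]
    have := hmass ħ hħ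
    have h3 : ħ ^ s = ħ ^ (s - s') * ħ ^ s' := by rw [← pow_add]; congr 1; omega
    have h4 := hħ.1.le
    rw [h3]
    gcongr
    exact hħ.2
  | @congr s f g hf h h1 =>
    obtain ⟨C, hC⟩ := h1
    refine ⟨C, fun ħ hħ => ?_⟩
    beta_reduce
    rw [show g ħ = f ħ from funext (h ħ hħ.1)]
    exact hC ħ hħ

theorem Localized.sqBound_derivSum (hκ : IsSmoothChart κ) (hc : Concentrates c x₀) (hμ : 0 < μ)
    {ħ₀ : ℝ} (hħ₀ : 2 * ħ₀ ≤ μ) (k : ℕ) (hf : Localized κ x₀ c μ s f) :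
    SqBound (Set.Ioc 0 ħ₀) (massScale c x₀ μ s)
      fun ħ b => ENNReal.ofReal (derivSum ħ k (f ħ) b) := by
  induction k generalizing f with
  | zero =>
    have := hf.sqBound hκ hc hμ hħ₀
    simpa only [derivSum, ofReal_norm] using this
  | succ k ih =>
    have h1 := (ih hf).add (SqBound.sum Finset.univ fun i _ =>
      ih (hf.scaledDeriv hκ hc.toSlowGrowth i))
    have e : ∀ ħ b, ENNReal.ofReal (derivSum ħ (k + 1) (f ħ) b) =
        ENNReal.ofReal (derivSum ħ k (f ħ) b) +
        ∑ i, ENNReal.ofReal (derivSum ħ k (SphereEgorov.scaledDeriv ħ i (f ħ)) b) := fun ħ b => by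
      rw [derivSum, ENNReal.ofReal_add (derivSum_nonneg _ _ _ _)
        (Finset.sum_nonneg fun i _ => derivSum_nonneg _ _ _ _),
        ENNReal.ofReal_sum_of_nonneg fun i _ => derivSum_nonneg _ _ _ _]
    simp_rw [e]
    exact h1

/-- Pairings of localized families through operators with symbols are small. -/
theorem Localized.exists_pairing_le (hκ : IsSmoothChart κ) (hc : Concentrates c x₀) (hμ : 0 < μ)
    {ħ₀ t m : ℝ} (hħ₀ : 2 * ħ₀ ≤ μ) (ht : t ∈ Set.Icc (0 : ℝ) 1)
    {A : ℝ → Model n × Model n → ℂ} (hA : SymbolBound (Set.Ioc 0 ħ₀) ⊤ m A)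
    (hf : Localized κ x₀ c μ s f) (hg : Localized κ x₀ c μ s' g) (hs : s + s' = 2) :
    ∃ C : ℝ, 0 ≤ C ∧ ∀ ħ ∈ Set.Ioc 0 ħ₀,
      ∫⁻ b, ‖pseudo t ħ (A ħ) (f ħ) b‖ₑ * ‖g ħ b‖ₑ ≤
        ENNReal.ofReal (C * ħ * egfMass c x₀ (μ / ħ)) := by
  obtain ⟨k, C, hC, h⟩ := hA.exists_pairing_le ht
  obtain ⟨-, C₁, h1⟩ := hf.sqBound_derivSum hκ hc hμ hħ₀ k
  obtain ⟨-, C₂, h2⟩ := hg.sqBound hκ hc hμ hħ₀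
  refine ⟨C * √(C₁ * C₂), by positivity, fun ħ hħ => ?_⟩
  have hM : 0 ≤ egfMass c x₀ (μ / ħ) := integral_nonneg fun _ => by positivity
  have hħ0 := hħ.1.le
  refine (h ħ hħ (f ħ) (hf.isTest hκ hc.toSlowGrowth hħ.1) (g ħ)
    (hg.isTest hκ hc.toSlowGrowth hħ.1).1.continuous).trans ?_
  rw [mul_assoc, mul_assoc, ENNReal.ofReal_mul hC]
  gcongr
  calc _ ≤ (C₁ * massScale c x₀ μ s ħ) ^ (1 / 2 : ℝ) *
        (C₂ * massScale c x₀ μ s' ħ) ^ (1 / 2 : ℝ) := by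
        gcongr
        · exact h1 ħ hħ
        · exact h2 ħ hħ
    -- Since s + s' = 2, the geometric mean of ħ^s and ħ^{s'} is exactly ħ.
    _ = ENNReal.ofReal ((C₁ * C₂ * (ħ * egfMass c x₀ (μ / ħ)) ^ 2) ^ (1 / 2 : ℝ)) := by
        rw [← ENNReal.mul_rpow_of_nonneg _ _ (by norm_num), massScale, massScale,
          ← ENNReal.ofReal_rpow_of_nonneg (by positivity) (by norm_num),
          ← ENNReal.ofReal_coe_nnreal (p := C₁), ← ENNReal.ofReal_coe_nnreal (p := C₂),
          ← ENNReal.ofReal_mul (by positivity), ← ENNReal.ofReal_mul (by positivity),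
          ← ENNReal.ofReal_mul (by positivity)]
        congr 2
        have : ħ ^ 2 = ħ ^ s * ħ ^ s' := by rw [← pow_add, hs]
        rw [mul_pow, this]
        ring
    _ ≤ _ := by
        rw [← Real.sqrt_eq_rpow, Real.sqrt_mul (by positivity),
          Real.sqrt_sq (by positivity)]

end SquareBounds

/-! ### The action of operators on localized families -/

section Remainders

open MeasureTheory

theorem measurable_pseudo {d : ℕ} (t ħ : ℝ) {A : Vec d × Vec d → ℂ} (hA : ContDiff ℝ ∞ A)
    {f : Vec d → ℂ} (hf : IsTest f) : Measurable (pseudo t ħ A f) := by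
  have hAc := hA.continuous
  have hfc := hf.1.continuous
  have h1 : Continuous (Function.uncurry fun (p : Vec d × Vec d) (c : Vec d) =>
      wave ħ p.1 p.2 c * amplitude t A f p.1 p.2 c) := by
    unfold wave amplitude
    simp only [Function.uncurry_def]
    fun_prop
  have h2 : StronglyMeasurable fun p : Vec d × Vec d => innerIntegral t ħ A f p.1 p.2 :=
    h1.stronglyMeasurable.integral_prod_right
  have h3 : StronglyMeasurable fun b : Vec d => ∫ ξ, innerIntegral t ħ A f b ξ :=
    StronglyMeasurable.integral_prod_right (f := fun b ξ => innerIntegral t ħ A f b ξ) h2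
  exact h3.measurable.const_mul _

variable {n : ℕ} {κ : Chart n} {x₀ : CSphere n} {c : ℕ → ℝ} {μ : ℝ} {s s' : ℕ}
  {f g : ℝ → Model n → ℂ} {S : Set ℝ}

/-- Families whose pairings with `g_ħ` are `O(ħ ‖K‖²)`. -/
def Remainder (S : Set ℝ) (c : ℕ → ℝ) (x₀ : CSphere n) (μ : ℝ) (g R : ℝ → Model n → ℂ) : Prop :=
  (∀ ħ ∈ S, Measurable (R ħ)) ∧ ∃ C : ℝ, 0 ≤ C ∧ ∀ ħ ∈ S,
    ∫⁻ b, ‖R ħ b‖ₑ * ‖g ħ b‖ₑ ≤ ENNReal.ofReal (C * (ħ * egfMass c x₀ (μ / ħ)))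

theorem egfMass_nonneg (c : ℕ → ℝ) (x₀ : CSphere n) (lam : ℝ) : 0 ≤ egfMass c x₀ lam :=
  integral_nonneg fun _ => by positivity

theorem Remainder.congr {R R' : ℝ → Model n → ℂ} (h : Remainder S c x₀ μ g R)
    (e : ∀ ħ ∈ S, ∀ b, R' ħ b = R ħ b) : Remainder S c x₀ μ g R' := by
  obtain ⟨hm, C, hC, h⟩ := h
  refine ⟨fun ħ hħ => ?_, C, hC, fun ħ hħ => ?_⟩
  · rw [show R' ħ = R ħ from funext (e ħ hħ)]; exact hm ħ hħ
  · rw [show R' ħ = R ħ from funext (e ħ hħ)]; exact h ħ hħ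

theorem Remainder.add {R R' : ℝ → Model n → ℂ} (hS : ∀ ħ ∈ S, 0 < ħ)
    (hg : ∀ ħ ∈ S, Measurable (g ħ)) (h : Remainder S c x₀ μ g R) (h' : Remainder S c x₀ μ g R') :
    Remainder S c x₀ μ g fun ħ b => R ħ b + R' ħ b := by
  obtain ⟨hm, C, hC, h⟩ := h
  obtain ⟨hm', C', hC', h'⟩ := h'
  refine ⟨fun ħ hħ => (hm ħ hħ).add (hm' ħ hħ), C + C', by positivity, fun ħ hħ => ?_⟩
  have hM := egfMass_nonneg c x₀ (μ / ħ)
  have hħ0 := (hS ħ hħ).le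
  calc ∫⁻ b, ‖R ħ b + R' ħ b‖ₑ * ‖g ħ b‖ₑ
      ≤ ∫⁻ b, (‖R ħ b‖ₑ * ‖g ħ b‖ₑ + ‖R' ħ b‖ₑ * ‖g ħ b‖ₑ) := by
        refine lintegral_mono fun b => ?_
        rw [← add_mul]
        gcongr
        exact enorm_add_le _ _
    _ = (∫⁻ b, ‖R ħ b‖ₑ * ‖g ħ b‖ₑ) + ∫⁻ b, ‖R' ħ b‖ₑ * ‖g ħ b‖ₑ :=
        lintegral_add_left ((hm ħ hħ).enorm.mul (hg ħ hħ).enorm) _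
    _ ≤ _ := by
        rw [add_mul, ENNReal.ofReal_add (by positivity) (by positivity)]
        exact add_le_add (h ħ hħ) (h' ħ hħ)

theorem Remainder.sum {ι : Type*} (T : Finset ι) {R : ι → ℝ → Model n → ℂ} (hS : ∀ ħ ∈ S, 0 < ħ)
    (hg : ∀ ħ ∈ S, Measurable (g ħ)) (h : ∀ i ∈ T, Remainder S c x₀ μ g (R i)) :
    Remainder S c x₀ μ g fun ħ b => ∑ i ∈ T, R i ħ b := by
  classical
  induction T using Finset.induction_on with
  | empty => exact ⟨fun ħ _ => by simp, 0, le_rfl, fun ħ _ => by simp⟩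
  | insert a T ha ih =>
    simp_rw [Finset.sum_insert ha]
    exact (h a (Finset.mem_insert_self a T)).add hS hg
      (ih fun i hi => h i (Finset.mem_insert_of_mem hi))

theorem Remainder.mul_bounded {R : ℝ → Model n → ℂ} (h : Remainder S c x₀ μ g R) {a : ℝ → ℂ}
    {B : ℝ} (hB : ∀ ħ ∈ S, ‖a ħ‖ ≤ B) : Remainder S c x₀ μ g fun ħ b => a ħ * R ħ b := by
  obtain ⟨hm, C, hC, h⟩ := h
  refine ⟨fun ħ hħ => (hm ħ hħ).const_mul _, |B| * C, by positivity, fun ħ hħ => ?_⟩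
  simp_rw [enorm_mul, mul_assoc]
  rw [lintegral_const_mul' _ _ enorm_ne_top, ENNReal.ofReal_mul (abs_nonneg B), ← ofReal_norm]
  gcongr
  · exact (hB ħ hħ).trans (le_abs_self B)
  · exact h ħ hħ

theorem continuous_coord (b₀ : Model n) (i : Fin (2 * n - 1)) :
    Continuous fun b : Model n => (((b - b₀) i : ℝ) : ℂ) := (contDiff_coord b₀ i).continuous

variable [NeZero n] {ħ₀ t m : ℝ}

/-- A weight `q` on the output of the operator may be moved to the other side of the pairing, so
what counts are the orders of `f` and of `q g`. -/
theorem Localized.remainder (hκ : IsSmoothChart κ) (hc : Concentrates c x₀) (hμ : 0 < μ)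
    (hħ₀ : 2 * ħ₀ ≤ μ) (ht : t ∈ Set.Icc (0 : ℝ) 1)
    {A : ℝ → Model n × Model n → ℂ} (hA : SymbolBound (Set.Ioc 0 ħ₀) ⊤ m A)
    (hf : Localized κ x₀ c μ s f) {q : ℝ → Model n → ℂ}
    (hq : ∀ ħ ∈ Set.Ioc 0 ħ₀, Measurable (q ħ))
    (hqg : Localized κ x₀ c μ s' fun ħ b => q ħ b * g ħ b) (hs : s + s' = 2) :
    Remainder (Set.Ioc 0 ħ₀) c x₀ μ g fun ħ b => q ħ b * pseudo t ħ (A ħ) (f ħ) b := by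
  obtain ⟨C, hC, h⟩ := hf.exists_pairing_le hκ hc hμ hħ₀ ht hA hqg hs
  refine ⟨fun ħ hħ => (hq ħ hħ).mul (measurable_pseudo t ħ (hA.1 ħ hħ)
    (hf.isTest hκ hc.toSlowGrowth hħ.1)), C, hC, fun ħ hħ => ?_⟩
  rw [← mul_assoc]
  refine le_trans (le_of_eq (lintegral_congr fun b => ?_)) (h ħ hħ)
  rw [enorm_mul, enorm_mul]
  ring

variable {ξ₀ : Model n}

/-- First order expansion of an operator on a localized family. -/
theorem Localized.remainder_pseudo_sub (hκ : IsSmoothChart κ) (hc : Concentrates c x₀) (hμ : 0 < μ)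
    (hħ₀ : 2 * ħ₀ ≤ μ) (ht : t ∈ Set.Icc (0 : ℝ) 1) (hx : x₀ ∈ κ.source)
    (hξ : ∀ i, ((ξ₀ i : ℝ) : ℂ) = -Complex.I * (μ * dotGrad κ x₀ i (κ x₀)))
    {A : ℝ → Model n × Model n → ℂ} (hA : SymbolBound (Set.Ioc 0 ħ₀) ⊤ m A)
    (hf : Localized κ x₀ c μ s f) {q : ℝ → Model n → ℂ}
    (hg : ∀ ħ ∈ Set.Ioc 0 ħ₀, Measurable (g ħ))
    (hq : ∀ ħ ∈ Set.Ioc 0 ħ₀, Measurable (q ħ))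
    (hqg : Localized κ x₀ c μ s' fun ħ b => q ħ b * g ħ b) (hs : s + s' = 1) :
    Remainder (Set.Ioc 0 ħ₀) c x₀ μ g fun ħ b =>
      q ħ b * (pseudo t ħ (A ħ) (f ħ) b - A ħ (κ x₀, ξ₀) * f ħ b) := by
  obtain ⟨α, β, hα, hβ, heq⟩ := hA.exists_expansion (κ x₀, ξ₀)
  have hS : ∀ ħ ∈ Set.Ioc 0 ħ₀, 0 < ħ := fun ħ hħ => hħ.1
  have hsg := hc.toSlowGrowth
  have hqX : ∀ i, Localized κ x₀ c μ (s' + 1)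
      fun ħ b => (((b - κ x₀) i : ℝ) : ℂ) * q ħ b * g ħ b := fun i =>
    (hqg.coordMul hκ hx (by omega) i).congr fun ħ _ b => by simp only [SphereEgorov.coordMul]; ring
  have hqħ : Localized κ x₀ c μ (s' + 2) fun ħ b => (ħ : ℂ) * q ħ b * g ħ b :=
    hqg.scale.congr fun ħ _ b => by ring
  -- In each of the four terms of the expansion the total order rises from 1 to 2: the coordinate
  -- acts on `g` or on `f`, the shifted derivative acts on `f`, and the explicit ħ alone is worth
  -- two orders.
  have h1 := fun i => (hf.remainder hκ hc hμ hħ₀ ht (hα i)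
    (q := fun ħ b => (((b - κ x₀) i : ℝ) : ℂ) * q ħ b)
    (fun ħ hħ => (continuous_coord _ i).measurable.mul (hq ħ hħ)) (hqX i)
      (by omega)).mul_bounded (a := fun _ => ((1 - t : ℝ) : ℂ)) (fun ħ _ => le_rfl)
  have h2 := fun i => ((hf.coordMul hκ hx (by omega) i).remainder hκ hc hμ hħ₀ ht (hα i)
    hq hqg (by omega)).mul_bounded (a := fun _ => (t : ℂ)) (fun ħ _ => le_rfl)
  have h3 := fun i => (hf.shiftedDeriv hκ hsg hx hξ (by omega) i).remainder hκ hc hμ hħ₀ ht (hβ i)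
    hq hqg (by omega)
  have h4 := fun i => (hf.remainder hκ hc hμ hħ₀ ht ((hβ i).baseDeriv i)
    (q := fun ħ b => (ħ : ℂ) * q ħ b)
    (fun ħ hħ => (hq ħ hħ).const_mul _) (hqħ.weaken (show 2 - s ≤ s' + 2 by omega))
      (by omega)).mul_bounded (a := fun _ => (t : ℂ)) (fun ħ _ => le_rfl)
  refine ((Remainder.sum Finset.univ hS hg fun i _ => (h1 i).add hS hg (h2 i)).add hS hg
    (Remainder.sum Finset.univ hS hg fun i _ => (h3 i).add hS hg (h4 i))).congr fun ħ hħ b => ?_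
  rw [pseudo_expansion ht hα hβ heq hħ (hf.isTest hκ hsg hħ.1) b, add_assoc, add_sub_cancel_left,
    mul_add, Finset.mul_sum, Finset.mul_sum]
  congr 1
  · refine Finset.sum_congr rfl fun i _ => ?_
    push_cast
    ring
  · refine Finset.sum_congr rfl fun i _ => ?_
    ring

/-- Second order expansion of an operator on a localized family. -/
theorem Localized.exists_expansion (hκ : IsSmoothChart κ) (hc : Concentrates c x₀) (hμ : 0 < μ)
    (hħ₀ : 2 * ħ₀ ≤ μ) (ht : t ∈ Set.Icc (0 : ℝ) 1) (hx : x₀ ∈ κ.source)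
    (hξ : ∀ i, ((ξ₀ i : ℝ) : ℂ) = -Complex.I * (μ * dotGrad κ x₀ i (κ x₀)))
    {A : ℝ → Model n × Model n → ℂ} (hA : SymbolBound (Set.Ioc 0 ħ₀) ⊤ m A)
    (hf : Localized κ x₀ c μ 0 f) (hg : Localized κ x₀ c μ 0 g) :
    ∃ (u v : Fin (2 * n - 1) → ℝ → ℂ) (B : ℝ),
      (∀ i, ∀ ħ ∈ Set.Ioc 0 ħ₀, ‖u i ħ‖ ≤ B) ∧ (∀ i, ∀ ħ ∈ Set.Ioc 0 ħ₀, ‖v i ħ‖ ≤ B) ∧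
      Remainder (Set.Ioc 0 ħ₀) c x₀ μ g fun ħ b => pseudo t ħ (A ħ) (f ħ) b -
        (A ħ (κ x₀, ξ₀) * f ħ b + ∑ i, u i ħ * SphereEgorov.coordMul (κ x₀) i (f ħ) b +
          ∑ i, v i ħ * SphereEgorov.shiftedDeriv ħ ξ₀ i (f ħ) b) := by
  obtain ⟨α, β, hα, hβ, heq⟩ := hA.exists_expansion (κ x₀, ξ₀)
  have hS : ∀ ħ ∈ Set.Ioc 0 ħ₀, 0 < ħ := fun ħ hħ => hħ.1
  have hsg := hc.toSlowGrowth
  have hgm : ∀ ħ ∈ Set.Ioc 0 ħ₀, Measurable (g ħ) := fun ħ hħ =>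
    (hg.isTest hκ hsg hħ.1).1.continuous.measurable
  have hbound : ∀ γ : Fin (2 * n - 1) → ℝ → Model n × Model n → ℂ,
      (∀ i, SymbolBound (Set.Ioc 0 ħ₀) ⊤ |m| (γ i)) →
      ∃ B : ℝ, ∀ i, ∀ ħ ∈ Set.Ioc 0 ħ₀, ‖γ i ħ (κ x₀, ξ₀)‖ ≤ B := by
    intro γ hγ
    choose C hC0 hC using fun i => (hγ i).norm_le
    refine ⟨∑ i, C i * bracket ξ₀ ^ |m|, fun i ħ hħ => ?_⟩
    refine (hC i ħ hħ (κ x₀, ξ₀)).trans ?_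
    refine Finset.single_le_sum (f := fun i => C i * bracket ξ₀ ^ |m|) (fun j _ => ?_)
      (Finset.mem_univ i)
    exact mul_nonneg (hC0 j) (Real.rpow_nonneg (bracket_pos ξ₀).le _)
  obtain ⟨B₁, hB₁⟩ := hbound α hα
  obtain ⟨B₂, hB₂⟩ := hbound β hβ
  have hg1 : Localized κ x₀ c μ 0 fun ħ b => (1 : ℂ) * g ħ b := hg.congr fun ħ _ b => one_mul _
  have hX : ∀ i, Localized κ x₀ c μ 1 fun ħ b => (((b - κ x₀) i : ℝ) : ℂ) * g ħ b := fun i =>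
    (hg.coordMul hκ hx (by norm_num) i).congr fun ħ _ b => by simp only [SphereEgorov.coordMul]
  have hħg : Localized κ x₀ c μ 2 fun ħ b => (ħ : ℂ) * g ħ b := hg.scale
  have m1 : ∀ ħ ∈ Set.Ioc 0 ħ₀, Measurable fun _ : Model n => (1 : ℂ) := fun _ _ => measurable_const
  -- The operators in the first order terms are expanded once more, with total order 1, and so may
  -- be replaced by the constants α_i(b₀, ξ₀) and β_i(b₀, ξ₀). The two occurrences of α_i, with
  -- weights 1 - t and t, recombine.
  have h1 := fun i => (hf.remainder_pseudo_sub hκ hc hμ hħ₀ ht hx hξ (hα i)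
    (q := fun _ b => (((b - κ x₀) i : ℝ) : ℂ)) hgm
    (fun ħ hħ => (continuous_coord _ i).measurable) (hX i) (by norm_num)).mul_bounded
      (a := fun _ => ((1 - t : ℝ) : ℂ)) (fun ħ _ => le_rfl)
  have h2 := fun i => ((hf.coordMul hκ hx (by norm_num) i).remainder_pseudo_sub hκ hc hμ hħ₀ ht hx
    hξ (hα i) (q := fun _ _ => (1 : ℂ)) hgm m1 hg1 (by norm_num)).mul_bounded
      (a := fun _ => (t : ℂ)) (fun ħ _ => le_rfl)
  have h3 := fun i => (hf.shiftedDeriv hκ hsg hx hξ (by norm_num) i).remainder_pseudo_sub hκ hc hμ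
    hħ₀ ht hx hξ (hβ i) (q := fun _ _ => (1 : ℂ)) hgm m1 hg1 (by norm_num)
  have h4 := fun i => (hf.remainder hκ hc hμ hħ₀ ht ((hβ i).baseDeriv i)
    (q := fun ħ _ => (ħ : ℂ)) (fun ħ hħ => measurable_const) hħg (by norm_num)).mul_bounded
      (a := fun _ => (t : ℂ)) (fun ħ _ => le_rfl)
  refine ⟨fun i ħ => α i ħ (κ x₀, ξ₀), fun i ħ => β i ħ (κ x₀, ξ₀), max B₁ B₂,
    fun i ħ hħ => (hB₁ i ħ hħ).trans (le_max_left _ _),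
    fun i ħ hħ => (hB₂ i ħ hħ).trans (le_max_right _ _), ?_⟩
  refine ((Remainder.sum Finset.univ hS hgm fun i _ => (h1 i).add hS hgm (h2 i)).add hS hgm
    (Remainder.sum Finset.univ hS hgm fun i _ => (h3 i).add hS hgm (h4 i))).congr fun ħ hħ b => ?_
  rw [pseudo_expansion ht hα hβ heq hħ (hf.isTest hκ hsg hħ.1) b]
  have e : ∀ p q r p' q' : ℂ, p + q + r - (p + p' + q') = (q - p') + (r - q') := fun _ _ _ _ _ => by
    ring
  rw [e, ← Finset.sum_sub_distrib, ← Finset.sum_sub_distrib]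
  congr 1
  · refine Finset.sum_congr rfl fun i _ => ?_
    simp only [SphereEgorov.coordMul]
    push_cast
    ring
  · refine Finset.sum_congr rfl fun i _ => ?_
    ring

/-- Localized families of second order are remainders. -/
theorem Localized.remainder_self (hκ : IsSmoothChart κ) (hc : Concentrates c x₀) (hμ : 0 < μ)
    (hħ₀ : 2 * ħ₀ ≤ μ) (hf : Localized κ x₀ c μ 2 f) (hg : Localized κ x₀ c μ 0 g) :
    Remainder (Set.Ioc 0 ħ₀) c x₀ μ g f := by
  have ht : (0 : ℝ) ∈ Set.Icc (0 : ℝ) 1 := by simp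
  have hg1 : Localized κ x₀ c μ 0 fun ħ b => (1 : ℂ) * g ħ b := hg.congr fun ħ _ b => one_mul _
  -- The constant symbol 1 quantizes to the identity, so this is the pairing estimate with a trivial
  -- operator.
  refine (hf.remainder hκ hc hμ hħ₀ ht (SymbolBound.const_zero_order (1 : ℂ))
    (q := fun _ _ => 1) (fun _ _ => measurable_const) hg1 rfl).congr fun ħ hħ b => ?_
  rw [pseudo_const ht hħ.1 1 (hf.isTest hκ hc.toSlowGrowth hħ.1)]
  ring

end Remainders

/-! ### Integrals over the sphere of relative size `ħ` -/

section SmallIntegrals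

open MeasureTheory

variable {n : ℕ} {x₀ : CSphere n} {c : ℕ → ℝ} {μ : ℝ} {S : Set ℝ}

/-- Functions of `ħ` that are `O(ħ ‖K‖²)`. -/
def IsSmall (S : Set ℝ) (c : ℕ → ℝ) (x₀ : CSphere n) (μ : ℝ) (I : ℝ → ℂ) : Prop :=
  ∃ C : ℝ, 0 ≤ C ∧ ∀ ħ ∈ S, ‖I ħ‖ ≤ C * (ħ * egfMass c x₀ (μ / ħ))

theorem IsSmall.congr {I J : ℝ → ℂ} (h : IsSmall S c x₀ μ I) (e : ∀ ħ ∈ S, J ħ = I ħ) :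
    IsSmall S c x₀ μ J := by
  obtain ⟨C, hC, h⟩ := h
  exact ⟨C, hC, fun ħ hħ => by rw [e ħ hħ]; exact h ħ hħ⟩

theorem IsSmall.mono {S' : Set ℝ} {I : ℝ → ℂ} (h : IsSmall S c x₀ μ I) (e : S' ⊆ S) :
    IsSmall S' c x₀ μ I := by
  obtain ⟨C, hC, h⟩ := h
  exact ⟨C, hC, fun ħ hħ => h ħ (e hħ)⟩

theorem IsSmall.add {I J : ℝ → ℂ} (h : IsSmall S c x₀ μ I) (h' : IsSmall S c x₀ μ J) :
    IsSmall S c x₀ μ fun ħ => I ħ + J ħ := by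
  obtain ⟨C, hC, h⟩ := h
  obtain ⟨C', hC', h'⟩ := h'
  refine ⟨C + C', by positivity, fun ħ hħ => ?_⟩
  rw [add_mul]
  exact (norm_add_le _ _).trans (add_le_add (h ħ hħ) (h' ħ hħ))

theorem IsSmall.sum {ι : Type*} (T : Finset ι) {I : ι → ℝ → ℂ}
    (h : ∀ i ∈ T, IsSmall S c x₀ μ (I i)) : IsSmall S c x₀ μ fun ħ => ∑ i ∈ T, I i ħ := by
  classical
  induction T using Finset.induction_on with
  | empty => exact ⟨0, le_rfl, fun ħ _ => by simp⟩
  | insert a T ha ih =>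
    simp_rw [Finset.sum_insert ha]
    exact (h a (Finset.mem_insert_self a T)).add (ih fun i hi => h i (Finset.mem_insert_of_mem hi))

theorem IsSmall.mul_bounded {I a : ℝ → ℂ} (h : IsSmall S c x₀ μ I) {B : ℝ}
    (hB : ∀ ħ ∈ S, ‖a ħ‖ ≤ B) : IsSmall S c x₀ μ fun ħ => a ħ * I ħ := by
  obtain ⟨C, hC, h⟩ := h
  refine ⟨|B| * C, by positivity, fun ħ hħ => ?_⟩
  rw [norm_mul, mul_assoc]
  exact mul_le_mul ((hB ħ hħ).trans (le_abs_self B)) (h ħ hħ) (norm_nonneg _) (abs_nonneg _)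

end SmallIntegrals

/-! ### From estimates in a chart to integrals over the sphere -/

section Transfer

open MeasureTheory

variable {n : ℕ} {κ : Chart n} {x₀ : CSphere n} {c : ℕ → ℝ} {μ ħ₀ : ℝ} {S : Set ℝ}

theorem chartPush_of_mem {f : CSphere n → ℂ} {b : Model n} (hb : b ∈ κ.target) :
    chartPush κ f b = f (κ.symm b) := Set.indicator_of_mem hb _

theorem chartPush_apply {f : CSphere n → ℂ} {x : CSphere n} (hx : x ∈ κ.source) :
    chartPush κ f (κ x) = f x := by
  rw [chartPush_of_mem (κ.map_source hx), κ.left_inv hx]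

theorem isCompact_image_tsupport {f : CSphere n → ℂ} (hf : tsupport f ⊆ κ.source) :
    IsCompact (κ '' tsupport f) :=
  (isClosed_tsupport f).isCompact.image_of_continuousOn (κ.continuousOn.mono hf)

theorem image_tsupport_subset {f : CSphere n → ℂ} (hf : tsupport f ⊆ κ.source) :
    κ '' tsupport f ⊆ κ.target := by
  rintro _ ⟨x, hx, rfl⟩
  exact κ.map_source (hf hx)

theorem chartPush_eq_zero {f : CSphere n → ℂ} {b : Model n} (hb : b ∉ κ '' tsupport f) :
    chartPush κ f b = 0 := by
  by_cases h : b ∈ κ.target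
  · rw [chartPush_of_mem h]
    by_contra h0
    exact hb ⟨κ.symm b, subset_tsupport f h0, κ.right_inv h⟩
  · exact Set.indicator_of_notMem h _

variable [NeZero n]

theorem contMDiff_smooth (ψ : Smooth n) :
    ContMDiff (𝓡 (2 * n - 1)) 𝓘(ℝ, ℂ) ∞ (ψ : CSphere n → ℂ) := ψ.2

theorem continuous_smooth (ψ : Smooth n) : Continuous (ψ : CSphere n → ℂ) := (contMDiff_smooth ψ).continuous

theorem contDiffOn_smooth_symm (ψ : Smooth n) (hκ : IsSmoothChart κ) :
    ContDiffOn ℝ ∞ (fun b => (ψ : CSphere n → ℂ) (κ.symm b)) κ.target := by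
  rw [← contMDiffOn_iff_contDiffOn]
  exact (contMDiff_smooth ψ).comp_contMDiffOn (contMDiffOn_symm_of_mem_maximalAtlas hκ)

theorem isCutoff_chartPush (hκ : IsSmoothChart κ) (ψ : Smooth n)
    (hψ : tsupport (ψ : CSphere n → ℂ) ⊆ κ.source) : IsCutoff κ (chartPush κ ψ) := by
  have hK := isCompact_image_tsupport hψ
  have hsub : tsupport (chartPush κ (ψ : CSphere n → ℂ)) ⊆ κ '' tsupport (ψ : CSphere n → ℂ) := by
    refine closure_minimal (fun b hb => ?_) hK.isClosed
    by_contra h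
    exact hb (chartPush_eq_zero h)
  refine ⟨contDiff_iff_contDiffAt.2 fun b => ?_, hK.of_isClosed_subset (isClosed_tsupport _) hsub,
    hsub.trans (image_tsupport_subset hψ)⟩
  by_cases hb : b ∈ κ.target
  · have hn := κ.open_target.mem_nhds hb
    refine ((contDiffOn_smooth_symm ψ hκ).contDiffAt hn).congr_of_eventuallyEq ?_
    filter_upwards [hn] with b' hb' using chartPush_of_mem hb'
  · have hn := hK.isClosed.isOpen_compl.mem_nhds fun h => hb (image_tsupport_subset hψ h)
    refine (contDiffAt_const (c := (0 : ℂ))).congr_of_eventuallyEq ?_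
    filter_upwards [hn] with b' hb' using chartPush_eq_zero hb'

/-- Only absolute values are compared, so the density of the surface measure in the chart enters
through a constant. -/
theorem Remainder.isSmall (hκ : IsSmoothChart κ) {g R : ℝ → Model n → ℂ} {T : Set (Model n)}
    (hT : IsCompact T) (hTκ : T ⊆ κ.target) (h : Remainder S c x₀ μ g R)
    {Θ : ℝ → CSphere n → ℂ} (hout : ∀ ħ ∈ S, ∀ x, x ∉ κ.symm '' T → Θ ħ x = 0)
    (hin : ∀ ħ ∈ S, ∀ b ∈ T, ‖Θ ħ (κ.symm b)‖ ≤ ‖R ħ b‖ * ‖g ħ b‖) (hS : ∀ ħ ∈ S, 0 < ħ) :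
    IsSmall S c x₀ μ fun ħ => ∫ x, Θ ħ x ∂(surfaceMeasure n) := by
  obtain ⟨-, C, hC, h⟩ := h
  obtain ⟨D, hD, -⟩ := exists_lintegral_bounds hκ hT hTκ
  refine ⟨D * C, by positivity, fun ħ hħ => ?_⟩
  have hm := egfMass_nonneg c x₀ (μ / ħ)
  have hħ0 := (hS ħ hħ).le
  have hTm : MeasurableSet (κ.symm '' T) :=
    (hT.image_of_continuousOn (κ.continuousOn_symm.mono hTκ)).measurableSet
  have h1 : ‖∫ x, Θ ħ x ∂(surfaceMeasure n)‖ₑ ≤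
      ENNReal.ofReal (D * C * (ħ * egfMass c x₀ (μ / ħ))) := by
    calc ‖∫ x, Θ ħ x ∂(surfaceMeasure n)‖ₑ
        ≤ ∫⁻ x, ‖Θ ħ x‖ₑ ∂(surfaceMeasure n) := enorm_integral_le_lintegral_enorm _
      _ = ∫⁻ x in κ.symm '' T, ‖Θ ħ x‖ₑ ∂(surfaceMeasure n) := by
          rw [← lintegral_indicator hTm]
          refine lintegral_congr fun x => ?_
          by_cases hx : x ∈ κ.symm '' T
          · rw [Set.indicator_of_mem hx]
          · rw [Set.indicator_of_notMem hx, hout ħ hħ x hx, enorm_zero]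
      _ ≤ D * ∫⁻ b in T, ‖Θ ħ (κ.symm b)‖ₑ := hD _
      _ ≤ D * ∫⁻ b, ‖R ħ b‖ₑ * ‖g ħ b‖ₑ := by
          refine mul_le_mul_right ?_ _
          refine (setLIntegral_mono' hT.measurableSet fun b hb => ?_).trans
            (setLIntegral_le_lintegral T _)
          rw [← enorm_mul]
          refine enorm_le_iff_norm_le.2 ?_
          rw [norm_mul]
          exact hin ħ hħ b hb
      _ ≤ D * ENNReal.ofReal (C * (ħ * egfMass c x₀ (μ / ħ))) := by gcongr; exact h ħ hħ
      _ = _ := by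
          rw [mul_assoc (D : ℝ), ENNReal.ofReal_mul (NNReal.coe_nonneg D), ENNReal.ofReal_coe_nnreal]
  rw [← ofReal_norm] at h1
  exact (ENNReal.ofReal_le_ofReal_iff (by positivity)).1 h1

theorem continuous_mul_comp_chart (ψ : Smooth n)
    (hψ : tsupport (ψ : CSphere n → ℂ) ⊆ κ.source) {G : Model n → ℂ}
    (hG : ContinuousOn G κ.target) :
    Continuous fun x => (ψ : CSphere n → ℂ) x * G (κ x) := by
  refine ContinuousOn.continuous_of_tsupport_subset (s := κ.source) ?_ κ.open_source ?_
  · exact (continuous_smooth ψ).continuousOn.mul (hG.comp κ.continuousOn fun x hx => κ.map_source hx)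
  · exact (closure_mono (Function.support_mul_subset_left _ _)).trans hψ

theorem Concentrates.isSmall_of_vanishing (hc : Concentrates c x₀) (hκ : IsSmoothChart κ)
    (hμ : 0 < μ) (hħ₀ : 2 * ħ₀ ≤ μ) (hx : x₀ ∈ κ.source) (ψ : Smooth n)
    (hψ : tsupport (ψ : CSphere n → ℂ) ⊆ κ.source) {G : Model n → ℂ}
    (hG : ContDiffOn ℝ ∞ G κ.target) (h0 : G (κ x₀) = 0) :
    IsSmall (Set.Ioc 0 ħ₀) c x₀ μ fun ħ => ∫ x, (ψ : CSphere n → ℂ) x * G (κ x) *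
      ((‖egf c (scaledDot x₀ (μ / ħ) x)‖ ^ 2 : ℝ) : ℂ) ∂(surfaceMeasure n) := by
  have hT := κ.open_target.mem_nhds (κ.map_source hx)
  obtain ⟨C, hC, h⟩ := hc.exists_integral_vanishing_le
    (continuous_mul_comp_chart ψ hψ hG.continuousOn) hκ hx
    (by
      refine ((((contDiffOn_smooth_symm ψ hκ).mul hG).contDiffAt hT).of_le
        ENat.LEInfty.out).congr_of_eventuallyEq ?_
      filter_upwards [hT] with b hb
      simp only [κ.right_inv hb]) (by simp [h0])
  refine ⟨C * μ⁻¹, by positivity, fun ħ hħ => ?_⟩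
  have h2 : 2 ≤ μ / ħ := by rw [le_div_iff₀ hħ.1]; linarith [hħ.2]
  refine (h _ h2).trans (le_of_eq ?_)
  rw [inv_div]
  ring

end Transfer

/-! ### Localization of the covariant symbol -/

section LocalSymbol

open MeasureTheory

variable {n : ℕ} {κ : Chart n} {x₀ : CSphere n} {c : ℕ → ℝ} {μ ħ₀ t m : ℝ}
  {ξ₀ : Model n}

theorem mul_conj_eq_sq (w : ℂ) : w * conj w = ((‖w‖ ^ 2 : ℝ) : ℂ) := by
  rw [Complex.mul_conj, Complex.normSq_eq_norm_sq]

theorem integral_sub_add_add {X : Type*} [MeasurableSpace X] {ν : Measure X} {f g p q : X → ℂ}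
    (hf : Integrable f ν) (hg : Integrable g ν) (hp : Integrable p ν) (hq : Integrable q ν) :
    ∫ x, (f x - (g x + p x + q x)) ∂ν = ∫ x, f x ∂ν - (∫ x, g x ∂ν + ∫ x, p x ∂ν + ∫ x, q x ∂ν) := by
  have h1 : ∫ x, (g x + p x + q x) ∂ν = ∫ x, (g x + p x) ∂ν + ∫ x, q x ∂ν :=
    integral_add (hg.add hp) hq
  rw [← integral_add hg hp, ← h1]
  exact integral_sub hf ((hg.add hp).add hq)

theorem chartPush_mul_egf (ψ : CSphere n → ℂ) (lam : ℝ) :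
    chartPush κ (fun x => ψ x * egf c (scaledDot x₀ lam x)) =
      fun b => chartPush κ ψ b * egfChart c κ x₀ lam 0 b := by
  funext b
  by_cases hb : b ∈ κ.target
  · rw [chartPush_of_mem hb, chartPush_of_mem hb, egfChart, egfShift_zero]
  · rw [chartPush, chartPush, Set.indicator_of_notMem hb, Set.indicator_of_notMem hb, zero_mul]

theorem continuous_conj_egf (hc : SlowGrowth c) (x₀ : CSphere n) (lam : ℝ) :
    Continuous fun x => conj (egf c (scaledDot x₀ lam x)) :=
  Complex.continuous_conj.comp
    (hc.expGrowth.continuous_egf.comp (continuous_scaledDot x₀ lam))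

theorem continuous_sq_egf (hc : SlowGrowth c) (x₀ : CSphere n) (lam : ℝ) :
    Continuous fun x => ((‖egf c (scaledDot x₀ lam x)‖ ^ 2 : ℝ) : ℂ) :=
  Complex.continuous_ofReal.comp
    ((hc.expGrowth.continuous_egf.comp (continuous_scaledDot x₀ lam)).norm.pow 2)

theorem exists_norm_le_norm_sub_sq {ψ : CSphere n → ℂ} (hψ : Continuous ψ) {x₀ : CSphere n}
    (hx : x₀ ∉ tsupport ψ) :
    ∃ C : ℝ, 0 ≤ C ∧ ∀ x, ‖ψ x‖ ≤ C * ‖(x : Cn n) - x₀‖ ^ 2 := by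
  obtain ⟨D, hD⟩ := (HasCompactSupport.of_compactSpace ψ).exists_bound_of_continuous hψ
  obtain ⟨δ, hδ, hball⟩ := Metric.isOpen_iff.1 (isClosed_tsupport ψ).isOpen_compl x₀ hx
  have hD0 : 0 ≤ D := (norm_nonneg _).trans (hD x₀)
  refine ⟨D * (δ ^ 2)⁻¹, by positivity, fun x => ?_⟩
  by_cases h : ψ x = 0
  · rw [h, norm_zero]; positivity
  · have h1 : δ ≤ ‖(x : Cn n) - x₀‖ := by
      by_contra h2
      refine hball (?_ : x ∈ Metric.ball x₀ δ) (subset_tsupport ψ h)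
      rw [Metric.mem_ball, Subtype.dist_eq, dist_eq_norm]
      exact not_le.1 h2
    refine (hD x).trans ?_
    rw [mul_assoc]
    refine le_mul_of_one_le_right hD0 ?_
    rw [← div_eq_inv_mul, one_le_div (by positivity)]
    gcongr

variable [NeZero n]

/-- To second order ħD_i - ξ₀_i acts on the family as multiplication by a function, which vanishes
at the center once ξ₀ is the differential of the phase. The error consists of the derivative of the
cutoff and a difference of consecutive shifts. -/
theorem exists_localized_shiftedDeriv (hκ : IsSmoothChart κ) (hc : SlowGrowth c) {h : Model n → ℂ}
    (hh : IsCutoff κ h) (x₀ : CSphere n) (μ : ℝ) (ξ₀ : Model n) (i : Fin (2 * n - 1)) :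
    ∃ R : ℝ → Model n → ℂ, Localized κ x₀ c μ 2 R ∧ ∀ ħ > 0, ∀ b,
      shiftedDeriv ħ ξ₀ i (fun b => h b * egfChart c κ x₀ (μ / ħ) 0 b) b =
        R ħ b + h b * (-Complex.I * (μ * dotGrad κ x₀ i b) - ((ξ₀ i : ℝ) : ℂ)) *
          egfChart c κ x₀ (μ / ħ) 0 b := by
  have h1 : IsCutoff κ fun b => h b * (-Complex.I * (μ * dotGrad κ x₀ i b)) :=
    hh.mul (contDiffOn_const.mul (contDiffOn_const.mul (contDiffOn_dotGrad hκ x₀ i)))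
  refine ⟨_, (((hh.isCutoff_partialDeriv i).localized_zero x₀ c μ 0).const_mul
    (-Complex.I)).scale.add (.diff h1 0), fun ħ hħ b => ?_⟩
  rw [shiftedDeriv, hh.scaledDeriv_mul hκ hc x₀ hħ.ne' μ 0 i b]
  ring

/-- After the second order expansion, the first order terms become averages of functions of the
point against ψ|K|². These functions vanish at `x₀`, so by the reflection symmetry the averages are
O(ħ). -/
theorem Concentrates.isSmall_pairing (hκ : IsSmoothChart κ) (hc : Concentrates c x₀)
    (hμ : 0 < μ) (hħ₀ : 2 * ħ₀ ≤ μ) (ht : t ∈ Set.Icc (0 : ℝ) 1) (hx : x₀ ∈ κ.source)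
    (hξ : ∀ i, ((ξ₀ i : ℝ) : ℂ) = -Complex.I * (μ * dotGrad κ x₀ i (κ x₀)))
    {A : ℝ → Model n × Model n → ℂ} (hA : SymbolBound (Set.Ioc 0 ħ₀) ⊤ m A)
    {Φ ψ : Smooth n} (hΦ : tsupport (Φ : CSphere n → ℂ) ⊆ κ.source)
    (hψ : tsupport (ψ : CSphere n → ℂ) ⊆ κ.source)
    (hΦψ : ∀ x, (ψ : CSphere n → ℂ) x ≠ 0 → (Φ : CSphere n → ℂ) x = 1)
    {B : ℝ → CSphere n → ℂ} (hB : ∀ ħ, Continuous (B ħ))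
    (hloc : ∀ ħ ∈ Set.Ioc 0 ħ₀, ∀ x, (Φ : CSphere n → ℂ) x * B ħ x =
      (Φ : CSphere n → ℂ) x * pseudo t ħ (A ħ)
        (chartPush κ fun x => (ψ : CSphere n → ℂ) x * egf c (scaledDot x₀ (μ / ħ) x)) (κ x)) :
    IsSmall (Set.Ioc 0 ħ₀) c x₀ μ fun ħ =>
      ∫ x, (Φ : CSphere n → ℂ) x * B ħ x * conj (egf c (scaledDot x₀ (μ / ħ) x))
          ∂(surfaceMeasure n) -
        A ħ (κ x₀, ξ₀) * ∫ x, (ψ : CSphere n → ℂ) x *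
          ((‖egf c (scaledDot x₀ (μ / ħ) x)‖ ^ 2 : ℝ) : ℂ) ∂(surfaceMeasure n) := by
  have hs := hc.toSlowGrowth
  have hh := isCutoff_chartPush hκ ψ hψ
  have hf := hh.localized_zero x₀ c μ 0
  have hg := (isCutoff_chartPush hκ Φ hΦ).localized_zero x₀ c μ 0
  have hS : ∀ ħ ∈ Set.Ioc 0 ħ₀, 0 < ħ := fun ħ hħ => hħ.1
  have hgm := fun ħ (hħ : ħ ∈ Set.Ioc 0 ħ₀) => (hg.isTest hκ hs hħ.1).1.continuous.measurable
  obtain ⟨u, v, D, hu, hv, hrem⟩ := hf.exists_expansion hκ hc hμ hħ₀ ht hx hξ hA hg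
  choose R' hR' hR'eq using fun i => exists_localized_shiftedDeriv hκ hs hh x₀ μ ξ₀ i
  have hRtot := hrem.add hS hgm (Remainder.sum Finset.univ hS hgm fun i _ =>
    ((hR' i).remainder_self hκ hc hμ hħ₀ hg).mul_bounded (hv i))
  have hX : ∀ i, ContDiffOn ℝ ∞ (fun b : Model n => (((b - κ x₀) i : ℝ) : ℂ)) κ.target :=
    fun i => (contDiff_coord (κ x₀) i).contDiffOn
  have hP : ∀ i, ContDiffOn ℝ ∞
      (fun b : Model n => -Complex.I * (μ * dotGrad κ x₀ i b) - ((ξ₀ i : ℝ) : ℂ)) κ.target :=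
    fun i => (contDiffOn_const.mul (contDiffOn_const.mul (contDiffOn_dotGrad hκ x₀ i))).sub
      contDiffOn_const
  have hXs := fun i => (hc.isSmall_of_vanishing hκ hμ hħ₀ hx ψ hψ (hX i) (by simp)).mul_bounded
    (hu i)
  have hPs := fun i => (hc.isSmall_of_vanishing hκ hμ hħ₀ hx ψ hψ (hP i)
    (by simp [hξ i])).mul_bounded (hv i)
  -- The explicit terms are subtracted as functions on the sphere before the chart estimate is used;
  -- thus their integrals remain exact surface integrals.
  have hΘ := hRtot.isSmall hκ (isCompact_image_tsupport hΦ) (image_tsupport_subset hΦ)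
    (Θ := fun ħ x => (Φ : CSphere n → ℂ) x * B ħ x * conj (egf c (scaledDot x₀ (μ / ħ) x)) -
      (A ħ (κ x₀, ξ₀) * ((ψ : CSphere n → ℂ) x *
          ((‖egf c (scaledDot x₀ (μ / ħ) x)‖ ^ 2 : ℝ) : ℂ)) +
        ∑ i, u i ħ * ((ψ : CSphere n → ℂ) x * (((κ x - κ x₀) i : ℝ) : ℂ) *
          ((‖egf c (scaledDot x₀ (μ / ħ) x)‖ ^ 2 : ℝ) : ℂ)) +
        ∑ i, v i ħ * ((ψ : CSphere n → ℂ) x *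
          (-Complex.I * (μ * dotGrad κ x₀ i (κ x)) - ((ξ₀ i : ℝ) : ℂ)) *
          ((‖egf c (scaledDot x₀ (μ / ħ) x)‖ ^ 2 : ℝ) : ℂ)))) ?_ ?_ hS
  · refine (hΘ.add ((IsSmall.sum Finset.univ fun i _ => hXs i).add
      (IsSmall.sum Finset.univ fun i _ => hPs i))).congr fun ħ hħ => ?_
    have hK2 := continuous_sq_egf hs x₀ (μ / ħ)
    have i1 : Integrable (fun x => (Φ : CSphere n → ℂ) x * B ħ x *
        conj (egf c (scaledDot x₀ (μ / ħ) x))) (surfaceMeasure n) :=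
      integrable_of_continuous (((continuous_smooth Φ).mul (hB ħ)).mul (continuous_conj_egf hs x₀ _))
    have i2 : Integrable (fun x => A ħ (κ x₀, ξ₀) * ((ψ : CSphere n → ℂ) x *
        ((‖egf c (scaledDot x₀ (μ / ħ) x)‖ ^ 2 : ℝ) : ℂ))) (surfaceMeasure n) :=
      (integrable_of_continuous ((continuous_smooth ψ).mul hK2)).const_mul _
    have i3 : ∀ i, Integrable (fun x => u i ħ * ((ψ : CSphere n → ℂ) x *
        (((κ x - κ x₀) i : ℝ) : ℂ) * ((‖egf c (scaledDot x₀ (μ / ħ) x)‖ ^ 2 : ℝ) : ℂ)))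
        (surfaceMeasure n) := fun i => (integrable_of_continuous
          ((continuous_mul_comp_chart ψ hψ (hX i).continuousOn).mul hK2)).const_mul _
    have i4 : ∀ i, Integrable (fun x => v i ħ * ((ψ : CSphere n → ℂ) x *
        (-Complex.I * (μ * dotGrad κ x₀ i (κ x)) - ((ξ₀ i : ℝ) : ℂ)) *
        ((‖egf c (scaledDot x₀ (μ / ħ) x)‖ ^ 2 : ℝ) : ℂ)))
        (surfaceMeasure n) := fun i => (integrable_of_continuous
          ((continuous_mul_comp_chart ψ hψ (hP i).continuousOn).mul hK2)).const_mul _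
    rw [integral_sub_add_add i1 i2 (integrable_finsetSum _ fun i _ => i3 i)
      (integrable_finsetSum _ fun i _ => i4 i),
      integral_finsetSum _ fun i _ => i3 i, integral_finsetSum _ fun i _ => i4 i]
    simp_rw [integral_const_mul]
    ring
  · intro ħ hħ x hx'
    have h1 : (Φ : CSphere n → ℂ) x = 0 := by
      by_contra h
      have h2 := subset_tsupport _ h
      exact hx' ⟨κ x, ⟨x, h2, rfl⟩, κ.left_inv (hΦ h2)⟩
    have h2 : (ψ : CSphere n → ℂ) x = 0 := by
      by_contra h
      rw [hΦψ x h] at h1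
      exact one_ne_zero h1
    simp [h1, h2]
  · rintro ħ hħ _ ⟨x, hxΦ, rfl⟩
    have hxs := hΦ hxΦ
    -- As Φ = 1 wherever ψ ≠ 0, Φ can be dropped in front of ψ. It is Φ that cuts the second factor
    -- K off to the chart.
    have h1 : (Φ : CSphere n → ℂ) x * (ψ : CSphere n → ℂ) x = (ψ : CSphere n → ℂ) x := by
      by_cases h : (ψ : CSphere n → ℂ) x = 0
      · simp [h]
      · rw [hΦψ x h, one_mul]
    rw [κ.left_inv hxs, hloc ħ hħ x, chartPush_mul_egf]
    simp only [hR'eq _ ħ hħ.1, SphereEgorov.coordMul, ← mul_conj_eq_sq]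
    rw [chartPush_apply hxs, chartPush_apply hxs, egfChart, κ.left_inv hxs, egfShift_zero,
      norm_mul, ← RCLike.norm_conj (egf c (scaledDot x₀ (μ / ħ) x)), ← norm_mul, ← norm_mul]
    refine le_of_eq (congrArg _ ?_)
    generalize egf c (scaledDot x₀ (μ / ħ) x) = K at *
    generalize pseudo t ħ (A ħ) _ (κ x) = P
    simp only [mul_add, Finset.sum_add_distrib]
    have e1 : ∀ w : Fin (2 * n - 1) → ℂ, ∑ i, u i ħ * ((ψ : CSphere n → ℂ) x * w i * (K * conj K)) =
        (Φ : CSphere n → ℂ) x * conj K * ∑ i, u i ħ * (w i * ((ψ : CSphere n → ℂ) x * K)) := by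
      intro w
      rw [Finset.mul_sum]
      refine Finset.sum_congr rfl fun i _ => ?_
      linear_combination (-(u i ħ * w i * K * conj K)) * h1
    have e2 : ∀ w : Fin (2 * n - 1) → ℂ, ∑ i, v i ħ * ((ψ : CSphere n → ℂ) x * w i * (K * conj K)) =
        (Φ : CSphere n → ℂ) x * conj K * ∑ i, v i ħ * ((ψ : CSphere n → ℂ) x * w i * K) := by
      intro w
      rw [Finset.mul_sum]
      refine Finset.sum_congr rfl fun i _ => ?_
      linear_combination (-(v i ħ * w i * K * conj K)) * h1
    rw [e1, e2]
    linear_combination (A ħ (κ x₀, ξ₀) * K * conj K) * h1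

theorem Concentrates.isSmall_of_notMem_tsupport (hc : Concentrates c x₀) (hμ : 0 < μ)
    (hħ₀ : 2 * ħ₀ ≤ μ) {ψ : CSphere n → ℂ} (hψ : Continuous ψ) (hx : x₀ ∉ tsupport ψ) :
    IsSmall (Set.Ioc 0 ħ₀) c x₀ μ fun ħ => ∫ x, ψ x *
      ((‖egf c (scaledDot x₀ (μ / ħ) x)‖ ^ 2 : ℝ) : ℂ) ∂(surfaceMeasure n) := by
  obtain ⟨D, hD, hle⟩ := exists_norm_le_norm_sub_sq hψ hx
  obtain ⟨C, hC, h⟩ := hc.exists_integral_pow_le 0 (s := 1) (by norm_num)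
  refine ⟨D * (C * μ⁻¹), by positivity, fun ħ hħ => ?_⟩
  have h2 : 2 ≤ μ / ħ := by rw [le_div_iff₀ hħ.1]; linarith [hħ.2]
  have hK : Continuous fun x => ‖egf c (scaledDot x₀ (μ / ħ) x)‖ ^ 2 :=
    ((hc.toSlowGrowth.expGrowth.continuous_egf.comp (continuous_scaledDot x₀ _)).norm.pow 2)
  have hr : Continuous fun x : CSphere n => ‖(x : Cn n) - x₀‖ ^ 2 := by fun_prop
  calc ‖∫ x, ψ x * ((‖egf c (scaledDot x₀ (μ / ħ) x)‖ ^ 2 : ℝ) : ℂ) ∂(surfaceMeasure n)‖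
      ≤ ∫ x, ‖ψ x * ((‖egf c (scaledDot x₀ (μ / ħ) x)‖ ^ 2 : ℝ) : ℂ)‖ ∂(surfaceMeasure n) :=
        norm_integral_le_integral_norm _
    _ ≤ ∫ x, D * (‖(x : Cn n) - x₀‖ ^ 2 * ‖egf c (scaledDot x₀ (μ / ħ) x)‖ ^ 2)
          ∂(surfaceMeasure n) := by
        refine integral_mono (integrable_of_continuous
          (hψ.mul (Complex.continuous_ofReal.comp hK)).norm)
          ((integrable_of_continuous (hr.mul hK)).const_mul _) fun x => ?_
        rw [norm_mul, Complex.norm_real, Real.norm_of_nonneg (by positivity), ← mul_assoc]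
        exact mul_le_mul_of_nonneg_right (hle x) (by positivity)
    _ ≤ D * (C * (μ / ħ)⁻¹ ^ 1 * egfMass c x₀ (μ / ħ)) := by
        rw [integral_const_mul]
        exact mul_le_mul_of_nonneg_left (h _ h2) hD
    _ = _ := by
        rw [inv_div]
        ring

/-- A cutoff vanishing near `x₀` is O(|x - x₀|²), so ψ K is localized of order 2 and the pairing
estimate already gives O(ħ). -/
theorem Concentrates.isSmall_pairing_of_notMem (hκ : IsSmoothChart κ) (hc : Concentrates c x₀)
    (hμ : 0 < μ) (hħ₀ : 2 * ħ₀ ≤ μ) (ht : t ∈ Set.Icc (0 : ℝ) 1)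
    {A : ℝ → Model n × Model n → ℂ} (hA : SymbolBound (Set.Ioc 0 ħ₀) ⊤ m A)
    {Φ ψ : Smooth n} (hΦ : tsupport (Φ : CSphere n → ℂ) ⊆ κ.source)
    (hψ : tsupport (ψ : CSphere n → ℂ) ⊆ κ.source) (hx : x₀ ∉ tsupport (ψ : CSphere n → ℂ))
    {B : ℝ → CSphere n → ℂ}
    (hloc : ∀ ħ ∈ Set.Ioc 0 ħ₀, ∀ x, (Φ : CSphere n → ℂ) x * B ħ x =
      (Φ : CSphere n → ℂ) x * pseudo t ħ (A ħ)
        (chartPush κ fun x => (ψ : CSphere n → ℂ) x * egf c (scaledDot x₀ (μ / ħ) x)) (κ x)) :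
    IsSmall (Set.Ioc 0 ħ₀) c x₀ μ fun ħ =>
      ∫ x, (Φ : CSphere n → ℂ) x * B ħ x * conj (egf c (scaledDot x₀ (μ / ħ) x))
          ∂(surfaceMeasure n) := by
  have hh := isCutoff_chartPush hκ ψ hψ
  obtain ⟨D, hD, hle⟩ := exists_norm_le_norm_sub_sq (continuous_smooth ψ) hx
  have hf : Localized κ x₀ c μ 2 _ := .base hh 0 le_rfl (C := D) fun b hb => by
    rw [chartPush_of_mem hb]
    exact hle _
  have hg := (isCutoff_chartPush hκ Φ hΦ).localized_zero x₀ c μ 0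
  have hrem := hf.remainder hκ hc hμ hħ₀ ht hA (q := fun _ _ => 1)
    (fun _ _ => measurable_const) (hg.congr fun ħ _ b => one_mul _) rfl
  refine hrem.isSmall hκ (isCompact_image_tsupport hΦ) (image_tsupport_subset hΦ) ?_ ?_
    fun ħ hħ => hħ.1
  · intro ħ hħ x hx'
    have h1 : (Φ : CSphere n → ℂ) x = 0 := by
      by_contra h
      have h2 := subset_tsupport _ h
      exact hx' ⟨κ x, ⟨x, h2, rfl⟩, κ.left_inv (hΦ h2)⟩
    simp [h1]
  · rintro ħ hħ _ ⟨x, hxΦ, rfl⟩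
    have hxs := hΦ hxΦ
    rw [κ.left_inv hxs, hloc ħ hħ x, chartPush_mul_egf]
    rw [chartPush_apply hxs, egfChart, κ.left_inv hxs, egfShift_zero, one_mul,
      norm_mul, norm_mul, norm_mul, RCLike.norm_conj]
    exact le_of_eq (by ring)

end LocalSymbol

/-! ### The covariant symbol -/

section Covariant

open MeasureTheory

variable {n : ℕ} {κ : Chart n} {x₀ : CSphere n} {c : ℕ → ℝ} {μ ħ₀ t m : ℝ}

theorem norm_smul_direction (z : Cn n) (hz : z ≠ 0) : ‖z‖ • (direction z hz : Cn n) = z := by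
  rw [direction, smul_smul, mul_inv_cancel₀ (norm_ne_zero_iff.2 hz), one_smul]

theorem dot_eq_norm_mul (x z : Cn n) (hz : z ≠ 0) :
    dot x z = ‖z‖ * dot x (direction z hz) := by
  conv_lhs => rw [← norm_smul_direction z hz]
  rw [dot_eq_inner, dot_eq_inner, ← Complex.coe_smul, inner_smul_left, Complex.conj_ofReal]

variable [NeZero n]

theorem norm_sphereInner_le {f g : CSphere n → ℂ} (hf : Continuous f) (hg : Continuous g) :
    ‖sphereInner f g‖ ≤ sphereNorm f * sphereNorm g := by
  have hp : (2 : ℝ).HolderConjugate 2 := Real.HolderConjugate.two_two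
  have hL : ∀ {f : CSphere n → ℂ}, Continuous f →
      MemLp (fun x => ‖f x‖) (ENNReal.ofReal 2) (surfaceMeasure n) := fun hf =>
    hf.norm.memLp_of_hasCompactSupport (HasCompactSupport.of_compactSpace _)
  have h := integral_mul_le_Lp_mul_Lq_of_nonneg (μ := surfaceMeasure n) hp
    (f := fun x => ‖f x‖) (g := fun x => ‖g x‖) (ae_of_all _ fun _ => norm_nonneg _)
    (ae_of_all _ fun _ => norm_nonneg _) (hL hf) (hL hg)
  simp only [Real.rpow_two, ← Real.sqrt_eq_rpow] at h
  refine (norm_integral_le_integral_norm _).trans (le_trans (le_of_eq ?_) h)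
  exact integral_congr_ae (ae_of_all _ fun x => by simp)

theorem familyFun_apply (p ħ : ℝ) {z : Cn n} (hz : z ≠ 0) (x : CSphere n) :
    (familyFun n p ħ z : CSphere n → ℂ) x =
      egf (familyCoeff n p) (scaledDot (direction z hz) (‖z‖ / ħ) x) := by
  change familySeries n p (dot (x : Cn n) z / (ħ : ℂ)) = _
  rw [familySeries_eq_egf, scaledDot, dot_eq_norm_mul _ z hz]
  push_cast
  congr 1
  ring

theorem sphereNorm_familyFun_sq (p ħ : ℝ) {z : Cn n} (hz : z ≠ 0) :
    sphereNorm (familyFun n p ħ z : CSphere n → ℂ) * sphereNorm (familyFun n p ħ z : CSphere n → ℂ) =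
      egfMass (familyCoeff n p) (direction z hz) (‖z‖ / ħ) := by
  rw [sphereNorm, Real.mul_self_sqrt (integral_nonneg fun _ => by positivity), egfMass]
  simp_rw [familyFun_apply p ħ hz]

theorem sphereInner_familyFun (p ħ : ℝ) {z : Cn n} (hz : z ≠ 0) :
    sphereInner (familyFun n p ħ z : CSphere n → ℂ) (familyFun n p ħ z : CSphere n → ℂ) =
      (egfMass (familyCoeff n p) (direction z hz) (‖z‖ / ħ) : ℂ) := by
  rw [sphereInner, egfMass, ← integral_complex_ofReal]
  simp_rw [mul_conj_eq_sq, familyFun_apply p ħ hz]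

theorem dotGrad_apply_center (hκ : IsSmoothChart κ) (x₀ : CSphere n) (i : Fin (2 * n - 1))
    {b : Model n} (hb : b ∈ κ.target) :
    dotGrad κ x₀ i b =
      inner ℂ (x₀ : Cn n) (fderiv ℝ (chartMap κ) b (EuclideanSpace.single i 1)) := by
  have hd : DifferentiableAt ℝ (chartMap κ) b :=
    ((contDiffOn_chartMap hκ).differentiableOn (by simp)).differentiableAt
      (κ.open_target.mem_nhds hb)
  let L : Cn n →L[ℝ] ℂ := (innerSL ℂ (x₀ : Cn n)).restrictScalars ℝ
  have h1 : (fun b => dot (chartMap κ b) (x₀ : Cn n)) = fun b => L (chartMap κ b) :=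
    funext fun b => dot_eq_inner _ _
  rw [dotGrad, h1]
  have h2 := (L.hasFDerivAt.comp b hd.hasFDerivAt).fderiv
  have h3 : (fun b => L (chartMap κ b)) = L ∘ chartMap κ := rfl
  rw [h3, h2]
  rfl

theorem real_inner_fderiv_chartMap (hκ : IsSmoothChart κ) {b : Model n} (hb : b ∈ κ.target)
    (v : Model n) : ⟪chartMap κ b, fderiv ℝ (chartMap κ) b v⟫_ℝ = 0 := by
  have hd : DifferentiableAt ℝ (chartMap κ) b :=
    ((contDiffOn_chartMap hκ).differentiableOn (by simp)).differentiableAt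
      (κ.open_target.mem_nhds hb)
  have h1 := (hd.hasFDerivAt.norm_sq).fderiv
  have h2 : (fun b => ‖chartMap κ b‖ ^ 2) = fun _ => (1 : ℝ) := by
    funext b; rw [norm_chartMap, one_pow]
  have h4 : (‖chartMap κ ·‖ ^ 2) = fun _ => (1 : ℝ) := h2
  rw [h4, fderiv_fun_const] at h1
  have h3 := congrArg (fun L : Model n →L[ℝ] ℝ => L v) h1
  simpa using h3

/-- The covector `v ↦ Im (v · z)` in a chart. -/
theorem chartCovector_direction (hκ : IsSmoothChart κ) {z : Cn n} (hz : z ≠ 0)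
    (hx : direction z hz ∈ κ.source) (i : Fin (2 * n - 1)) :
    ((chartCovector κ (direction z hz) (covectorOf (direction z hz) (Complex.I • z)) i : ℝ) : ℂ) =
      -Complex.I * (‖z‖ * dotGrad κ (direction z hz) i (κ (direction z hz))) := by
  have hT := κ.map_source hx
  have h1 := real_inner_fderiv_chartMap hκ hT (EuclideanSpace.single i 1)
  rw [chartMap_apply hx, real_inner_eq_re_inner_complex] at h1
  rw [chartCovector_covectorOf hκ hx, real_inner_eq_re_inner_complex,
    dotGrad_apply_center hκ _ i hT]
  have e : ∀ v : Cn n, inner ℂ z v = ‖z‖ * inner ℂ (direction z hz : Cn n) v := fun v => by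
    conv_lhs => rw [← norm_smul_direction z hz]
    rw [← Complex.coe_smul, inner_smul_left, Complex.conj_ofReal]
  rw [inner_smul_left, Complex.conj_I, e]
  generalize inner ℂ ((direction z hz : CSphere n) : Cn n) _ = w at *
  -- Tangent vectors are real orthogonal to x₀, so `w` is purely imaginary. Hence -i|z|w is real and
  -- equals Re(-i|z|w), the coordinate of the covector.
  apply Complex.ext <;> simp [h1]

end Covariant

/-! ### Partition of unity and conclusion -/

section Assembly

open MeasureTheory

variable {n : ℕ} {κ : Chart n}

theorem IsSmall.of_norm_le {c : ℕ → ℝ} {x₀ : CSphere n} {μ ħ₁ C D : ℝ} {b I : ℝ → ℂ} (hC : 0 ≤ C)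
    (hb : ∀ ħ ∈ Set.Ioc 0 ħ₁, ‖b ħ‖ ≤ C * ħ) (hD : 0 ≤ D)
    (hI : ∀ ħ ∈ Set.Ioc 0 ħ₁, ‖I ħ‖ ≤ D * egfMass c x₀ (μ / ħ)) :
    IsSmall (Set.Ioc 0 ħ₁) c x₀ μ fun ħ => b ħ * I ħ := by
  refine ⟨C * D, by positivity, fun ħ hħ => ?_⟩
  rw [norm_mul]
  refine (mul_le_mul (hb ħ hħ) (hI ħ hħ) (norm_nonneg _) (mul_nonneg hC hħ.1.le)).trans
    (le_of_eq (by ring))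

variable [NeZero n]

/-- A real smooth function as a complex one. -/
def complexify (f : ContMDiffMap (𝓡 (2 * n - 1)) 𝓘(ℝ) (CSphere n) ℝ ∞) : Smooth n :=
  ⟨fun x => (f x : ℂ), Complex.ofRealCLM.contDiff.contMDiff.comp f.contMDiff⟩

theorem complexify_apply (f : ContMDiffMap (𝓡 (2 * n - 1)) 𝓘(ℝ) (CSphere n) ℝ ∞)
    (x : CSphere n) : (complexify f : CSphere n → ℂ) x = f x := rfl

theorem tsupport_complexify (f : ContMDiffMap (𝓡 (2 * n - 1)) 𝓘(ℝ) (CSphere n) ℝ ∞) :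
    tsupport (complexify f : CSphere n → ℂ) = tsupport f := by
  unfold tsupport
  congr 1
  ext x
  simp [complexify_apply]

theorem exists_smooth_eq_one_near {s U : Set (CSphere n)} (hs : IsClosed s) (hU : IsOpen U)
    (hsU : s ⊆ U) : ∃ Φ : Smooth n, tsupport (Φ : CSphere n → ℂ) ⊆ U ∧
      Disjoint (tsupport ((1 - Φ : Smooth n) : CSphere n → ℂ)) s := by
  obtain ⟨f, h0, h1, -⟩ := exists_contMDiffMap_zero_one_nhds_of_isClosed (n := ⊤)
    (𝓡 (2 * n - 1)) hU.isClosed_compl hs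
    (Set.disjoint_left.2 fun x hx hx' => hx (hsU hx'))
  refine ⟨complexify f, fun x hx => ?_, Set.disjoint_left.2 fun x hx hxs => ?_⟩
  · by_contra h
    refine (notMem_tsupport_iff_eventuallyEq.2 ?_) hx
    filter_upwards [(Filter.Eventually.filter_mono (nhds_le_nhdsSet h) h0)] with y hy
    rw [complexify_apply, hy, Complex.ofReal_zero, Pi.zero_apply]
  · refine (notMem_tsupport_iff_eventuallyEq.2 ?_) hx
    filter_upwards [(Filter.Eventually.filter_mono (nhds_le_nhdsSet hxs) h1)] with y hy
    change 1 - ((f y : ℝ) : ℂ) = 0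
    rw [hy, Complex.ofReal_one, sub_self]

theorem exists_smooth_partition {𝓕 : Set (Chart n)} (h𝓕 : IsSmoothAtlas 𝓕) :
    ∃ (T : Finset 𝓕) (ψ : T → Smooth n),
      (∀ i, tsupport (ψ i : CSphere n → ℂ) ⊆ i.1.1.source) ∧ ∑ i, ψ i = 1 := by
  obtain ⟨T, hT⟩ := isCompact_univ.elim_finite_subcover (fun κ : 𝓕 => κ.1.source)
    (fun κ => κ.1.open_source) fun x _ => by
      obtain ⟨κ, hκ, hx⟩ := h𝓕.covers x
      exact Set.mem_iUnion.2 ⟨⟨κ, hκ⟩, hx⟩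
  obtain ⟨ρ, hρ⟩ := SmoothPartitionOfUnity.exists_isSubordinate (𝓡 (2 * n - 1)) isClosed_univ
    (fun i : T => i.1.1.source) (fun i => i.1.1.open_source) fun x hx => by
      obtain ⟨κ, hκ, hx⟩ := Set.mem_iUnion₂.1 (hT hx)
      exact Set.mem_iUnion.2 ⟨⟨κ, hκ⟩, hx⟩
  refine ⟨T, fun i => complexify (ρ i), fun i => ?_, Subtype.ext (funext fun x => ?_)⟩
  · rw [tsupport_complexify]
    exact hρ i
  · have h := ρ.sum_eq_one (Set.mem_univ x)
    rw [finsum_eq_sum_of_fintype] at h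
    have h2 : ((∑ i, complexify (ρ i) : Smooth n) : CSphere n → ℂ) x = ∑ i, (ρ i x : ℂ) := by
      rw [AddSubmonoidClass.coe_finsetSum, Finset.sum_apply]
      rfl
    rw [h2, ← Complex.ofReal_sum, h]
    simp

variable {p ħ₀ m t : ℝ} {𝓕 : Set (Chart n)} {A : ℝ → Smooth n →ₗ[ℂ] Smooth n}
  {a : Chart n → ℝ → Model n → Model n → ℂ} {aj : Chart n → ℕ → Model n → Model n → ℂ}

theorem IsClassicalSymbol.exists_norm_sub_leading_le {d : ℕ} {a : ℝ → Vec d → Vec d → ℂ}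
    {aj : ℕ → Vec d → Vec d → ℂ} (h : IsClassicalSymbol ħ₀ m a aj) (b ξ : Vec d) :
    ∃ ħ₁ ∈ Set.Ioc 0 ħ₀, ∃ C : ℝ, 0 ≤ C ∧ ∀ ħ ∈ Set.Ioc 0 ħ₁, ‖a ħ b ξ - aj 0 b ξ‖ ≤ C * ħ := by
  -- The remainder after the terms j ≤ N is only O(ħ^N), so N = 1 is needed to obtain O(ħ) for the
  -- leading term.
  obtain ⟨ħ₁, hħ₁, C, hC⟩ := h.asymptotic 1 0
  refine ⟨ħ₁, hħ₁, |C| * bracket ξ ^ m + ‖aj 1 b ξ‖, add_nonneg (mul_nonneg (abs_nonneg _)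
    (Real.rpow_nonneg (bracket_pos ξ).le _)) (norm_nonneg _), fun ħ hħ => ?_⟩
  have h1 := hC ħ hħ b ξ
  rw [norm_iteratedFDeriv_zero, Finset.sum_range_succ, Finset.sum_range_one, pow_zero, one_mul,
    pow_one, pow_one] at h1
  have hb := Real.rpow_nonneg (bracket_pos ξ).le m
  calc ‖a ħ b ξ - aj 0 b ξ‖
      = ‖(a ħ b ξ - (aj 0 b ξ + ħ * aj 1 b ξ)) + ħ * aj 1 b ξ‖ := by congr 1; ring
    _ ≤ C * ħ * bracket ξ ^ m + ħ * ‖aj 1 b ξ‖ := by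
        refine (norm_add_le _ _).trans (add_le_add h1 (le_of_eq ?_))
        rw [norm_mul, Complex.norm_real, Real.norm_of_nonneg hħ.1.le]
    _ ≤ |C| * ħ * bracket ξ ^ m + ħ * ‖aj 1 b ξ‖ := by
        have := hħ.1.le
        gcongr
        exact le_abs_self C
    _ = _ := by ring

theorem IsSemiclassicalPDOWith.isSmall_pairing_offDiagonal
    (hA : IsSemiclassicalPDOWith 𝓕 A ħ₀ m t a aj) {Φ ψ : Smooth n}
    (hd : Disjoint (tsupport (Φ : CSphere n → ℂ)) (tsupport (ψ : CSphere n → ℂ)))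
    {z : Cn n} (hz : z ≠ 0) (p : ℝ) :
    ∃ ħ₁ ∈ Set.Ioc 0 ħ₀, IsSmall (Set.Ioc 0 ħ₁) (familyCoeff n p) (direction z hz) ‖z‖ fun ħ =>
      sphereInner ((Φ * A ħ (ψ * familyFun n p ħ z) : Smooth n) : CSphere n → ℂ)
        (familyFun n p ħ z : CSphere n → ℂ) := by
  obtain ⟨ħ₁, hħ₁, C, hC⟩ := hA.pseudolocal Φ ψ hd 1
  refine ⟨ħ₁, hħ₁, |C|, abs_nonneg C, fun ħ hħ => ?_⟩
  have hN : 0 ≤ sphereNorm (familyFun n p ħ z : CSphere n → ℂ) := Real.sqrt_nonneg _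
  rw [← sphereNorm_familyFun_sq p ħ hz]
  refine (norm_sphereInner_le (continuous_smooth _) (continuous_smooth _)).trans ?_
  refine (mul_le_mul_of_nonneg_right (hC ħ hħ (familyFun n p ħ z)) hN).trans ?_
  rw [pow_one, mul_assoc, mul_assoc]
  exact mul_le_mul_of_nonneg_right (le_abs_self C)
    (mul_nonneg hħ.1.le (mul_nonneg hN hN))

theorem exists_norm_integral_le {c : ℕ → ℝ} (hc : SlowGrowth c) (x₀ : CSphere n)
    {ψ : CSphere n → ℂ} (hψ : Continuous ψ) :
    ∃ D : ℝ, 0 ≤ D ∧ ∀ lam, ‖∫ x, ψ x * ((‖egf c (scaledDot x₀ lam x)‖ ^ 2 : ℝ) : ℂ)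
      ∂(surfaceMeasure n)‖ ≤ D * egfMass c x₀ lam := by
  obtain ⟨D, hD⟩ := (HasCompactSupport.of_compactSpace ψ).exists_bound_of_continuous hψ
  refine ⟨D, (norm_nonneg _).trans (hD x₀), fun lam => ?_⟩
  have hK : Continuous fun x => ‖egf c (scaledDot x₀ lam x)‖ ^ 2 :=
    ((hc.expGrowth.continuous_egf.comp (continuous_scaledDot x₀ _)).norm.pow 2)
  rw [egfMass, ← integral_const_mul]
  refine norm_integral_le_of_norm_le ((integrable_of_continuous hK).const_mul D)
    (ae_of_all _ fun x => ?_)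
  rw [norm_mul, Complex.norm_real, Real.norm_of_nonneg (by positivity)]
  exact mul_le_mul_of_nonneg_right (hD x) (by positivity)

/-- With Φ = 1 near the support of ψ, the part (1 - Φ)A(ψK) is negligible by pseudolocality and
ΦA(ψK) is given by the symbol in the chart. If `x₀` lies outside the chart, both terms are
separately small, so the value `s` is then arbitrary. -/
theorem IsSemiclassicalPDOWith.isSmall_localized (hn : 2 ≤ n) (hp : p = 0 ∨ p = -1)
    (h𝓕 : IsSmoothAtlas 𝓕) (ht : t ∈ Set.Icc (0 : ℝ) 1)
    (hA : IsSemiclassicalPDOWith 𝓕 A ħ₀ m t a aj) (hκ : κ ∈ 𝓕) {ψ : Smooth n}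
    (hψ : tsupport (ψ : CSphere n → ℂ) ⊆ κ.source) {z : Cn n} (hz : z ≠ 0) {s : ℂ}
    (hs : direction z hz ∈ κ.source → s = aj κ 0 (κ (direction z hz))
      (chartCovector κ (direction z hz) (covectorOf (direction z hz) (Complex.I • z)))) :
    ∃ ħ₁ > 0, IsSmall (Set.Ioc 0 ħ₁) (familyCoeff n p) (direction z hz) ‖z‖ fun ħ =>
      sphereInner (A ħ (ψ * familyFun n p ħ z) : CSphere n → ℂ)
          (familyFun n p ħ z : CSphere n → ℂ) -
        s * ∫ x, (ψ : CSphere n → ℂ) x * ((‖egf (familyCoeff n p)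
          (scaledDot (direction z hz) (‖z‖ / ħ) x)‖ ^ 2 : ℝ) : ℂ) ∂(surfaceMeasure n) := by
  have hsm : IsSmoothChart κ := h𝓕.subset_maximalAtlas hκ
  have hμ : 0 < ‖z‖ := norm_pos_iff.2 hz
  have hc := concentrates_familyCoeff hn hp (direction z hz)
  obtain ⟨Φ, hΦ, hd⟩ := exists_smooth_eq_one_near (isClosed_tsupport (ψ : CSphere n → ℂ))
    κ.open_source hψ
  obtain ⟨ħ₁, hħ₁, hoff⟩ := hA.isSmall_pairing_offDiagonal hd hz p
  have hΦψ : ∀ x, (ψ : CSphere n → ℂ) x ≠ 0 → (Φ : CSphere n → ℂ) x = 1 := by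
    intro x hx
    have h1 : x ∉ tsupport ((1 - Φ : Smooth n) : CSphere n → ℂ) := fun h =>
      Set.disjoint_left.1 hd h (subset_tsupport _ hx)
    have h2 : ((1 - Φ : Smooth n) : CSphere n → ℂ) x = 0 := image_eq_zero_of_notMem_tsupport h1
    change 1 - (Φ : CSphere n → ℂ) x = 0 at h2
    exact (sub_eq_zero.1 h2).symm
  have hsymb := isSymbol_iff_symbolBound.1 (hA.classical κ hκ).isSymbol
  obtain ⟨k, hk⟩ := exists_nat_gt (m + (((2 * n - 1 : ℕ) : ℝ) + 1))
  obtain ⟨_, _, hq⟩ := exists_quantizationBound ht k hsymb hk.le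
  have hloc : ∀ ħ ∈ Set.Ioc 0 ħ₀, ∀ x, (Φ : CSphere n → ℂ) x *
      (A ħ (ψ * familyFun n p ħ z) : CSphere n → ℂ) x = (Φ : CSphere n → ℂ) x *
      pseudo t ħ (Function.uncurry (a κ ħ)) (chartPush κ fun x => (ψ : CSphere n → ℂ) x *
        egf (familyCoeff n p) (scaledDot (direction z hz) (‖z‖ / ħ) x)) (κ x) := by
    intro ħ hħ x
    have e : ((ψ * familyFun n p ħ z : Smooth n) : CSphere n → ℂ) = fun x =>
        (ψ : CSphere n → ℂ) x *
          egf (familyCoeff n p) (scaledDot (direction z hz) (‖z‖ / ħ) x) := by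
      funext x
      rw [← familyFun_apply p ħ hz]
      rfl
    have ht' := (isCutoff_chartPush hsm ψ hψ).localized_zero (direction z hz) (familyCoeff n p)
      ‖z‖ 0 |>.isTest hsm hc.toSlowGrowth hħ.1
    rw [hA.local_form κ hκ Φ ψ _ hΦ hψ k (by linarith) ħ hħ x, e, chartPush_mul_egf,
      (hq ħ hħ _ ht' (κ x)).quantization_eq]
  set M : ℝ → ℂ := fun ħ => ∫ x, (ψ : CSphere n → ℂ) x * ((‖egf (familyCoeff n p)
    (scaledDot (direction z hz) (‖z‖ / ħ) x)‖ ^ 2 : ℝ) : ℂ) ∂(surfaceMeasure n) with hM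
  have hsplit : ∀ ħ, sphereInner (A ħ (ψ * familyFun n p ħ z) : CSphere n → ℂ)
      (familyFun n p ħ z : CSphere n → ℂ) =
      ∫ x, (Φ : CSphere n → ℂ) x * (A ħ (ψ * familyFun n p ħ z) : CSphere n → ℂ) x *
        conj (egf (familyCoeff n p) (scaledDot (direction z hz) (‖z‖ / ħ) x))
          ∂(surfaceMeasure n) +
      sphereInner (((1 - Φ) * A ħ (ψ * familyFun n p ħ z) : Smooth n) : CSphere n → ℂ)
        (familyFun n p ħ z : CSphere n → ℂ) := by
    intro ħ
    have hK := continuous_smooth (familyFun n p ħ z)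
    simp_rw [← familyFun_apply p ħ hz]
    rw [sphereInner, sphereInner, ← integral_add]
    · refine integral_congr_ae (ae_of_all _ fun x => ?_)
      change _ = _ + (1 - (Φ : CSphere n → ℂ) x) * _ * _
      ring
    · exact integrable_of_continuous (((continuous_smooth Φ).mul (continuous_smooth _)).mul
        (Complex.continuous_conj.comp hK))
    · exact integrable_of_continuous ((continuous_smooth _).mul
        (Complex.continuous_conj.comp hK))
  by_cases hx : direction z hz ∈ κ.source
  · obtain ⟨ħ₂, hħ₂, C, hC, hlead⟩ := (hA.classical κ hκ).exists_norm_sub_leading_le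
      (κ (direction z hz))
      (chartCovector κ (direction z hz) (covectorOf (direction z hz) (Complex.I • z)))
    obtain ⟨D, hD, hint⟩ := exists_norm_integral_le hc.toSlowGrowth (direction z hz)
      (continuous_smooth ψ)
    set ħ₃ := min (min ħ₁ ħ₂) (‖z‖ / 2) with hħ₃
    have h0 : 0 < ħ₃ := lt_min (lt_min hħ₁.1 hħ₂.1) (by positivity)
    have h1 : Set.Ioc 0 ħ₃ ⊆ Set.Ioc 0 ħ₁ :=
      Set.Ioc_subset_Ioc_right ((min_le_left _ _).trans (min_le_left _ _))
    have h2 : Set.Ioc 0 ħ₃ ⊆ Set.Ioc 0 ħ₂ :=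
      Set.Ioc_subset_Ioc_right ((min_le_left _ _).trans (min_le_right _ _))
    have h3 : 2 * ħ₃ ≤ ‖z‖ := by linarith [min_le_right (min ħ₁ ħ₂) (‖z‖ / 2)]
    have h4 : Set.Ioc 0 ħ₃ ⊆ Set.Ioc 0 ħ₀ := h1.trans (Set.Ioc_subset_Ioc_right hħ₁.2)
    refine ⟨ħ₃, h0, ?_⟩
    have hmain := Concentrates.isSmall_pairing hsm hc hμ h3 ht hx
      (chartCovector_direction hsm hz hx) (hsymb.mono_set h4) hΦ hψ hΦψ
      (fun ħ => continuous_smooth _) fun ħ hħ => hloc ħ (h4 hħ)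
    -- Replacing the full symbol at the point by its leading part costs O(ħ) times the mass.
    have herr := IsSmall.of_norm_le (I := M) hC (fun ħ hħ => hlead ħ (h2 hħ)) hD
      fun ħ _ => hint (‖z‖ / ħ)
    refine ((hmain.add (hoff.mono h1)).add herr).congr fun ħ hħ => ?_
    rw [hsplit ħ, hs hx]
    simp only [Function.uncurry, hM]
    ring
  · have hx' : direction z hz ∉ tsupport (ψ : CSphere n → ℂ) := fun h => hx (hψ h)
    set ħ₃ := min ħ₁ (‖z‖ / 2) with hħ₃
    have h0 : 0 < ħ₃ := lt_min hħ₁.1 (by positivity)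
    have h1 : Set.Ioc 0 ħ₃ ⊆ Set.Ioc 0 ħ₁ := Set.Ioc_subset_Ioc_right (min_le_left _ _)
    have h3 : 2 * ħ₃ ≤ ‖z‖ := by linarith [min_le_right ħ₁ (‖z‖ / 2)]
    have h4 : Set.Ioc 0 ħ₃ ⊆ Set.Ioc 0 ħ₀ := h1.trans (Set.Ioc_subset_Ioc_right hħ₁.2)
    refine ⟨ħ₃, h0, ?_⟩
    have hmain := Concentrates.isSmall_pairing_of_notMem hsm hc hμ h3 ht (hsymb.mono_set h4) hΦ hψ hx'
      fun ħ hħ => hloc ħ (h4 hħ)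
    have herr := (hc.isSmall_of_notMem_tsupport hμ h3 (continuous_smooth ψ) hx').mul_bounded
      (a := fun _ => -s) (fun _ _ => le_rfl)
    refine ((hmain.add (hoff.mono h1)).add herr).congr fun ħ hħ => ?_
    rw [hsplit ħ]
    ring

theorem HasPrincipalSymbol.isBigO_covariantSymbol_sub (hn : 2 ≤ n) (hp : p = 0 ∨ p = -1)
    (h𝓕 : IsSmoothAtlas 𝓕) {σ : (x : CSphere n) → Cotangent x → ℂ} (hA : HasPrincipalSymbol 𝓕 A σ)
    {z : Cn n} (hz : z ≠ 0) :
    (fun ħ : ℝ => covariantSymbol p ħ (A ħ) z -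
        σ (direction z hz) (covectorOf (direction z hz) (Complex.I • z))) =O[𝓝[>] 0]
      (fun ħ : ℝ => ħ) := by
  obtain ⟨ħ₀, hħ₀, m, t, ht, a, aj, hpdo, hσ⟩ := hA
  obtain ⟨T, ψ, hψ, hsum⟩ := exists_smooth_partition h𝓕
  set s := σ (direction z hz) (covectorOf (direction z hz) (Complex.I • z)) with hs
  choose δ hδ hsmall using fun i : T => hpdo.isSmall_localized hn hp h𝓕 ht i.1.2 (hψ i) hz
    (s := s) fun hx => hσ _ i.1.2 _ hx _
  obtain ⟨η, hη, hηle⟩ : ∃ η > 0, ∀ i, η ≤ δ i := by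
    rcases isEmpty_or_nonempty T with h | h
    · exact ⟨1, one_pos, fun i => h.elim i⟩
    · obtain ⟨i, hi⟩ := Finite.exists_min δ
      exact ⟨δ i, hδ i, hi⟩
  have hc := concentrates_familyCoeff hn hp (direction z hz)
  obtain ⟨C, hC, h⟩ := IsSmall.sum Finset.univ fun i _ =>
    (hsmall i).mono (Set.Ioc_subset_Ioc_right (hηle i))
  refine Asymptotics.IsBigO.of_bound C ?_
  filter_upwards [Ioc_mem_nhdsGT hη] with ħ hħ
  have hm := hc.toSlowGrowth.one_le_egfMass (direction z hz)
    (div_nonneg (norm_nonneg z) hħ.1.le)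
  set K := familyFun n p ħ z with hK
  have hm0 : egfMass (familyCoeff n p) (direction z hz) (‖z‖ / ħ) ≠ 0 := by positivity
  have hKK := sphereInner_familyFun (n := n) p ħ hz
  have h1 : (A ħ K : CSphere n → ℂ) = fun x => ∑ i, (A ħ (ψ i * K) : CSphere n → ℂ) x := by
    -- The partition of unity is inserted before applying the operator, while the second factor of
    -- the pairing stays the full function K. Summing the local integrals then recovers exactly the
    -- norm squared in the denominator.
    have : K = ∑ i, ψ i * K := by rw [← Finset.sum_mul, hsum, one_mul]
    conv_lhs => rw [this, map_sum]
    funext x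
    rw [AddSubmonoidClass.coe_finsetSum, Finset.sum_apply]
  have h2 : sphereInner (A ħ K : CSphere n → ℂ) (K : CSphere n → ℂ) =
      ∑ i, sphereInner (A ħ (ψ i * K) : CSphere n → ℂ) (K : CSphere n → ℂ) := by
    simp only [sphereInner, h1, Finset.sum_mul]
    exact integral_finsetSum _ fun i _ => integrable_of_continuous
      ((continuous_smooth _).mul (Complex.continuous_conj.comp (continuous_smooth K)))
  have h3 : ∑ i, ∫ x, (ψ i : CSphere n → ℂ) x * ((‖egf (familyCoeff n p)
      (scaledDot (direction z hz) (‖z‖ / ħ) x)‖ ^ 2 : ℝ) : ℂ) ∂(surfaceMeasure n) =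
      (egfMass (familyCoeff n p) (direction z hz) (‖z‖ / ħ) : ℂ) := by
    have hint : ∀ i, Integrable (fun x => (ψ i : CSphere n → ℂ) x * ((‖egf (familyCoeff n p)
        (scaledDot (direction z hz) (‖z‖ / ħ) x)‖ ^ 2 : ℝ) : ℂ)) (surfaceMeasure n) := fun i =>
      integrable_of_continuous
        ((continuous_smooth (ψ i)).mul (continuous_sq_egf hc.toSlowGrowth _ _))
    rw [← integral_finsetSum _ fun i _ => hint i, egfMass, ← integral_complex_ofReal]
    congr 1
    funext x
    have h4 := congrArg (fun f : Smooth n => (f : CSphere n → ℂ) x) hsum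
    simp only [AddSubmonoidClass.coe_finsetSum, Finset.sum_apply] at h4
    rw [← Finset.sum_mul, h4]
    exact one_mul _
  have h5 := h ħ hħ
  simp only at h5
  rw [Finset.sum_sub_distrib, ← Finset.mul_sum, ← h2, h3] at h5
  have h6 : covariantSymbol p ħ (A ħ) z - s = (sphereInner (A ħ K : CSphere n → ℂ)
      (K : CSphere n → ℂ) - s * (egfMass (familyCoeff n p) (direction z hz) (‖z‖ / ħ) : ℂ)) /
        (egfMass (familyCoeff n p) (direction z hz) (‖z‖ / ħ) : ℂ) := by
    rw [covariantSymbol, hKK, sub_div, mul_div_cancel_right₀ _ (by exact_mod_cast hm0)]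
  rw [h6, norm_div, Complex.norm_real, Real.norm_of_nonneg (by positivity),
    Real.norm_of_nonneg hħ.1.le, div_le_iff₀ (by positivity), mul_assoc]
  exact h5

end Assembly

end SphereEgorov

end

theorem mainTheorem3 (n : ℕ) [NeZero n] (hn : 2 ≤ n) (p : ℝ) (hp : p = 0 ∨ p = -1)
    (𝓕 : Set (SphereEgorov.Chart n)) (h𝓕 : SphereEgorov.IsSmoothAtlas 𝓕)
    (A : ℝ → SphereEgorov.Smooth n →ₗ[ℂ] SphereEgorov.Smooth n)
    (σ : (x : SphereEgorov.CSphere n) → SphereEgorov.Cotangent x → ℂ)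
    (hA : SphereEgorov.HasPrincipalSymbol 𝓕 A σ)
    (z : SphereEgorov.Cn n) (hz : z ≠ 0) :
    (fun ħ : ℝ => SphereEgorov.covariantSymbol p ħ (A ħ) z -
        σ (SphereEgorov.direction z hz)
          (SphereEgorov.covectorOf (SphereEgorov.direction z hz) (Complex.I • z)))
      =O[𝓝[>] 0] (fun ħ : ℝ => ħ) :=
  SphereEgorov.HasPrincipalSymbol.isBigO_covariantSymbol_sub hn hp h𝓕 hA hz
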